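/- **Setting.** Let $\nabla_\hslash=\hslash d-\Phi_\hslash$, $\Phi_\hslash=\sum_{\ell\ge 0}\hslash^\ell\Phi_\ell$, be a rational $\hslash$-connection on the trivial $\mathrm{GL}_r(\mathbb C)$-bundle over $\mathbb P^1$: each $\Phi_\ell$ is an $r\times r$ matrix of rational one-forms in $x$. Put $\varphi=\Phi_0$, $E(x,\omega)=\det(\omega\,\mathrm{Id}-\varphi(x))$ and $E_\omega=\partial E/\partial\omega$. Assume that the spectral curve $\{E=0\}\subset T^*\mathbb P^1$ is a smooth curve of genus $0$ (irreducible, with function field $\mathbb C(z)$, without singular points over the complement of the poles of $\varphi$), parametrized by $z\in\Sigma=\mathbb P^1\mapsto(x(z),\,\omega(z)=y(z)\,dx(z))$. Let $\Psi_\hslash=\widehat U_\hslash\exp\big(\hslash^{-1}\int\widehat Y_\hslash\big)$ be a formal WKB solution of $\nabla_\hslash\Psi_\hslash=0$ over a domain $D\subset\mathbb C$ that contains no pole of $\varphi$ and over which the sheets $z^1,\dots,z^r:D\to\Sigma$ of $x$ are defined: $\widehat U_\hslash=V+O(\hslash)$ is an invertible matrix of formal power series in $\hslash$ with holomorphic coefficients,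 and $\widehat Y_\hslash$ is diagonal with leading order $\mathrm{diag}(\omega(z^1),\dots,\omega(z^r))$. For an $r\times r$ matrix $E$ let $M_\hslash(z,E)=\Psi_\hslash E\Psi_\hslash^{-1}$, and let $e_a$ be the $a$-th diagonal matrix unit; $M_\hslash(\cdot,e_a)=\widehat U_\hslash e_a\widehat U_\hslash^{-1}$ is a power series in $\hslash$. With $x_i=x(z_i)$, the connected amplitudes are $$W_1(z;E)=\tfrac1\hslash\operatorname{Tr}\big(M_\hslash(z,E)\Phi_\hslash(x(z))\big),$$ $$W_n(z_1,\dots,z_n;E_1,\dots,E_n)=(-1)^{n-1}\sum_{\sigma}\frac{\operatorname{Tr}\big(M_\hslash(z_{\sigma^1},E_{\sigma^1})\cdots M_\hslash(z_{\sigma^n},E_{\sigma^n})\big)}{(x_{\sigma^1}-x_{\sigma^2})\cdots(x_{\sigma^n}-x_{\sigma^1})}\prod_{i}dx_i\qquad(n\ge2),$$ where $\sigma$ runs over the cyclic orders $(\sigma^1=1,\sigma^2,\dots,\sigma^n)$ of $\{1,\dots,n\}$. They are considered for diagonal $E_i$; for $E_i=e_{a_i}$ the $i$-th argument is the point of $\Sigma$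 on the sheet $a_i$. **Assumptions.** 1. (Assumption 5*) For all $\ell>0$ the singularities of $\Phi_\ell$ are among those of $\varphi$. For all $n\ge1$ and all $J=\{(z_1,E_1),\dots,(z_n,E_n)\}$ with $x_1,\dots,x_n\in D$ distinct and $E_1,\dots,E_n$ arbitrary matrices, each $\hslash$-coefficient of $$[\delta_1\cdots\delta_n]\det\big(\omega\,\mathrm{Id}-\Phi_\hslash(x(z))-\mathcal M^{(n)}_{\vec\delta}(x(z);J)\big)\frac1{E_\omega(x,\omega)}$$ restricts to a one-form on $\Sigma$ that is analytic at every point over a singularity of $\varphi$. Here $$\mathcal M^{(n)}_{\vec\delta}(x;J)=\sum_{k=1}^n\ \sum_{i_1,\dots,i_k\text{ distinct}}\delta_{i_1}\cdots\delta_{i_k}\frac{M_\hslash(z_{i_1},E_{i_1})\cdots M_\hslash(z_{i_k},E_{i_k})}{(x-x_{i_1})(x_{i_1}-x_{i_2})\cdots(x_{i_k}-x)}\,dx\prod_{j=1}^k dx_{i_j}.$$ (Expand multilinearly in the entries of the $E_i$; the scalar factors $e^{\hslash^{-1}\int(\widehat Y_a-\widehat Y_b)}$, evaluated at $z_i$,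 that come with the off-diagonal matrix units $e_{ab}$ do not depend on $z$ and are omitted.) 2. $M_\hslash(\cdot,e_a)=Ve_aV^{-1}+\sum_{k\ge1}\hslash^kM^{(k)}$, where $M^{(k)}$ is a rational function on $\Sigma$ evaluated on the sheet $a$, and its poles are ramification points of $x$ or lie over poles of $\varphi$. Also, $Ve_aV^{-1}$ is given by a rational function on $\Sigma$ in the same way. 3. $[\hslash^0]W_2=\dfrac{dz_1\,dz_2}{(z_1-z_2)^2}$. **Conclusion.** The amplitudes $W_n$, $n\geq 1$, evaluated at the matrices $e_a$, are symmetric and have the topological type property: - each $W_n$ has an $\hslash$-expansion whose coefficients are rational $n$-forms on $\Sigma^n$; - for $n\ge2$ the coefficients of $W_n$, apart from $[\hslash^0]W_2$, have poles only at ramification points of $x$, and $[\hslash^0]W_2$ has a residueless double pole on the diagonal and no other pole. The coefficients of $W_1$, apart from $[\hslash^{-1}]W_1$, have poles only at ramification points of $x$ or over singularities of $\varphi$. In particular, if all points of $\Sigma$ over singularities of $\varphi$ are ramification points of $x$, then all these coefficients have poles only at ramification points; - $W_n=O(\hslash^{n-2})$ for all $n\ge1$. Moreover, for every $k\ge1$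 and all $j\ge k$, $W_j=O(\hslash^{k-2})$ for all diagonal $E_1,\dots,E_j$. -/

import Mathlib

open Polynomial Matrix

noncomputable section

/-! ### Rational functions and rational one-forms on the projective line

Points of `ℙ¹` are elements of `OnePoint ℂ`. A rational function is an element of `RatFunc ℂ`;
a rational one-form `g dz` is represented by its coefficient `g`. -/

/-- The derivative of a rational function of one variable. -/
def ratDeriv (f : RatFunc ℂ) : RatFunc ℂ :=
  algebraMap ℂ[X] (RatFunc ℂ) (derivative f.num * f.denom - f.num * derivative f.denom) /
    algebraMap ℂ[X] (RatFunc ℂ) (f.denom ^ 2)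

/-- The value `f(a)` of a rational function at a finite point which is not a pole. -/
def ratEval (f : RatFunc ℂ) (a : ℂ) : ℂ := f.eval (RingHom.id ℂ) a

/-- The composition `z ↦ f (x z)` of rational functions. -/
def pullback (x f : RatFunc ℂ) : RatFunc ℂ := f.eval (RatFunc.C : ℂ →+* RatFunc ℂ) x

/-- The rational function `f` has no pole at the point `q` of `ℙ¹`. -/
def FunRegularAt (f : RatFunc ℂ) : OnePoint ℂ → Prop
  | none => f.intDegree ≤ 0
  | some a => f.denom.eval a ≠ 0

/-- The rational one-form `g dz` has no pole at the point `q` of `ℙ¹`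
(at infinity, `dz` has a double pole). -/
def FormRegularAt (g : RatFunc ℂ) : OnePoint ℂ → Prop
  | none => g = 0 ∨ g.intDegree ≤ -2
  | some a => g.denom.eval a ≠ 0

/-- The rational one-form `g dz` is regular and vanishes at the point `q` of `ℙ¹`. -/
def FormVanishesAt (g : RatFunc ℂ) : OnePoint ℂ → Prop
  | none => g = 0 ∨ g.intDegree ≤ -3
  | some a => g.denom.eval a ≠ 0 ∧ g.num.eval a = 0

open Classical in
/-- The map `ℙ¹ → ℙ¹` defined by a rational function. (Denominators of elements of `RatFunc` are
monic, so the value at infinity of `f`, if it is finite, is the coefficient of its numerator in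
the degree of its denominator.) -/
def ratMap (f : RatFunc ℂ) (q : OnePoint ℂ) : OnePoint ℂ :=
  if FunRegularAt f q then
    match q with
    | none => ((f.num.coeff f.denom.natDegree : ℂ) : OnePoint ℂ)
    | some a => ((ratEval f a : ℂ) : OnePoint ℂ)
  else OnePoint.infty

open Classical in
/-- `q` is a ramification point of the covering `x : ℙ¹ → ℙ¹`: the differential of `x`
(of `1 / x` if `x(q) = ∞`) vanishes at `q`. -/
def IsRamified (x : RatFunc ℂ) (q : OnePoint ℂ) : Prop :=
  if ratMap x q = OnePoint.infty then FormVanishesAt (ratDeriv x⁻¹) q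
  else FormVanishesAt (ratDeriv x) q

/-! ### Rational `ħ`-connections and their spectral curves -/

/-- A rational `ħ`-connection `∇ = ħ d - Φ` on the trivial `GL_r(ℂ)`-bundle over `ℙ¹`, given by
its potential `Φ = ∑ ħ ^ ℓ Φ_ℓ`, where `Φ_ℓ = (coeff ℓ) dx` is a matrix of rational one-forms. -/
structure RationalHConnection (r : ℕ) where
  coeff : ℕ → Matrix (Fin r) (Fin r) (RatFunc ℂ)

namespace RationalHConnection

variable {r : ℕ} (Φ : RationalHConnection r)

/-- The Higgs field `φ = Φ_0` (coefficient of `dx`). -/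
def higgs : Matrix (Fin r) (Fin r) (RatFunc ℂ) := Φ.coeff 0

/-- `p ∈ ℙ¹` is a singularity (a pole) of the matrix-valued one-form `Φ_ℓ`. -/
def IsSingularity (ℓ : ℕ) (p : OnePoint ℂ) : Prop :=
  ∃ i j, ¬ FormRegularAt (Φ.coeff ℓ i j) p

/-- The formal series `Φ_ħ(t)` (coefficient of `dx`) at a point `t` of the base. The variable of
the power series is `ħ`. -/
def at' (t : ℂ) : Matrix (Fin r) (Fin r) (PowerSeries ℂ) :=
  Matrix.of fun i j => PowerSeries.mk fun ℓ => ratEval (Φ.coeff ℓ i j) t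

/-- The formal series `Φ_ħ(x(z))` (coefficient of `dx`), as a matrix of power series in `ħ` whose
coefficients are rational functions of `z`. -/
def pull (x : RatFunc ℂ) : Matrix (Fin r) (Fin r) (PowerSeries (RatFunc ℂ)) :=
  Matrix.of fun i j => PowerSeries.mk fun ℓ => pullback x (Φ.coeff ℓ i j)

/-- The Higgs field in the coordinate `u = 1 / x`, i.e. `φ = (higgsAtInfinity) du`. -/
def higgsAtInfinity : Matrix (Fin r) (Fin r) (RatFunc ℂ) :=
  Φ.higgs.map fun f => -(RatFunc.X⁻¹ ^ 2) * pullback RatFunc.X⁻¹ f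

end RationalHConnection

/-- The curve `{(t, η) | det (η - A t) = 0}` is smooth at its points over `t = t₀`: at each of them
one of the partial derivatives of `E(t, η) = det (η - A t)` does not vanish. (To be used when `A`
is regular at `t₀`.) -/
def SmoothOver {r : ℕ} (A : Matrix (Fin r) (Fin r) (RatFunc ℂ)) (t₀ : ℂ) : Prop :=
  ∀ η : ℂ, ratEval (A.charpoly.eval (RatFunc.C η)) t₀ = 0 →
    ratEval ((derivative A.charpoly).eval (RatFunc.C η)) t₀ ≠ 0 ∨
      ratEval (ratDeriv (A.charpoly.eval (RatFunc.C η))) t₀ ≠ 0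

/-- The spectral curve `E(x, ω) = det (ω - φ(x)) = 0` in `T^* ℙ¹` is a smooth curve of genus zero,
with parametrization `z ↦ (x(z), ω(z) = y(z) dx(z))` by `Σ = ℙ¹`: it is irreducible, its function
field is `ℂ(x, y) = ℂ(z)`, and it has no singular point (away from the poles of `φ`, where it is a
subset of `T^* ℙ¹`; the point `∞` of the base, if it is not a pole, is seen in the chart
`u = 1 / x`). -/
structure IsSmoothGenusZeroSpectralCurve {r : ℕ} (Φ : RationalHConnection r) (x y : RatFunc ℂ) :
    Prop where
  nonconstant : ∀ c : ℂ, x ≠ RatFunc.C c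
  irreducible : Irreducible Φ.higgs.charpoly
  on_curve : (Φ.higgs.map (pullback x)).charpoly.eval y = 0
  generates : IntermediateField.adjoin ℂ {x, y} = ⊤
  smooth : ∀ t : ℂ, ¬ Φ.IsSingularity 0 (t : OnePoint ℂ) → SmoothOver Φ.higgs t
  smooth_infinity : ¬ Φ.IsSingularity 0 OnePoint.infty → SmoothOver Φ.higgsAtInfinity 0

/-! ### WKB solutions -/

/-- A formal WKB solution of `∇ Ψ = 0` over a domain `D` of the base over which the spectral
covering `x : Σ → ℙ¹` is trivialised by `r` holomorphic sheets:
`Ψ(t) = U(t) exp (ħ⁻¹ ∫ Y(t) dt)`, where `U = V + O(ħ)` is an invertible matrix of formal power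
series in `ħ` with holomorphic coefficients, and `Y = diag (Y 0, …, Y (r - 1))` is diagonal, with
leading order `Y_0 = diag (y(z⁰(t)), …, y(z^{r-1}(t)))`. The equation `ħ dΨ = Φ Ψ` reads
`ħ U' = Φ U - U Y`; order `ħ⁰` says that the columns of `V` are eigenvectors of `φ`. -/
structure WKBSolution {r : ℕ} (Φ : RationalHConnection r) (x y : RatFunc ℂ) where
  D : Set ℂ
  isOpen : IsOpen D
  isConnected : IsConnected D
  not_singular : ∀ t ∈ D, ¬ Φ.IsSingularity 0 (t : OnePoint ℂ)
  /-- `sheet a t` is the point `z^a(t)` of `Σ`. -/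
  sheet : Fin r → ℂ → ℂ
  sheet_holomorphic : ∀ a, DifferentiableOn ℂ (sheet a) D
  sheet_over : ∀ a, ∀ t ∈ D, ratMap x (sheet a t : OnePoint ℂ) = (t : OnePoint ℂ)
  sheet_injective : ∀ t ∈ D, Function.Injective fun a => sheet a t
  U : ℂ → Matrix (Fin r) (Fin r) (PowerSeries ℂ)
  Y : ℂ → Fin r → PowerSeries ℂ
  isUnit_det : ∀ t ∈ D, IsUnit (U t).det
  leading_Y : ∀ a, ∀ t ∈ D, PowerSeries.coeff 0 (Y t a) = ratEval y (sheet a t)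
  equation_zero : ∀ t ∈ D, ∀ i j,
    PowerSeries.coeff 0 ((Φ.at' t * U t - U t * Matrix.diagonal (Y t)) i j) = 0
  equation_succ : ∀ t ∈ D, ∀ i j, ∀ k : ℕ,
    HasDerivAt (fun s => PowerSeries.coeff k (U s i j))
      (PowerSeries.coeff (k + 1) ((Φ.at' t * U t - U t * Matrix.diagonal (Y t)) i j)) t

namespace WKBSolution

variable {r : ℕ} {Φ : RationalHConnection r} {x y : RatFunc ℂ} (S : WKBSolution Φ x y)

/-- `M_ħ(t, E) = Ψ(t) E Ψ(t)⁻¹`. For diagonal `E` the exponential factor of `Ψ` drops out, so that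
this is `U E U⁻¹`. For a matrix unit `E = e_{ab}` the exponential factor only contributes the
scalar `exp (ħ⁻¹ ∫ (Y a - Y b))` to `Ψ E Ψ⁻¹`, which is left out here; so for general `E` this is
`Ψ E' Ψ⁻¹` where `E'` is `E` with its off-diagonal entries rescaled by these scalars. -/
def M (t : ℂ) (E : Matrix (Fin r) (Fin r) ℂ) : Matrix (Fin r) (Fin r) (PowerSeries ℂ) :=
  S.U t * E.map (PowerSeries.C : ℂ →+* PowerSeries ℂ) * (S.U t)⁻¹

/-- The `a`-th diagonal basis matrix `e_a`. -/
def e (a : Fin r) : Matrix (Fin r) (Fin r) ℂ := Matrix.diagonal (Pi.single a 1)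

/-- The connected amplitude `W_n` at base points `t i` with initial conditions `E i`, as a formal
Laurent series in `ħ` (coefficient of `dx_1 ⋯ dx_n`): for `n = 1` it is `ħ⁻¹ Tr (M Φ)`, and for
`n ≥ 2`
`(-1)^(n-1) ∑_σ Tr (M_{σ^1} ⋯ M_{σ^n}) / ((x_{σ^1} - x_{σ^2}) ⋯ (x_{σ^n} - x_{σ^1}))`,
where the sum is over the cyclic orders `(σ^1, …, σ^n)` of the `n` variables, starting with the
first variable. -/
def amplitude (n : ℕ) (t : Fin n → ℂ) (E : Fin n → Matrix (Fin r) (Fin r) ℂ) : LaurentSeries ℂ :=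
  if h : n = 1 then
    HahnSeries.single (-1 : ℤ) (1 : ℂ) *
      HahnSeries.ofPowerSeries ℤ ℂ
        (S.M (t ⟨0, by omega⟩) (E ⟨0, by omega⟩) * Φ.at' (t ⟨0, by omega⟩)).trace
  else
    HahnSeries.ofPowerSeries ℤ ℂ
      ((-1) ^ (n - 1) *
        ∑ σ : Equiv.Perm (Fin n) with ∀ i : Fin n, (i : ℕ) = 0 → σ i = i,
          PowerSeries.C (∏ i, (t (σ i) - t (σ (finRotate n i))))⁻¹ *
            ((List.ofFn fun i => S.M (t (σ i)) (E (σ i))).prod).trace)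

/-- The expansion property: `M_ħ(·, e_a) = V e_a V⁻¹ + ∑_{k ≥ 1} ħ^k M^(k)`, where `M^(k)` is a
rational function on the spectral curve, evaluated on the sheet `a`, which may only have poles at
ramification points or over poles of `φ`. (`N k` is `M^(k)` for `k ≥ 1`; `N 0` represents
`V e_a V⁻¹`.) -/
def HasRationalExpansion : Prop :=
  ∃ N : ℕ → Matrix (Fin r) (Fin r) (RatFunc ℂ),
    (∀ a, ∀ t ∈ S.D, ∀ k i j,
      PowerSeries.coeff k (S.M t (e a) i j) = ratEval (N k i j) (S.sheet a t)) ∧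
    ∀ k, 1 ≤ k → ∀ i j q, ¬ FunRegularAt (N k i j) q →
      IsRamified x q ∨ Φ.IsSingularity 0 (ratMap x q)

/-- The matrix `𝓜_δ^(n)(x(z); J)` (coefficient of `dx dx_1 ⋯ dx_n`), for `J` given by base points
`t i` and matrices `E i`: the sum over `k = 1, …, n` and over all `k`-tuples of distinct indices
`(i_1, …, i_k)` of
`δ_{i_1} ⋯ δ_{i_k} M_{i_1} ⋯ M_{i_k} / ((x - x_{i_1}) (x_{i_1} - x_{i_2}) ⋯ (x_{i_k} - x))`.
Its entries are polynomials in the `δ i`, with coefficients in the power series in `ħ` over the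
field of rational functions of `z`. -/
def deltaM {n : ℕ} (t : Fin n → ℂ) (E : Fin n → Matrix (Fin r) (Fin r) ℂ) :
    Matrix (Fin r) (Fin r) (MvPolynomial (Fin n) (PowerSeries (RatFunc ℂ))) :=
  ∑ k ∈ Finset.range n, ∑ f : Fin (k + 1) ↪ Fin n,
    (MvPolynomial.C (PowerSeries.C
        ((x - RatFunc.C (t (f 0))) *
          (∏ j : Fin k, RatFunc.C (t (f j.castSucc) - t (f j.succ))) *
          (RatFunc.C (t (f (Fin.last k))) - x))⁻¹) *
      ∏ j, MvPolynomial.X (f j)) •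
    ((List.ofFn fun j => S.M (t (f j)) (E (f j))).prod).map
      fun s => MvPolynomial.C (PowerSeries.map (RatFunc.C : ℂ →+* RatFunc ℂ) s)

/-- `[δ_1 ⋯ δ_n] det (ω - Φ_ħ(x(z)) - 𝓜_δ^(n)(x(z); J))`, as a power series in `ħ` whose
coefficients are rational functions of the point `z` of the spectral curve. -/
def loopDet {n : ℕ} (t : Fin n → ℂ) (E : Fin n → Matrix (Fin r) (Fin r) ℂ) :
    PowerSeries (RatFunc ℂ) :=
  MvPolynomial.coeff (Finsupp.equivFunOnFinite.symm fun _ => 1)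
    (Matrix.det
      (Matrix.scalar (Fin r) (MvPolynomial.C (PowerSeries.C y)) -
        (Φ.pull x).map MvPolynomial.C - S.deltaM t E))

/-- Assumption 5*: the singularities of all `Φ_ℓ` are among those of `φ`, and for every `n ≥ 1` and
every `J` all `ħ`-coefficients of
`[δ_1 ⋯ δ_n] det (ω - Φ_ħ(x(z)) - 𝓜_δ^(n)(x(z); J)) / E_ω(x, ω)`
restrict to one-forms on the spectral curve that are analytic at all points over the singularities
of `φ`. The determinant is of degree `r` in `dx`, and `E_ω` of degree `r - 1`. -/
def Assumption5Star : Prop :=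
  (∀ ℓ, 0 < ℓ → ∀ p, Φ.IsSingularity ℓ p → Φ.IsSingularity 0 p) ∧
  ∀ n : ℕ, 1 ≤ n → ∀ (t : Fin n → ℂ) (E : Fin n → Matrix (Fin r) (Fin r) ℂ),
    (∀ i, t i ∈ S.D) → Function.Injective t →
    ∀ (m : ℕ) (q : OnePoint ℂ), Φ.IsSingularity 0 (ratMap x q) →
      FormRegularAt
        (PowerSeries.coeff m (S.loopDet t E) /
          (derivative (Φ.higgs.map (pullback x)).charpoly).eval y * ratDeriv x) q

/-- `[ħ⁰] W_2 = dz_1 dz_2 / (z_1 - z_2)²` on the spectral curve. -/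
def LeadingW2IsBergman : Prop :=
  ∀ (t : Fin 2 → ℂ) (a : Fin 2 → Fin r), (∀ i, t i ∈ S.D) → Function.Injective t →
    (S.amplitude 2 t fun i => e (a i)).coeff 0 *
        ∏ i, ratEval (ratDeriv x) (S.sheet (a i) (t i)) =
      1 / (S.sheet (a 0) (t 0) - S.sheet (a 1) (t 1)) ^ 2

end WKBSolution

/-! ### Rational forms in several variables and the topological type property -/

/-- The field of rational functions of `z_1, …, z_n`. -/
abbrev MvRat (n : ℕ) : Type := FractionRing (MvPolynomial (Fin n) ℂ)

/-- The rational function `f` is regular at `p ∈ ℂⁿ` with value `v`. -/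
def MvHasValueAt {n : ℕ} (f : MvRat n) (p : Fin n → ℂ) (v : ℂ) : Prop :=
  ∃ N Q : MvPolynomial (Fin n) ℂ, MvPolynomial.eval p Q ≠ 0 ∧
    f * algebraMap _ (MvRat n) Q = algebraMap _ (MvRat n) N ∧
    v = MvPolynomial.eval p N / MvPolynomial.eval p Q

/-- The rational `n`-form `f dz_1 ⋯ dz_n` on `(ℙ¹)ⁿ` has, in each variable `z_i`, only poles at
points of `R`: its denominator is a product of factors `z_i - a` with `a ∈ R`, and, if `∞` is not
in `R`, it is regular along each `z_i = ∞`. -/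
def MvPolesIn {n : ℕ} (R : Set (OnePoint ℂ)) (f : MvRat n) : Prop :=
  ∃ (q : ℂ[X]) (N : MvPolynomial (Fin n) ℂ), q ≠ 0 ∧
    (∀ a, q.eval a = 0 → (a : OnePoint ℂ) ∈ R) ∧
    f * algebraMap _ (MvRat n)
        (∏ i : Fin n, aeval (MvPolynomial.X i : MvPolynomial (Fin n) ℂ) q) =
      algebraMap _ (MvRat n) N ∧
    (OnePoint.infty ∉ R → ∀ i, N = 0 ∨ N.degreeOf i + 2 ≤ q.natDegree)

/-- The rational bidifferential `f dz_1 dz_2` on `ℙ¹ × ℙ¹` has a double pole without residue on the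
diagonal, and no other pole. -/
def ResiduelessDoublePole (f : MvRat 2) : Prop :=
  ∃ N : MvPolynomial (Fin 2) ℂ,
    f * algebraMap (MvPolynomial (Fin 2) ℂ) (MvRat 2) ((MvPolynomial.X 0 - MvPolynomial.X 1) ^ 2) =
      algebraMap _ (MvRat 2) N ∧
    MvPolynomial.aeval (R := ℂ) (fun _ : Fin 2 => (X : ℂ[X])) N ≠ 0 ∧
    ∀ i : Fin 2, MvPolynomial.aeval (R := ℂ) (fun _ : Fin 2 => (X : ℂ[X])) (MvPolynomial.pderiv i N) = 0 ∧
      N.degreeOf i + 2 ≤ 2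

namespace WKBSolution

variable {r : ℕ} {Φ : RationalHConnection r} {x y : RatFunc ℂ} (S : WKBSolution Φ x y)

/-- The topological type property of the (symmetric) amplitudes `W_n`, `n ≥ 1`, where `R₁` is the
set of points of `Σ` at which the coefficients of `W_1`, except `[ħ⁻¹] W_1`, may have poles; for
`R₁` the set of ramification points of `x` it is the topological type property in the usual sense.

1. `W_n` has an `ħ`-expansion whose coefficients `w n k dz_1 ⋯ dz_n` are rational on `Σⁿ`;
2. apart from `[ħ⁻¹] W_1` and `[ħ⁰] W_2`, these have poles only at the ramification points of `x`
   (in `R₁`, for `n = 1`), and `[ħ⁰] W_2` has a double pole without residue on the diagonal and no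
   other pole;
3. `W_n = O(ħ^(n-2))`. -/
def TopologicalType (R₁ : Set (OnePoint ℂ)) : Prop :=
  (∀ (n : ℕ) (σ : Equiv.Perm (Fin n)) (t : Fin n → ℂ) (a : Fin n → Fin r),
    (∀ i, t i ∈ S.D) → Function.Injective t →
    S.amplitude n (t ∘ σ) (fun i => e (a (σ i))) = S.amplitude n t fun i => e (a i)) ∧
  ∃ w : (n : ℕ) → ℤ → MvRat n,
    (∀ n : ℕ, 1 ≤ n → ∀ (t : Fin n → ℂ) (a : Fin n → Fin r), (∀ i, t i ∈ S.D) → Function.Injective t →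
      ∀ k : ℤ, MvHasValueAt (w n k) (fun i => S.sheet (a i) (t i))
        ((S.amplitude n t fun i => e (a i)).coeff k *
          ∏ i, ratEval (ratDeriv x) (S.sheet (a i) (t i)))) ∧
    (∀ k : ℤ, k ≠ -1 → MvPolesIn R₁ (w 1 k)) ∧
    (∀ n : ℕ, 2 ≤ n → ∀ k : ℤ, ¬ (n = 2 ∧ k = 0) → MvPolesIn {q | IsRamified x q} (w n k)) ∧
    ResiduelessDoublePole (w 2 0) ∧
    ∀ n : ℕ, 1 ≤ n → ∀ k : ℤ, k < (n : ℤ) - 2 → w n k = 0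

end WKBSolution

end

/-! The amplitudes are determinantal. As `M_ħ(·, e_a)` is a projector of rank one, `W_n` for `n ≥ 2`
is the sum over the `n`-cycles `c` of `sign c · ∏ K(j, c j)`, where `K(i, j) = (U(t_i)⁻¹
U(t_j))_{a_i a_j} / (t_i - t_j)` (`amplitude_eq`). Symmetry is then immediate. What remains is to
locate the poles of these sums in each variable and to bound their order in `ħ`.

Poles. Let `H = y - Φ_ħ(x(z))`. Assumption 5* concerns arbitrary `E_i`, so by multilinearity it
extends to arbitrary matrices over `ℂ[[ħ]]` in place of the `M_ħ(z_i, E_i)`. For suitable matrix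
units the loop determinant becomes a minor of `H` (`loopCoeff_mem`, `loopCoeff_single`). This bounds
all minors of `H` over the singularities of `φ`, and smoothness of the curve gives the same bound
elsewhere (`minor_mem`). Hence `adj H / E_ω` is regular wherever `x` is unramified; its leading term
is `V e_a V⁻¹`. The commutator `[adj H, M]` is a combination of the entries of `[H, M] = -ħ dM/dx`
with minors of codimension two as coefficients. Together with `M² = M` this shows, order by order,
that all coefficients of `M` are regular at the unramified points, also over singularities
(`IsExpansion.mem`). Now `W_n` is linear in the projector of any one of its points, and its apparent
poles at coinciding points cancel between cycles, except in `[ħ⁰] W_2`. So in each variable its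
coefficients are forms with poles only at ramification points (`exists_oneVar`).

Order. By induction on `k`, `W_n = O(ħ^(min(n, k) - 2))` for all `n ≥ 2`. On the sheet `a`, after
conjugation by `U`, the coefficient of `δ_1 ⋯ δ_n` in `det (H + ħ 𝓜)` is up to sign the sum over the
permutations of `Fin r ⊕ Fin n` all of whose cycles meet `Fin r` (`coeff_det_chainMat`, a Schur
complement argument). The cycles on a block of at least two elements sum to a limit of correlators,
times one `ħ` for each element of `Fin r` in the block. If `n ≥ k`, the induction hypothesis leaves
a single contribution modulo `ħ^k`, the block formed by `a` and all of `Fin n`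
(`cluster_main_term`); its leading part is `ħ W_{n+1} E_ω`. So `[ħ^(k-2)] W_{n+1}` is up to sign
`[ħ^(k-1)]` of the loop determinant times `dx / E_ω`, which the bound on minors makes regular at
ramification points. A one-form regular on all of `ℙ¹` vanishes, which improves the bound
(`OrderBound.succ`).

Rationality. The pole orders in one variable are bounded independently of the other points. This
gives a common denominator, and interpolation on a grid shows that the numerator is a polynomial in
all variables (`exists_mvPolynomial`, `exists_mvForm`). `W_1` is read off from `Tr (M Φ)`, and `[ħ⁰]
W_2` is given by assumption. -/

open Polynomial Matrix

noncomputable section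

local notation "K" => RatFunc ℂ
local notation "R₀" => PowerSeries ℂ

/-! ### Rational functions of one variable -/

lemma ratFunc_eq_div (f : K) : ∃ p q : ℂ[X], q ≠ 0 ∧ f = algebraMap ℂ[X] K p / algebraMap ℂ[X] K q :=
  ⟨f.num, f.denom, f.denom_ne_zero, (RatFunc.num_div_denom f).symm⟩

lemma algebraMap_ratFunc_ne_zero {q : ℂ[X]} (hq : q ≠ 0) : algebraMap ℂ[X] K q ≠ 0 :=
  RatFunc.algebraMap_ne_zero hq

lemma num_mul_eq_of_eq_div {f : K} {p q : ℂ[X]} (hq : q ≠ 0)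
    (hf : f = algebraMap ℂ[X] K p / algebraMap ℂ[X] K q) : f.num * q = p * f.denom := by
  apply RatFunc.algebraMap_injective ℂ
  rw [map_mul, map_mul]
  exact (div_eq_div_iff (algebraMap_ratFunc_ne_zero f.denom_ne_zero)
    (algebraMap_ratFunc_ne_zero hq)).1 ((RatFunc.num_div_denom f).trans hf)

/-- `ratDeriv` is defined through the reduced fraction. Freedom in the choice of the fraction makes
the sum and product rules plain computations, without cancelling common factors. -/
lemma ratDeriv_eq_of_eq_div {f : K} {p q : ℂ[X]} (hq : q ≠ 0)
    (hf : f = algebraMap ℂ[X] K p / algebraMap ℂ[X] K q) :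
    ratDeriv f =
      algebraMap ℂ[X] K (derivative p * q - p * derivative q) / algebraMap ℂ[X] K (q ^ 2) := by
  have h := num_mul_eq_of_eq_div hq hf
  have h2 := congrArg derivative h
  rw [derivative_mul, derivative_mul] at h2
  have hd2 := algebraMap_ratFunc_ne_zero (pow_ne_zero 2 f.denom_ne_zero)
  have hq2 := algebraMap_ratFunc_ne_zero (pow_ne_zero 2 hq)
  have key : (derivative f.num * f.denom - f.num * derivative f.denom) * q ^ 2 =
      (derivative p * q - p * derivative q) * f.denom ^ 2 := by
    generalize f.num = n at *
    generalize f.denom = d at *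
    linear_combination (d * q) * h2 - (derivative d * q + derivative q * d) * h
  rw [ratDeriv, div_eq_div_iff hd2 hq2, ← map_mul, ← map_mul, key]

lemma ratDeriv_div (p q : ℂ[X]) (hq : q ≠ 0) :
    ratDeriv (algebraMap ℂ[X] K p / algebraMap ℂ[X] K q) =
      algebraMap ℂ[X] K (derivative p * q - p * derivative q) / algebraMap ℂ[X] K (q ^ 2) :=
  ratDeriv_eq_of_eq_div hq rfl

lemma ratDeriv_add (f g : K) : ratDeriv (f + g) = ratDeriv f + ratDeriv g := by
  obtain ⟨p, q, hq, rfl⟩ := ratFunc_eq_div f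
  obtain ⟨s, t, ht, rfl⟩ := ratFunc_eq_div g
  have hq' := algebraMap_ratFunc_ne_zero hq
  have ht' := algebraMap_ratFunc_ne_zero ht
  rw [div_add_div _ _ hq' ht', ← map_mul, ← map_mul, ← map_mul, ← map_add,
    ratDeriv_div _ _ (mul_ne_zero hq ht), ratDeriv_div _ _ hq, ratDeriv_div _ _ ht]
  simp only [derivative_mul, map_add, map_sub, map_mul, map_pow]
  field_simp
  ring

lemma ratDeriv_mul (f g : K) : ratDeriv (f * g) = ratDeriv f * g + f * ratDeriv g := by
  obtain ⟨p, q, hq, rfl⟩ := ratFunc_eq_div f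
  obtain ⟨s, t, ht, rfl⟩ := ratFunc_eq_div g
  have hq' := algebraMap_ratFunc_ne_zero hq
  have ht' := algebraMap_ratFunc_ne_zero ht
  rw [div_mul_div_comm, ← map_mul, ← map_mul,
    ratDeriv_div _ _ (mul_ne_zero hq ht), ratDeriv_div _ _ hq, ratDeriv_div _ _ ht]
  simp only [derivative_mul, map_add, map_sub, map_mul, map_pow]
  field_simp
  ring

lemma ratDeriv_C (c : ℂ) : ratDeriv (RatFunc.C c) = 0 := by
  simp [ratDeriv]

/-- `ratDeriv` as a derivation over the constants. -/
def ratDerivation : Derivation ℂ K K where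
  toFun := ratDeriv
  map_add' := ratDeriv_add
  map_smul' c f := by
    rw [RatFunc.smul_eq_C_mul, ratDeriv_mul, ratDeriv_C]
    simp [RatFunc.smul_eq_C_mul]
  map_one_eq_zero' := by simpa using ratDeriv_C 1
  leibniz' f g := by
    simp only [LinearMap.coe_mk, AddHom.coe_mk, ratDeriv_mul, smul_eq_mul]; ring

lemma ratDerivation_apply (f : K) : ratDerivation f = ratDeriv f := rfl

lemma ratDeriv_inv (f : K) (hf : f ≠ 0) : ratDeriv f⁻¹ = -ratDeriv f / f ^ 2 := by
  have h := ratDeriv_mul f f⁻¹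
  rw [mul_inv_cancel₀ hf] at h
  have h1 : ratDeriv (1 : K) = 0 := by simpa using ratDeriv_C 1
  rw [h1] at h
  field_simp
  field_simp at h
  linear_combination -h

lemma ratDeriv_sub (f g : K) : ratDeriv (f - g) = ratDeriv f - ratDeriv g :=
  ratDerivation.map_sub f g

/-! #### Values at finite points -/

lemma regular_of_eq_div {f : K} {a : ℂ} {p q : ℂ[X]} (hq : q.eval a ≠ 0)
    (h : f = algebraMap ℂ[X] K p / algebraMap ℂ[X] K q) : f.denom.eval a ≠ 0 := by
  have : f.denom ∣ q := by
    rw [h]; exact RatFunc.denom_div_dvd p q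
  obtain ⟨c, hc⟩ := this
  intro h0
  rw [hc, eval_mul, h0, zero_mul] at hq
  exact hq rfl

lemma ratEval_div {a : ℂ} (p q : ℂ[X]) (hq : q.eval a ≠ 0) :
    ratEval (algebraMap ℂ[X] K p / algebraMap ℂ[X] K q) a = p.eval a / q.eval a := by
  have hq0 : q ≠ 0 := by rintro rfl; simp at hq
  have hd := regular_of_eq_div (f := algebraMap ℂ[X] K p / algebraMap ℂ[X] K q) hq rfl
  have h := num_mul_eq_of_eq_div hq0 (rfl : algebraMap ℂ[X] K p / algebraMap ℂ[X] K q = _)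
  have h2 := congrArg (eval a) h
  rw [eval_mul, eval_mul] at h2
  exact (div_eq_div_iff hd hq).2 h2

lemma ratEval_C (c a : ℂ) : ratEval (RatFunc.C c) a = c := by simp [ratEval]

lemma ratEval_add {f g : K} {a : ℂ} (hf : f.denom.eval a ≠ 0) (hg : g.denom.eval a ≠ 0) :
    ratEval (f + g) a = ratEval f a + ratEval g a := RatFunc.eval_add _ _ hf hg

lemma ratEval_mul {f g : K} {a : ℂ} (hf : f.denom.eval a ≠ 0) (hg : g.denom.eval a ≠ 0) :
    ratEval (f * g) a = ratEval f a * ratEval g a := RatFunc.eval_mul _ _ hf hg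

lemma hasDerivAt_ratEval {f : K} {a : ℂ} (hf : f.denom.eval a ≠ 0) :
    HasDerivAt (ratEval f) (ratEval (ratDeriv f) a) a := by
  have h1 := ratEval_div (derivative f.num * f.denom - f.num * derivative f.denom) (f.denom ^ 2)
    (by simpa using pow_ne_zero 2 hf : (f.denom ^ 2).eval a ≠ 0)
  have h2 := (f.num.hasDerivAt a).div (f.denom.hasDerivAt a) hf
  rw [ratDeriv, h1]
  exact h2.congr_deriv (by simp only [eval_sub, eval_mul, eval_pow])

/-! #### The valuation ring of a point -/

lemma intDegree_nonpos_add {f g : K} (hf : f.intDegree ≤ 0) (hg : g.intDegree ≤ 0) :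
    (f + g).intDegree ≤ 0 := by
  by_cases h : f + g = 0
  · simp [h]
  by_cases hg0 : g = 0
  · simpa [hg0] using hf
  exact (RatFunc.intDegree_add_le hg0 h).trans (max_le hf hg)

lemma intDegree_nonpos_mul {f g : K} (hf : f.intDegree ≤ 0) (hg : g.intDegree ≤ 0) :
    (f * g).intDegree ≤ 0 := by
  by_cases h : f = 0
  · simp [h]
  by_cases hg0 : g = 0
  · simp [hg0]
  rw [RatFunc.intDegree_mul h hg0]; omega

/-- The ring of rational functions which are regular at the point `q` of the projective line. -/
def regAt (q : OnePoint ℂ) : ValuationSubring K where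
  carrier := {f | FunRegularAt f q}
  zero_mem' := by cases q <;> simp [FunRegularAt]
  one_mem' := by cases q <;> simp [FunRegularAt]
  add_mem' {f g} hf hg := by
    cases q with
    | infty => exact intDegree_nonpos_add hf hg
    | coe a =>
      have hf : f.denom.eval a ≠ 0 := hf
      have hg : g.denom.eval a ≠ 0 := hg
      refine regular_of_eq_div (p := f.num * g.denom + f.denom * g.num) (q := f.denom * g.denom)
        (by simp [hf, hg]) ?_
      conv_lhs => rw [← RatFunc.num_div_denom f, ← RatFunc.num_div_denom g]
      rw [div_add_div _ _ (algebraMap_ratFunc_ne_zero f.denom_ne_zero)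
        (algebraMap_ratFunc_ne_zero g.denom_ne_zero)]
      simp
  mul_mem' {f g} hf hg := by
    cases q with
    | infty => exact intDegree_nonpos_mul hf hg
    | coe a =>
      have hf : f.denom.eval a ≠ 0 := hf
      have hg : g.denom.eval a ≠ 0 := hg
      refine regular_of_eq_div (p := f.num * g.num) (q := f.denom * g.denom)
        (by simp [hf, hg]) ?_
      conv_lhs => rw [← RatFunc.num_div_denom f, ← RatFunc.num_div_denom g]
      rw [div_mul_div_comm]
      simp
  neg_mem' {f} hf := by
    cases q with
    | infty => simpa [FunRegularAt] using hf
    | coe a =>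
      have hf : f.denom.eval a ≠ 0 := hf
      refine regular_of_eq_div (p := -f.num) (q := f.denom) hf ?_
      conv_lhs => rw [← RatFunc.num_div_denom f]
      rw [map_neg]; exact neg_div' _ _
  mem_or_inv_mem' f := by
    cases q with
    | infty =>
      simp only [Set.mem_ofPred_eq, FunRegularAt, RatFunc.intDegree_inv]
      omega
    | coe a =>
      by_cases h : f.denom.eval a = 0
      · right
        have hn : f.num.eval a ≠ 0 := by
          intro hn
          have := (RatFunc.isCoprime_num_denom f)
          obtain ⟨u, v, huv⟩ := this
          have := congrArg (eval a) huv
          simp [hn, h] at this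
        refine regular_of_eq_div (p := f.denom) (q := f.num) hn ?_
        conv_lhs => rw [← RatFunc.num_div_denom f]
        rw [inv_div]
      · exact Or.inl h

lemma mem_regAt {f : K} {q : OnePoint ℂ} : f ∈ regAt q ↔ FunRegularAt f q := Iff.rfl

lemma mem_regAt_coe {f : K} {a : ℂ} : f ∈ regAt (a : OnePoint ℂ) ↔ f.denom.eval a ≠ 0 := Iff.rfl

lemma mem_regAt_infty {f : K} : f ∈ regAt OnePoint.infty ↔ f.intDegree ≤ 0 := Iff.rfl

/-- The valuation (written multiplicatively) of the point `q`. -/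
def ordAt (q : OnePoint ℂ) : Valuation K (regAt q).ValueGroup := (regAt q).valuation

lemma ordAt_le_one_iff {f : K} {q : OnePoint ℂ} : ordAt q f ≤ 1 ↔ f ∈ regAt q :=
  (regAt q).valuation_le_one_iff f

lemma C_mem_regAt (c : ℂ) (q : OnePoint ℂ) : RatFunc.C c ∈ regAt q := by
  cases q <;> simp [mem_regAt, FunRegularAt]

lemma ordAt_C {c : ℂ} (hc : c ≠ 0) (q : OnePoint ℂ) : ordAt q (RatFunc.C c) = 1 := by
  apply le_antisymm (ordAt_le_one_iff.2 (C_mem_regAt c q))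
  have h := ordAt_le_one_iff.2 (C_mem_regAt c⁻¹ q)
  rw [map_inv₀, map_inv₀] at h
  have h0 : ordAt q (RatFunc.C c) ≠ 0 := by
    rw [Valuation.ne_zero_iff]; simpa using hc
  exact (inv_le_one₀ (zero_lt_iff.2 h0)).1 h

/-- The valuation is written multiplicatively: `≤ 1` means regular and `< 1` means vanishing. In a
valuation ring the latter says exactly that the inverse is not regular. -/
lemma ordAt_lt_one_iff_inv_not_mem {f : K} {q : OnePoint ℂ} (hf : f ≠ 0) :
    ordAt q f < 1 ↔ f⁻¹ ∉ regAt q := by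
  rw [← ordAt_le_one_iff, map_inv₀, not_le,
    one_lt_inv₀ (zero_lt_iff.2 ((Valuation.ne_zero_iff _).2 hf))]

lemma ordAt_coe_lt_one_iff {f : K} {a : ℂ} :
    ordAt (a : OnePoint ℂ) f < 1 ↔ f.denom.eval a ≠ 0 ∧ f.num.eval a = 0 := by
  by_cases hf : f = 0
  · simp [hf]
  rw [ordAt_lt_one_iff_inv_not_mem hf]
  constructor
  · intro h
    have h1 : f ∈ regAt (a : OnePoint ℂ) := ((regAt _).mem_or_inv_mem f).resolve_right h
    refine ⟨h1, ?_⟩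
    by_contra hn
    apply h
    refine regular_of_eq_div (p := f.denom) (q := f.num) hn ?_
    conv_lhs => rw [← RatFunc.num_div_denom f]
    rw [inv_div]
  · rintro ⟨h1, h2⟩ h3
    have h4 := ratEval_mul h1 (mem_regAt_coe.1 h3)
    rw [mul_inv_cancel₀ hf] at h4
    have : ratEval f a = f.num.eval a / f.denom.eval a := rfl
    rw [this, h2] at h4
    simp [ratEval] at h4

lemma ordAt_infty_lt_one_iff {f : K} :
    ordAt OnePoint.infty f < 1 ↔ f = 0 ∨ f.intDegree ≤ -1 := by
  by_cases hf : f = 0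
  · simp [hf]
  rw [ordAt_lt_one_iff_inv_not_mem hf, mem_regAt_infty, RatFunc.intDegree_inv]
  simp only [hf, false_or]; omega

lemma ordAt_sub_C_lt_one_iff {f : K} {a c : ℂ} (hf : f.denom.eval a ≠ 0) :
    ordAt (a : OnePoint ℂ) (f - RatFunc.C c) < 1 ↔ ratEval f a = c := by
  have h1 : f - RatFunc.C c ∈ regAt (a : OnePoint ℂ) :=
    sub_mem (mem_regAt_coe.2 hf) (C_mem_regAt c _)
  have h2 : ratEval (f - RatFunc.C c) a = ratEval f a - c := by
    rw [sub_eq_add_neg, ← map_neg, ratEval_add hf (C_mem_regAt (-c) (a : OnePoint ℂ)), ratEval_C]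
    ring
  have h3 : ratEval (f - RatFunc.C c) a =
    (f - RatFunc.C c).num.eval a / (f - RatFunc.C c).denom.eval a := rfl
  rw [ordAt_coe_lt_one_iff, ← sub_eq_zero (a := ratEval f a), ← h2, h3, div_eq_zero_iff]
  have : (f - RatFunc.C c).denom.eval a ≠ 0 := h1
  tauto

lemma intDegree_eq_zero_sub {f : K} (h0 : f.intDegree = 0) (hf0 : f ≠ 0) :
    ∃ c, f - RatFunc.C c = 0 ∨ (f - RatFunc.C c).intDegree ≤ -1 := by
  have hl : f.num.natDegree = f.denom.natDegree := by
    have : (f.num.natDegree : ℤ) - f.denom.natDegree = 0 := h0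
    omega
  set c := f.num.leadingCoeff with hc
  have hcn : c ≠ 0 := by simpa [hc] using hf0
  refine ⟨c, ?_⟩
  by_cases h : f - RatFunc.C c = 0
  · exact Or.inl h
  right
  have e : f - RatFunc.C c = algebraMap ℂ[X] K (f.num - C c * f.denom) /
      algebraMap ℂ[X] K f.denom := by
    conv_lhs => rw [← RatFunc.num_div_denom f]
    have := algebraMap_ratFunc_ne_zero f.denom_ne_zero
    rw [map_sub, map_mul, RatFunc.algebraMap_C]
    field_simp
  have hn : f.num - C c * f.denom ≠ 0 := by
    intro hn; rw [hn] at e; simp at e; exact h e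
  have hlt : (f.num - C c * f.denom).natDegree < f.denom.natDegree := by
    have hd : f.num.degree = (C c * f.denom).degree := by
      rw [degree_C_mul hcn, degree_eq_natDegree (by simpa using hf0),
        degree_eq_natDegree f.denom_ne_zero, hl]
    have := degree_sub_lt_left hd (by simpa using hf0)
      (by rw [leadingCoeff_mul, leadingCoeff_C, (RatFunc.monic_denom f).leadingCoeff, mul_one])
    have h2 := natDegree_lt_natDegree hn this
    omega
  rw [e, RatFunc.intDegree_div (algebraMap_ratFunc_ne_zero hn)
    (algebraMap_ratFunc_ne_zero f.denom_ne_zero), RatFunc.intDegree_polynomial,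
    RatFunc.intDegree_polynomial]
  omega

/-- The residue field of a point is `ℂ`. -/
lemma exists_residue {f : K} {q : OnePoint ℂ} (hf : f ∈ regAt q) :
    ∃ c, ordAt q (f - RatFunc.C c) < 1 := by
  cases q with
  | infty =>
    by_cases hf0 : f = 0
    · exact ⟨0, by simp [hf0]⟩
    rcases lt_or_eq_of_le (show f.intDegree ≤ 0 from hf) with h | h
    · exact ⟨0, ordAt_infty_lt_one_iff.2 (Or.inr (by simp; omega))⟩
    · obtain ⟨c, hc⟩ := intDegree_eq_zero_sub h hf0
      exact ⟨c, ordAt_infty_lt_one_iff.2 hc⟩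
  | coe a => exact ⟨_, (ordAt_sub_C_lt_one_iff hf).2 rfl⟩

/-! #### One-forms -/

open Classical in
/-- The factor `θ` such that `g dz` is regular at `q` if and only if `θ g` is. -/
def formFactor : OnePoint ℂ → K
  | none => RatFunc.X ^ 2
  | some _ => 1

lemma formFactor_ne_zero (q : OnePoint ℂ) : formFactor q ≠ 0 := by
  cases q <;> simp [formFactor, RatFunc.X_ne_zero]

lemma intDegree_X_sq_mul {g : K} (hg : g ≠ 0) :
    (RatFunc.X ^ 2 * g).intDegree = g.intDegree + 2 := by
  rw [RatFunc.intDegree_mul (pow_ne_zero 2 RatFunc.X_ne_zero) hg, pow_two,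
    RatFunc.intDegree_mul RatFunc.X_ne_zero RatFunc.X_ne_zero, RatFunc.intDegree_X]
  ring

lemma formRegularAt_iff {g : K} {q : OnePoint ℂ} :
    FormRegularAt g q ↔ ordAt q (formFactor q * g) ≤ 1 := by
  rw [ordAt_le_one_iff]
  cases q with
  | infty =>
    by_cases hg : g = 0
    · simp [FormRegularAt, hg]
    change _ ↔ (RatFunc.X ^ 2 * g).intDegree ≤ 0
    rw [intDegree_X_sq_mul hg]
    simp only [FormRegularAt, hg, false_or]; omega
  | coe a => simp [formFactor, FormRegularAt, mem_regAt, FunRegularAt]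

lemma formVanishesAt_iff {g : K} {q : OnePoint ℂ} :
    FormVanishesAt g q ↔ ordAt q (formFactor q * g) < 1 := by
  cases q with
  | infty =>
    by_cases hg : g = 0
    · simp [FormVanishesAt, hg]
    rw [ordAt_infty_lt_one_iff]
    change _ ↔ RatFunc.X ^ 2 * g = 0 ∨ (RatFunc.X ^ 2 * g).intDegree ≤ -1
    rw [intDegree_X_sq_mul hg]
    have h2 : RatFunc.X ^ 2 * g ≠ 0 := mul_ne_zero (pow_ne_zero 2 RatFunc.X_ne_zero) hg
    simp only [FormVanishesAt, hg, h2, false_or]; omega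
  | coe a =>
    rw [ordAt_coe_lt_one_iff]
    simp [formFactor, FormVanishesAt]

/-- In degree `2n - 1` the two products have the same coefficient `n p_n q_n`, so the degree drops
by one more. This matches the double pole of `dz` at infinity. -/
lemma ratDeriv_infty_aux {p q : ℂ[X]} {n : ℕ} (hp : p.natDegree ≤ n) (hq : q.natDegree = n) :
    (derivative p * q - p * derivative q).natDegree + 2 ≤ 2 * n ∨
      derivative p * q - p * derivative q = 0 := by
  by_cases h : derivative p * q - p * derivative q = 0
  · exact Or.inr h
  left
  rcases n with _ | n
  · rw [Nat.le_zero, natDegree_eq_zero] at hp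
    obtain ⟨a, rfl⟩ := hp
    obtain ⟨b, rfl⟩ := natDegree_eq_zero.1 hq
    simp at h
  have h1 : (derivative p).natDegree ≤ n := (natDegree_derivative_le p).trans (by omega)
  have h2 : (derivative q).natDegree ≤ n := (natDegree_derivative_le q).trans (by omega)
  have h3 : (derivative p * q - p * derivative q).natDegree ≤ 2 * n + 1 := by
    refine (natDegree_sub_le _ _).trans (max_le ?_ ?_)
    · exact natDegree_mul_le.trans (by omega)
    · exact natDegree_mul_le.trans (by omega)
  have h4 : (derivative p * q - p * derivative q).coeff (2 * n + 1) = 0 := by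
    rw [coeff_sub, show 2 * n + 1 = n + (n + 1) by ring,
      coeff_mul_add_eq_of_natDegree_le h1 hq.le, add_comm n (n + 1),
      coeff_mul_add_eq_of_natDegree_le hp h2, coeff_derivative, coeff_derivative]
    ring
  rcases lt_or_eq_of_le h3 with h5 | h5
  · omega
  · exact absurd (leadingCoeff_eq_zero.1 (by rw [leadingCoeff, h5, h4])) h

/-- The differential of a regular function is regular. -/
lemma formRegularAt_ratDeriv {f : K} {q : OnePoint ℂ} (hf : f ∈ regAt q) :
    FormRegularAt (ratDeriv f) q := by
  cases q with
  | infty =>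
    by_cases h0 : ratDeriv f = 0
    · exact Or.inl h0
    right
    have hn : derivative f.num * f.denom - f.num * derivative f.denom ≠ 0 := by
      intro h; apply h0; simp [ratDeriv, h]
    have hle : f.num.natDegree ≤ f.denom.natDegree := by
      have : (f.num.natDegree : ℤ) - f.denom.natDegree ≤ 0 := hf
      omega
    have := (ratDeriv_infty_aux hle rfl).resolve_right hn
    rw [ratDeriv, RatFunc.intDegree_div (algebraMap_ratFunc_ne_zero hn)
      (algebraMap_ratFunc_ne_zero (pow_ne_zero 2 f.denom_ne_zero)), RatFunc.intDegree_polynomial,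
      RatFunc.intDegree_polynomial, natDegree_pow]
    push_cast
    omega
  | coe a =>
    exact regular_of_eq_div (q := f.denom ^ 2) (by simpa using (mem_regAt_coe.1 hf)) rfl

/-- A rational one-form without poles is zero. -/
lemma eq_zero_of_formRegularAt {g : K} (h : ∀ q, FormRegularAt g q) : g = 0 := by
  by_contra hg
  have hinf := (h OnePoint.infty).resolve_left hg
  have hdeg : g.denom.natDegree = 0 := by
    by_contra hne
    obtain ⟨a, ha⟩ := Complex.exists_root (f := g.denom)
      (natDegree_pos_iff_degree_pos.1 (Nat.pos_of_ne_zero hne))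
    exact h (a : OnePoint ℂ) ha
  have : (g.num.natDegree : ℤ) - g.denom.natDegree ≤ -2 := hinf
  omega

lemma finite_not_regular (f : K) : {a : ℂ | f.denom.eval a = 0}.Finite := by
  have := (f.denom.roots.toFinset).finite_toSet
  refine this.subset fun a ha => ?_
  simpa [f.denom_ne_zero] using ha

/-- Rational functions which agree at infinitely many points are equal. -/
lemma ratFunc_eq_of_infinite {f g : K} {A : Set ℂ} (hA : A.Infinite)
    (h : ∀ a ∈ A, f.denom.eval a ≠ 0 → g.denom.eval a ≠ 0 → ratEval f a = ratEval g a) : f = g := by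
  have hB := hA.sdiff ((finite_not_regular f).union (finite_not_regular g))
  have hp : f.num * g.denom = g.num * f.denom := by
    refine Polynomial.eq_of_infinite_eval_eq _ _ (hB.mono ?_)
    rintro a ⟨ha, hn⟩
    simp only [Set.mem_union, Set.mem_ofPred_eq, not_or] at hn
    have h1 : f.num.eval a / f.denom.eval a = g.num.eval a / g.denom.eval a := h a ha hn.1 hn.2
    rw [div_eq_div_iff hn.1 hn.2] at h1
    simpa using h1
  rw [← RatFunc.num_div_denom f, ← RatFunc.num_div_denom g,
    div_eq_div_iff (algebraMap_ratFunc_ne_zero f.denom_ne_zero)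
      (algebraMap_ratFunc_ne_zero g.denom_ne_zero), ← map_mul, ← map_mul, hp]

/-! ### Pullback along a nonconstant rational function -/

section Pullback

variable {x : K} (hx : ∀ c : ℂ, x ≠ RatFunc.C c)

lemma transcendental_of_nonconstant (hx : ∀ c : ℂ, x ≠ RatFunc.C c) : Transcendental ℂ x :=
  RatFunc.transcendental_of_ne_C (f := x) (by rintro ⟨c, hc⟩; exact hx c hc)

/-- The pullback by a nonconstant rational function, as a homomorphism of fields. -/
def pullbackHom (hx : ∀ c : ℂ, x ≠ RatFunc.C c) : K →ₐ[ℂ] K :=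
  (IntermediateField.val _).comp
    (RatFunc.algEquivOfTranscendental x (transcendental_of_nonconstant hx)).toAlgHom

lemma pullback_eq_aeval_div (x f : K) : pullback x f = aeval x f.num / aeval x f.denom := rfl

lemma pullbackHom_apply (f : K) : pullbackHom hx f = pullback x f := by
  rw [pullback_eq_aeval_div]
  exact RatFunc.algEquivOfTranscendental_apply x (transcendental_of_nonconstant hx) f

lemma pullbackHom_algebraMap (p : ℂ[X]) : pullbackHom hx (algebraMap ℂ[X] K p) = aeval x p := by
  rw [pullbackHom_apply, pullback_eq_aeval_div]; simp

lemma pullbackHom_X : pullbackHom hx RatFunc.X = x := by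
  rw [← RatFunc.algebraMap_X, pullbackHom_algebraMap, aeval_X]

lemma ratDeriv_aeval (x : K) (p : ℂ[X]) :
    ratDeriv (aeval x p) = aeval x (derivative p) * ratDeriv x := by
  exact ratDerivation.map_aeval p x

/-- The chain rule. -/
lemma ratDeriv_pullbackHom (f : K) :
    ratDeriv (pullbackHom hx f) = pullbackHom hx (ratDeriv f) * ratDeriv x := by
  have hd : aeval x f.denom ≠ 0 := by
    rw [← pullbackHom_algebraMap hx]
    exact (_root_.map_ne_zero _).2 (algebraMap_ratFunc_ne_zero f.denom_ne_zero)
  have h : pullbackHom hx f * aeval x f.denom = aeval x f.num := by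
    rw [pullbackHom_apply, pullback_eq_aeval_div, div_mul_cancel₀ _ hd]
  have h2 := congrArg ratDeriv h
  rw [ratDeriv_mul, ratDeriv_aeval, ratDeriv_aeval] at h2
  have h3 : pullbackHom hx (ratDeriv f) = _ := map_div₀ _ _ _
  rw [pullbackHom_algebraMap, pullbackHom_algebraMap] at h3
  rw [h3]
  simp only [map_sub, map_mul, map_pow]
  rw [eq_div_of_mul_eq hd h] at h2 ⊢
  field_simp at h2 ⊢
  linear_combination h2

/-- A vanishing derivative of a reduced fraction forces the denominator to divide its own
derivative, hence to be constant in characteristic zero, and then the numerator is constant too. -/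
lemma ratDeriv_ne_zero (hx : ∀ c : ℂ, x ≠ RatFunc.C c) : ratDeriv x ≠ 0 := by
  intro h
  have h1 : ∀ g : K, ratDeriv g = 0 → ∃ c, g = RatFunc.C c := by
    intro g hg
    have hn : derivative g.num * g.denom - g.num * derivative g.denom = 0 := by
      by_contra hn
      rw [ratDeriv, div_eq_zero_iff] at hg
      rcases hg with hg | hg
      · exact algebraMap_ratFunc_ne_zero hn hg
      · exact algebraMap_ratFunc_ne_zero (pow_ne_zero 2 g.denom_ne_zero) hg
    have hdvd : g.denom ∣ derivative g.denom := by
      refine (RatFunc.isCoprime_num_denom g).symm.dvd_of_dvd_mul_left ?_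
      exact ⟨derivative g.num, by linear_combination -hn⟩
    have hd0 : derivative g.denom = 0 := by
      by_contra hne
      have h2 := natDegree_le_of_dvd hdvd hne
      have hpos : g.denom.natDegree ≠ 0 := by
        intro h0
        obtain ⟨c, hc⟩ := natDegree_eq_zero.1 h0
        rw [← hc] at hne; simp at hne
      exact absurd h2 (not_le.2 (natDegree_derivative_lt hpos))
    have hn0 : derivative g.num = 0 := by
      rw [hd0, mul_zero, sub_zero] at hn
      exact (mul_eq_zero.1 hn).resolve_right g.denom_ne_zero
    obtain ⟨c, hc⟩ := natDegree_eq_zero.1 (derivative_eq_zero.1 hn0)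
    obtain ⟨d, hd⟩ := natDegree_eq_zero.1 (derivative_eq_zero.1 hd0)
    refine ⟨c / d, ?_⟩
    rw [← RatFunc.num_div_denom g, ← hc, ← hd, RatFunc.algebraMap_C, RatFunc.algebraMap_C, map_div₀]
  obtain ⟨c, hc⟩ := h1 x h
  exact hx c hc

end Pullback

/-! ### Local analysis -/

lemma ratMap_eq_infty_iff {x : K} {q : OnePoint ℂ} : ratMap x q = OnePoint.infty ↔ x ∉ regAt q := by
  rw [mem_regAt, ratMap.eq_def]
  split_ifs with h
  · simp only [h, not_true_eq_false, iff_false]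
    cases q <;> exact OnePoint.coe_ne_infty _
  · simp [h]

lemma ratMap_coe_of_regular {x : K} {a : ℂ} (h : x.denom.eval a ≠ 0) :
    ratMap x (a : OnePoint ℂ) = (ratEval x a : ℂ) := by
  rw [ratMap.eq_def]; exact if_pos h

lemma ordAt_eq_one_of_sub_lt {q : OnePoint ℂ} {f : K} {c : ℂ} (hc : c ≠ 0)
    (h : ordAt q (f - RatFunc.C c) < 1) : ordAt q f = 1 := by
  have h1 := ordAt_C hc q
  have : f = (f - RatFunc.C c) + RatFunc.C c := by ring
  rw [this, Valuation.map_add_eq_of_lt_right _ (by rw [h1]; exact h), h1]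

lemma ratMap_eq_coe_iff {x : K} {q : OnePoint ℂ} {t : ℂ} :
    ratMap x q = (t : OnePoint ℂ) ↔ ordAt q (x - RatFunc.C t) < 1 := by
  -- Once some value `c` of `x` at `q` is known, both sides of the equivalence amount to `t = c`.
  have huniq : ∀ c : ℂ, ordAt q (x - RatFunc.C c) < 1 →
      (ratMap x q = (t : OnePoint ℂ) ↔ ratMap x q = (c : OnePoint ℂ) ∧ t = c) →
      ratMap x q = (c : OnePoint ℂ) →
      (ratMap x q = (t : OnePoint ℂ) ↔ ordAt q (x - RatFunc.C t) < 1) := by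
    intro c hc h1 h2
    rw [h1]
    constructor
    · rintro ⟨-, rfl⟩; exact hc
    · intro ht
      refine ⟨h2, ?_⟩
      by_contra hne
      have : ordAt q (RatFunc.C (c - t)) < 1 := by
        have e : RatFunc.C (c - t) = (x - RatFunc.C t) - (x - RatFunc.C c) := by
          rw [map_sub]; ring
        rw [e]
        exact (Valuation.map_sub _ _ _).trans_lt (max_lt ht hc)
      rw [ordAt_C (sub_ne_zero.2 (Ne.symm hne))] at this
      exact lt_irrefl _ this
  by_cases hreg : x ∈ regAt q
  · cases q with
    | coe a =>
      refine huniq (ratEval x a) ((ordAt_sub_C_lt_one_iff hreg).2 rfl) ?_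
        (ratMap_coe_of_regular hreg)
      rw [ratMap_coe_of_regular hreg]
      simp [eq_comm]
    | infty =>
      have hr : ratMap x OnePoint.infty = ((x.num.coeff x.denom.natDegree : ℂ) : OnePoint ℂ) := by
        rw [ratMap.eq_def]; exact if_pos hreg
      refine huniq _ ?_ ?_ hr
      · have hdeg : x.intDegree ≤ 0 := hreg
        have hle : x.num.natDegree ≤ x.denom.natDegree := by
          have : (x.num.natDegree : ℤ) - x.denom.natDegree ≤ 0 := hdeg
          omega
        rw [ordAt_infty_lt_one_iff]
        set c := x.num.coeff x.denom.natDegree with hc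
        by_cases h : x - RatFunc.C c = 0
        · exact Or.inl h
        right
        have e : x - RatFunc.C c = algebraMap ℂ[X] K (x.num - C c * x.denom) /
            algebraMap ℂ[X] K x.denom := by
          conv_lhs => rw [← RatFunc.num_div_denom x]
          have := algebraMap_ratFunc_ne_zero x.denom_ne_zero
          rw [map_sub, map_mul, RatFunc.algebraMap_C]
          field_simp
        have hn : x.num - C c * x.denom ≠ 0 := by
          intro hn; rw [hn] at e; simp at e; exact h e
        have hlt : (x.num - C c * x.denom).natDegree < x.denom.natDegree := by
          have h1 : (x.num - C c * x.denom).natDegree ≤ x.denom.natDegree :=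
            (natDegree_sub_le _ _).trans (max_le hle (natDegree_C_mul_le _ _))
          refine lt_of_le_of_ne h1 fun h2 => hn ?_
          have h3 : (x.num - C c * x.denom).coeff x.denom.natDegree = 0 := by
            rw [coeff_sub, coeff_C_mul, coeff_natDegree, (RatFunc.monic_denom x).leadingCoeff,
              mul_one, hc, sub_self]
          rw [← leadingCoeff_eq_zero, leadingCoeff, h2, h3]
        rw [e, RatFunc.intDegree_div (algebraMap_ratFunc_ne_zero hn)
          (algebraMap_ratFunc_ne_zero x.denom_ne_zero), RatFunc.intDegree_polynomial,
          RatFunc.intDegree_polynomial]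
        omega
      · rw [hr]
        simp [eq_comm]
  · have h1 := ratMap_eq_infty_iff.2 hreg
    rw [h1]
    refine iff_of_false (OnePoint.infty_ne_coe _) fun h => hreg ?_
    rw [show x = (x - RatFunc.C t) + RatFunc.C t by ring]
    exact add_mem (ordAt_le_one_iff.1 h.le) (C_mem_regAt t q)

section PullbackLocal

variable {x : K} {q : OnePoint ℂ}

/-- `f` has the value `c` at `q`. -/
lemma ordAt_aeval_sub_lt {t : ℂ} (h : ordAt q (x - RatFunc.C t) < 1) (p : ℂ[X]) :
    ordAt q (aeval x p - RatFunc.C (p.eval t)) < 1 := by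
  obtain ⟨s, hs⟩ := X_sub_C_dvd_sub_C_eval (a := t) (p := p)
  have h2 := congrArg (aeval x) hs
  simp only [map_sub, map_mul, aeval_X, aeval_C, RatFunc.algebraMap_eq_C] at h2
  rw [h2, map_mul]
  have hx : x ∈ regAt q := by
    rw [show x = (x - RatFunc.C t) + RatFunc.C t by ring]
    exact add_mem (ordAt_le_one_iff.1 h.le) (C_mem_regAt t q)
  have h3 : aeval x s ∈ regAt q := by
    rw [aeval_eq_sum_range]
    refine sum_mem fun i _ => ?_
    rw [RatFunc.smul_eq_C_mul]
    exact mul_mem (C_mem_regAt _ _) (pow_mem hx i)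
  calc _ ≤ ordAt q (x - RatFunc.C t) * 1 := by gcongr; exact ordAt_le_one_iff.2 h3
    _ < 1 := by rwa [mul_one]

lemma ordAt_div_sub_lt {f g : K} {c d : ℂ} (hd : d ≠ 0) (hf : ordAt q (f - RatFunc.C c) < 1)
    (hg : ordAt q (g - RatFunc.C d) < 1) : ordAt q (f / g - RatFunc.C (c / d)) < 1 := by
  have h1 := ordAt_eq_one_of_sub_lt hd hg
  have hg0 : g ≠ 0 := by rintro rfl; simp at h1
  have hd0 : RatFunc.C d ≠ 0 := by simpa using hd
  have e : f / g - RatFunc.C (c / d) =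
      ((f - RatFunc.C c) - RatFunc.C (c / d) * (g - RatFunc.C d)) * g⁻¹ := by
    rw [map_div₀]; field_simp; ring
  rw [e, map_mul, map_inv₀, h1, inv_one, mul_one]
  refine (Valuation.map_sub _ _ _).trans_lt (max_lt hf ?_)
  rw [map_mul]
  calc _ ≤ 1 * ordAt q (g - RatFunc.C d) := by
        gcongr; exact ordAt_le_one_iff.2 (C_mem_regAt _ _)
    _ < 1 := by rwa [one_mul]

lemma ordAt_pullback_sub_lt {t : ℂ} (h : ordAt q (x - RatFunc.C t) < 1) {f : K}
    (hf : f.denom.eval t ≠ 0) :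
    ordAt q (pullback x f - RatFunc.C (ratEval f t)) < 1 :=
  ordAt_div_sub_lt hf (ordAt_aeval_sub_lt h _) (ordAt_aeval_sub_lt h _)

lemma mem_of_sub_lt {f : K} {c : ℂ} (h : ordAt q (f - RatFunc.C c) < 1) : f ∈ regAt q := by
  rw [show f = (f - RatFunc.C c) + RatFunc.C c by ring]
  exact add_mem (ordAt_le_one_iff.1 h.le) (C_mem_regAt c q)

lemma pullback_mem_regAt {t : ℂ} (h : ordAt q (x - RatFunc.C t) < 1) {f : K}
    (hf : f.denom.eval t ≠ 0) : pullback x f ∈ regAt q :=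
  mem_of_sub_lt (ordAt_pullback_sub_lt h hf)

/-- At a pole of `x`, a polynomial in `x` has the order of the leading term. -/
lemma ordAt_aeval_of_pole (h : x ∉ regAt q) {p : ℂ[X]} (hp : p ≠ 0) :
    ordAt q (aeval x p) = ordAt q x ^ p.natDegree := by
  have hlt : 1 < ordAt q x := by
    rw [← not_le, ordAt_le_one_iff]; exact h
  have h0 : ordAt q x ≠ 0 := (zero_lt_one.trans hlt).ne'
  induction hn : p.natDegree using Nat.strong_induction_on generalizing p with
  | _ n ih =>
    rw [← eraseLead_add_C_mul_X_pow p, map_add, map_mul, map_pow, aeval_X, aeval_C, hn]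
    have hl : ordAt q (algebraMap ℂ K p.leadingCoeff * x ^ n) = ordAt q x ^ n := by
      rw [map_mul, map_pow, RatFunc.algebraMap_eq_C, ordAt_C (by simpa using hp), one_mul]
    by_cases he : p.eraseLead = 0
    · rw [he, map_zero, zero_add, hl]
    · have hlt' : p.eraseLead.natDegree < n := by
        rcases eraseLead_natDegree_lt_or_eraseLead_eq_zero p with h | h
        · omega
        · exact absurd h he
      have h1 := ih _ hlt' he rfl
      rw [Valuation.map_add_eq_of_lt_right _ ?_, hl]
      rw [hl, h1]
      exact pow_lt_pow_right₀ hlt hlt'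

/-- In the coordinate `u = 1 / x` the form `f dx` has coefficient `-x² f`, so regularity at infinity
of the base means that `x² f(x)` stays bounded at a pole of `x`. -/
lemma ordAt_pullback_of_pole (h : x ∉ regAt q) {f : K} (hf : FormRegularAt f OnePoint.infty) :
    ordAt q (x ^ 2 * pullback x f) ≤ 1 := by
  by_cases hf0 : f = 0
  · simp [hf0, pullback]
  have hdeg := hf.resolve_left hf0
  have hle : f.num.natDegree + 2 ≤ f.denom.natDegree := by
    have : (f.num.natDegree : ℤ) - f.denom.natDegree ≤ -2 := hdeg
    omega
  have hlt : 1 < ordAt q x := by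
    rw [← not_le, ordAt_le_one_iff]; exact h
  rw [pullback_eq_aeval_div, map_mul, map_pow, map_div₀, ordAt_aeval_of_pole h (by simpa using hf0),
    ordAt_aeval_of_pole h f.denom_ne_zero, ← mul_div_assoc, ← pow_add]
  rw [div_le_one₀ (pow_pos (zero_lt_one.trans hlt) _), add_comm]
  exact pow_le_pow_right₀ hlt.le hle

end PullbackLocal

/-! ### Values of rational functions at points of the projective line -/

/-- The rational function `f` is regular at `q`, with value `c`. -/
def HasVal (q : OnePoint ℂ) (f : K) (c : ℂ) : Prop := ordAt q (f - RatFunc.C c) < 1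

namespace HasVal

variable {q : OnePoint ℂ} {f g : K} {c d : ℂ}

lemma mem (h : HasVal q f c) : f ∈ regAt q := mem_of_sub_lt h

lemma add (hf : HasVal q f c) (hg : HasVal q g d) : HasVal q (f + g) (c + d) := by
  unfold HasVal at *
  rw [map_add, add_sub_add_comm]
  exact (Valuation.map_add _ _ _).trans_lt (max_lt hf hg)

lemma mul (hf : HasVal q f c) (hg : HasVal q g d) : HasVal q (f * g) (c * d) := by
  have h1 := ordAt_le_one_iff.2 hg.mem
  have h2 := ordAt_le_one_iff.2 (C_mem_regAt c q)
  unfold HasVal at *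
  rw [map_mul, show f * g - RatFunc.C c * RatFunc.C d =
    (f - RatFunc.C c) * g + RatFunc.C c * (g - RatFunc.C d) by ring]
  refine (Valuation.map_add _ _ _).trans_lt (max_lt ?_ ?_)
  · rw [map_mul]
    calc _ ≤ ordAt q (f - RatFunc.C c) * 1 := by gcongr
      _ < 1 := by rwa [mul_one]
  · rw [map_mul]
    calc _ ≤ 1 * ordAt q (g - RatFunc.C d) := by gcongr
      _ < 1 := by rwa [one_mul]

lemma const (c : ℂ) (q : OnePoint ℂ) : HasVal q (RatFunc.C c) c := by simp [HasVal]

lemma pow (hf : HasVal q f c) (n : ℕ) : HasVal q (f ^ n) (c ^ n) := by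
  induction n with
  | zero => simpa using HasVal.const 1 q
  | succ n ih => rw [pow_succ, pow_succ]; exact ih.mul hf

lemma sum {ι : Type*} (s : Finset ι) {f : ι → K} {c : ι → ℂ} (h : ∀ i ∈ s, HasVal q (f i) (c i)) :
    HasVal q (∑ i ∈ s, f i) (∑ i ∈ s, c i) := by
  classical
  induction s using Finset.induction_on with
  | empty => simpa using HasVal.const 0 q
  | insert a s ha ih =>
    rw [Finset.sum_insert ha, Finset.sum_insert ha]
    exact (h a (by simp)).add (ih fun i hi => h i (by simp [hi]))

lemma coe_iff {a : ℂ} : HasVal (a : OnePoint ℂ) f c ↔ f.denom.eval a ≠ 0 ∧ ratEval f a = c := by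
  constructor
  · intro h
    exact ⟨h.mem, (ordAt_sub_C_lt_one_iff h.mem).1 h⟩
  · rintro ⟨h1, h2⟩
    exact (ordAt_sub_C_lt_one_iff h1).2 h2

lemma ratMap_iff {t : ℂ} : ratMap f q = (t : OnePoint ℂ) ↔ HasVal q f t := ratMap_eq_coe_iff

lemma comp {x : K} {t : ℂ} (h : HasVal q x t) (hf : HasVal (t : OnePoint ℂ) f c) :
    HasVal q (pullback x f) c := by
  obtain ⟨h1, rfl⟩ := coe_iff.1 hf
  exact ordAt_pullback_sub_lt h h1

end HasVal

/-! ### Smoothness of a plane curve -/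

section Smooth

variable {r : ℕ} {A : Matrix (Fin r) (Fin r) K} {ξ η : K} {t₀ : ℂ} {q : OnePoint ℂ}

lemma charpoly_coeff_mem {O : Subring K} (hA : ∀ i j, A i j ∈ O) (i : ℕ) :
    A.charpoly.coeff i ∈ O := by
  let A' : Matrix (Fin r) (Fin r) O := fun i j => ⟨A i j, hA i j⟩
  have : A = A'.map O.subtype := by ext; rfl
  rw [this, charpoly_map, coeff_map]
  exact Subtype.prop _

/-- Valuation rings are integrally closed. -/
lemma mem_regAt_of_isRoot {P : K[X]} (hP : P.Monic) (hc : ∀ i, P.coeff i ∈ regAt q)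
    (h : P.eval η = 0) : η ∈ regAt q := by
  have hl : P ∈ lifts (algebraMap (regAt q) K) := by
    rw [lifts_iff_coeff_lifts]
    exact fun n => ⟨⟨_, hc n⟩, rfl⟩
  obtain ⟨Q, hQ, -, hQm⟩ := lifts_and_degree_eq_and_monic hl hP
  have hint : IsIntegral (regAt q) η := ⟨Q, hQm, by rw [← eval_map, hQ, h]⟩
  obtain ⟨z, hz⟩ := IsIntegrallyClosed.isIntegral_iff.1 hint
  rw [← hz]; exact z.2

lemma hasVal_eval (hξ : HasVal q ξ t₀) {η₀ : ℂ} (hη : HasVal q η η₀) (n : ℕ) {c : ℕ → K}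
    (hc : ∀ i, c i ∈ regAt (t₀ : OnePoint ℂ)) :
    HasVal q (∑ i ∈ Finset.range n, pullback ξ (c i) * η ^ i)
      (ratEval (∑ i ∈ Finset.range n, c i * (RatFunc.C η₀) ^ i) t₀) := by
  have h1 : ∀ i, HasVal (t₀ : OnePoint ℂ) (c i) (ratEval (c i) t₀) := fun i =>
    HasVal.coe_iff.2 ⟨hc i, rfl⟩
  have h2 : HasVal (t₀ : OnePoint ℂ) (∑ i ∈ Finset.range n, c i * (RatFunc.C η₀) ^ i)
      (∑ i ∈ Finset.range n, ratEval (c i) t₀ * η₀ ^ i) :=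
    HasVal.sum _ fun i _ => (h1 i).mul ((HasVal.const η₀ _).pow i)
  rw [(HasVal.coe_iff.1 h2).2]
  exact HasVal.sum _ fun i _ => (hξ.comp (h1 i)).mul (hη.pow i)

/-- At a smooth point of the curve `E(ξ, η) = 0`, the form `dξ / E_η` is regular. -/
lemma smooth_form_regular (hξc : ∀ c : ℂ, ξ ≠ RatFunc.C c) (hξ : HasVal q ξ t₀)
    (hA : ∀ i j, A i j ∈ regAt (t₀ : OnePoint ℂ))
    (hs : SmoothOver A t₀) (hη : (A.charpoly.map (pullbackHom hξc).toRingHom).eval η = 0) :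
    η ∈ regAt q ∧ FormRegularAt (ratDeriv ξ /
      ((derivative A.charpoly).map (pullbackHom hξc).toRingHom).eval η) q := by
  set P := A.charpoly with hPdef
  have hPm : P.Monic := charpoly_monic A
  have hPc : ∀ i, P.coeff i ∈ regAt (t₀ : OnePoint ℂ) := fun i =>
    charpoly_coeff_mem (O := (regAt (t₀ : OnePoint ℂ)).toSubring) hA i
  have hcomp : ∀ f ∈ regAt (t₀ : OnePoint ℂ), pullback ξ f ∈ regAt q := fun f hf =>
    (hξ.comp (HasVal.coe_iff.2 ⟨hf, rfl⟩)).mem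
  have hηr : η ∈ regAt q := by
    refine mem_regAt_of_isRoot (hPm.map _) (fun i => ?_) hη
    rw [coeff_map]
    exact (pullbackHom_apply hξc (P.coeff i)) ▸ hcomp _ (hPc i)
  refine ⟨hηr, ?_⟩
  obtain ⟨η₀, hη₀⟩ := exists_residue hηr
  set n := P.natDegree + 1 with hn
  have hdn : (derivative P).natDegree < n := (natDegree_derivative_le P).trans_lt (by omega)
  have e0 : (P.map (pullbackHom hξc).toRingHom).eval η =
      ∑ i ∈ Finset.range n, pullback ξ (P.coeff i) * η ^ i := by
    rw [eval_map, eval₂_eq_sum_range]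
    exact Finset.sum_congr rfl fun i _ => by rw [← pullbackHom_apply hξc]; rfl
  have e1 : ((derivative P).map (pullbackHom hξc).toRingHom).eval η =
      ∑ i ∈ Finset.range n, pullback ξ ((derivative P).coeff i) * η ^ i := by
    rw [eval_map, eval₂_eq_sum_range' _ hdn]
    exact Finset.sum_congr rfl fun i _ => by rw [← pullbackHom_apply hξc]; rfl
  have hdc : ∀ i, (derivative P).coeff i ∈ regAt (t₀ : OnePoint ℂ) := fun i => by
    rw [coeff_derivative]
    refine mul_mem (hPc _) (add_mem ?_ (one_mem _))
    exact natCast_mem _ _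
  have v0 := hasVal_eval hξ hη₀ n hPc
  have v1 := hasVal_eval hξ hη₀ n hdc
  have hPd : ∀ i, ratDeriv (P.coeff i) ∈ regAt (t₀ : OnePoint ℂ) := fun i => by
    have := formRegularAt_ratDeriv (hPc i)
    exact this
  have v2 := hasVal_eval hξ hη₀ n hPd
  have s0 : P.eval (RatFunc.C η₀) = ∑ i ∈ Finset.range n, P.coeff i * (RatFunc.C η₀) ^ i := by
    rw [eval_eq_sum_range]
  have s1 : (derivative P).eval (RatFunc.C η₀) =
      ∑ i ∈ Finset.range n, (derivative P).coeff i * (RatFunc.C η₀) ^ i := by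
    rw [eval_eq_sum_range' hdn]
  have s2 : ratDeriv (P.eval (RatFunc.C η₀)) =
      ∑ i ∈ Finset.range n, ratDeriv (P.coeff i) * (RatFunc.C η₀) ^ i := by
    rw [s0, ← ratDerivation_apply, map_sum]
    refine Finset.sum_congr rfl fun i _ => ?_
    rw [ratDerivation_apply, ratDeriv_mul, ← map_pow, ratDeriv_C, mul_zero, add_zero]
  rw [← s0, ← e0, hη] at v0
  rw [← s1, ← e1] at v1
  rw [← s2] at v2
  have hzero : ratEval (P.eval (RatFunc.C η₀)) t₀ = 0 := by
    by_contra hne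
    have := ordAt_eq_one_of_sub_lt hne v0
    simp at this
  -- Differentiating `E(ξ, η) = 0` gives `E_ξ dξ + E_η dη = 0`.
  have hrel : ratDeriv ξ * (∑ i ∈ Finset.range n, pullback ξ (ratDeriv (P.coeff i)) * η ^ i) +
      ((derivative P).map (pullbackHom hξc).toRingHom).eval η * ratDeriv η = 0 := by
    have h := congrArg ratDerivation hη
    rw [e0, map_sum, map_zero] at h
    have hd : ((derivative P).map (pullbackHom hξc).toRingHom).eval η =
        ∑ i ∈ Finset.range n, pullback ξ (P.coeff i) * i * η ^ (i - 1) := by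
      rw [← derivative_map, derivative_eval, sum_over_range' _ (by simp) n
        ((natDegree_map_le).trans_lt (by omega))]
      refine Finset.sum_congr rfl fun i _ => ?_
      rw [coeff_map, ← pullbackHom_apply hξc]; rfl
    rw [← h, Finset.mul_sum, hd, Finset.sum_mul, ← Finset.sum_add_distrib]
    refine Finset.sum_congr rfl fun i _ => ?_
    rw [ratDerivation_apply, ratDeriv_mul, ← pullbackHom_apply hξc, ← pullbackHom_apply hξc,
      ratDeriv_pullbackHom, ← ratDerivation_apply (η ^ i), ratDerivation.leibniz_pow]
    simp only [ratDerivation_apply, smul_eq_mul, nsmul_eq_mul]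
    ring
  rw [formRegularAt_iff]
  set Eη := ((derivative P).map (pullbackHom hξc).toRingHom).eval η with hEη
  -- If `E_η` is nonzero at the point, `dξ / E_η` is visibly regular. Otherwise `E_ξ` is nonzero
  -- there and `dξ / E_η = -dη / E_ξ`; when `E_η` is identically zero the quotient is zero by
  -- convention.
  rcases hs η₀ hzero with h | h
  · have h1 := ordAt_eq_one_of_sub_lt h v1
    rw [← mul_div_assoc, map_div₀, h1, div_one]
    exact formRegularAt_iff.1 (formRegularAt_ratDeriv hξ.mem)
  · have h1 := ordAt_eq_one_of_sub_lt h v2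
    set Ex := ∑ i ∈ Finset.range n, pullback ξ (ratDeriv (P.coeff i)) * η ^ i
    by_cases hE0 : Eη = 0
    · simp [hE0]
    have hEx0 : Ex ≠ 0 := by rintro h0; rw [h0] at h1; simp at h1
    have e : ratDeriv ξ / Eη = -(ratDeriv η) / Ex := by
      field_simp
      linear_combination hrel
    rw [e, ← mul_div_assoc, map_div₀, h1, div_one, mul_neg, Valuation.map_neg]
    exact formRegularAt_iff.1 (formRegularAt_ratDeriv hηr)

end Smooth

/-! ### The spectral covering -/

section Cover

variable {r : ℕ} {Φ : RationalHConnection r} {x y : K}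

lemma map_pullback_eq (hx : ∀ c : ℂ, x ≠ RatFunc.C c) (A : Matrix (Fin r) (Fin r) K) :
    A.map (pullback x) = A.map (pullbackHom hx).toRingHom := by
  ext i j
  exact (pullbackHom_apply hx (A i j)).symm

lemma charpoly_pullback (hx : ∀ c : ℂ, x ≠ RatFunc.C c) (A : Matrix (Fin r) (Fin r) K) :
    (A.map (pullback x)).charpoly = A.charpoly.map (pullbackHom hx).toRingHom := by
  rw [map_pullback_eq hx, charpoly_map]

namespace IsSmoothGenusZeroSpectralCurve

/-- `E_ω` does not vanish identically on the spectral curve. -/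
lemma derivative_ne_zero (h : IsSmoothGenusZeroSpectralCurve Φ x y) :
    (derivative (Φ.higgs.map (pullback x)).charpoly).eval y ≠ 0 := by
  rw [charpoly_pullback h.nonconstant, derivative_map]
  have h1 := h.on_curve
  rw [charpoly_pullback h.nonconstant] at h1
  have hsep : Φ.higgs.charpoly.Separable := h.irreducible.separable
  obtain ⟨a, b, hab⟩ := hsep
  intro h2
  have := congrArg (fun p => (p.map (pullbackHom h.nonconstant).toRingHom).eval y) hab
  simp only [Polynomial.map_add, Polynomial.map_mul, eval_add, eval_mul, h1, h2] at this
  simp at this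

lemma pos (h : IsSmoothGenusZeroSpectralCurve Φ x y) : 0 < r := by
  rcases Nat.eq_zero_or_pos r with rfl | hr
  · have := h.irreducible.not_isUnit
    rw [charpoly_isEmpty] at this
    simp at this
  · exact hr

-- The degree of `x` is `[ℂ(z) : ℂ(x)]`. As `x` and `y` generate `ℂ(z)`, this is the degree of `y`
-- over `ℂ(x)`, and `y` is a root of a characteristic polynomial of degree `r`.
open IntermediateField in
lemma natDegree_le (h : IsSmoothGenusZeroSpectralCurve Φ x y) :
    max x.num.natDegree x.denom.natDegree ≤ r := by
  have hr := h.pos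
  have : Nonempty (Fin r) := ⟨⟨0, hr⟩⟩
  rw [← RatFunc.finrank_eq_max_natDegree]
  let φ : K →+* ℂ⟮x⟯ :=
    (RatFunc.algEquivOfTranscendental x (transcendental_of_nonconstant h.nonconstant)).toAlgHom.toRingHom
  let P : ℂ⟮x⟯[X] := (Φ.higgs.map φ).charpoly
  have hP : P.Monic := charpoly_monic _
  have hdeg : P.natDegree = r := by
    rw [charpoly_natDegree_eq_dim, Fintype.card_fin]
  have hroot : aeval y P = 0 := by
    have h1 := h.on_curve
    rw [charpoly_pullback h.nonconstant] at h1
    rw [aeval_def, ← eval_map, ← h1]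
    simp only [P]
    rw [charpoly_map, Polynomial.map_map]
    rfl
  have hint : IsIntegral ℂ⟮x⟯ y := ⟨P, hP, hroot⟩
  have htop : ℂ⟮x⟯⟮y⟯ = ⊤ := by
    refine restrictScalars_eq_top_iff.1 ((adjoin_simple_adjoin_simple ℂ x y).trans h.generates)
  have : Module.finrank ℂ⟮x⟯ K = (minpoly ℂ⟮x⟯ y).natDegree := by
    rw [← adjoin.finrank hint, htop, finrank_top']
  rw [this, ← hdeg]
  exact natDegree_le_of_dvd (minpoly.dvd _ _ hroot) hP.ne_zero

end IsSmoothGenusZeroSpectralCurve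

namespace WKBSolution

variable (S : WKBSolution Φ x y)

lemma hasVal_sheet (a : Fin r) {t : ℂ} (ht : t ∈ S.D) :
    HasVal (S.sheet a t : OnePoint ℂ) x t :=
  HasVal.ratMap_iff.1 (S.sheet_over a t ht)

lemma sheet_ne {a b : Fin r} {s t : ℂ} (hs : s ∈ S.D) (ht : t ∈ S.D) (hst : s ≠ t) :
    S.sheet a s ≠ S.sheet b t := by
  intro h
  have h1 := S.sheet_over a s hs
  rw [h, S.sheet_over b t ht] at h1
  exact hst (OnePoint.coe_injective h1).symm

/-- The `r` sheets give `r` distinct roots of a polynomial of degree at most `r`. So there are no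
further roots, all roots are simple, and the degree does not drop, which excludes a point at
infinity in the fibre. -/
lemma fibrePoly_roots (hcurve : IsSmoothGenusZeroSpectralCurve Φ x y) {t : ℂ} (ht : t ∈ S.D) :
    (x.num - C t * x.denom).natDegree = r ∧
    (x.num - C t * x.denom).roots.Nodup ∧
    (x.num - C t * x.denom).roots.toFinset = Finset.univ.image fun a => S.sheet a t := by
  set p := x.num - C t * x.denom with hp
  have hp0 : p ≠ 0 := by
    intro h0
    apply hcurve.nonconstant t
    rw [sub_eq_zero] at h0
    rw [← RatFunc.num_div_denom x, h0, map_mul, RatFunc.algebraMap_C,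
      mul_div_cancel_right₀ _ (algebraMap_ratFunc_ne_zero x.denom_ne_zero)]
  have hdeg : p.natDegree ≤ r := by
    refine le_trans ((natDegree_sub_le _ _).trans (max_le_max le_rfl (natDegree_C_mul_le _ _)))
      hcurve.natDegree_le
  have hsub : (Finset.univ.image fun a => S.sheet a t) ⊆ p.roots.toFinset := by
    intro z hz
    obtain ⟨a, -, rfl⟩ := Finset.mem_image.1 hz
    rw [Multiset.mem_toFinset, mem_roots hp0, IsRoot.def]
    obtain ⟨h1, h2⟩ := HasVal.coe_iff.1 (S.hasVal_sheet a ht)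
    have h3 : x.num.eval (S.sheet a t) / x.denom.eval (S.sheet a t) = t := h2
    rw [div_eq_iff h1] at h3
    simp [hp, h3]
  have hcard : (Finset.univ.image fun a => S.sheet a t).card = r := by
    rw [Finset.card_image_of_injective _ (S.sheet_injective t ht), Finset.card_univ,
      Fintype.card_fin]
  have h1 := Finset.card_le_card hsub
  have h2 := Multiset.toFinset_card_le p.roots
  have h3 := p.card_roots'
  refine ⟨by omega, ?_, ?_⟩
  · rw [← Multiset.toFinset_card_eq_card_iff_nodup]; omega
  · exact (Finset.eq_of_subset_of_card_le hsub (by omega)).symm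

/-- The sheets exhaust the fibres of the covering over `D`. -/
lemma exists_sheet (hcurve : IsSmoothGenusZeroSpectralCurve Φ x y) {t : ℂ} (ht : t ∈ S.D)
    {q : OnePoint ℂ} (hq : HasVal q x t) : ∃ a, q = (S.sheet a t : OnePoint ℂ) := by
  obtain ⟨h1, -, h3⟩ := S.fibrePoly_roots hcurve ht
  have hr := hcurve.pos
  set p := x.num - C t * x.denom with hp
  have hp0 : p ≠ 0 := by rintro h0; rw [h0] at h1; simp at h1; omega
  have e : x - RatFunc.C t = algebraMap ℂ[X] K p / algebraMap ℂ[X] K x.denom := by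
    conv_lhs => rw [← RatFunc.num_div_denom x]
    have := algebraMap_ratFunc_ne_zero x.denom_ne_zero
    rw [hp, map_sub, map_mul, RatFunc.algebraMap_C]
    field_simp
  cases q with
  | infty =>
    exfalso
    have h4 := ordAt_infty_lt_one_iff.1 hq
    have hne : x - RatFunc.C t ≠ 0 := sub_ne_zero.2 (hcurve.nonconstant t)
    have h5 := h4.resolve_left hne
    rw [e, RatFunc.intDegree_div (algebraMap_ratFunc_ne_zero hp0)
      (algebraMap_ratFunc_ne_zero x.denom_ne_zero), RatFunc.intDegree_polynomial,
      RatFunc.intDegree_polynomial, h1] at h5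
    have := (le_max_right _ _).trans hcurve.natDegree_le
    omega
  | coe z =>
    obtain ⟨h4, h5⟩ := HasVal.coe_iff.1 hq
    have h6 : x.num.eval z / x.denom.eval z = t := h5
    rw [div_eq_iff h4] at h6
    have hz : z ∈ p.roots.toFinset := by
      rw [Multiset.mem_toFinset, mem_roots hp0, IsRoot.def]
      simp [hp, h6]
    rw [h3] at hz
    obtain ⟨a, -, ha⟩ := Finset.mem_image.1 hz
    exact ⟨a, by rw [← ha]⟩

/-- At a root of `num - t · denom` the derivative of `x` is that of this polynomial divided by the
denominator of `x`, and the roots are simple. -/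
lemma ratEval_deriv_sheet_ne_zero (hcurve : IsSmoothGenusZeroSpectralCurve Φ x y) (a : Fin r)
    {t : ℂ} (ht : t ∈ S.D) : ratEval (ratDeriv x) (S.sheet a t) ≠ 0 := by
  obtain ⟨h1, h2, h3⟩ := S.fibrePoly_roots hcurve ht
  have hr := hcurve.pos
  set p := x.num - C t * x.denom with hp
  have hp0 : p ≠ 0 := by rintro h0; rw [h0] at h1; simp at h1; omega
  set z := S.sheet a t with hzdef
  obtain ⟨h4, h5⟩ := HasVal.coe_iff.1 (S.hasVal_sheet a ht)
  have h6 : x.num.eval z / x.denom.eval z = t := h5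
  rw [div_eq_iff h4] at h6
  have hz : z ∈ p.roots := by
    rw [mem_roots hp0, IsRoot.def, hp, eval_sub, h6]; simp [hzdef]
  have hone : p.rootMultiplicity z = 1 := by
    rw [← count_roots]; exact Multiset.count_eq_one_of_mem h2 hz
  have hd : (derivative p).eval z ≠ 0 := by
    intro h0
    have := (one_lt_rootMultiplicity_iff_isRoot hp0).2 ⟨(mem_roots hp0).1 hz, h0⟩
    omega
  rw [ratDeriv, ratEval_div _ _ (by simpa using h4)]
  have h7 : (derivative p).eval z = (derivative x.num).eval z - t * (derivative x.denom).eval z := by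
    simp [hp]
  rw [h7] at hd
  have : eval z (derivative x.num * x.denom - x.num * derivative x.denom) =
      ((derivative x.num).eval z - t * (derivative x.denom).eval z) * x.denom.eval z := by
    rw [eval_sub, eval_mul, eval_mul, h6]; ring
  rw [this, eval_pow]
  exact div_ne_zero (mul_ne_zero hd h4) (pow_ne_zero 2 h4)

lemma ratDeriv_sheet_mem (a : Fin r) {t : ℂ} (ht : t ∈ S.D) :
    (ratDeriv x).denom.eval (S.sheet a t) ≠ 0 :=
  formRegularAt_ratDeriv (q := (S.sheet a t : OnePoint ℂ)) (S.hasVal_sheet a ht).mem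

/-- The covering is unramified over `D`. -/
lemma not_isRamified_sheet (hcurve : IsSmoothGenusZeroSpectralCurve Φ x y) (a : Fin r)
    {t : ℂ} (ht : t ∈ S.D) : ¬ IsRamified x (S.sheet a t : OnePoint ℂ) := by
  rw [IsRamified, if_neg (by rw [S.sheet_over a t ht]; exact OnePoint.coe_ne_infty t)]
  rintro ⟨h1, h2⟩
  apply S.ratEval_deriv_sheet_ne_zero hcurve a ht
  change _ / _ = _
  rw [show (ratDeriv x).num.eval₂ (RingHom.id ℂ) (S.sheet a t) = 0 from h2, zero_div]

lemma infinite_D : S.D.Infinite := by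
  obtain ⟨t, ht⟩ := S.isConnected.nonempty
  exact infinite_of_mem_nhds t (S.isOpen.mem_nhds ht)

lemma injOn_sheet (a : Fin r) : Set.InjOn (S.sheet a) S.D := fun s hs t ht h => by
  by_contra hne; exact S.sheet_ne hs ht hne h

lemma infinite_sheet_image (a : Fin r) {A : Set ℂ} (hA : A ⊆ S.D) (hi : A.Infinite) :
    (S.sheet a '' A).Infinite :=
  hi.image ((S.injOn_sheet a).mono hA)

/-- Points of `Σ` that do not lie over `D`. -/
lemma not_hasVal_of_isRamified (hcurve : IsSmoothGenusZeroSpectralCurve Φ x y) {q : OnePoint ℂ}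
    (hq : IsRamified x q) {t : ℂ} (ht : t ∈ S.D) : ¬ HasVal q x t := by
  intro h
  obtain ⟨a, rfl⟩ := S.exists_sheet hcurve ht h
  exact S.not_isRamified_sheet hcurve a ht hq

lemma not_hasVal_of_isSingularity {q : OnePoint ℂ} (hq : Φ.IsSingularity 0 (ratMap x q))
    {t : ℂ} (ht : t ∈ S.D) : ¬ HasVal q x t := by
  intro h
  rw [HasVal.ratMap_iff.2 h] at hq
  exact S.not_singular t ht hq

end WKBSolution

/-! #### The coordinate `1 / (x - t₀)` -/

lemma ordAt_sub_C_eq_of_pole {q : OnePoint ℂ} (h : x ∉ regAt q) (t : ℂ) :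
    ordAt q (x - RatFunc.C t) = ordAt q x := by
  have hlt : 1 < ordAt q x := by rw [← not_le, ordAt_le_one_iff]; exact h
  rw [sub_eq_add_neg]
  exact Valuation.map_add_eq_of_lt_left _
    (by rw [Valuation.map_neg]; exact (ordAt_le_one_iff.2 (C_mem_regAt t q)).trans_lt hlt)

lemma ordAt_sub_C_eq_one {q : OnePoint ℂ} (h : x ∈ regAt q) {t : ℂ} (ht : ¬ HasVal q x t) :
    ordAt q (x - RatFunc.C t) = 1 := by
  have h1 : ordAt q (x - RatFunc.C t) ≤ 1 := ordAt_le_one_iff.2 (sub_mem h (C_mem_regAt t q))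
  exact le_antisymm h1 (not_lt.1 ht)

lemma ordAt_sub_C_eq {q : OnePoint ℂ} {s t : ℂ} (hs : ¬ HasVal q x s) (ht : ¬ HasVal q x t) :
    ordAt q (x - RatFunc.C s) = ordAt q (x - RatFunc.C t) := by
  by_cases h : x ∈ regAt q
  · rw [ordAt_sub_C_eq_one h hs, ordAt_sub_C_eq_one h ht]
  · rw [ordAt_sub_C_eq_of_pole h, ordAt_sub_C_eq_of_pole h]

/-- The coordinate `1 / (x - t₀)`. -/
def invCoord (x : K) (t₀ : ℂ) : K := (x - RatFunc.C t₀)⁻¹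

lemma ordAt_invCoord_le_one {q : OnePoint ℂ} {t : ℂ} (ht : ¬ HasVal q x t) :
    ordAt q (invCoord x t) ≤ 1 := by
  rw [invCoord, map_inv₀]
  exact inv_le_one_of_one_le₀ (not_lt.1 ht)

lemma ratDeriv_invCoord (hx : ∀ c : ℂ, x ≠ RatFunc.C c) (t : ℂ) :
    ratDeriv (invCoord x t) = -ratDeriv x * invCoord x t ^ 2 := by
  have hne : x - RatFunc.C t ≠ 0 := sub_ne_zero.2 (hx t)
  rw [invCoord, ratDeriv_inv _ hne, ratDeriv_sub, ratDeriv_C, sub_zero, inv_pow, div_eq_mul_inv]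

/-- Off the fibre of `t` the function `1 / (x - t)` serves as a coordinate of the base both at
finite points and at infinity. It replaces the two charts in the definition of ramification, and all
later weights are expressed in it. -/
lemma isRamified_iff (hx : ∀ c : ℂ, x ≠ RatFunc.C c) {q : OnePoint ℂ} {t : ℂ}
    (ht : ¬ HasVal q x t) :
    IsRamified x q ↔ ordAt q (formFactor q * ratDeriv (invCoord x t)) < 1 := by
  have hx0 : x ≠ 0 := by simpa using hx 0
  rw [ratDeriv_invCoord hx, mul_comm (formFactor q), map_mul, map_mul, Valuation.map_neg, map_pow,
    invCoord, map_inv₀, IsRamified]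
  split_ifs with h
  · rw [ratMap_eq_infty_iff] at h
    rw [formVanishesAt_iff, ratDeriv_inv _ hx0, ordAt_sub_C_eq_of_pole h, mul_comm (formFactor q),
      map_mul, map_div₀, Valuation.map_neg, map_pow, inv_pow, div_eq_mul_inv]
  · rw [ratMap_eq_infty_iff, not_not] at h
    rw [formVanishesAt_iff, ordAt_sub_C_eq_one h ht]
    simp [mul_comm]

lemma formRegularAt_ratDeriv_invCoord {q : OnePoint ℂ} {t : ℂ} (ht : ¬ HasVal q x t) :
    ordAt q (formFactor q * ratDeriv (invCoord x t)) ≤ 1 :=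
  formRegularAt_iff.1 (formRegularAt_ratDeriv (ordAt_le_one_iff.1 (ordAt_invCoord_le_one ht)))

lemma ordAt_invCoord_eq_one {q : OnePoint ℂ} (h : x ∈ regAt q) {t : ℂ} (ht : ¬ HasVal q x t) :
    ordAt q (invCoord x t) = 1 := by
  rw [invCoord, map_inv₀, ordAt_sub_C_eq_one h ht, inv_one]

/-- The pullback of a one-form which is regular at `x(q)`. -/
lemma ordAt_pullback_le {q : OnePoint ℂ} {t : ℂ} (ht : ¬ HasVal q x t) {f : K}
    (hf : FormRegularAt f (ratMap x q)) : ordAt q (pullback x f) ≤ ordAt q (invCoord x t) ^ 2 := by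
  by_cases h : x ∈ regAt q
  · rw [ordAt_invCoord_eq_one h ht, one_pow, ordAt_le_one_iff]
    obtain ⟨c, hc⟩ := exists_residue h
    rw [HasVal.ratMap_iff.2 hc] at hf
    exact pullback_mem_regAt hc hf
  · rw [ratMap_eq_infty_iff.2 h] at hf
    have h1 := ordAt_pullback_of_pole h hf
    have h0 : ordAt q x ≠ 0 := by
      rw [Valuation.ne_zero_iff]; rintro rfl; exact h (zero_mem _)
    rw [invCoord, map_inv₀, ordAt_sub_C_eq_of_pole h, inv_pow, ← one_div,
      le_div_iff₀ (pow_pos (zero_lt_iff.2 h0) 2), mul_comm, ← map_pow, ← map_mul]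
    exact h1

end Cover

/-! ### The spectral curve over the regular points of the Higgs field -/

section Regular

variable {r : ℕ} {Φ : RationalHConnection r} {x y : K}

/-- `E_ω` restricted to the spectral curve. -/
def Eω (Φ : RationalHConnection r) (x y : K) : K :=
  (derivative (Φ.higgs.map (pullback x)).charpoly).eval y

lemma pullbackHom_inv_inv (hx' : ∀ c : ℂ, x⁻¹ ≠ RatFunc.C c)
    (f : K) : pullbackHom hx' (pullback RatFunc.X⁻¹ f) = pullback x f := by
  rw [pullback_eq_aeval_div, pullback_eq_aeval_div, map_div₀, ← aeval_algHom_apply,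
    ← aeval_algHom_apply, map_inv₀, pullbackHom_X, inv_inv]

lemma X_inv_not_mem_regAt_zero : (RatFunc.X⁻¹ : K) ∉ regAt ((0 : ℂ) : OnePoint ℂ) := by
  rw [← ordAt_lt_one_iff_inv_not_mem RatFunc.X_ne_zero, ordAt_coe_lt_one_iff]
  simp

/-- Homogeneity of the characteristic polynomial, needed for the change of chart: in `u = 1 / x` the
Higgs field and its eigenvalue are both multiplied by `-x²`. -/
lemma charpoly_smul_comp (B : Matrix (Fin r) (Fin r) K) (c : K) :
    (c • B).charpoly.comp (C c * X) = C (c ^ r) * B.charpoly := by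
  refine Polynomial.funext fun t => ?_
  rw [eval_comp, eval_mul, eval_mul, eval_C, eval_C, eval_X, eval_charpoly, eval_charpoly]
  have : scalar (Fin r) (c * t) - c • B = c • (scalar (Fin r) t - B) := by
    rw [smul_sub]; congr 1
    ext i j; simp [scalar_apply, diagonal_apply]
  rw [this, det_smul, Fintype.card_fin]

lemma charpoly_smul_eval (B : Matrix (Fin r) (Fin r) K) (c t : K) :
    (c • B).charpoly.eval (c * t) = c ^ r * B.charpoly.eval t := by
  have := congrArg (eval t) (charpoly_smul_comp B c)
  simpa using this

lemma derivative_charpoly_smul_eval (hr : 0 < r) (B : Matrix (Fin r) (Fin r) K) {c : K} (hc : c ≠ 0)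
    (t : K) : (derivative (c • B).charpoly).eval (c * t) =
      c ^ (r - 1) * (derivative B.charpoly).eval t := by
  have := congrArg (fun p => eval t (derivative p)) (charpoly_smul_comp B c)
  simp only [derivative_comp, derivative_mul, derivative_C, derivative_X, zero_mul, mul_one,
    zero_add, eval_mul, eval_C, eval_comp, eval_X] at this
  obtain ⟨k, rfl⟩ : ∃ k, r = k + 1 := ⟨r - 1, by omega⟩
  rw [Nat.add_sub_cancel]
  rw [pow_succ] at this
  apply mul_left_cancel₀ hc
  rw [this]; ring

/-- The behaviour of `y` and of `dx / E_ω` over a point where the Higgs field is regular, in terms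
of the coordinate `v = 1 / (x - t₀)`. -/
lemma regular_of_not_isSingularity (hcurve : IsSmoothGenusZeroSpectralCurve Φ x y)
    {q : OnePoint ℂ} (hq : ¬ Φ.IsSingularity 0 (ratMap x q)) {t₀ : ℂ} (ht : ¬ HasVal q x t₀) :
    ordAt q y ≤ ordAt q (invCoord x t₀) ^ 2 ∧
      ordAt q (formFactor q * ratDeriv (invCoord x t₀) * invCoord x t₀ ^ (2 * (r - 1)) / Eω Φ x y)
        ≤ 1 := by
  have hx := hcurve.nonconstant
  have hr := hcurve.pos
  have hreg : ∀ i j, FormRegularAt (Φ.higgs i j) (ratMap x q) := by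
    intro i j
    by_contra h
    exact hq ⟨i, j, h⟩
  by_cases h : x ∈ regAt q
  · obtain ⟨p, hp⟩ := exists_residue h
    have hv := ordAt_invCoord_eq_one h ht
    rw [HasVal.ratMap_iff.2 hp] at hq hreg
    have hroot := hcurve.on_curve
    rw [charpoly_pullback hx] at hroot
    obtain ⟨h1, h2⟩ := smooth_form_regular hx hp (A := Φ.higgs) (fun i j => hreg i j)
      (hcurve.smooth p hq) hroot
    rw [hv, one_pow]
    refine ⟨ordAt_le_one_iff.2 h1, ?_⟩
    rw [formRegularAt_iff] at h2
    rw [ratDeriv_invCoord hx, map_div₀, map_mul, map_mul, map_mul, Valuation.map_neg, map_pow,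
      map_pow, hv, one_pow, one_pow, mul_one, mul_one, ← map_mul, ← map_div₀, mul_div_assoc]
    rw [Eω, charpoly_pullback hx, derivative_map]
    exact h2
  · have hlt : 1 < ordAt q x := by rw [← not_le, ordAt_le_one_iff]; exact h
    have h0 : ordAt q x ≠ 0 := (zero_lt_one.trans hlt).ne'
    have hx0 : x ≠ 0 := by rintro rfl; exact h (zero_mem _)
    have hx' : ∀ c : ℂ, x⁻¹ ≠ RatFunc.C c := by
      intro c hc
      apply hx c⁻¹
      rw [map_inv₀, ← hc, inv_inv]
    rw [ratMap_eq_infty_iff.2 h] at hq hreg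
    have hval : HasVal q x⁻¹ 0 := by
      rw [HasVal, map_zero, sub_zero, map_inv₀]
      exact inv_lt_one_of_one_lt₀ hlt
    have hA : ∀ i j, Φ.higgsAtInfinity i j ∈ regAt ((0 : ℂ) : OnePoint ℂ) := by
      intro i j
      have := ordAt_pullback_of_pole X_inv_not_mem_regAt_zero (hreg i j)
      rw [← ordAt_le_one_iff]
      have e : Φ.higgsAtInfinity i j = -(RatFunc.X⁻¹ ^ 2 * pullback RatFunc.X⁻¹ (Φ.higgs i j)) := by
        simp [RationalHConnection.higgsAtInfinity]
      rw [e, Valuation.map_neg]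
      exact this
    -- Over infinity, smoothness is applied in the chart `u = 1 / x`, where the spectral data on the
    -- curve are `(1 / x, -x² y)`.
    have hmap : Φ.higgsAtInfinity.map (pullbackHom hx').toRingHom =
        (-x ^ 2) • (Φ.higgs.map (pullback x)) := by
      ext i j
      change pullbackHom hx' (-(RatFunc.X⁻¹ ^ 2) * pullback RatFunc.X⁻¹ (Φ.higgs i j)) =
        (-x ^ 2) * pullback x (Φ.higgs i j)
      rw [map_mul, map_neg, map_pow, map_inv₀, pullbackHom_X, inv_inv, pullbackHom_inv_inv hx']
    have hc : (-x ^ 2 : K) ≠ 0 := neg_ne_zero.2 (pow_ne_zero 2 hx0)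
    have hroot : (Φ.higgsAtInfinity.charpoly.map (pullbackHom hx').toRingHom).eval (-x ^ 2 * y)
        = 0 := by
      rw [← charpoly_map]
      change (Φ.higgsAtInfinity.map (pullbackHom hx').toRingHom).charpoly.eval _ = 0
      rw [hmap, charpoly_smul_eval, hcurve.on_curve, mul_zero]
    obtain ⟨h1, h2⟩ := smooth_form_regular hx' hval hA (hcurve.smooth_infinity hq) hroot
    have hv : ordAt q (invCoord x t₀) = (ordAt q x)⁻¹ := by
      rw [invCoord, map_inv₀, ordAt_sub_C_eq_of_pole h]
    constructor
    · rw [← ordAt_le_one_iff, map_mul, Valuation.map_neg, map_pow] at h1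
      rw [hv, inv_pow, ← one_div, le_div_iff₀ (pow_pos (zero_lt_iff.2 h0) 2), mul_comm]
      exact h1
    -- The derivative of the characteristic polynomial is homogeneous of degree `r - 1`. The
    -- resulting factor `x ^ (2 (r - 1))` is what the power of `v` in the statement compensates.
    · have e : ((derivative Φ.higgsAtInfinity.charpoly).map (pullbackHom hx').toRingHom).eval
          (-x ^ 2 * y) = (-x ^ 2) ^ (r - 1) * Eω Φ x y := by
        rw [← derivative_map, ← charpoly_map]
        change (derivative (Φ.higgsAtInfinity.map (pullbackHom hx').toRingHom).charpoly).eval _ = _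
        rw [hmap, derivative_charpoly_smul_eval hr _ hc, Eω]
      rw [e, formRegularAt_iff, ratDeriv_inv _ hx0] at h2
      refine le_of_eq_of_le ?_ h2
      rw [ratDeriv_invCoord hx]
      simp only [map_mul, map_div₀, map_pow, Valuation.map_neg, hv, inv_pow, pow_mul]
      simp only [div_eq_mul_inv, mul_inv]
      simp only [mul_comm, mul_left_comm, mul_assoc]

end Regular

/-! ### Expansion of determinants in rows -/

section Det

variable {ι R : Type*} [Fintype ι] [DecidableEq ι] [CommRing R]

/-- The matrix with the rows of `A` in `s` and those of `B` elsewhere. -/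
def rowPiecewise (s : Finset ι) (A B : Matrix ι ι R) : Matrix ι ι R :=
  of fun i j => if i ∈ s then A i j else B i j

omit [Fintype ι] [CommRing R] in
lemma rowPiecewise_apply (s : Finset ι) (A B : Matrix ι ι R) (i j : ι) :
    rowPiecewise s A B i j = if i ∈ s then A i j else B i j := rfl

lemma det_add_eq_sum_piecewise (A B : Matrix ι ι R) :
    (A + B).det = ∑ s : Finset ι, (rowPiecewise s A B).det := by
  refine ((detRowAlternating (R := R) (n := ι)).toMultilinearMap.map_add_univ A B).trans
    (Finset.sum_congr rfl fun s _ => ?_)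
  change det _ = _
  congr 1
  ext i j
  by_cases hi : i ∈ s <;> simp [rowPiecewise, Finset.piecewise, hi]

lemma det_piecewise_mul (s : Finset ι) (c : ι → R) (A B : Matrix ι ι R) :
    (rowPiecewise s (of fun i j => c i * A i j) B).det =
      (∏ i ∈ s, c i) * (rowPiecewise s A B).det := by
  have h := det_mul_column (fun i => if i ∈ s then c i else 1) (rowPiecewise s A B)
  rw [Finset.prod_ite_mem, Finset.univ_inter] at h
  rw [← h]
  congr 1
  ext i j
  by_cases hi : i ∈ s <;> simp [rowPiecewise, hi]

/-- The matrix `H` with the rows in `s` replaced by the unit vectors `e_{g i}`. -/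
def rowRepl (H : Matrix ι ι R) (s : Finset ι) (g : ι → ι) : Matrix ι ι R :=
  rowPiecewise s (of fun i j => if j = g i then 1 else 0) H

omit [Fintype ι] in
lemma rowRepl_apply (H : Matrix ι ι R) (s : Finset ι) (g : ι → ι) (i j : ι) :
    rowRepl H s g i j = if i ∈ s then (if j = g i then 1 else 0) else H i j := by
  rfl

omit [Fintype ι] in
lemma rowRepl_map {R' : Type*} [CommRing R'] (φ : R →+* R') (H : Matrix ι ι R) (s : Finset ι)
    (g : ι → ι) : (rowRepl H s g).map φ = rowRepl (H.map φ) s g := by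
  ext i j
  simp only [map_apply, rowRepl_apply]
  split_ifs <;> simp

/-- To control all the determinants of `rowRepl H s g`, it suffices to control those for which
`g` maps no element of `s` to another element of `s`. -/
lemma rowRepl_det_mem {G : AddSubgroup R} (H : Matrix ι ι R) (s : Finset ι)
    (h : ∀ g : ι → ι, (∀ i ∈ s, ∀ j ∈ s, i ≠ j → g i ≠ j) → (rowRepl H s g).det ∈ G) (g : ι → ι) :
    (rowRepl H s g).det ∈ G := by
  -- Induction on the number of `i ∈ s` with `g i ≠ i`. If `g i = j` for another `j ∈ s`, then
  -- either row `j` is also `e_j` and the determinant vanishes, or exchanging rows `i` and `j` makes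
  -- `j` a new fixed point without destroying the old ones.
  induction hn : s.card - (s.filter fun i => g i = i).card using Nat.strong_induction_on
    generalizing g with
  | _ n ih =>
    by_cases hg : ∀ i ∈ s, ∀ j ∈ s, i ≠ j → g i ≠ j
    · exact h g hg
    push Not at hg
    obtain ⟨i, hi, j, hj, hij, hgi⟩ := hg
    by_cases hgj : g j = j
    · have h0 : (rowRepl H s g).det = 0 := by
        refine det_zero_of_row_eq hij ?_
        ext k
        simp [rowRepl_apply, hi, hj, hgi, hgj]
      rw [h0]; exact G.zero_mem
    have hswap : rowRepl H s g = (rowRepl H s (g ∘ Equiv.swap i j)).submatrix (Equiv.swap i j) id := by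
      ext a b
      rw [submatrix_apply, rowRepl_apply, rowRepl_apply]
      by_cases ha : a = i
      · subst ha; simp [hi, hj]
      by_cases hb : a = j
      · subst hb; simp [hi, hj]
      simp [Equiv.swap_apply_of_ne_of_ne ha hb]
    rw [hswap, det_permute, Equiv.Perm.sign_swap hij]
    have hlt : (s.filter fun k => g k = k).card <
        (s.filter fun k => (g ∘ Equiv.swap i j) k = k).card := by
      apply Finset.card_lt_card
      rw [Finset.ssubset_iff_of_subset]
      · refine ⟨j, ?_, ?_⟩
        · simp [hj, hgi]
        · simp [hgj]
      · intro k hk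
        rw [Finset.mem_filter] at hk ⊢
        refine ⟨hk.1, ?_⟩
        have h1 : k ≠ i := by rintro rfl; exact hij (hk.2.symm.trans hgi)
        have h2 : k ≠ j := by rintro rfl; exact hgj hk.2
        simp [Equiv.swap_apply_of_ne_of_ne h1 h2, hk.2]
    have hle := Finset.card_filter_le s (fun k => (g ∘ Equiv.swap i j) k = k)
    have := ih _ (by omega) (g ∘ Equiv.swap i j) rfl
    simpa using G.neg_mem this

/-- Expanding the rows in `s` in unit vectors reduces determinants with perturbed rows to the minors
of `H` that are under control. -/
lemma det_piecewise_expand (s : Finset ι) (H N : Matrix ι ι R) :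
    (rowPiecewise s N H).det =
      ∑ g ∈ Fintype.piFinset fun i => if i ∈ s then Finset.univ else {i},
        (∏ i ∈ s, N i (g i)) * (rowRepl H s g).det := by
  have h1 : (rowPiecewise s N H : ι → ι → R) =
      fun i => ∑ k ∈ (if i ∈ s then Finset.univ else {i}),
        (fun j => if i ∈ s then N i k * (if j = k then 1 else 0) else H i j) := by
    ext i j
    by_cases hi : i ∈ s
    · simp [rowPiecewise, hi]
    · simp [rowPiecewise, hi]
  have h2 := (detRowAlternating (R := R) (n := ι)).toMultilinearMap.map_sum_finset
    (fun i k j => if i ∈ s then N i k * (if j = k then 1 else 0) else H i j)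
    (fun i => if i ∈ s then Finset.univ else {i})
  rw [← h1] at h2
  refine h2.trans (Finset.sum_congr rfl fun g _ => ?_)
  rw [rowRepl, ← det_piecewise_mul]
  rfl

end Det

/-! ### Coefficients of squarefree monomials -/

section Coeff

variable {n : ℕ} {R : Type*} [CommRing R]

/-- The exponent of the monomial `∏ X i`. -/
def allOnes (n : ℕ) : Fin n →₀ ℕ := Finsupp.equivFunOnFinite.symm fun _ => 1

lemma allOnes_apply (i : Fin n) : allOnes n i = 1 := rfl

lemma coeff_allOnes_sq_mul (j : Fin n) (p : MvPolynomial (Fin n) R) :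
    MvPolynomial.coeff (allOnes n) (MvPolynomial.X j ^ 2 * p) = 0 := by
  rw [mul_comm, MvPolynomial.X_pow_eq_monomial, MvPolynomial.coeff_mul_monomial', if_neg]
  intro h
  have := h j
  simp [allOnes_apply] at this

variable {ι : Type*} [Fintype ι] [DecidableEq ι]

/-- The coefficient of `∏ X i` in a determinant is affine in a perturbation divisible by `X j`. -/
lemma coeff_allOnes_det_add (j : Fin n) (Q B : Matrix ι ι (MvPolynomial (Fin n) R))
    (hB : ∀ i k, MvPolynomial.X j ∣ B i k) :
    MvPolynomial.coeff (allOnes n) (Q + B).det = MvPolynomial.coeff (allOnes n) Q.det +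
      ∑ i, MvPolynomial.coeff (allOnes n) (Q.updateRow i (B i)).det := by
  choose B' hB' using hB
  -- Every row taken from `B` brings a factor `X j`. With two such rows the determinant is divisible
  -- by `X j ^ 2` and cannot contain the squarefree monomial.
  have key : ∀ s : Finset ι, (rowPiecewise s B Q).det =
      MvPolynomial.X j ^ s.card * (rowPiecewise s (of B') Q).det := by
    intro s
    rw [← Finset.prod_const, ← det_piecewise_mul]
    congr 1
    ext i k
    simp [hB', rowPiecewise]
  rw [add_comm Q, det_add_eq_sum_piecewise, MvPolynomial.coeff_sum]
  have hsub : (insert ∅ (Finset.univ.image fun i : ι => ({i} : Finset ι))) ⊆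
    (Finset.univ : Finset (Finset ι)) := Finset.subset_univ _
  rw [← Finset.sum_subset hsub, Finset.sum_insert, Finset.sum_image]
  · have h0 : rowPiecewise ∅ B Q = Q := by ext; simp [rowPiecewise]
    rw [h0]
    congr 1
    refine Finset.sum_congr rfl fun i _ => ?_
    have h1 : rowPiecewise {i} B Q = Q.updateRow i (B i) := by
      ext a b
      by_cases h : a = i
      · subst h; simp [rowPiecewise]
      · simp [rowPiecewise, h, updateRow_apply]
    rw [h1]
  · intro a _ b _ h; simpa using h
  · simp
  · intro s _ hs
    have h2 : 2 ≤ s.card := by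
      by_contra hlt
      have : s.card = 0 ∨ s.card = 1 := by omega
      rcases this with h | h
      · rw [Finset.card_eq_zero] at h; simp [h] at hs
      · obtain ⟨a, rfl⟩ := Finset.card_eq_one.1 h; simp at hs
    rw [key, show s.card = 2 + (s.card - 2) by omega, pow_add, mul_assoc, coeff_allOnes_sq_mul]

end Coeff

/-! ### The loop determinant -/

section Loop

variable {r n : ℕ} (x : K)

/-- The coefficient `1 / ((x - t_{f 0}) (t_{f 0} - t_{f 1}) ⋯ (t_{f k} - x))`. -/
def chainCoeff (t : Fin n → ℂ) {k : ℕ} (f : Fin (k + 1) → Fin n) : K :=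
  ((x - RatFunc.C (t (f 0))) *
    (∏ j : Fin k, RatFunc.C (t (f j.castSucc) - t (f j.succ))) *
    (RatFunc.C (t (f (Fin.last k))) - x))⁻¹

/-- The embedding of the scalars. -/
def scalarHom (n : ℕ) : R₀ →+* MvPolynomial (Fin n) (PowerSeries K) :=
  MvPolynomial.C.comp (PowerSeries.map (RatFunc.C : ℂ →+* K))

/-- The term of `𝓜_δ` belonging to a tuple of indices. -/
def chainTerm (t : Fin n → ℂ) (N : Fin n → Matrix (Fin r) (Fin r) R₀) {k : ℕ}
    (f : Fin (k + 1) → Fin n) :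
    Matrix (Fin r) (Fin r) (MvPolynomial (Fin n) (PowerSeries K)) :=
  (MvPolynomial.C (PowerSeries.C (chainCoeff x t f)) * ∏ j, MvPolynomial.X (f j)) •
    ((List.ofFn fun j => N (f j)).prod).map (scalarHom n)

/-- The matrix `𝓜_δ` for arbitrary matrices `N i` in place of `M (t i) (E i)`. -/
def chainSum (t : Fin n → ℂ) (N : Fin n → Matrix (Fin r) (Fin r) R₀) :
    Matrix (Fin r) (Fin r) (MvPolynomial (Fin n) (PowerSeries K)) :=
  ∑ k ∈ Finset.range n, ∑ f : Fin (k + 1) ↪ Fin n, chainTerm x t N f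

/-- The coefficient of `δ_1 ⋯ δ_n` in `det (H - c 𝓜_δ)`. -/
def loopCoeff (H : Matrix (Fin r) (Fin r) (PowerSeries K)) (c : PowerSeries K) (t : Fin n → ℂ)
    (N : Fin n → Matrix (Fin r) (Fin r) R₀) : PowerSeries K :=
  MvPolynomial.coeff (allOnes n) (H.map MvPolynomial.C - (MvPolynomial.C c : MvPolynomial (Fin n) (PowerSeries K)) • chainSum x t N).det

variable {x}

/-- The difference of two values of a term of `𝓜_δ` under a change of one of the matrices. -/
lemma chainTerm_update_sub (t : Fin n → ℂ) (N : Fin n → Matrix (Fin r) (Fin r) R₀) {k : ℕ}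
    (f : Fin (k + 1) ↪ Fin n) (j : Fin n) :
    ∃ Λ : Matrix (Fin r) (Fin r) R₀ →ₗ[R₀] Matrix (Fin r) (Fin r) R₀, ∀ A,
      chainTerm x t (Function.update N j A) f - chainTerm x t (Function.update N j 0) f =
        (MvPolynomial.C (PowerSeries.C (chainCoeff x t f)) * ∏ j, MvPolynomial.X (f j)) •
          (Λ A).map (scalarHom n) ∧ (j ∉ Set.range f → Λ A = 0) := by
  by_cases hj : j ∈ Set.range f
  · obtain ⟨i, rfl⟩ := hj
    let Λ := (MultilinearMap.mkPiAlgebraFin R₀ (k + 1) (Matrix (Fin r) (Fin r) R₀)).toLinearMap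
      (fun i => N (f i)) i
    have hΛ : ∀ A, (List.ofFn fun j => Function.update N (f i) A (f j)).prod = Λ A := by
      intro A
      have e : (fun j => Function.update N (f i) A (f j)) = Function.update (fun j => N (f j)) i A :=
        Function.update_comp_eq_of_injective N f.injective i A
      rw [e]
      simp only [Λ, MultilinearMap.toLinearMap_apply, MultilinearMap.mkPiAlgebraFin_apply]
    refine ⟨Λ, fun A => ⟨?_, fun h => absurd ⟨i, rfl⟩ h⟩⟩
    rw [chainTerm, chainTerm, hΛ, hΛ, map_zero, Matrix.map_zero _ (map_zero _), smul_zero, sub_zero]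
  · refine ⟨0, fun A => ⟨?_, fun _ => rfl⟩⟩
    have e : ∀ B, (fun i => Function.update N j B (f i)) = fun i => N (f i) := by
      intro B; ext1 i
      exact Function.update_of_ne (fun h => hj ⟨i, h⟩) _ _
    rw [chainTerm, chainTerm, e, e, sub_self]
    simp

/-- The loop determinant is affine in each of the matrices. -/
lemma loopCoeff_update (H : Matrix (Fin r) (Fin r) (PowerSeries K)) (c : PowerSeries K)
    (t : Fin n → ℂ) (N : Fin n → Matrix (Fin r) (Fin r) R₀) (j : Fin n) :
    ∃ Λ : Matrix (Fin r) (Fin r) R₀ →+ PowerSeries K,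
      (∀ (s : R₀) A, Λ (s • A) = PowerSeries.map (RatFunc.C : ℂ →+* K) s * Λ A) ∧
      ∀ A, loopCoeff x H c t (Function.update N j A) =
        loopCoeff x H c t (Function.update N j 0) + Λ A := by
  choose Λ hΛ hΛ0 using fun (k : ℕ) (f : Fin (k + 1) ↪ Fin n) =>
    chainTerm_update_sub (x := x) t N f j |>.imp fun Λ h => (⟨fun A => (h A).1, fun A => (h A).2⟩ :
      (∀ A, _) ∧ ∀ A, _)
  let B : Matrix (Fin r) (Fin r) R₀ → Matrix (Fin r) (Fin r) (MvPolynomial (Fin n) (PowerSeries K)) :=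
    fun A => ∑ k ∈ Finset.range n, ∑ f : Fin (k + 1) ↪ Fin n,
      (MvPolynomial.C (PowerSeries.C (chainCoeff x t f)) * ∏ j, MvPolynomial.X (f j)) •
          (Λ k f A).map (scalarHom n)
  have hB : ∀ A, chainSum x t (Function.update N j A) =
      chainSum x t (Function.update N j 0) + B A := by
    intro A
    simp only [chainSum, B, ← Finset.sum_add_distrib]
    refine Finset.sum_congr rfl fun k _ => Finset.sum_congr rfl fun f _ => ?_
    rw [← hΛ, add_sub_cancel]
  have hadd : ∀ A A', B (A + A') = B A + B A' := by
    intro A A'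
    simp only [B, ← Finset.sum_add_distrib]
    refine Finset.sum_congr rfl fun k _ => Finset.sum_congr rfl fun f _ => ?_
    rw [map_add, Matrix.map_add _ (map_add _), smul_add]
  have hsmul : ∀ (s : R₀) A, B (s • A) = scalarHom n s • B A := by
    intro s A
    simp only [B, Finset.smul_sum]
    refine Finset.sum_congr rfl fun k _ => Finset.sum_congr rfl fun f _ => ?_
    rw [map_smul, smul_comm (scalarHom n s)]
    congr 1
    ext1 a b
    simp
  have hdvd : ∀ A a b, MvPolynomial.X j ∣ B A a b := by
    intro A a b
    simp only [B, Matrix.sum_apply]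
    refine Finset.dvd_sum fun k _ => Finset.dvd_sum fun f _ => ?_
    by_cases hj : j ∈ Set.range f
    · obtain ⟨i, rfl⟩ := hj
      rw [Matrix.smul_apply, smul_eq_mul]
      exact Dvd.dvd.mul_right (Dvd.dvd.mul_left
        (Finset.dvd_prod_of_mem (fun i => MvPolynomial.X (f i)) (Finset.mem_univ i)) _) _
    · rw [hΛ0 k f A hj]; simp
  set Q := H.map MvPolynomial.C - (MvPolynomial.C c : MvPolynomial (Fin n) (PowerSeries K)) • chainSum x t (Function.update N j 0) with hQ
  let B' : Matrix (Fin r) (Fin r) R₀ → Matrix (Fin r) (Fin r) (MvPolynomial (Fin n) (PowerSeries K)) :=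
    fun A => -((MvPolynomial.C c : MvPolynomial (Fin n) (PowerSeries K)) • B A)
  have hB' : ∀ A, H.map MvPolynomial.C - (MvPolynomial.C c : MvPolynomial (Fin n) (PowerSeries K)) • chainSum x t (Function.update N j A) =
      Q + B' A := by
    intro A; rw [hB, hQ, smul_add]; simp only [B']; abel
  refine ⟨⟨⟨fun A => ∑ i, MvPolynomial.coeff (allOnes n) (Q.updateRow i (B' A i)).det, ?_⟩, ?_⟩,
    ?_, ?_⟩
  · have h0 : B 0 = 0 := by simpa using hsmul 0 0
    refine Finset.sum_eq_zero fun i _ => ?_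
    have : B' 0 i = 0 := by simp only [B', h0]; ext; simp
    rw [this, det_eq_zero_of_row_eq_zero i (by simp), MvPolynomial.coeff_zero]
  · intro A A'
    simp only
    rw [← Finset.sum_add_distrib]
    refine Finset.sum_congr rfl fun i _ => ?_
    have : B' (A + A') i = B' A i + B' A' i := by
      simp only [B', hadd, smul_add, neg_add]; rfl
    rw [this, det_updateRow_add, MvPolynomial.coeff_add]
  · intro s A
    simp only [AddMonoidHom.coe_mk, ZeroHom.coe_mk]
    rw [Finset.mul_sum]
    refine Finset.sum_congr rfl fun i _ => ?_
    have hB's : B' (s • A) = scalarHom n s • B' A := by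
      simp only [B', hsmul, smul_neg]
      rw [smul_comm]
    have : B' (s • A) i = scalarHom n s • B' A i := by
      generalize B' (s • A) = P at hB's
      generalize B' A = P' at hB's
      rw [hB's]; rfl
    rw [this, det_updateRow_smul, scalarHom, RingHom.comp_apply, MvPolynomial.coeff_C_mul]
  · intro A
    simp only [AddMonoidHom.coe_mk, ZeroHom.coe_mk]
    rw [loopCoeff, loopCoeff, hB', ← hQ]
    refine coeff_allOnes_det_add j Q (B' A) fun i k => ?_
    simp only [B', Matrix.neg_apply, Matrix.smul_apply, smul_eq_mul]
    exact (dvd_neg.2 ((hdvd A i k).mul_left _))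

/-- Values of the loop determinant that lie in a submodule for `N i = U i E (U i)⁻¹` with constant
matrices `E` do so for arbitrary matrices. -/
lemma loopCoeff_mem (G : AddSubgroup (PowerSeries K))
    (hG : ∀ (s : R₀), ∀ g ∈ G, PowerSeries.map (RatFunc.C : ℂ →+* K) s * g ∈ G)
    (H : Matrix (Fin r) (Fin r) (PowerSeries K)) (c : PowerSeries K)
    (t : Fin n → ℂ) (U : Fin n → Matrix (Fin r) (Fin r) R₀) (hU : ∀ i, IsUnit (U i).det)
    (h : ∀ E : Fin n → Matrix (Fin r) (Fin r) ℂ,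
      loopCoeff x H c t (fun i => U i * (E i).map (PowerSeries.C : ℂ →+* R₀) * (U i)⁻¹) ∈ G)
    (N : Fin n → Matrix (Fin r) (Fin r) R₀) : loopCoeff x H c t N ∈ G := by
  classical
  -- The conjugates `U E U⁻¹` are replaced by arbitrary matrices one index at a time; `s` collects
  -- the indices already freed.
  suffices hs : ∀ s : Finset (Fin n), ∀ N : Fin n → Matrix (Fin r) (Fin r) R₀,
      (∀ i ∉ s, ∃ E : Matrix (Fin r) (Fin r) ℂ,
        N i = U i * E.map (PowerSeries.C : ℂ →+* R₀) * (U i)⁻¹) → loopCoeff x H c t N ∈ G from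
    hs Finset.univ N fun i hi => absurd (Finset.mem_univ i) hi
  intro s
  induction s using Finset.induction_on with
  | empty =>
    intro N hN
    choose E hE using fun i => hN i (by simp)
    have := h E
    rwa [← funext hE] at this
  | insert j s hj ih =>
    intro N hN
    obtain ⟨Λ, hΛs, hΛ⟩ := loopCoeff_update (x := x) H c t N j
    have hE : ∀ E : Matrix (Fin r) (Fin r) ℂ, loopCoeff x H c t
        (Function.update N j (U j * E.map (PowerSeries.C : ℂ →+* R₀) * (U j)⁻¹)) ∈ G := by
      intro E
      refine ih _ fun i hi => ?_
      by_cases hij : i = j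
      · subst hij; exact ⟨E, by simp⟩
      · rw [Function.update_of_ne hij]; exact hN i (by simp [hij, hi])
    have h0 : loopCoeff x H c t (Function.update N j 0) ∈ G := by
      have := hE 0
      rwa [Matrix.map_zero _ (map_zero _), mul_zero, zero_mul] at this
    have hΛE : ∀ E : Matrix (Fin r) (Fin r) ℂ,
        Λ (U j * E.map (PowerSeries.C : ℂ →+* R₀) * (U j)⁻¹) ∈ G := by
      intro E
      have := G.sub_mem (hE E) h0
      rwa [hΛ, add_sub_cancel_left] at this
    -- As `U j` is invertible over `ℂ[[ħ]]`, the conjugated matrix units span all matrices over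
    -- `ℂ[[ħ]]`. By affineness in the `j`-th matrix and closure of `G` under `ℂ[[ħ]]` this is
    -- enough.
    have hN' : N j = ∑ a, ∑ b, ((U j)⁻¹ * N j * U j) a b •
        (U j * (Matrix.single a b (1 : ℂ)).map (PowerSeries.C : ℂ →+* R₀) * (U j)⁻¹) := by
      have e1 : (U j)⁻¹ * N j * U j = ∑ a, ∑ b, ((U j)⁻¹ * N j * U j) a b •
          (Matrix.single a b (1 : ℂ)).map (PowerSeries.C : ℂ →+* R₀) := by
        conv_lhs => rw [matrix_eq_sum_single ((U j)⁻¹ * N j * U j)]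
        refine Finset.sum_congr rfl fun a _ => Finset.sum_congr rfl fun b _ => ?_
        ext1 i k
        simp only [single_apply, Matrix.smul_apply, map_apply, smul_eq_mul]
        split_ifs <;> simp
      have e2 : N j = U j * ((U j)⁻¹ * N j * U j) * (U j)⁻¹ := by
        simp only [Matrix.mul_assoc]
        rw [mul_nonsing_inv _ (hU j), mul_one, ← Matrix.mul_assoc, mul_nonsing_inv _ (hU j),
          Matrix.one_mul]
      conv_lhs => rw [e2, e1]
      simp only [Finset.mul_sum, Finset.sum_mul, Matrix.mul_smul, Matrix.smul_mul]
    have := hΛ (N j)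
    rw [Function.update_eq_self] at this
    rw [this]
    refine G.add_mem h0 ?_
    rw [hN', map_sum]
    refine G.sum_mem fun a _ => ?_
    rw [map_sum]
    refine G.sum_mem fun b _ => ?_
    rw [hΛs]
    exact hG _ _ (hΛE _)

end Loop

/-! ### Minors of `y - Φ` -/

section Indicator

variable {n : ℕ}

/-- The exponent of the monomial `∏ i ∈ I, X i`. -/
def ind (I : Finset (Fin n)) : Fin n →₀ ℕ := ∑ i ∈ I, Finsupp.single i 1

lemma ind_apply (I : Finset (Fin n)) (j : Fin n) : ind I j = if j ∈ I then 1 else 0 := by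
  simp [ind, Finsupp.finsetSum_apply, Finsupp.single_apply]

lemma ind_univ : ind (Finset.univ : Finset (Fin n)) = allOnes n := by
  ext j; simp [ind_apply, allOnes_apply]

lemma ind_injective : Function.Injective (ind : Finset (Fin n) → _) := by
  intro I J h
  ext j
  have := DFunLike.congr_fun h j
  rw [ind_apply, ind_apply] at this
  by_cases h1 : j ∈ I <;> by_cases h2 : j ∈ J <;> simp_all

lemma prod_X_eq_monomial {R : Type*} [CommSemiring R] (I : Finset (Fin n)) :
    ∏ i ∈ I, (MvPolynomial.X i : MvPolynomial (Fin n) R) = MvPolynomial.monomial (ind I) 1 := by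
  rw [ind, MvPolynomial.monomial_sum_one]
  rfl

lemma coeff_ind_C_mul_prod_X {R : Type*} [CommSemiring R] (I J : Finset (Fin n)) (a : R) :
    MvPolynomial.coeff (ind J) (MvPolynomial.C a * ∏ i ∈ I, MvPolynomial.X i) =
      if I = J then a else 0 := by
  rw [prod_X_eq_monomial, MvPolynomial.coeff_C_mul, MvPolynomial.coeff_monomial]
  simp only [ind_injective.eq_iff]
  split_ifs <;> simp

end Indicator

/-! ### Minors as coefficients of the loop determinant -/

section Minors

variable {r : ℕ} {x : K}

lemma chainTerm_zero_eq {n : ℕ} (t : Fin n → ℂ) (N : Fin n → Matrix (Fin r) (Fin r) R₀)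
    (f : Fin 1 → Fin n) : chainTerm x t N f =
      (MvPolynomial.C (PowerSeries.C (chainCoeff x t f)) * MvPolynomial.X (f 0)) •
        (N (f 0)).map (scalarHom n) := by
  simp [chainTerm]

/-- The determinant with rows replaced, as a coefficient of the loop determinant. -/
lemma loopCoeff_single (H : Matrix (Fin r) (Fin r) (PowerSeries K)) (s : Finset (Fin r))
    (hs : s.Nonempty) (g : Fin r → Fin r) (hg : ∀ i ∈ s, ∀ j ∈ s, i ≠ j → g i ≠ j)
    (e : Fin s.card ≃ s) (t : Fin s.card → ℂ) :
    loopCoeff x H 1 t (fun j => Matrix.single (e j : Fin r) (g (e j)) 1) =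
      PowerSeries.C (∏ j, -chainCoeff x t (fun _ : Fin 1 => j)) * (rowRepl H s g).det := by
  classical
  set N : Fin s.card → Matrix (Fin r) (Fin r) R₀ :=
    fun j => Matrix.single (e j : Fin r) (g (e j)) 1 with hN
  -- The product of two different matrix units is zero, because `g` never maps one replaced row to
  -- another. Only chains of length one survive.
  have hzero : ∀ k : ℕ, 0 < k → ∀ f : Fin (k + 1) ↪ Fin s.card, chainTerm x t N f = 0 := by
    intro k hk f
    obtain ⟨k, rfl⟩ : ∃ m, k = m + 1 := ⟨k - 1, by omega⟩
    have h01 : (f 0) ≠ f 1 := fun h => by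
      have := f.injective h; simp at this
    have : (List.ofFn fun j => N (f j)).prod = 0 := by
      rw [List.ofFn_succ, List.ofFn_succ, List.prod_cons, List.prod_cons, ← mul_assoc]
      have : N (f 0) * N (f (Fin.succ 0)) = 0 := by
        simp only [hN]
        refine single_mul_single_of_ne _ _ _ _ ?_ _
        refine hg _ (e _).2 _ (e _).2 fun h => h01 ?_
        exact e.injective (Subtype.ext h)
      rw [this, zero_mul]
    rw [chainTerm, this, Matrix.map_zero _ (map_zero _), smul_zero]
  let d : Fin r → MvPolynomial (Fin s.card) (PowerSeries K) := fun i =>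
    if h : i ∈ s then MvPolynomial.C (PowerSeries.C (-chainCoeff x t (fun _ : Fin 1 => e.symm ⟨i, h⟩)))
      * MvPolynomial.X (e.symm ⟨i, h⟩) else 0
  have hd : ∀ j, d (e j) = MvPolynomial.C (PowerSeries.C (-chainCoeff x t (fun _ : Fin 1 => j)))
      * MvPolynomial.X j := by
    intro j; simp [d]
  have hsum : H.map MvPolynomial.C - (MvPolynomial.C 1 : MvPolynomial (Fin s.card) (PowerSeries K))
      • chainSum x t N =
      (of fun i k => d i * (of fun i k => if k = g i then (1 : MvPolynomial (Fin s.card) (PowerSeries K)) else 0) i k) +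
        H.map MvPolynomial.C := by
    have h1 : chainSum x t N = ∑ j, (MvPolynomial.C (PowerSeries.C (chainCoeff x t (fun _ : Fin 1 => j)))
        * MvPolynomial.X j) • (N j).map (scalarHom s.card) := by
      rw [chainSum, Finset.sum_eq_single 0]
      · let ε : (Fin 1 ↪ Fin s.card) ≃ Fin s.card :=
          { toFun := fun f => f 0
            invFun := fun j => ⟨fun _ => j, fun a b _ => Subsingleton.elim a b⟩
            left_inv := fun f => by ext i; rw [Subsingleton.elim i 0]; rfl
            right_inv := fun j => rfl }
        refine Fintype.sum_equiv ε _ _ fun f => ?_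
        rw [chainTerm_zero_eq]
        have : (f : Fin 1 → Fin s.card) = fun _ => ε f := by
          ext i; rw [Subsingleton.elim i 0]; rfl
        rw [this]
      · intro k _ hk
        exact Finset.sum_eq_zero fun f _ => hzero k (Nat.pos_of_ne_zero hk) f
      · intro h
        exact absurd (Finset.mem_range.2 (Finset.card_pos.2 hs)) h
    rw [map_one, one_smul, h1, sub_eq_neg_add]
    congr 1
    ext1 i k
    rw [Matrix.neg_apply, Matrix.sum_apply]
    simp only [Matrix.smul_apply, map_apply, hN, smul_eq_mul, of_apply, single_apply]
    by_cases hi : i ∈ s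
    · rw [Finset.sum_eq_single (e.symm ⟨i, hi⟩)]
      · simp only [d, hi, dif_pos, Equiv.apply_symm_apply, map_neg]
        by_cases hk : k = g i
        · subst hk
          simp only [and_self, if_true, map_one, mul_one]
          generalize MvPolynomial.C (PowerSeries.C (chainCoeff x t fun _ => e.symm ⟨i, hi⟩)) = z
          generalize (MvPolynomial.X (e.symm ⟨i, hi⟩) :
            MvPolynomial (Fin s.card) (PowerSeries K)) = z'
          ring
        · have : ¬ (g i = k) := fun h => hk h.symm
          simp [hk, this]
      · intro j _ hj
        have : ¬ ((e j : Fin r) = i) := fun h => hj (by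
          rw [Equiv.eq_symm_apply]; exact Subtype.ext h)
        simp [this]
      · simp
    · simp only [d, hi, dif_neg, not_false_eq_true, zero_mul]
      rw [neg_eq_zero]
      refine Finset.sum_eq_zero fun j _ => ?_
      have : ¬ ((e j : Fin r) = i) := fun h => hi (h ▸ (e j).2)
      simp [this]
  rw [loopCoeff, hsum, det_add_eq_sum_piecewise, MvPolynomial.coeff_sum, Finset.sum_eq_single s]
  · rw [det_piecewise_mul]
    change MvPolynomial.coeff (allOnes s.card) (_ * (rowRepl (H.map MvPolynomial.C) s g).det) = _
    rw [← rowRepl_map, ← RingHom.mapMatrix_apply, ← RingHom.map_det]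
    have : ∏ i ∈ s, d i = MvPolynomial.C (PowerSeries.C (∏ j, -chainCoeff x t (fun _ : Fin 1 => j)))
        * ∏ j ∈ Finset.univ, MvPolynomial.X j := by
      rw [← Finset.prod_coe_sort s, ← Equiv.prod_comp e, map_prod, map_prod,
        ← Finset.prod_mul_distrib]
      exact Finset.prod_congr rfl fun j _ => hd j
    rw [this, mul_comm, ← mul_assoc, ← map_mul, ← ind_univ, coeff_ind_C_mul_prod_X, if_pos rfl,
      mul_comm]
  -- A set `u` of rows other than `s` yields either a proper submonomial of `δ_1 ⋯ δ_m`, or zero if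
  -- it contains a row outside `s`.
  · intro u _ hu
    rw [det_piecewise_mul]
    change MvPolynomial.coeff (allOnes s.card) (_ * (rowRepl (H.map MvPolynomial.C) u g).det) = _
    rw [← rowRepl_map, ← RingHom.mapMatrix_apply, ← RingHom.map_det]
    by_cases hus : u ⊆ s
    · set u' : Finset (Fin s.card) := Finset.univ.filter fun j => (e j : Fin r) ∈ u with hu'
      have himg : u = u'.image fun j => (e j : Fin r) := by
        ext i
        simp only [hu', Finset.mem_image, Finset.mem_filter, Finset.mem_univ, true_and]
        constructor
        · intro hi; exact ⟨e.symm ⟨i, hus hi⟩, by simpa using hi, by simp⟩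
        · rintro ⟨j, hj, rfl⟩; exact hj
      have : ∏ i ∈ u, d i = MvPolynomial.C (PowerSeries.C
          (∏ j ∈ u', -chainCoeff x t (fun _ : Fin 1 => j))) * ∏ j ∈ u', MvPolynomial.X j := by
        rw [himg, Finset.prod_image (fun a _ b _ h => e.injective (Subtype.ext h)), map_prod,
          map_prod, ← Finset.prod_mul_distrib]
        exact Finset.prod_congr rfl fun j _ => hd j
      rw [this, mul_comm, ← mul_assoc, ← map_mul, ← ind_univ, coeff_ind_C_mul_prod_X, if_neg]
      intro h
      apply hu
      rw [himg, h]
      ext i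
      simp only [Finset.mem_image, Finset.mem_univ, true_and]
      constructor
      · rintro ⟨j, rfl⟩; exact (e j).2
      · intro hi; exact ⟨e.symm ⟨i, hi⟩, by simp⟩
    · obtain ⟨i, hi, his⟩ := Finset.not_subset.1 hus
      rw [Finset.prod_eq_zero hi (by simp [d, his]), zero_mul, MvPolynomial.coeff_zero]
  · simp

end Minors

/-! ### Bounds for the minors at the points of the curve -/

section Assumption

variable {r : ℕ} {Φ : RationalHConnection r} {x y : K}

/-- The matrix `y - Φ_ħ(x(z))`. -/
def charMat (Φ : RationalHConnection r) (x y : K) : Matrix (Fin r) (Fin r) (PowerSeries K) :=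
  Matrix.scalar (Fin r) (PowerSeries.C y) - Φ.pull x

lemma loopDet_eq (S : WKBSolution Φ x y) {n : ℕ} (t : Fin n → ℂ)
    (E : Fin n → Matrix (Fin r) (Fin r) ℂ) :
    S.loopDet t E = loopCoeff x (charMat Φ x y) 1 t (fun i => S.M (t i) (E i)) := by
  have h1 : (charMat Φ x y).map (MvPolynomial.C : _ →+* MvPolynomial (Fin n) (PowerSeries K)) =
      Matrix.scalar (Fin r) (MvPolynomial.C (PowerSeries.C y)) - (Φ.pull x).map MvPolynomial.C := by
    ext1 i j
    by_cases h : i = j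
    · subst h; simp [charMat]
    · simp [charMat, h]
  rw [loopCoeff, h1, map_one, one_smul]
  rfl

/-- The power series with coefficients `f` for which `w f` is regular at `q`. -/
def regSeries (q : OnePoint ℂ) (w : K) : AddSubgroup (PowerSeries K) where
  carrier := {f | ∀ k, ordAt q (w * PowerSeries.coeff k f) ≤ 1}
  zero_mem' := by simp
  add_mem' {f g} hf hg k := by
    rw [map_add, mul_add]
    exact (Valuation.map_add _ _ _).trans (max_le (hf k) (hg k))
  neg_mem' {f} hf k := by
    rw [map_neg, mul_neg, Valuation.map_neg]; exact hf k

lemma mul_mem_regSeries {q : OnePoint ℂ} {w w' : K} {f g : PowerSeries K} (hf : f ∈ regSeries q w)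
    (hg : g ∈ regSeries q w') : f * g ∈ regSeries q (w * w') := by
  intro k
  rw [PowerSeries.coeff_mul, Finset.mul_sum]
  refine Valuation.map_sum_le _ fun p _ => ?_
  rw [show w * w' * (PowerSeries.coeff p.1 f * PowerSeries.coeff p.2 g) =
    (w * PowerSeries.coeff p.1 f) * (w' * PowerSeries.coeff p.2 g) by ring, map_mul]
  exact mul_le_one' (hf _) (hg _)

lemma C_mem_regSeries {q : OnePoint ℂ} {w a : K} (h : ordAt q (w * a) ≤ 1) :
    PowerSeries.C a ∈ regSeries q w := by
  intro k
  rw [PowerSeries.coeff_C]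
  split_ifs
  · exact h
  · simp

lemma map_C_mem_regSeries (q : OnePoint ℂ) (s : R₀) :
    PowerSeries.map (RatFunc.C : ℂ →+* K) s ∈ regSeries q 1 := by
  intro k
  rw [PowerSeries.coeff_map, one_mul]
  exact ordAt_le_one_iff.2 (C_mem_regAt _ _)

lemma prod_mem_regSeries {q : OnePoint ℂ} {ι : Type*} (s : Finset ι) {w : ι → K}
    {f : ι → PowerSeries K} (hf : ∀ i ∈ s, f i ∈ regSeries q (w i)) :
    ∏ i ∈ s, f i ∈ regSeries q (∏ i ∈ s, w i) := by
  classical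
  induction s using Finset.induction_on with
  | empty =>
    rw [Finset.prod_empty, Finset.prod_empty, ← map_one PowerSeries.C]
    exact C_mem_regSeries (by simp)
  | insert a s ha ih =>
    rw [Finset.prod_insert ha, Finset.prod_insert ha]
    exact mul_mem_regSeries (hf a (by simp)) (ih fun i hi => hf i (by simp [hi]))

lemma det_mem_regSeries {q : OnePoint ℂ} {ι : Type*} [Fintype ι] [DecidableEq ι] {w : ι → K}
    {A : Matrix ι ι (PowerSeries K)} (h : ∀ i j, A i j ∈ regSeries q (w i)) :
    A.det ∈ regSeries q (∏ i, w i) := by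
  rw [← det_transpose, det_apply]
  refine AddSubgroup.sum_mem _ fun σ _ => ?_
  rcases Int.units_eq_one_or (Equiv.Perm.sign σ) with hs | hs
  · rw [hs, one_smul]; exact prod_mem_regSeries _ fun i _ => h i _
  · rw [hs, Units.neg_smul, one_smul]
    exact AddSubgroup.neg_mem _ (prod_mem_regSeries _ fun i _ => h i _)

/-- The weight with which the minors of size `r - m` of `y - Φ_ħ` are regular. -/
def minorWeight (Φ : RationalHConnection r) (x y : K) (q : OnePoint ℂ) (t₀ : ℂ) (m : ℕ) : K :=
  formFactor q * ratDeriv (invCoord x t₀) * invCoord x t₀ ^ (2 * (m - 1)) / Eω Φ x y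

lemma invCoord_ne_zero (hx : ∀ c : ℂ, x ≠ RatFunc.C c) (t : ℂ) : invCoord x t ≠ 0 :=
  inv_ne_zero (sub_ne_zero.2 (hx t))

lemma ordAt_invCoord_eq {q : OnePoint ℂ} {s t : ℂ} (hs : ¬ HasVal q x s) (ht : ¬ HasVal q x t) :
    ordAt q (invCoord x s) = ordAt q (invCoord x t) := by
  rw [invCoord, invCoord, map_inv₀, map_inv₀, ordAt_sub_C_eq hs ht]

/-- Assumption 5* controls all minors of `y - Φ_ħ` over the singularities of the Higgs field. -/
lemma minor_mem_of_isSingularity (hcurve : IsSmoothGenusZeroSpectralCurve Φ x y)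
    (S : WKBSolution Φ x y) (hA : S.Assumption5Star) {q : OnePoint ℂ}
    (hq : Φ.IsSingularity 0 (ratMap x q)) {t₀ : ℂ} (ht₀ : t₀ ∈ S.D) (s : Finset (Fin r))
    (hs : s.Nonempty) (g : Fin r → Fin r) :
    (rowRepl (charMat Φ x y) s g).det ∈ regSeries q (minorWeight Φ x y q t₀ s.card) := by
  refine rowRepl_det_mem _ s (fun g hg => ?_) g
  have hx := hcurve.nonconstant
  let e : Fin s.card ≃ s := s.equivFin.symm
  obtain ⟨t, ht⟩ := S.infinite_D.exists_subset_card_eq s.card |>.imp fun A h => h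
  obtain ⟨htD, htc⟩ := ht
  let τ : Fin s.card → ℂ := fun j => ((t.equivFinOfCardEq htc).symm j : ℂ)
  have hτ : ∀ j, τ j ∈ S.D := fun j => htD ((t.equivFinOfCardEq htc).symm j).2
  have hτi : Function.Injective τ := fun a b h =>
    (t.equivFinOfCardEq htc).symm.injective (Subtype.ext h)
  set w : K := formFactor q * (ratDeriv x / Eω Φ x y) with hw
  -- Assumption 5* for conjugated constant matrices, carried over to arbitrary matrices by
  -- multilinearity.
  have hmem : ∀ N : Fin s.card → Matrix (Fin r) (Fin r) R₀,
      loopCoeff x (charMat Φ x y) 1 τ N ∈ regSeries q w := by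
    refine loopCoeff_mem (regSeries q w) (fun a g hg => ?_) _ _ τ (fun j => S.U (τ j))
      (fun j => S.isUnit_det _ (hτ j)) fun E => ?_
    · have := mul_mem_regSeries (map_C_mem_regSeries q a) hg
      rwa [one_mul] at this
    · have h1 := hA.2 s.card (Finset.card_pos.2 hs) τ E hτ hτi
      intro k
      have h2 := formRegularAt_iff.1 (h1 k q hq)
      rw [loopDet_eq] at h2
      refine le_of_eq_of_le ?_ h2
      rw [hw]
      congr 1
      simp only [WKBSolution.M, Eω]
      ring
  have h1 := hmem (fun j => Matrix.single (e j : Fin r) (g (e j)) 1)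
  rw [loopCoeff_single _ s hs g hg e τ] at h1
  have hnv : ∀ t ∈ S.D, ¬ HasVal q x t := fun t ht => S.not_hasVal_of_isSingularity hq ht
  -- A chain of length one has coefficient `-1 / (x - τ j)²`, of order `v²`. With `m` such factors
  -- and `dx = -dv / v²`, the weight of a minor with `m` replaced rows becomes `v ^ (2 (m - 1)) dv /
  -- E_ω`.
  have hcc : ∀ j, ordAt q (-chainCoeff x τ (fun _ : Fin 1 => j)) = ordAt q (invCoord x t₀) ^ 2 := by
    intro j
    have : chainCoeff x τ (fun _ : Fin 1 => j) = -(invCoord x (τ j)) ^ 2 := by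
      rw [chainCoeff, invCoord]
      simp only [Finset.univ_eq_empty, Finset.prod_empty, mul_one]
      rw [show RatFunc.C (τ j) - x = -(x - RatFunc.C (τ j)) by ring, mul_neg, ← pow_two, inv_neg,
        inv_pow]
    rw [this, neg_neg, map_pow, ordAt_invCoord_eq (hnv _ (hτ j)) (hnv _ ht₀)]
  intro k
  have h2 := h1 k
  rw [PowerSeries.coeff_C_mul, ← mul_assoc, map_mul, map_mul, map_prod,
    Finset.prod_congr rfl fun j _ => hcc j, Finset.prod_const, Finset.card_univ,
    Fintype.card_fin] at h2
  rw [map_mul]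
  refine le_of_eq_of_le ?_ h2
  congr 1
  have hv0 := invCoord_ne_zero hx t₀
  have e1 : ratDeriv x = -ratDeriv (invCoord x t₀) / invCoord x t₀ ^ 2 := by
    rw [ratDeriv_invCoord hx]; field_simp
  obtain ⟨m, hm⟩ : ∃ m, s.card = m + 1 := ⟨s.card - 1, by have := Finset.card_pos.2 hs; omega⟩
  rw [← map_pow, ← map_pow, ← map_mul, ← Valuation.map_neg _ (_ * _)]
  congr 1
  rw [minorWeight, hw, e1, hm, Nat.add_sub_cancel]
  have hE := hcurve.derivative_ne_zero
  rw [← Eω] at hE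
  field_simp
  ring

/-- Smoothness controls all minors of `y - Φ_ħ` over the other points. -/
lemma minor_mem_of_not_isSingularity (hcurve : IsSmoothGenusZeroSpectralCurve Φ x y)
    (S : WKBSolution Φ x y) (hA : S.Assumption5Star) {q : OnePoint ℂ}
    (hq : ¬ Φ.IsSingularity 0 (ratMap x q)) {t₀ : ℂ} (ht₀ : ¬ HasVal q x t₀) (s : Finset (Fin r))
    (hs : s.Nonempty) (g : Fin r → Fin r) :
    (rowRepl (charMat Φ x y) s g).det ∈ regSeries q (minorWeight Φ x y q t₀ s.card) := by
  have hx := hcurve.nonconstant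
  obtain ⟨h1, h2⟩ := regular_of_not_isSingularity hcurve hq ht₀
  have hv0 := invCoord_ne_zero hx t₀
  set v := invCoord x t₀ with hv
  have hvo : ordAt q v ≠ 0 := (Valuation.ne_zero_iff _).2 hv0
  have hΦ : ∀ ℓ i j, FormRegularAt (Φ.coeff ℓ i j) (ratMap x q) := by
    intro ℓ i j
    by_contra h
    rcases Nat.eq_zero_or_pos ℓ with rfl | hℓ
    · exact hq ⟨i, j, h⟩
    · exact hq (hA.1 ℓ hℓ _ ⟨i, j, h⟩)
  have hH : ∀ i j, charMat Φ x y i j ∈ regSeries q (v⁻¹ ^ 2) := by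
    intro i j
    have hscal : ∀ f : K, ordAt q f ≤ ordAt q v ^ 2 → ordAt q (v⁻¹ ^ 2 * f) ≤ 1 := by
      intro f hf
      rw [map_mul, map_pow, map_inv₀, inv_pow, mul_comm, ← div_eq_mul_inv,
        div_le_one₀ (pow_pos (zero_lt_iff.2 hvo) 2)]
      exact hf
    rw [charMat, Matrix.sub_apply]
    refine AddSubgroup.sub_mem _ ?_ ?_
    · by_cases h : i = j
      · subst h; simpa using C_mem_regSeries (hscal y h1)
      · simp [h]
    · intro k
      refine hscal _ ?_
      simp only [RationalHConnection.pull, of_apply, PowerSeries.coeff_mk]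
      exact ordAt_pullback_le ht₀ (hΦ k i j)
  -- The `m` replaced rows are constant, and each of the other `r - m` rows is of order `v²`.
  -- Combined with the regularity of `v ^ (2 (r - 1)) dv / E_ω` this leaves exactly the weight `v ^
  -- (2 (m - 1)) dv / E_ω`.
  have h3 : (rowRepl (charMat Φ x y) s g).det ∈
      regSeries q (∏ i, if i ∈ s then 1 else v⁻¹ ^ 2) := by
    refine det_mem_regSeries fun i j => ?_
    rw [rowRepl_apply]
    split_ifs
    · rw [← map_one PowerSeries.C]; exact C_mem_regSeries (by simp)
    · exact AddSubgroup.zero_mem _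
    · exact hH i j
  have hprod : (∏ i, if i ∈ s then (1 : K) else v⁻¹ ^ 2) = v⁻¹ ^ (2 * (r - s.card)) := by
    rw [Finset.prod_ite, Finset.prod_const_one, one_mul, Finset.prod_const, ← pow_mul]
    congr 2
    have : (Finset.univ.filter fun i => i ∉ s) = sᶜ := by ext; simp
    rw [this, Finset.card_compl, Fintype.card_fin]
  rw [hprod] at h3
  intro k
  have h4 : minorWeight Φ x y q t₀ s.card * PowerSeries.coeff k (rowRepl (charMat Φ x y) s g).det =
      (formFactor q * ratDeriv v * v ^ (2 * (r - 1)) / Eω Φ x y) *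
        (v⁻¹ ^ (2 * (r - s.card)) * PowerSeries.coeff k (rowRepl (charMat Φ x y) s g).det) := by
    have hc : s.card ≤ r := by simpa using Finset.card_le_univ s
    have hc0 := Finset.card_pos.2 hs
    rw [minorWeight, ← hv, show 2 * (r - 1) = 2 * (s.card - 1) + 2 * (r - s.card) by omega,
      pow_add, inv_pow]
    field_simp
  rw [h4, map_mul]
  exact mul_le_one' h2 (h3 k)

/-- Assumption 5* gives the bound over the singularities of `φ`, smoothness of the spectral curve
gives it elsewhere. The fibre of `t₀` is left out because the coordinate `1 / (x - t₀)` has its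
poles there. -/
lemma minor_mem (hcurve : IsSmoothGenusZeroSpectralCurve Φ x y)
    (S : WKBSolution Φ x y) (hA : S.Assumption5Star) {q : OnePoint ℂ} {t₀ : ℂ} (ht₀ : t₀ ∈ S.D)
    (hq : ¬ HasVal q x t₀) (s : Finset (Fin r)) (hs : s.Nonempty) (g : Fin r → Fin r) :
    (rowRepl (charMat Φ x y) s g).det ∈ regSeries q (minorWeight Φ x y q t₀ s.card) := by
  by_cases h : Φ.IsSingularity 0 (ratMap x q)
  · exact minor_mem_of_isSingularity hcurve S hA h ht₀ s hs g
  · exact minor_mem_of_not_isSingularity hcurve S hA h hq s hs g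

end Assumption

/-! ### Coefficientwise limits and derivatives of power series -/

section CoeffCalculus

open Filter Topology

/-- Coefficientwise convergence of power series. -/
def CoeffTendsto {α : Type*} (l : Filter α) (F : α → R₀) (f : R₀) : Prop :=
  ∀ k, Tendsto (fun s => PowerSeries.coeff k (F s)) l (𝓝 (PowerSeries.coeff k f))

/-- Coefficientwise derivatives of power series. -/
def CoeffHasDeriv (F : ℂ → R₀) (F' : R₀) (t : ℂ) : Prop :=
  ∀ k, HasDerivAt (fun s => PowerSeries.coeff k (F s)) (PowerSeries.coeff k F') t

namespace CoeffTendsto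

variable {α : Type*} {l : Filter α} {F G : α → R₀} {f g : R₀}

lemma const (f : R₀) (l : Filter α) : CoeffTendsto l (fun _ => f) f := fun _ => tendsto_const_nhds

lemma mul (hF : CoeffTendsto l F f) (hG : CoeffTendsto l G g) :
    CoeffTendsto l (fun s => F s * G s) (f * g) := fun k => by
  simp only [PowerSeries.coeff_mul]
  exact tendsto_finsetSum _ fun p _ => (hF p.1).mul (hG p.2)

lemma sum {ι : Type*} (s : Finset ι) {F : ι → α → R₀} {f : ι → R₀}
    (h : ∀ i ∈ s, CoeffTendsto l (F i) (f i)) :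
    CoeffTendsto l (fun t => ∑ i ∈ s, F i t) (∑ i ∈ s, f i) := fun k => by
  simp only [map_sum]
  exact tendsto_finsetSum _ fun i hi => h i hi k

lemma prod {ι : Type*} (s : Finset ι) {F : ι → α → R₀} {f : ι → R₀}
    (h : ∀ i ∈ s, CoeffTendsto l (F i) (f i)) :
    CoeffTendsto l (fun t => ∏ i ∈ s, F i t) (∏ i ∈ s, f i) := by
  classical
  induction s using Finset.induction_on with
  | empty => simpa using const 1 l
  | insert a s ha ih =>
    simp only [Finset.prod_insert ha]
    exact (h a (by simp)).mul (ih fun i hi => h i (by simp [hi]))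

lemma congr' (hF : CoeffTendsto l F f) (h : ∀ᶠ s in l, F s = G s) : CoeffTendsto l G f := fun k =>
  (hF k).congr' (h.mono fun s hs => by simp only [hs])

lemma comp {β : Type*} {l' : Filter β} {φ : β → α} (hF : CoeffTendsto l F f)
    (h : Tendsto φ l' l) : CoeffTendsto l' (fun s => F (φ s)) f := fun k => (hF k).comp h

end CoeffTendsto

namespace CoeffHasDeriv

variable {F G : ℂ → R₀} {f g F' G' : R₀} {t : ℂ}

lemma tendsto (hF : CoeffHasDeriv F F' t) : CoeffTendsto (𝓝 t) F (F t) := fun k =>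
  (hF k).continuousAt

lemma const (f : R₀) (t : ℂ) : CoeffHasDeriv (fun _ => f) 0 t := fun k => by
  simpa using hasDerivAt_const t _

lemma neg (hF : CoeffHasDeriv F F' t) : CoeffHasDeriv (fun s => -F s) (-F') t := fun k => by
  simp only [map_neg]; exact (hF k).neg

lemma mul (hF : CoeffHasDeriv F F' t) (hG : CoeffHasDeriv G G' t) :
    CoeffHasDeriv (fun s => F s * G s) (F' * G t + F t * G') t := fun k => by
  simp only [PowerSeries.coeff_mul, map_add]
  rw [← Finset.sum_add_distrib]
  exact HasDerivAt.fun_sum fun p _ => (hF p.1).mul (hG p.2)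

lemma sum {ι : Type*} (s : Finset ι) {F : ι → ℂ → R₀} {F' : ι → R₀}
    (h : ∀ i ∈ s, CoeffHasDeriv (F i) (F' i) t) :
    CoeffHasDeriv (fun t => ∑ i ∈ s, F i t) (∑ i ∈ s, F' i) t := fun k => by
  simp only [map_sum]
  exact HasDerivAt.fun_sum fun i hi => h i hi k

lemma unique (h : CoeffHasDeriv F F' t) (h' : CoeffHasDeriv F G' t) : F' = G' := by
  ext k; exact (h k).unique (h' k)

lemma congr (hF : CoeffHasDeriv F F' t) (h : ∀ᶠ s in 𝓝 t, G s = F s) : CoeffHasDeriv G F' t :=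
  fun k => (hF k).congr_of_eventuallyEq (h.mono fun s hs => by simp only [hs])

lemma slope (hF : CoeffHasDeriv F F' t) :
    CoeffTendsto (𝓝[≠] t) (fun s => PowerSeries.C (s - t)⁻¹ * (F s - F t)) F' := fun k => by
  refine ((hasDerivAt_iff_tendsto_slope.1 (hF k))).congr fun s => ?_
  rw [PowerSeries.coeff_C_mul, map_sub, slope_def_field, div_eq_inv_mul]

lemma exists_prod {ι : Type*} (s : Finset ι) {F : ι → ℂ → R₀}
    (h : ∀ i ∈ s, ∃ F', CoeffHasDeriv (F i) F' t) :
    ∃ F', CoeffHasDeriv (fun t => ∏ i ∈ s, F i t) F' t := by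
  classical
  induction s using Finset.induction_on with
  | empty => exact ⟨0, by simpa using const 1 t⟩
  | insert a s ha ih =>
    obtain ⟨F', hF'⟩ := h a (by simp)
    obtain ⟨G', hG'⟩ := ih fun i hi => h i (by simp [hi])
    simp only [Finset.prod_insert ha]
    exact ⟨_, hF'.mul hG'⟩

lemma exists_det {ι : Type*} [Fintype ι] [DecidableEq ι] {A : ℂ → Matrix ι ι R₀}
    (h : ∀ i j, ∃ F', CoeffHasDeriv (fun s => A s i j) F' t) :
    ∃ F', CoeffHasDeriv (fun s => (A s).det) F' t := by
  simp only [det_apply']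
  choose F' hF' using fun σ : Equiv.Perm ι => exists_prod (t := t) Finset.univ
    (F := fun i s => A s (σ i) i) fun i _ => h (σ i) i
  exact ⟨_, sum Finset.univ fun σ _ => (const _ t).mul (hF' σ)⟩

/-- The coefficients of the inverse are determined recursively by division by the constant
coefficient only. -/
lemma exists_inv (hF : CoeffHasDeriv F F' t) (h0 : PowerSeries.constantCoeff (F t) ≠ 0) :
    ∃ G', CoeffHasDeriv (fun s => (F s)⁻¹) G' t := by
  have h : ∀ k, DifferentiableAt ℂ (fun s => PowerSeries.coeff k (F s)⁻¹) t := by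
    intro k
    induction k using Nat.strong_induction_on with
    | _ k ih =>
      have hd : ∀ k, DifferentiableAt ℂ (fun s => PowerSeries.coeff k (F s)) t := fun k =>
        (hF k).differentiableAt
      have hd0 : DifferentiableAt ℂ (fun s => PowerSeries.constantCoeff (F s)) t := by
        simpa using hd 0
      rw [show (fun s => PowerSeries.coeff k (F s)⁻¹) = _ from
        funext fun s => PowerSeries.coeff_inv k (F s)]
      by_cases hk : k = 0
      · simp only [hk, if_true]; exact hd0.inv h0
      · simp only [hk, if_false]
        refine (hd0.inv h0).neg.mul (DifferentiableAt.fun_sum fun p hp => ?_)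
        by_cases hlt : p.2 < k
        · simp only [hlt, if_true]; exact (hd _).mul (ih _ hlt)
        · simp only [hlt, if_false]; exact differentiableAt_const _
  refine ⟨PowerSeries.mk fun k => deriv (fun s => PowerSeries.coeff k (F s)⁻¹) t, fun k => ?_⟩
  rw [PowerSeries.coeff_mk]
  exact (h k).hasDerivAt

end CoeffHasDeriv

lemma ringInverse_powerSeries {f : R₀} (hf : IsUnit f) : Ring.inverse f = f⁻¹ := by
  have h0 : PowerSeries.constantCoeff f ≠ 0 :=
    (hf.map (PowerSeries.constantCoeff (R := ℂ))).ne_zero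
  have h1 := PowerSeries.mul_inv_cancel f h0
  calc Ring.inverse f = Ring.inverse f * (f * f⁻¹) := by rw [h1, mul_one]
    _ = f⁻¹ := by rw [← mul_assoc, Ring.inverse_mul_cancel _ hf, one_mul]

end CoeffCalculus

/-! ### The WKB solution over the domain -/

namespace WKBSolution

open Filter Topology

variable {r : ℕ} {Φ : RationalHConnection r} {x y : K} (S : WKBSolution Φ x y)

/-- The derivative of `U`. -/
def dU (t : ℂ) : Matrix (Fin r) (Fin r) R₀ := of fun i j => PowerSeries.mk fun k =>
  PowerSeries.coeff (k + 1) ((Φ.at' t * S.U t - S.U t * diagonal (S.Y t)) i j)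

/-- The WKB equation `ħ U' = Φ U - U Y` in one piece: the order `ħ⁰` equation makes the right-hand
side divisible by `ħ`, and the other orders define the quotient. -/
lemma X_smul_dU {t : ℂ} (ht : t ∈ S.D) :
    (PowerSeries.X : R₀) • S.dU t = Φ.at' t * S.U t - S.U t * diagonal (S.Y t) := by
  ext i j k
  rw [Matrix.smul_apply, smul_eq_mul]
  cases k with
  | zero => rw [S.equation_zero t ht i j, PowerSeries.coeff_zero_X_mul]
  | succ k => rw [PowerSeries.coeff_succ_X_mul, dU, of_apply, PowerSeries.coeff_mk]

lemma coeffHasDeriv_U {t : ℂ} (ht : t ∈ S.D) (i j : Fin r) :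
    CoeffHasDeriv (fun s => S.U s i j) (S.dU t i j) t := fun k => by
  have := S.equation_succ t ht i j k
  rwa [dU, of_apply, PowerSeries.coeff_mk]

lemma eventually_mem {t : ℂ} (ht : t ∈ S.D) : ∀ᶠ s in 𝓝 t, s ∈ S.D := S.isOpen.mem_nhds ht

lemma exists_coeffHasDeriv_inv {t : ℂ} (ht : t ∈ S.D) (i j : Fin r) :
    ∃ G', CoeffHasDeriv (fun s => (S.U s)⁻¹ i j) G' t := by
  obtain ⟨d', hd⟩ := CoeffHasDeriv.exists_det (t := t) (A := S.U)
    fun i j => ⟨_, S.coeffHasDeriv_U ht i j⟩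
  obtain ⟨e', he⟩ := hd.exists_inv
    ((S.isUnit_det t ht).map (PowerSeries.constantCoeff (R := ℂ))).ne_zero
  obtain ⟨a', ha⟩ := CoeffHasDeriv.exists_det (t := t)
    (A := fun s => (S.U s).updateRow j (Pi.single i 1)) (fun k l => by
      by_cases h : k = j
      · simp only [updateRow_apply, h, if_true]
        exact ⟨_, CoeffHasDeriv.const _ t⟩
      · simp only [updateRow_apply, h, if_false]
        exact ⟨_, S.coeffHasDeriv_U ht k l⟩)
  refine ⟨_, (he.mul ha).congr ((S.eventually_mem ht).mono fun s hs => ?_)⟩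
  rw [inv_def, Matrix.smul_apply, smul_eq_mul, ringInverse_powerSeries (S.isUnit_det s hs),
    adjugate_apply]

lemma inv_mul_U {t : ℂ} (ht : t ∈ S.D) : (S.U t)⁻¹ * S.U t = 1 :=
  nonsing_inv_mul _ (S.isUnit_det t ht)

lemma U_mul_inv {t : ℂ} (ht : t ∈ S.D) : S.U t * (S.U t)⁻¹ = 1 :=
  mul_nonsing_inv _ (S.isUnit_det t ht)

lemma M_e_apply (t : ℂ) (a i j : Fin r) : S.M t (e a) i j = S.U t i a * (S.U t)⁻¹ a j := by
  rw [M, e, diagonal_map (map_zero _), mul_apply, Finset.sum_eq_single a]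
  · rw [mul_diagonal]; simp
  · intro b _ hb
    rw [mul_diagonal]; simp [hb]
  · simp

lemma M_e_mul_self {t : ℂ} (ht : t ∈ S.D) (a : Fin r) : S.M t (e a) * S.M t (e a) = S.M t (e a) := by
  ext1 i j
  simp only [mul_apply, M_e_apply]
  calc ∑ k, S.U t i a * (S.U t)⁻¹ a k * (S.U t k a * (S.U t)⁻¹ a j) =
      (∑ k, (S.U t)⁻¹ a k * S.U t k a) * (S.U t i a * (S.U t)⁻¹ a j) := by
        rw [Finset.sum_mul]; exact Finset.sum_congr rfl fun k _ => by ring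
    _ = _ := by rw [← mul_apply, S.inv_mul_U ht, one_apply_eq, one_mul]

/-- The projectors satisfy the adjoint equation. -/
lemma exists_coeffHasDeriv_M {t : ℂ} (ht : t ∈ S.D) (a : Fin r) :
    ∃ M' : Matrix (Fin r) (Fin r) R₀,
      (∀ i j, CoeffHasDeriv (fun s => S.M s (e a) i j) (M' i j) t) ∧
      (PowerSeries.X : R₀) • M' = Φ.at' t * S.M t (e a) - S.M t (e a) * Φ.at' t := by
  choose V' hV' using fun i j => S.exists_coeffHasDeriv_inv ht i j
  let M' : Matrix (Fin r) (Fin r) R₀ :=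
    of fun i j => S.dU t i a * (S.U t)⁻¹ a j + S.U t i a * V' a j
  have hM' : ∀ i j, CoeffHasDeriv (fun s => S.M s (e a) i j) (M' i j) t := by
    intro i j
    simp only [M_e_apply]
    exact (S.coeffHasDeriv_U ht i a).mul (hV' a j)
  refine ⟨M', hM', ?_⟩
  set ε : Matrix (Fin r) (Fin r) R₀ := (e a).map (PowerSeries.C : ℂ →+* R₀) with hε
  have hMU : ∀ s ∈ S.D, S.M s (e a) * S.U s = S.U s * ε := by
    intro s hs
    rw [M, Matrix.mul_assoc, S.inv_mul_U hs, mul_one]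
  -- The derivative of `M U = U ε`. Substituting `ħ U' = Φ U - U Y`, the terms with `Y` cancel
  -- because `Y` and `ε` are both diagonal.
  have h1 : M' * S.U t + S.M t (e a) * S.dU t = S.dU t * ε := by
    ext1 i j
    have l : CoeffHasDeriv (fun s => (S.M s (e a) * S.U s) i j)
        (∑ k, (M' i k * S.U t k j + S.M t (e a) i k * S.dU t k j)) t := by
      simp only [mul_apply]
      exact CoeffHasDeriv.sum _ fun k _ => (hM' i k).mul (S.coeffHasDeriv_U ht k j)
    have r : CoeffHasDeriv (fun s => (S.U s * ε) i j)
        (∑ k, (S.dU t i k * ε k j + S.U t i k * 0)) t := by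
      simp only [mul_apply]
      exact CoeffHasDeriv.sum _ fun k _ => (S.coeffHasDeriv_U ht i k).mul (CoeffHasDeriv.const _ t)
    have := l.unique (r.congr ((S.eventually_mem ht).mono fun s hs => by rw [hMU s hs]))
    simp only [mul_zero, add_zero] at this
    rw [Finset.sum_add_distrib] at this
    exact this
  have hεd : ε * diagonal (S.Y t) = diagonal (S.Y t) * ε := by
    rw [hε, e, diagonal_map (map_zero _), diagonal_mul_diagonal, diagonal_mul_diagonal]
    congr 1; ext1 i; exact mul_comm _ _
  have h2 : ((PowerSeries.X : R₀) • M') * S.U t =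
      (Φ.at' t * S.M t (e a) - S.M t (e a) * Φ.at' t) * S.U t := by
    have h3 : ((PowerSeries.X : R₀) • M') * S.U t =
        ((PowerSeries.X : R₀) • S.dU t) * ε - S.M t (e a) * ((PowerSeries.X : R₀) • S.dU t) := by
      rw [Matrix.smul_mul, Matrix.smul_mul, Matrix.mul_smul, ← h1, smul_add, add_sub_cancel_right]
    rw [h3, S.X_smul_dU ht, Matrix.sub_mul, Matrix.mul_sub, Matrix.sub_mul, Matrix.mul_assoc (Φ.at' t),
      Matrix.mul_assoc (Φ.at' t), hMU t ht, ← Matrix.mul_assoc (S.M t (e a)) (S.U t), hMU t ht,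
      Matrix.mul_assoc (S.U t) (diagonal _), Matrix.mul_assoc (S.U t) ε, hεd, ← Matrix.mul_assoc]
    simp only [Matrix.mul_assoc]
    abel
  have h3 := congrArg (· * (S.U t)⁻¹) h2
  simp only [Matrix.mul_assoc] at h3
  rwa [S.U_mul_inv ht, mul_one, mul_one] at h3

/-! #### Leading order -/

/-- The eigenvalue `y(z^a(t))`. -/
def eig (a : Fin r) (t : ℂ) : ℂ := ratEval y (S.sheet a t)

/-- Order `ħ⁰` of the WKB equation reads `φ V = V diag(y(z^a))`, so the leading projectors are the
spectral projectors of `φ`. -/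
lemma higgs_eq {t : ℂ} (ht : t ∈ S.D) :
    ∃ V W : Matrix (Fin r) (Fin r) ℂ, V * W = 1 ∧ W * V = 1 ∧
      (Φ.at' t).map (PowerSeries.constantCoeff (R := ℂ)) = V * diagonal (fun a => S.eig a t) * W ∧
      (∀ a, (S.M t (e a)).map (PowerSeries.constantCoeff (R := ℂ)) = V * e a * W) := by
  set V := (PowerSeries.constantCoeff (R := ℂ)).mapMatrix (S.U t) with hV
  set W := (PowerSeries.constantCoeff (R := ℂ)).mapMatrix (S.U t)⁻¹ with hW
  have h1 : V * W = 1 := by rw [hV, hW, ← map_mul, S.U_mul_inv ht, map_one]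
  have h2 : W * V = 1 := by rw [hV, hW, ← map_mul, S.inv_mul_U ht, map_one]
  refine ⟨V, W, h1, h2, ?_, fun a => ?_⟩
  · have h3 : (PowerSeries.constantCoeff (R := ℂ)).mapMatrix
        (Φ.at' t * S.U t - S.U t * diagonal (S.Y t)) = 0 := by
      ext i j
      have := S.equation_zero t ht i j
      rwa [PowerSeries.coeff_zero_eq_constantCoeff] at this
    have h4 : (PowerSeries.constantCoeff (R := ℂ)).mapMatrix (diagonal (S.Y t)) =
        diagonal (fun a => S.eig a t) := by
      rw [RingHom.mapMatrix_apply, diagonal_map (map_zero _)]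
      congr 1; ext1 a
      have := S.leading_Y a t ht
      rwa [PowerSeries.coeff_zero_eq_constantCoeff] at this
    rw [map_sub, map_mul, map_mul, h4, sub_eq_zero, ← hV] at h3
    rw [← h3, Matrix.mul_assoc, h1, mul_one]
    rfl
  · change (PowerSeries.constantCoeff (R := ℂ)).mapMatrix (S.M t (e a)) = _
    rw [M, map_mul, map_mul]
    congr 2

end WKBSolution

/-! ### Evaluation of determinants -/

section SubringProd

variable {A B ι : Type*} [CommRing A] [CommRing B] [Fintype ι] [DecidableEq ι]
  {T : Subring (A × B)} {M : Matrix ι ι A} {M' : Matrix ι ι B}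

lemma Subring.sum_pair_mem {κ : Type*} (s : Finset κ) {f : κ → A} {g : κ → B}
    (h : ∀ i ∈ s, (f i, g i) ∈ T) : (∑ i ∈ s, f i, ∑ i ∈ s, g i) ∈ T := by
  have := T.sum_mem h
  rwa [show ∑ i ∈ s, (f i, g i) = (∑ i ∈ s, f i, ∑ i ∈ s, g i) from
    Prod.ext (Prod.fst_sum ..) (Prod.snd_sum ..)] at this

lemma Subring.prod_pair_mem {κ : Type*} (s : Finset κ) {f : κ → A} {g : κ → B}
    (h : ∀ i ∈ s, (f i, g i) ∈ T) : (∏ i ∈ s, f i, ∏ i ∈ s, g i) ∈ T := by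
  have := T.prod_mem h
  rwa [show ∏ i ∈ s, (f i, g i) = (∏ i ∈ s, f i, ∏ i ∈ s, g i) from
    Prod.ext (Prod.fst_prod ..) (Prod.snd_prod ..)] at this

lemma Subring.add_pair_mem {f f' : A} {g g' : B} (h : (f, g) ∈ T) (h' : (f', g') ∈ T) :
    (f + f', g + g') ∈ T := T.add_mem h h'

lemma Subring.mul_pair_mem {f f' : A} {g g' : B} (h : (f, g) ∈ T) (h' : (f', g') ∈ T) :
    (f * f', g * g') ∈ T := T.mul_mem h h'

lemma Subring.sub_pair_mem {f f' : A} {g g' : B} (h : (f, g) ∈ T) (h' : (f', g') ∈ T) :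
    (f - f', g - g') ∈ T := T.sub_mem h h'

lemma Subring.neg_pair_mem {f : A} {g : B} (h : (f, g) ∈ T) : (-f, -g) ∈ T := T.neg_mem h

lemma Subring.zero_pair_mem : ((0 : A), (0 : B)) ∈ T := T.zero_mem

lemma Subring.one_pair_mem : ((1 : A), (1 : B)) ∈ T := T.one_mem

/-- The matrix over `T` with given entries. -/
def pairMatrix (h : ∀ i j, (M i j, M' i j) ∈ T) : Matrix ι ι T := of fun i j => ⟨_, h i j⟩

/-- Evaluation at a point is not defined on all rational functions, but the pairs of a regular
object and its value form a subring of a product. A determinant over this subring projects to the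
determinants of both components, so it can be evaluated entrywise. -/
lemma Subring.det_pair_mem (h : ∀ i j, (M i j, M' i j) ∈ T) : (M.det, M'.det) ∈ T := by
  have h1 := RingHom.map_det ((RingHom.fst A B).comp T.subtype) (pairMatrix h)
  have h2 := RingHom.map_det ((RingHom.snd A B).comp T.subtype) (pairMatrix h)
  have := (pairMatrix h).det.2
  rwa [show ((pairMatrix h).det : A × B) = (M.det, M'.det) from Prod.ext h1 h2] at this

lemma Subring.adjugate_pair_mem (h : ∀ i j, (M i j, M' i j) ∈ T) (i j : ι) :
    (M.adjugate i j, M'.adjugate i j) ∈ T := by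
  rw [adjugate_apply, adjugate_apply]
  refine Subring.det_pair_mem fun k l => ?_
  by_cases hk : k = j
  · subst hk
    rw [updateRow_self, updateRow_self, Pi.single_apply, Pi.single_apply]
    split_ifs
    · exact T.one_mem
    · exact T.zero_mem
  · rw [updateRow_ne hk, updateRow_ne hk]; exact h k l

lemma Subring.derivative_charpoly_eval_pair_mem (h : ∀ i j, (M i j, M' i j) ∈ T) {a : A} {b : B}
    (hab : (a, b) ∈ T) :
    ((derivative M.charpoly).eval a, (derivative M'.charpoly).eval b) ∈ T := by
  have h1 : (derivative M.charpoly).eval a = ((RingHom.fst A B).comp T.subtype)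
      ((derivative (pairMatrix h).charpoly).eval ⟨_, hab⟩) := by
    rw [← eval_map_apply, ← derivative_map, ← charpoly_map]
    rfl
  have h2 : (derivative M'.charpoly).eval b = ((RingHom.snd A B).comp T.subtype)
      ((derivative (pairMatrix h).charpoly).eval ⟨_, hab⟩) := by
    rw [← eval_map_apply, ← derivative_map, ← charpoly_map]
    rfl
  rw [h1, h2]
  exact Subtype.prop _

end SubringProd

/-! ### Functions, series and polynomials paired with their values at a point -/

section ValSubrings

variable (q : OnePoint ℂ)

lemma HasVal.neg {q : OnePoint ℂ} {f : K} {c : ℂ} (h : HasVal q f c) : HasVal q (-f) (-c) := by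
  unfold HasVal at *
  rw [map_neg, ← neg_sub', Valuation.map_neg]
  exact h

lemma HasVal.unique {q : OnePoint ℂ} {f : K} {c d : ℂ} (h : HasVal q f c) (h' : HasVal q f d) :
    c = d := by
  by_contra hne
  have h1 := h.add h'.neg
  unfold HasVal at h1
  rw [add_neg_cancel, zero_sub, Valuation.map_neg, ordAt_C] at h1
  · exact lt_irrefl _ h1
  · rwa [← sub_eq_add_neg, sub_ne_zero]

lemma HasVal.inv {q : OnePoint ℂ} {f : K} {c : ℂ} (h : HasVal q f c) (hc : c ≠ 0) :
    HasVal q f⁻¹ c⁻¹ := by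
  have h1 : ordAt q f = 1 := by
    refine le_antisymm (ordAt_le_one_iff.2 h.mem) (not_lt.1 fun hlt => hc ?_)
    refine h.unique ?_
    unfold HasVal
    rwa [map_zero, sub_zero]
  have hf : f ≠ 0 := by rintro rfl; simp at h1
  have hC : RatFunc.C c ≠ 0 := by simpa using hc
  unfold HasVal at *
  have e : f⁻¹ - RatFunc.C c⁻¹ = -(f - RatFunc.C c) * (f⁻¹ * (RatFunc.C c)⁻¹) := by
    rw [map_inv₀]; field_simp; ring
  rw [e, map_mul, Valuation.map_neg, map_mul, map_inv₀, map_inv₀, h1, ordAt_C hc, inv_one, mul_one,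
    mul_one]
  exact h

/-- The functions regular at `q`, together with their values. -/
def valPairs : Subring (K × ℂ) where
  carrier := {p | HasVal q p.1 p.2}
  mul_mem' ha hb := HasVal.mul ha hb
  one_mem' := by simpa using HasVal.const 1 q
  add_mem' ha hb := HasVal.add ha hb
  zero_mem' := by simpa using HasVal.const 0 q
  neg_mem' ha := HasVal.neg ha

/-- The power series with coefficients regular at `q`, together with their values. -/
def valSeries : Subring (PowerSeries K × R₀) where
  carrier := {p | ∀ k, HasVal q (PowerSeries.coeff k p.1) (PowerSeries.coeff k p.2)}
  mul_mem' {a b} ha hb k := by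
    simp only [Prod.fst_mul, Prod.snd_mul, PowerSeries.coeff_mul]
    exact HasVal.sum _ fun i _ => (ha _).mul (hb _)
  one_mem' k := by
    simp only [Prod.fst_one, Prod.snd_one, PowerSeries.coeff_one]
    split_ifs
    · simpa using HasVal.const 1 q
    · simpa using HasVal.const 0 q
  add_mem' ha hb k := by
    simp only [Prod.fst_add, Prod.snd_add, map_add]
    exact (ha k).add (hb k)
  zero_mem' k := by simpa using HasVal.const 0 q
  neg_mem' ha k := by
    simp only [Prod.fst_neg, Prod.snd_neg, map_neg]
    exact (ha k).neg

/-- The polynomials with coefficients regular at `q`, together with their values. -/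
def valMv (n : ℕ) : Subring (MvPolynomial (Fin n) (PowerSeries K) × MvPolynomial (Fin n) R₀) where
  carrier := {p | ∀ m, (MvPolynomial.coeff m p.1, MvPolynomial.coeff m p.2) ∈ valSeries q}
  mul_mem' {a b} ha hb m := by
    simp only [Prod.fst_mul, Prod.snd_mul, MvPolynomial.coeff_mul]
    exact Subring.sum_pair_mem _ fun i _ => Subring.mul_pair_mem (ha _) (hb _)
  one_mem' m := by
    simp only [Prod.fst_one, Prod.snd_one, MvPolynomial.coeff_one]
    split_ifs
    · exact Subring.one_pair_mem
    · exact Subring.zero_pair_mem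
  add_mem' ha hb m := by
    simp only [Prod.fst_add, Prod.snd_add, MvPolynomial.coeff_add]
    exact Subring.add_pair_mem (ha m) (hb m)
  zero_mem' m := by
    simp only [Prod.fst_zero, Prod.snd_zero, MvPolynomial.coeff_zero]
    exact Subring.zero_pair_mem
  neg_mem' ha m := by
    simp only [Prod.fst_neg, Prod.snd_neg, MvPolynomial.coeff_neg]
    exact Subring.neg_pair_mem (ha m)

variable {q}

lemma mem_valPairs {f : K} {c : ℂ} : (f, c) ∈ valPairs q ↔ HasVal q f c := Iff.rfl

lemma C_mem_valSeries {f : K} {c : ℂ} (h : HasVal q f c) :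
    (PowerSeries.C f, PowerSeries.C c) ∈ valSeries q := fun k => by
  simp only [PowerSeries.coeff_C]
  split_ifs
  · exact h
  · simpa using HasVal.const 0 q

lemma map_C_mem_valSeries (s : R₀) :
    (PowerSeries.map (RatFunc.C : ℂ →+* K) s, s) ∈ valSeries q := fun k => by
  simp only [PowerSeries.coeff_map]; exact HasVal.const _ q

lemma X_mem_valSeries : ((PowerSeries.X : PowerSeries K), (PowerSeries.X : R₀)) ∈ valSeries q := by
  have := map_C_mem_valSeries (q := q) (PowerSeries.X)
  rwa [PowerSeries.map_X] at this

lemma C_mem_valMv {n : ℕ} {f : PowerSeries K} {c : R₀} (h : (f, c) ∈ valSeries q) :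
    ((MvPolynomial.C f : MvPolynomial (Fin n) _), (MvPolynomial.C c : MvPolynomial (Fin n) _)) ∈
      valMv q n := fun m => by
  simp only [MvPolynomial.coeff_C]
  split_ifs
  · exact h
  · exact Subring.zero_pair_mem

lemma X_mem_valMv {n : ℕ} (j : Fin n) :
    ((MvPolynomial.X j : MvPolynomial (Fin n) (PowerSeries K)),
      (MvPolynomial.X j : MvPolynomial (Fin n) R₀)) ∈ valMv q n := fun m => by
  simp only [MvPolynomial.coeff_X]
  split_ifs
  · exact Subring.one_pair_mem
  · exact Subring.zero_pair_mem

end ValSubrings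

/-! ### Values on the sheets: `y - Φ`, `E_ω` and the adjugate -/

namespace WKBSolution

variable {r : ℕ} {Φ : RationalHConnection r} {x y : K} (S : WKBSolution Φ x y)

lemma exists_ne_mem (t : ℂ) : ∃ t₀ ∈ S.D, t₀ ≠ t := by
  obtain ⟨s, hs, hne⟩ := (S.infinite_D.sdiff (Set.finite_singleton t)).nonempty
  exact ⟨s, hs, hne⟩

/-- A point of `D` not under `q`. -/
lemma exists_not_hasVal (q : OnePoint ℂ) : ∃ t₀ ∈ S.D, ¬ HasVal q x t₀ := by
  by_cases h : ∃ t, HasVal q x t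
  · obtain ⟨t, ht⟩ := h
    obtain ⟨s, hs, hne⟩ := S.exists_ne_mem t
    exact ⟨s, hs, fun h' => hne (h'.unique ht)⟩
  · obtain ⟨t, ht⟩ := S.isConnected.nonempty
    exact ⟨t, ht, fun h' => h ⟨t, h'⟩⟩

lemma hasVal_y (hcurve : IsSmoothGenusZeroSpectralCurve Φ x y) (a : Fin r) {t : ℂ} (ht : t ∈ S.D) :
    HasVal (S.sheet a t : OnePoint ℂ) y (S.eig a t) := by
  obtain ⟨s, -, hne⟩ := S.exists_ne_mem t
  have hs : ¬ HasVal (S.sheet a t : OnePoint ℂ) x s := fun h =>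
    hne (h.unique (S.hasVal_sheet a ht))
  have hq : ¬ Φ.IsSingularity 0 (ratMap x (S.sheet a t : OnePoint ℂ)) := by
    rw [S.sheet_over a t ht]; exact S.not_singular t ht
  have h := (regular_of_not_isSingularity hcurve hq hs).1
  rw [ordAt_invCoord_eq_one (S.hasVal_sheet a ht).mem hs, one_pow, ordAt_le_one_iff] at h
  exact HasVal.coe_iff.2 ⟨h, rfl⟩

lemma hasVal_of_regular (a : Fin r) {t : ℂ} (ht : t ∈ S.D) {f : K}
    (hf : FormRegularAt f (t : OnePoint ℂ)) :
    HasVal (S.sheet a t : OnePoint ℂ) (pullback x f) (ratEval f t) :=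
  (S.hasVal_sheet a ht).comp (HasVal.coe_iff.2 ⟨hf, rfl⟩)

lemma regular_coeff (hA : S.Assumption5Star) {q : OnePoint ℂ} (hq : ¬ Φ.IsSingularity 0 q) (ℓ : ℕ)
    (i j : Fin r) : FormRegularAt (Φ.coeff ℓ i j) q := by
  by_contra h
  rcases Nat.eq_zero_or_pos ℓ with rfl | hℓ
  · exact hq ⟨i, j, h⟩
  · exact hq (hA.1 ℓ hℓ _ ⟨i, j, h⟩)

lemma pull_mem_valSeries (hA : S.Assumption5Star) (a : Fin r) {t : ℂ} (ht : t ∈ S.D) (i j : Fin r) :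
    (Φ.pull x i j, Φ.at' t i j) ∈ valSeries (S.sheet a t : OnePoint ℂ) := fun k => by
  simp only [RationalHConnection.pull, RationalHConnection.at', of_apply, PowerSeries.coeff_mk]
  exact S.hasVal_of_regular a ht (S.regular_coeff hA (S.not_singular t ht) k i j)

/-- The matrix `y(z^a(t)) - Φ_ħ(t)`. -/
def charMatAt (a : Fin r) (t : ℂ) : Matrix (Fin r) (Fin r) R₀ :=
  Matrix.scalar (Fin r) (PowerSeries.C (S.eig a t)) - Φ.at' t

lemma charMat_mem_valSeries (hcurve : IsSmoothGenusZeroSpectralCurve Φ x y)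
    (hA : S.Assumption5Star) (a : Fin r) {t : ℂ} (ht : t ∈ S.D) (i j : Fin r) :
    (charMat Φ x y i j, S.charMatAt a t i j) ∈ valSeries (S.sheet a t : OnePoint ℂ) := by
  refine Subring.sub_pair_mem ?_ (S.pull_mem_valSeries hA a ht i j)
  by_cases h : i = j
  · subst h
    simp only [scalar_apply, diagonal_apply_eq]
    exact C_mem_valSeries (S.hasVal_y hcurve a ht)
  · simp only [scalar_apply, diagonal_apply_ne _ h]
    exact Subring.zero_pair_mem

lemma higgs_mem_valPairs (a : Fin r) {t : ℂ} (ht : t ∈ S.D) (i j : Fin r) :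
    (Φ.higgs.map (pullback x) i j, (Φ.at' t).map (PowerSeries.constantCoeff (R := ℂ)) i j) ∈
      valPairs (S.sheet a t : OnePoint ℂ) := by
  have h1 : FormRegularAt (Φ.coeff 0 i j) (t : OnePoint ℂ) := by
    by_contra h; exact S.not_singular t ht ⟨i, j, h⟩
  have := S.hasVal_of_regular a ht h1
  simpa [RationalHConnection.at', mem_valPairs, RationalHConnection.higgs] using this

/-- The value of `E_ω`. -/
def eigProd (a : Fin r) (t : ℂ) : ℂ := ∏ s ∈ Finset.univ.erase a, (S.eig a t - S.eig s t)

lemma hasVal_Eω (hcurve : IsSmoothGenusZeroSpectralCurve Φ x y) (a : Fin r) {t : ℂ} (ht : t ∈ S.D) :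
    HasVal (S.sheet a t : OnePoint ℂ) (Eω Φ x y) (S.eigProd a t) := by
  have h := Subring.derivative_charpoly_eval_pair_mem (S.higgs_mem_valPairs a ht)
    (mem_valPairs.2 (S.hasVal_y hcurve a ht))
  obtain ⟨V, W, -, h2, h3, -⟩ := S.higgs_eq ht
  have h4 : ((Φ.at' t).map (PowerSeries.constantCoeff (R := ℂ))).charpoly =
      ∏ s, (X - Polynomial.C (S.eig s t)) := by
    rw [h3, charpoly_mul_comm, ← Matrix.mul_assoc, h2, Matrix.one_mul, charpoly_diagonal]
  rw [h4] at h
  have h5 : (derivative (∏ s, (X - Polynomial.C (S.eig s t)))).eval (S.eig a t) = S.eigProd a t := by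
    rw [derivative_prod_finset, eval_finsetSum, Finset.sum_eq_single a]
    · simp [eval_prod, eigProd]
    · intro b _ hb
      rw [eval_mul, eval_prod, Finset.prod_eq_zero (i := a), zero_mul]
      · simp [hb.symm]
      · simp
    · simp
  rw [h5] at h
  exact h

/-- The adjugate of `y - φ` is `E_ω` times the projector. -/
lemma hasVal_adjugate (hcurve : IsSmoothGenusZeroSpectralCurve Φ x y) (a : Fin r) {t : ℂ}
    (ht : t ∈ S.D) (i j : Fin r) :
    HasVal (S.sheet a t : OnePoint ℂ)
      ((Matrix.scalar (Fin r) y - Φ.higgs.map (pullback x)).adjugate i j)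
      (S.eigProd a t * PowerSeries.constantCoeff (S.M t (e a) i j)) := by
  obtain ⟨V, W, h1, h2, h3, h4⟩ := S.higgs_eq ht
  have hmem : ∀ i j, ((Matrix.scalar (Fin r) y - Φ.higgs.map (pullback x)) i j,
      (Matrix.scalar (Fin r) (S.eig a t) - (Φ.at' t).map (PowerSeries.constantCoeff (R := ℂ))) i j) ∈
      valPairs (S.sheet a t : OnePoint ℂ) := by
    intro i j
    refine Subring.sub_pair_mem ?_ (S.higgs_mem_valPairs a ht i j)
    by_cases h : i = j
    · subst h
      simp only [scalar_apply, diagonal_apply_eq]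
      exact S.hasVal_y hcurve a ht
    · simp only [scalar_apply, diagonal_apply_ne _ h]
      exact Subring.zero_pair_mem
  have h := Subring.adjugate_pair_mem hmem i j
  have h5 : Matrix.scalar (Fin r) (S.eig a t) - (Φ.at' t).map (PowerSeries.constantCoeff (R := ℂ)) =
      V * diagonal (fun s => S.eig a t - S.eig s t) * W := by
    rw [h3, ← diagonal_sub, Matrix.mul_sub, Matrix.sub_mul]
    congr 1
    rw [← smul_one_eq_diagonal, Matrix.mul_smul, mul_one, Matrix.smul_mul, h1, scalar_apply,
      smul_one_eq_diagonal]
  have hdet : V.det * W.det = 1 := by rw [← det_mul, h1, det_one]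
  have hV : V.adjugate = V.det • W := by
    rw [← mul_one V.adjugate, ← h1, ← Matrix.mul_assoc, adjugate_mul, Matrix.smul_mul, one_mul]
  have hW : W.adjugate = W.det • V := by
    rw [← mul_one W.adjugate, ← h2, ← Matrix.mul_assoc, adjugate_mul, Matrix.smul_mul, one_mul]
  have hD : (diagonal (fun s => S.eig a t - S.eig s t)).adjugate = S.eigProd a t • e a := by
    rw [adjugate_diagonal, e, ← diagonal_smul]
    congr 1; ext1 s
    by_cases hs : s = a
    · subst hs; simp [eigProd]
    · rw [Finset.prod_eq_zero (i := a) (by simp [Ne.symm hs]) (sub_self _)]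
      simp [hs]
  have h6 : (Matrix.scalar (Fin r) (S.eig a t) -
      (Φ.at' t).map (PowerSeries.constantCoeff (R := ℂ))).adjugate =
      S.eigProd a t • (S.M t (e a)).map (PowerSeries.constantCoeff (R := ℂ)) := by
    rw [h5, h4, adjugate_mul_distrib, adjugate_mul_distrib, hV, hW, hD]
    simp only [Matrix.smul_mul, Matrix.mul_smul, smul_smul, Matrix.mul_assoc]
    congr 1
    linear_combination (S.eigProd a t) * hdet
  rw [h6] at h
  exact h

end WKBSolution

/-! ### Commutators with the adjugate -/

section Commutator

variable {ι R : Type*} [Fintype ι] [DecidableEq ι] [CommRing R]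

open DualNumber TrivSqZeroExt

/-- The first-order variation of a determinant, row by row: since `ε² = 0`, at most one row can come
from the perturbation. -/
lemma snd_det_add_eps (Q B : Matrix ι ι R) :
    snd (Q.map (inlHom R R) + (ε : R[ε]) • B.map (inlHom R R)).det =
      ∑ k, (Q.updateRow k (B k)).det := by
  have key : ∀ s : Finset ι, (rowPiecewise s ((ε : R[ε]) • B.map (inlHom R R))
      (Q.map (inlHom R R))).det = ε ^ s.card * inlHom R R (rowPiecewise s B Q).det := by
    intro s
    rw [← Finset.prod_const]
    have := det_piecewise_mul s (fun _ => (ε : R[ε])) (B.map (inlHom R R)) (Q.map (inlHom R R))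
    rw [RingHom.map_det]
    refine Eq.trans ?_ (this.trans ?_)
    · rfl
    · congr 2
      ext1 i j
      simp only [rowPiecewise_apply, RingHom.mapMatrix_apply, map_apply]
      split_ifs <;> rfl
  rw [add_comm, det_add_eq_sum_piecewise, snd_sum]
  have hsub : (insert ∅ (Finset.univ.image fun i : ι => ({i} : Finset ι))) ⊆
    (Finset.univ : Finset (Finset ι)) := Finset.subset_univ _
  rw [← Finset.sum_subset hsub, Finset.sum_insert, Finset.sum_image]
  · rw [key, Finset.card_empty, pow_zero, one_mul, show snd (inlHom R R _) = 0 from rfl, zero_add]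
    refine Finset.sum_congr rfl fun i _ => ?_
    have h1 : rowPiecewise {i} B Q = Q.updateRow i (B i) := by
      ext a b
      by_cases h : a = i
      · subst h; simp [rowPiecewise]
      · simp [rowPiecewise, h, updateRow_apply]
    rw [key, h1, Finset.card_singleton, pow_one]
    simp
  · intro a _ b _ h; simpa using h
  · simp
  · intro s _ hs
    have h2 : 2 ≤ s.card := by
      by_contra hlt
      have : s.card = 0 ∨ s.card = 1 := by omega
      rcases this with h | h
      · rw [Finset.card_eq_zero] at h; simp [h] at hs
      · obtain ⟨a, rfl⟩ := Finset.card_eq_one.1 h; simp at hs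
    rw [key, show s.card = 2 + (s.card - 2) by omega, pow_add, pow_two, eps_mul_eps, zero_mul,
      zero_mul, snd_zero]

/-- Over the dual numbers `(1 - εZ) H (1 + εZ) = H + ε [H, Z]`, and taking adjugates commutes with
conjugation by invertible matrices. Invertibility of `H` itself is not needed. -/
lemma adjugate_dual (H Z : Matrix ι ι R) :
    (H.map (inlHom R R) + (ε : R[ε]) • (H * Z - Z * H).map (inlHom R R)).adjugate =
      H.adjugate.map (inlHom R R) +
        (ε : R[ε]) • (H.adjugate * Z - Z * H.adjugate).map (inlHom R R) := by
  set φ : Matrix ι ι R →+* Matrix ι ι R[ε] := (inlHom R R).mapMatrix with hφ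
  have hεε : ∀ A : Matrix ι ι R[ε], (ε : R[ε]) • ((ε : R[ε]) • A) = 0 := fun A => by
    rw [smul_smul, eps_mul_eps, zero_smul]
  have conj : ∀ A : Matrix ι ι R, (1 - (ε : R[ε]) • φ Z) * φ A * (1 + (ε : R[ε]) • φ Z) =
      φ A + (ε : R[ε]) • φ (A * Z - Z * A) := by
    intro A
    rw [map_sub, map_mul, map_mul, Matrix.sub_mul, Matrix.one_mul, Matrix.smul_mul,
      Matrix.mul_add, mul_one, Matrix.sub_mul, Matrix.mul_smul, Matrix.smul_mul, Matrix.mul_smul,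
      hεε, smul_sub]
    abel
  have h1 : (1 - (ε : R[ε]) • φ Z) * (1 + (ε : R[ε]) • φ Z) = 1 := by
    have := conj 1
    simpa using this
  have h2 : (1 + (ε : R[ε]) • φ Z) * (1 - (ε : R[ε]) • φ Z) = 1 := mul_eq_one_comm.1 h1
  set P := 1 - (ε : R[ε]) • φ Z with hP
  set P' := 1 + (ε : R[ε]) • φ Z with hP'
  have hdet : P'.det * P.det = 1 := by rw [← det_mul, h2, det_one]
  have hadj : P.adjugate = P.det • P' := by
    rw [← mul_one P.adjugate, ← h1, ← Matrix.mul_assoc, adjugate_mul, Matrix.smul_mul, one_mul]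
  have hadj' : P'.adjugate = P'.det • P := by
    rw [← mul_one P'.adjugate, ← h2, ← Matrix.mul_assoc, adjugate_mul, Matrix.smul_mul, one_mul]
  have h3 : (P * φ H * P').adjugate = P * φ H.adjugate * P' := by
    rw [adjugate_mul_distrib, adjugate_mul_distrib, hadj, hadj', hφ, RingHom.map_adjugate]
    simp only [Matrix.smul_mul, Matrix.mul_smul, smul_smul, Matrix.mul_assoc]
    rw [mul_comm P.det, hdet, one_smul]
  rw [conj, conj] at h3
  exact h3

/-- The derivative of the adjugate in the direction of a commutator. -/
lemma commutator_adjugate (H Z : Matrix ι ι R) (i j : ι) :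
    (H.adjugate * Z - Z * H.adjugate) i j =
      ∑ k, ∑ l, if k = j then 0 else
        (H * Z - Z * H) k l * (rowRepl H {j, k} (fun m => if m = j then i else l)).det := by
  have h1 := congrArg (fun A => snd (A i j)) (adjugate_dual H Z)
  have h2 : snd ((H.adjugate.map (inlHom R R) +
      (ε : R[ε]) • (H.adjugate * Z - Z * H.adjugate).map (inlHom R R)) i j) =
      (H.adjugate * Z - Z * H.adjugate) i j := by
    rw [Matrix.add_apply, Matrix.smul_apply, map_apply, map_apply, smul_eq_mul, snd_add]
    simp
  rw [h2] at h1
  rw [← h1]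
  change snd (Matrix.adjugate _ i j) = _
  set B := H * Z - Z * H with hB
  -- Entry `(i, j)` of the adjugate is a determinant whose row `j` is the constant vector `e_i`, so
  -- the perturbation acts on the other rows only. Expanding the perturbed row `k` then leaves
  -- minors with the two rows `j` and `k` replaced.
  have h3 : (H.map (inlHom R R) + (ε : R[ε]) • B.map (inlHom R R)).updateRow j (Pi.single i 1) =
      (H.updateRow j (Pi.single i 1)).map (inlHom R R) +
        (ε : R[ε]) • (B.updateRow j 0).map (inlHom R R) := by
    ext1 a b
    by_cases ha : a = j
    · subst ha
      simp only [updateRow_self, Matrix.add_apply, map_apply, Matrix.smul_apply, Pi.zero_apply,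
        map_zero, smul_zero, add_zero, Pi.single_apply]
      split_ifs <;> simp
    · simp [updateRow_ne ha]
  rw [adjugate_apply, h3, snd_det_add_eps]
  refine Finset.sum_congr rfl fun k _ => ?_
  by_cases hk : k = j
  · subst hk
    simp only [if_true, Finset.sum_const_zero]
    rw [updateRow_self]
    exact det_eq_zero_of_row_eq_zero k (by simp)
  · simp only [hk, if_false]
    rw [det_eq_sum_mul_adjugate_row _ k]
    refine Finset.sum_congr rfl fun l _ => ?_
    rw [updateRow_self, updateRow_ne hk, adjugate_apply, updateRow_idem]
    congr 2
    ext a b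
    rw [rowRepl_apply]
    by_cases ha : a = k
    · subst ha
      simp [hk, Pi.single_apply]
    · rw [updateRow_ne ha]
      by_cases ha' : a = j
      · subst ha'; simp [Pi.single_apply]
      · rw [updateRow_ne ha']; simp [ha, ha']

end Commutator

/-! ### The rational expansion of the projectors -/

lemma ratFunc_eq_of_hasVal {f g : K} {A : Set ℂ} (hA : A.Infinite)
    (h : ∀ a ∈ A, ∃ c, HasVal (a : OnePoint ℂ) f c ∧ HasVal (a : OnePoint ℂ) g c) : f = g := by
  refine ratFunc_eq_of_infinite hA fun a ha _ _ => ?_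
  obtain ⟨c, h1, h2⟩ := h a ha
  rw [(HasVal.coe_iff.1 h1).2, (HasVal.coe_iff.1 h2).2]

/-- Identities on the curve are checked over `D`: a single sheet already sweeps out infinitely many
points. -/
lemma series_eq_of_valSeries {f g : PowerSeries K} {A : Set ℂ} (hA : A.Infinite)
    (h : ∀ a ∈ A, ∃ c, (f, c) ∈ valSeries (a : OnePoint ℂ) ∧ (g, c) ∈ valSeries (a : OnePoint ℂ)) :
    f = g := by
  ext k
  refine ratFunc_eq_of_hasVal hA fun a ha => ?_
  obtain ⟨c, h1, h2⟩ := h a ha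
  exact ⟨_, h1 k, h2 k⟩

namespace WKBSolution

open Filter Topology

variable {r : ℕ} {Φ : RationalHConnection r} {x y : K} (S : WKBSolution Φ x y)

/-- `N` is the rational expansion of the projectors `M_ħ(·, e_a)`. -/
structure IsExpansion (N : ℕ → Matrix (Fin r) (Fin r) K) : Prop where
  value : ∀ a, ∀ t ∈ S.D, ∀ k i j,
    PowerSeries.coeff k (S.M t (e a) i j) = ratEval (N k i j) (S.sheet a t)
  poles : ∀ k, 1 ≤ k → ∀ i j q, ¬ FunRegularAt (N k i j) q →
    IsRamified x q ∨ Φ.IsSingularity 0 (ratMap x q)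

variable {S} {N : ℕ → Matrix (Fin r) (Fin r) K}

lemma charMat_constantCoeff : (charMat Φ x y).map (PowerSeries.constantCoeff (R := K)) =
    Matrix.scalar (Fin r) y - Φ.higgs.map (pullback x) := by
  ext i j
  by_cases h : i = j
  · subst h; simp [charMat, RationalHConnection.pull, RationalHConnection.higgs]
  · simp [charMat, RationalHConnection.pull, RationalHConnection.higgs, h]

/-- On each sheet both sides equal `∏ (y_a - y_s)` times the spectral projector of `φ`. This brings
the leading term, about whose poles nothing is assumed, under the control of the minors. -/
lemma IsExpansion.zero_eq (hN : S.IsExpansion N) (hcurve : IsSmoothGenusZeroSpectralCurve Φ x y)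
    (i j : Fin r) : N 0 i j * Eω Φ x y =
      PowerSeries.coeff 0 ((charMat Φ x y).adjugate i j) := by
  have h0 : PowerSeries.coeff 0 ((charMat Φ x y).adjugate i j) =
      (Matrix.scalar (Fin r) y - Φ.higgs.map (pullback x)).adjugate i j := by
    rw [← charMat_constantCoeff, PowerSeries.coeff_zero_eq_constantCoeff,
      ← RingHom.mapMatrix_apply, ← RingHom.map_adjugate]
    rfl
  rw [h0]
  let a : Fin r := ⟨0, hcurve.pos⟩
  -- The finitely many finite poles that `N 0` might have are excluded from the comparison.
  refine ratFunc_eq_of_hasVal (A := (S.sheet a '' S.D) \ {z | (N 0 i j).denom.eval z = 0})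
    ((S.infinite_sheet_image a subset_rfl S.infinite_D).sdiff (finite_not_regular _)) ?_
  rintro _ ⟨⟨t, ht, rfl⟩, hz⟩
  refine ⟨_, ?_, S.hasVal_adjugate hcurve a ht i j⟩
  rw [mul_comm (S.eigProd a t)]
  refine HasVal.mul ?_ (S.hasVal_Eω hcurve a ht)
  refine HasVal.coe_iff.2 ⟨hz, ?_⟩
  rw [← hN.value a t ht, PowerSeries.coeff_zero_eq_constantCoeff]

/-- Entries of the adjugate are minors with one replaced row, whose weight is `dv / E_ω` without any
power of `v`; and `dv` does not vanish at an unramified point. -/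
lemma adjugate_mem (hcurve : IsSmoothGenusZeroSpectralCurve Φ x y)
    (hA : S.Assumption5Star) {q : OnePoint ℂ} {t₀ : ℂ} (ht₀ : t₀ ∈ S.D) (hq : ¬ HasVal q x t₀)
    (hr : ¬ IsRamified x q) (i j : Fin r) (k : ℕ) :
    PowerSeries.coeff k ((charMat Φ x y).adjugate i j) / Eω Φ x y ∈ regAt q := by
  have h1 := minor_mem hcurve S hA ht₀ hq {j} (by simp) (fun _ => i) k
  have h2 : rowRepl (charMat Φ x y) {j} (fun _ => i) =
      (charMat Φ x y).updateRow j (Pi.single i 1) := by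
    ext1 a b
    rw [rowRepl_apply]
    by_cases ha : a = j
    · subst ha; simp [Pi.single_apply]
    · simp [ha]
  rw [h2, ← adjugate_apply, minorWeight, Finset.card_singleton, Nat.sub_self, mul_zero, pow_zero,
    mul_one, div_mul_eq_mul_div, mul_div_assoc, map_mul] at h1
  have h3 : ordAt q (formFactor q * ratDeriv (invCoord x t₀)) = 1 :=
    le_antisymm (formRegularAt_ratDeriv_invCoord hq)
      (not_lt.1 fun h => hr ((isRamified_iff hcurve.nonconstant hq).2 h))
  rwa [h3, one_mul, ordAt_le_one_iff] at h1

lemma IsExpansion.zero_mem (hN : S.IsExpansion N) (hcurve : IsSmoothGenusZeroSpectralCurve Φ x y)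
    (hA : S.Assumption5Star) {q : OnePoint ℂ} (hr : ¬ IsRamified x q) (i j : Fin r) :
    N 0 i j ∈ regAt q := by
  obtain ⟨t₀, ht₀, hq⟩ := S.exists_not_hasVal q
  have h := adjugate_mem hcurve hA ht₀ hq hr i j 0
  have hE : Eω Φ x y ≠ 0 := hcurve.derivative_ne_zero
  rwa [← hN.zero_eq hcurve, mul_div_cancel_right₀ _ hE] at h

lemma IsExpansion.sheet_mem (hN : S.IsExpansion N) (hcurve : IsSmoothGenusZeroSpectralCurve Φ x y)
    (hA : S.Assumption5Star) (a : Fin r) {t : ℂ} (ht : t ∈ S.D) (k : ℕ) (i j : Fin r) :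
    N k i j ∈ regAt (S.sheet a t : OnePoint ℂ) := by
  have hr := S.not_isRamified_sheet hcurve a ht
  rcases Nat.eq_zero_or_pos k with rfl | hk
  · exact hN.zero_mem hcurve hA hr i j
  · by_contra h
    rcases hN.poles k hk i j _ (mt mem_regAt.2 h) with h1 | h1
    · exact hr h1
    · rw [S.sheet_over a t ht] at h1
      exact S.not_singular t ht h1

lemma IsExpansion.hasVal (hN : S.IsExpansion N) (hcurve : IsSmoothGenusZeroSpectralCurve Φ x y)
    (hA : S.Assumption5Star) (a : Fin r) {t : ℂ} (ht : t ∈ S.D) (k : ℕ) (i j : Fin r) :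
    HasVal (S.sheet a t : OnePoint ℂ) (N k i j) (PowerSeries.coeff k (S.M t (e a) i j)) :=
  HasVal.coe_iff.2 ⟨hN.sheet_mem hcurve hA a ht k i j, (hN.value a t ht k i j).symm⟩

/-- The expansion as a matrix of power series. -/
def expSeries (N : ℕ → Matrix (Fin r) (Fin r) K) : Matrix (Fin r) (Fin r) (PowerSeries K) :=
  of fun i j => PowerSeries.mk fun k => N k i j

lemma coeff_expSeries (N : ℕ → Matrix (Fin r) (Fin r) K) (i j : Fin r) (k : ℕ) :
    PowerSeries.coeff k (expSeries N i j) = N k i j := by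
  rw [expSeries, of_apply, PowerSeries.coeff_mk]

lemma IsExpansion.mem_valSeries (hN : S.IsExpansion N)
    (hcurve : IsSmoothGenusZeroSpectralCurve Φ x y) (hA : S.Assumption5Star) (a : Fin r) {t : ℂ}
    (ht : t ∈ S.D) (i j : Fin r) :
    (expSeries N i j, S.M t (e a) i j) ∈ valSeries (S.sheet a t : OnePoint ℂ) := fun k => by
  simp only [coeff_expSeries]; exact hN.hasVal hcurve hA a ht k i j

lemma mul_pair_mem {q : OnePoint ℂ} {A B : Matrix (Fin r) (Fin r) (PowerSeries K)}
    {A' B' : Matrix (Fin r) (Fin r) R₀} (hA : ∀ i j, (A i j, A' i j) ∈ valSeries q)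
    (hB : ∀ i j, (B i j, B' i j) ∈ valSeries q) (i j : Fin r) :
    ((A * B) i j, (A' * B') i j) ∈ valSeries q := by
  rw [mul_apply, mul_apply]
  exact Subring.sum_pair_mem _ fun k _ => Subring.mul_pair_mem (hA i k) (hB k j)

lemma IsExpansion.mul_self (hN : S.IsExpansion N) (hcurve : IsSmoothGenusZeroSpectralCurve Φ x y)
    (hA : S.Assumption5Star) : expSeries N * expSeries N = expSeries N := by
  ext1 i j
  let a : Fin r := ⟨0, hcurve.pos⟩
  refine series_eq_of_valSeries (S.infinite_sheet_image a subset_rfl S.infinite_D) ?_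
  rintro _ ⟨t, ht, rfl⟩
  have h := hN.mem_valSeries hcurve hA a ht
  have h2 := mul_pair_mem h h i j
  rw [S.M_e_mul_self ht] at h2
  exact ⟨_, h2, h i j⟩

lemma ratEval_x_sheet (a : Fin r) {t : ℂ} (ht : t ∈ S.D) : ratEval x (S.sheet a t) = t :=
  (HasVal.coe_iff.1 (S.hasVal_sheet a ht)).2

lemma hasDerivAt_sheet (a : Fin r) {t : ℂ}
    (ht : t ∈ S.D) :
    HasDerivAt (S.sheet a) (ratEval (ratDeriv x) (S.sheet a t))⁻¹ t := by
  have h1 : DifferentiableAt ℂ (S.sheet a) t :=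
    (S.sheet_holomorphic a).differentiableAt (S.isOpen.mem_nhds ht)
  have h2 := (hasDerivAt_ratEval (HasVal.coe_iff.1 (S.hasVal_sheet a ht)).1).comp t h1.hasDerivAt
  have h3 : HasDerivAt (ratEval x ∘ S.sheet a) 1 t :=
    (hasDerivAt_id t).congr_of_eventuallyEq ((S.eventually_mem ht).mono fun s hs =>
      ratEval_x_sheet a hs)
  have h4 := h2.unique h3
  have h5 : (ratEval (ratDeriv x) (S.sheet a t))⁻¹ = deriv (S.sheet a) t :=
    inv_eq_of_mul_eq_one_right h4
  rw [h5]; exact h1.hasDerivAt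

/-- The adjoint equation for the expansion. -/
lemma IsExpansion.equation (hN : S.IsExpansion N) (hcurve : IsSmoothGenusZeroSpectralCurve Φ x y)
    (hA : S.Assumption5Star) (i j : Fin r) :
    PowerSeries.X * PowerSeries.mk (fun k => ratDeriv (N k i j)) =
      PowerSeries.C (ratDeriv x) * (Φ.pull x * expSeries N - expSeries N * Φ.pull x) i j := by
  let a : Fin r := ⟨0, hcurve.pos⟩
  refine series_eq_of_valSeries (S.infinite_sheet_image a subset_rfl S.infinite_D) ?_
  rintro _ ⟨t, ht, rfl⟩
  obtain ⟨M', hM', heq⟩ := S.exists_coeffHasDeriv_M ht a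
  set z := S.sheet a t with hz
  set c := ratEval (ratDeriv x) z with hc
  have hc0 : c ≠ 0 := S.ratEval_deriv_sheet_ne_zero hcurve a ht
  have h := hN.mem_valSeries hcurve hA a ht
  have hΦ := S.pull_mem_valSeries hA a ht
  have hx : HasVal (z : OnePoint ℂ) (ratDeriv x) c :=
    HasVal.coe_iff.2 ⟨S.ratDeriv_sheet_mem a ht, rfl⟩
  have h1 : (PowerSeries.mk (fun k => ratDeriv (N k i j)), PowerSeries.C c * M' i j) ∈
      valSeries (z : OnePoint ℂ) := by
    intro k
    simp only [PowerSeries.coeff_mk, PowerSeries.coeff_C_mul]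
    have hreg := HasVal.coe_iff.1 (hN.hasVal hcurve hA a ht k i j)
    refine HasVal.coe_iff.2 ⟨formRegularAt_ratDeriv (q := (z : OnePoint ℂ)) hreg.1, ?_⟩
    have h2 := (hasDerivAt_ratEval hreg.1).comp t (hasDerivAt_sheet a ht)
    have h3 := ((hM' i j) k).unique (h2.congr_of_eventuallyEq
      ((S.eventually_mem ht).mono fun s hs => hN.value a s hs k i j))
    rw [h3, ← hz, ← hc]
    field_simp
  have h2 := Subring.mul_pair_mem (X_mem_valSeries (q := (z : OnePoint ℂ))) h1
  have h3 := Subring.mul_pair_mem (C_mem_valSeries hx)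
    (Subring.sub_pair_mem (mul_pair_mem hΦ h i j) (mul_pair_mem h hΦ i j))
  refine ⟨_, h2, ?_⟩
  have h4 : PowerSeries.X * (PowerSeries.C c * M' i j) =
      PowerSeries.C c * ((Φ.at' t * S.M t (e a)) i j - (S.M t (e a) * Φ.at' t) i j) := by
    rw [← Matrix.sub_apply, ← heq, Matrix.smul_apply, smul_eq_mul]; ring
  rw [h4]
  exact h3

end WKBSolution

/-! ### Regularity of the expansion at unramified points -/

namespace WKBSolution

variable {r : ℕ} {Φ : RationalHConnection r} {x y : K} {S : WKBSolution Φ x y}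
  {N : ℕ → Matrix (Fin r) (Fin r) K}

/-- The matrices with entries regular at `q`. -/
def regMat (r : ℕ) (q : OnePoint ℂ) : Subring (Matrix (Fin r) (Fin r) K) :=
  (regAt q).toSubring.matrix

lemma charMat_commutator (A : Matrix (Fin r) (Fin r) (PowerSeries K)) :
    charMat Φ x y * A - A * charMat Φ x y = -(Φ.pull x * A - A * Φ.pull x) := by
  have h : Matrix.scalar (Fin r) (PowerSeries.C y) * A = A * Matrix.scalar (Fin r) (PowerSeries.C y) :=
    (Matrix.scalar_commute _ (fun _ => Commute.all _ _) A).eq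
  rw [charMat, Matrix.sub_mul, Matrix.mul_sub, h]
  abel

/-- The entries of `[adj H, M]` are combinations of the entries of `[H, M] = -[Φ, M] = -ħ dM/dx`
with minors of codimension two. The extra `ħ` lowers the order, so only coefficients of `M` below
order `m` are involved, and these are regular by hypothesis. -/
lemma IsExpansion.commutator_coeff (hN : S.IsExpansion N)
    (hcurve : IsSmoothGenusZeroSpectralCurve Φ x y) (hA : S.Assumption5Star) {q : OnePoint ℂ}
    (hr : ¬ IsRamified x q) (m : ℕ) (ih : ∀ k < m, ∀ i j, N k i j ∈ regAt q) (i j : Fin r) :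
    PowerSeries.coeff m (((charMat Φ x y).adjugate * expSeries N -
      expSeries N * (charMat Φ x y).adjugate) i j) / Eω Φ x y ∈ regAt q := by
  obtain ⟨t₀, ht₀, hq⟩ := S.exists_not_hasVal q
  have hx := hcurve.nonconstant
  have hE : Eω Φ x y ≠ 0 := hcurve.derivative_ne_zero
  set v := invCoord x t₀ with hv
  have hv0 : v ≠ 0 := invCoord_ne_zero hx t₀
  have hu : ordAt q (formFactor q * ratDeriv v) = 1 :=
    le_antisymm (formRegularAt_ratDeriv_invCoord hq)
      (not_lt.1 fun h => hr ((isRamified_iff hx hq).2 h))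
  have hu0 : formFactor q * ratDeriv v ≠ 0 := by intro h; rw [h] at hu; simp at hu
  have hx' : ratDeriv x = -ratDeriv v / v ^ 2 := by
    rw [hv, ratDeriv_invCoord hx, ← hv, neg_mul, neg_neg, mul_div_cancel_right₀ _ (pow_ne_zero 2 hv0)]
  have hx0 : ratDeriv x ≠ 0 := ratDeriv_ne_zero hx
  have key : ∀ k l : Fin r, k ≠ j → PowerSeries.coeff m ((charMat Φ x y * expSeries N -
      expSeries N * charMat Φ x y) k l *
        (rowRepl (charMat Φ x y) {j, k} (fun m => if m = j then i else l)).det) / Eω Φ x y ∈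
      regAt q := by
    intro k l hk
    set δ := (rowRepl (charMat Φ x y) {j, k} (fun m => if m = j then i else l)).det with hδ
    have hδm : ∀ p, ordAt q (formFactor q * ratDeriv v * v ^ 2 / Eω Φ x y *
        PowerSeries.coeff p δ) ≤ 1 := by
      intro p
      have := minor_mem hcurve S hA ht₀ hq {j, k} (by simp) (fun m => if m = j then i else l) p
      rwa [minorWeight, Finset.card_pair hk.symm] at this
    rw [charMat_commutator, Matrix.neg_apply]
    have h1 : PowerSeries.C (ratDeriv x) * (-((Φ.pull x * expSeries N - expSeries N * Φ.pull x) k l) * δ) =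
        -(PowerSeries.X * (PowerSeries.mk (fun k' => ratDeriv (N k' k l)) * δ)) := by
      rw [← mul_assoc, mul_neg, ← hN.equation hcurve hA k l]; ring
    have h2 := congrArg (PowerSeries.coeff m) h1
    rw [PowerSeries.coeff_C_mul] at h2
    rw [map_neg] at h2
    have h3 : ∀ z w : K, ratDeriv x * z = -w → z / Eω Φ x y = -(w / (ratDeriv x * Eω Φ x y)) := by
      intro z w h
      rw [eq_neg_iff_add_eq_zero, ← mul_div_mul_left z _ hx0, h, ← add_div, neg_add_cancel, zero_div]
    rw [h3 _ _ h2]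
    -- The factor `ħ` kills order zero and shifts all other orders down by one.
    cases m with
    | zero => rw [PowerSeries.coeff_zero_X_mul, zero_div, neg_zero]; exact ZeroMemClass.zero_mem _
    | succ m =>
      rw [PowerSeries.coeff_succ_X_mul, PowerSeries.coeff_mul, Finset.sum_div]
      refine neg_mem (sum_mem fun p hp => ?_)
      rw [PowerSeries.coeff_mk]
      have hp1 : p.1 < m + 1 := by have := Finset.HasAntidiagonal.mem_antidiagonal.1 hp; omega
      have h4 := formRegularAt_iff.1 (formRegularAt_ratDeriv (ih p.1 hp1 k l))
      -- The minor has weight `v² dv / E_ω` and `dx = -dv / v²`, so the powers of `v` cancel. What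
      -- remains is a square of `dv`, a unit at the unramified point `q`.
      have h5 : ratDeriv (N p.1 k l) * PowerSeries.coeff p.2 δ / (ratDeriv x * Eω Φ x y) =
          -((formFactor q * ratDeriv (N p.1 k l)) * (formFactor q * ratDeriv v * v ^ 2 / Eω Φ x y *
            PowerSeries.coeff p.2 δ) * ((formFactor q * ratDeriv v) ^ 2)⁻¹) := by
        have hθ : formFactor q ≠ 0 := left_ne_zero_of_mul hu0
        have hv' : ratDeriv v ≠ 0 := right_ne_zero_of_mul hu0
        rw [hx']
        field_simp
      rw [h5, ← ordAt_le_one_iff, Valuation.map_neg, map_mul, map_inv₀, map_pow, hu, one_pow,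
        inv_one, mul_one, map_mul]
      exact mul_le_one' h4 (hδm p.2)
  rw [commutator_adjugate, map_sum, Finset.sum_div]
  refine sum_mem fun k _ => ?_
  rw [map_sum, Finset.sum_div]
  refine sum_mem fun l _ => ?_
  split_ifs with h
  · rw [map_zero, zero_div]; exact ZeroMemClass.zero_mem _
  · exact key k l h

/-- The coefficients of the projectors are regular at the points where `x` is unramified. -/
lemma IsExpansion.mem (hN : S.IsExpansion N) (hcurve : IsSmoothGenusZeroSpectralCurve Φ x y)
    (hA : S.Assumption5Star) {q : OnePoint ℂ} (hr : ¬ IsRamified x q) (k : ℕ) (i j : Fin r) :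
    N k i j ∈ regAt q := by
  suffices h : ∀ k, N k ∈ regMat r q from h k i j
  clear i j k
  intro m
  induction m using Nat.strong_induction_on with
  | _ m ih =>
    rcases Nat.eq_zero_or_pos m with rfl | hm
    · exact fun i j => hN.zero_mem hcurve hA hr i j
    obtain ⟨t₀, ht₀, hq⟩ := S.exists_not_hasVal q
    have hE : Eω Φ x y ≠ 0 := hcurve.derivative_ne_zero
    -- The coefficients of `adj H / E_ω`. They are regular at `q`, and the leading one is `N 0`.
    let α : ℕ → Matrix (Fin r) (Fin r) K := fun p => of fun i j =>
      PowerSeries.coeff p ((charMat Φ x y).adjugate i j) / Eω Φ x y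
    have hα : ∀ p, α p ∈ regMat r q := fun p i j => adjugate_mem hcurve hA ht₀ hq hr i j p
    have hα0 : α 0 = N 0 := by
      ext1 i j
      simp only [α, of_apply]
      rw [← hN.zero_eq hcurve, mul_div_cancel_right₀ _ hE]
    have hcomm : ∑ p ∈ Finset.HasAntidiagonal.antidiagonal m, (α p.1 * N p.2 - N p.2 * α p.1) ∈ regMat r q := by
      intro i j
      have h := hN.commutator_coeff hcurve hA hr m (fun k hk => ih k hk) i j
      change (∑ p ∈ Finset.HasAntidiagonal.antidiagonal m, (α p.1 * N p.2 - N p.2 * α p.1)) i j ∈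
        regAt q
      refine (congrArg (· ∈ regAt q) ?_).mpr h
      rw [Matrix.sum_apply, Matrix.sub_apply, mul_apply, mul_apply, map_sub, map_sum, map_sum]
      simp only [PowerSeries.coeff_mul, coeff_expSeries]
      simp only [mul_comm (N _ _ _)]
      rw [Finset.sum_comm]
      conv_rhs => rw [sub_div, Finset.sum_div]
      have h2 : (∑ k, ∑ p ∈ Finset.HasAntidiagonal.antidiagonal m, PowerSeries.coeff p.2 ((charMat Φ x y).adjugate k j) *
          N p.1 i k) = ∑ p ∈ Finset.HasAntidiagonal.antidiagonal m, ∑ k,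
            PowerSeries.coeff p.1 ((charMat Φ x y).adjugate k j) * N p.2 i k := by
        rw [Finset.sum_comm, ← Finset.Nat.sum_antidiagonal_swap]
        rfl
      rw [h2, Finset.sum_div, ← Finset.sum_sub_distrib]
      refine Finset.sum_congr rfl fun p _ => ?_
      rw [Matrix.sub_apply, mul_apply, mul_apply, Finset.sum_div, Finset.sum_div]
      congr 1 <;>
      · refine Finset.sum_congr rfl fun k _ => ?_
        simp only [α, of_apply]
        ring
    -- Every term of the convolution except `(0, m)` involves only `N p` with `p < m`, so `[N 0, N
    -- m]` is regular.
    have hC : N 0 * N m - N m * N 0 ∈ regMat r q := by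
      rw [← Finset.add_sum_erase _ _ (Finset.HasAntidiagonal.mem_antidiagonal.2 (zero_add m) :
        (0, m) ∈ Finset.HasAntidiagonal.antidiagonal m)] at hcomm
      rw [← hα0]
      refine (add_mem_cancel_right (H := regMat r q) (sum_mem fun p hp => ?_)).1 hcomm
      obtain ⟨hp1, hp2⟩ := Finset.mem_erase.1 hp
      have hp3 := Finset.HasAntidiagonal.mem_antidiagonal.1 hp2
      have hlt : p.2 < m := by
        by_contra h
        exact hp1 (Prod.ext (by simp only; omega) (by simp only; omega))
      exact sub_mem (mul_mem (hα _) (ih _ hlt)) (mul_mem (ih _ hlt) (hα _))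
    have hsq : ∀ p, ∑ p ∈ Finset.HasAntidiagonal.antidiagonal p, N p.1 * N p.2 = N p := by
      intro p
      ext1 i j
      have h := congrArg (fun A => PowerSeries.coeff p (A i j)) (hN.mul_self hcurve hA)
      simp only [coeff_expSeries] at h
      rw [← h, mul_apply, map_sum, Matrix.sum_apply]
      simp only [PowerSeries.coeff_mul, coeff_expSeries, mul_apply]
      rw [Finset.sum_comm]
    have h00 : N 0 * N 0 = N 0 := by simpa using hsq 0
    -- Order `m` of `M² = M`, with the two terms containing `N m` moved to the other side.
    have hR : N m - (N 0 * N m + N m * N 0) ∈ regMat r q := by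
      have h1 : (0, m) ∈ Finset.HasAntidiagonal.antidiagonal m := Finset.HasAntidiagonal.mem_antidiagonal.2 (zero_add m)
      have h2 : (m, 0) ∈ (Finset.HasAntidiagonal.antidiagonal m).erase (0, m) := by
        simp [Finset.HasAntidiagonal.mem_antidiagonal, Prod.ext_iff]; omega
      have h3 := hsq m
      rw [← Finset.add_sum_erase _ _ h1, ← Finset.add_sum_erase _ _ h2] at h3
      conv => enter [2, 1]; rw [← h3]
      rw [← add_assoc, add_sub_cancel_left]
      refine sum_mem fun p hp => ?_
      simp only [Finset.mem_erase, Finset.HasAntidiagonal.mem_antidiagonal] at hp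
      obtain ⟨hp1, hp2, hp3⟩ := hp
      have hlt : p.1 < m ∧ p.2 < m := by
        constructor
        · by_contra h
          exact hp1 (Prod.ext (by simp only; omega) (by simp only; omega))
        · by_contra h
          exact hp2 (Prod.ext (by simp only; omega) (by simp only; omega))
      exact mul_mem (ih _ hlt.1) (ih _ hlt.2)
    set P := N 0 with hP
    set A := N m with hA'
    have hPr : P ∈ regMat r q := ih 0 hm
    -- Put `R = A - PA - AP`. Since `P² = P`, one has `PAP = -PR`, then `PA = P[P, A] + PAP` and `AP
    -- = PA - [P, A]`. Thus regularity of `P`, `R` and `[P, A]` gives that of `A`.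
    have h1 : P * A * P ∈ regMat r q := by
      have := neg_mem (mul_mem hPr hR)
      have e : -(P * (A - (P * A + A * P))) = P * A * P := by
        rw [mul_sub, mul_add, ← mul_assoc P P, h00, ← mul_assoc]; abel
      rwa [e] at this
    have h2 : P * A ∈ regMat r q := by
      have := add_mem (mul_mem hPr hC) h1
      have e : P * (P * A - A * P) + P * A * P = P * A := by
        rw [mul_sub, ← mul_assoc P P, h00, ← mul_assoc]; abel
      rwa [e] at this
    have h3 : A = (A - (P * A + A * P)) + (P * A + (P * A - (P * A - A * P))) := by abel
    rw [h3]
    exact add_mem hR (add_mem h2 (sub_mem h2 hC))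

end WKBSolution

/-! ### Principal minors as sums over cycles -/

section Cycles

open Equiv

variable {ι : Type*} [Fintype ι] [DecidableEq ι] {R : Type*} [CommRing R]

/-- The permutation `c` is a cycle on `B` and fixes the complement of `B`. -/
def IsFullCycle (c : Perm ι) (B : Finset ι) : Prop :=
  (∀ j ∉ B, c j = j) ∧ ∀ x ∈ B, ∀ y ∈ B, c.SameCycle x y

omit [Fintype ι] [DecidableEq ι] in
lemma apply_mem_of_fixes {c : Perm ι} {B : Finset ι} (h : ∀ j ∉ B, c j = j) {j : ι} :
    c j ∈ B ↔ j ∈ B := by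
  constructor
  · intro hc
    by_contra hj
    rw [h j hj] at hc
    exact hj hc
  · intro hj
    by_contra hc
    have := c.injective (h _ hc)
    rw [this] at hc
    exact hc hj

omit [DecidableEq ι] in
lemma sameCycle_of_agree {f g : Perm ι} {B : Finset ι} (hf : ∀ j ∈ B, f j ∈ B)
    (h : ∀ j ∈ B, g j = f j) {u v : ι} (hu : u ∈ B) (huv : f.SameCycle u v) :
    v ∈ B ∧ g.SameCycle u v := by
  classical
  obtain ⟨n, -, -, rfl⟩ := huv.exists_pow_eq'
  have key : ∀ n : ℕ, (f ^ n) u ∈ B ∧ (g ^ n) u = (f ^ n) u := by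
    intro n
    induction n with
    | zero => simpa using hu
    | succ n ih =>
      rw [pow_succ', pow_succ', Perm.mul_apply, Perm.mul_apply, ih.2]
      exact ⟨hf _ ih.1, h _ ih.1⟩
  exact ⟨(key n).1, ⟨n, by simpa using (key n).2⟩⟩

open Classical in
/-- The sum over the permutations of `C`, i.e. the principal minor of `T`. -/
def permSum (T : Matrix ι ι R) (C : Finset ι) : R :=
  ∑ π : Perm ι with ∀ j ∉ C, π j = j, ((Perm.sign π : ℤ) : R) * ∏ j ∈ C, T j (π j)

open Classical in
/-- The sum over the cycles on `B`. -/
def cycSum (T : Matrix ι ι R) (B : Finset ι) : R :=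
  ∑ c : Perm ι with IsFullCycle c B, ((Perm.sign c : ℤ) : R) * ∏ j ∈ B, T j (c j)

lemma permSum_empty (T : Matrix ι ι R) : permSum T ∅ = 1 := by
  rw [permSum, Finset.sum_eq_single 1]
  · simp
  · intro π hπ hne
    exact absurd (Equiv.ext fun j => by simpa using (Finset.mem_filter.1 hπ).2 j) hne
  · simp

lemma det_rowPiecewise_one (T : Matrix ι ι R) (C : Finset ι) :
    (rowPiecewise C T 1).det = permSum T C := by
  classical
  rw [← det_transpose, det_apply', permSum, Finset.sum_filter]
  refine Finset.sum_congr rfl fun π _ => ?_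
  split_ifs with h
  · congr 1
    rw [← Finset.prod_subset (Finset.subset_univ C)]
    · refine Finset.prod_congr rfl fun j hj => ?_
      rw [transpose_apply, rowPiecewise_apply, if_pos hj]
    · intro j _ hj
      rw [transpose_apply, rowPiecewise_apply, if_neg hj, h j hj, one_apply_eq]
  · push Not at h
    obtain ⟨j, hj, hne⟩ := h
    rw [Finset.prod_eq_zero (Finset.mem_univ j), mul_zero]
    rw [transpose_apply, rowPiecewise_apply, if_neg hj, one_apply_ne hne.symm]

/-- A permutation of `C` is uniquely the product of its cycle through `a`, with support block `B`,
and a permutation of `C \ B`; signs and products of entries are multiplicative. -/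
lemma permSum_rec (T : Matrix ι ι R) {C : Finset ι} {a : ι} (ha : a ∈ C) :
    permSum T C = ∑ B ∈ C.powerset with a ∈ B, cycSum T B * permSum T (C \ B) := by
  classical
  have hmaps : ∀ π ∈ Finset.univ.filter (fun π : Perm ι => ∀ j ∉ C, π j = j),
      (Finset.univ.filter fun b => π.SameCycle a b) ∈ C.powerset.filter (a ∈ ·) := by
    intro π hπ
    rw [Finset.mem_filter] at hπ
    rw [Finset.mem_filter, Finset.mem_powerset]
    refine ⟨fun b hb => ?_, by simp [Perm.SameCycle.refl]⟩
    exact (sameCycle_of_agree (fun j hj => (apply_mem_of_fixes hπ.2).2 hj) (fun _ _ => rfl) ha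
      (Finset.mem_filter.1 hb).2).1
  rw [permSum, ← Finset.sum_fiberwise_of_maps_to hmaps]
  refine Finset.sum_congr rfl fun B hB => ?_
  obtain ⟨hBC, haB⟩ := Finset.mem_filter.1 hB
  rw [Finset.mem_powerset] at hBC
  rw [cycSum, permSum, Finset.sum_mul_sum, ← Finset.sum_product']
  refine Finset.sum_nbij' (fun π => (π.cycleOf a, (π.cycleOf a)⁻¹ * π)) (fun p => p.1 * p.2)
    ?_ ?_ ?_ ?_ ?_
  · intro π hπ
    simp only [Finset.mem_filter, Finset.mem_univ, true_and, Finset.mem_product] at hπ ⊢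
    obtain ⟨hfix, rfl⟩ := hπ
    have hcyc : ∀ j, π.SameCycle a j → π.cycleOf a j = π j := fun j hj => hj.cycleOf_apply
    have hcyc' : ∀ j, ¬ π.SameCycle a j → π.cycleOf a j = j :=
      fun j hj => Perm.cycleOf_apply_of_not_sameCycle hj
    refine ⟨⟨fun j hj => hcyc' j (by simpa using hj), ?_⟩, ?_⟩
    · intro u hu v hv
      have hu' := (Finset.mem_filter.1 hu).2
      have hv' := (Finset.mem_filter.1 hv).2
      refine (sameCycle_of_agree (f := π) (B := Finset.univ.filter fun b => π.SameCycle a b)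
        ?_ ?_ hu (hu'.symm.trans hv')).2
      · intro j hj
        simpa using (Finset.mem_filter.1 hj).2
      · intro j hj
        exact hcyc j (Finset.mem_filter.1 hj).2
    · intro j hj
      rw [Perm.mul_apply, Perm.inv_eq_iff_eq]
      by_cases hs : π.SameCycle a j
      · exact (hcyc j hs).symm
      · have hjC : j ∉ C := fun h => hj (by simp [h, hs])
        rw [hcyc' j hs, hfix j hjC]
  · rintro ⟨c, π'⟩ hp
    simp only [Finset.mem_filter, Finset.mem_univ, true_and, Finset.mem_product] at hp ⊢
    obtain ⟨⟨hc1, hc2⟩, hπ'⟩ := hp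
    have hB : ∀ j ∈ B, π' j = j := fun j hj => hπ' j (by simp [hj])
    have hag : ∀ j ∈ B, (c * π') j = c j := fun j hj => by rw [Perm.mul_apply, hB j hj]
    refine ⟨fun j hj => ?_, ?_⟩
    · rw [Perm.mul_apply, hπ' j (by simp [hj]), hc1 j fun h => hj (hBC h)]
    · ext b
      simp only [Finset.mem_filter, Finset.mem_univ, true_and]
      constructor
      · intro h
        refine (sameCycle_of_agree (f := c * π') (g := c * π') (fun j hj => ?_) (fun _ _ => rfl)
          haB h).1
        rw [hag j hj]; exact (apply_mem_of_fixes hc1).2 hj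
      · intro h
        exact (sameCycle_of_agree (f := c) (fun j hj => (apply_mem_of_fixes hc1).2 hj) hag haB
          (hc2 a haB b h)).2
  · intro π hπ
    simp
  · rintro ⟨c, π'⟩ hp
    simp only [Finset.mem_filter, Finset.mem_univ, true_and, Finset.mem_product] at hp
    obtain ⟨⟨hc1, hc2⟩, hπ'⟩ := hp
    have hB : ∀ j ∈ B, π' j = j := fun j hj => hπ' j (by simp [hj])
    have hag : ∀ j ∈ B, (c * π') j = c j := fun j hj => by rw [Perm.mul_apply, hB j hj]
    have hcy : (c * π').cycleOf a = c := by
      ext j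
      by_cases hj : j ∈ B
      · have hs := (sameCycle_of_agree (f := c) (fun j hj => (apply_mem_of_fixes hc1).2 hj) hag haB
          (hc2 a haB j hj)).2
        rw [hs.cycleOf_apply, hag j hj]
      · rw [Perm.cycleOf_apply_of_not_sameCycle, hc1 j hj]
        intro h
        refine hj (sameCycle_of_agree (f := c * π') (g := c * π') (fun j hj => ?_) (fun _ _ => rfl)
          haB h).1
        rw [hag j hj]; exact (apply_mem_of_fixes hc1).2 hj
    simp only [hcy, inv_mul_cancel_left]
  · intro π hπ
    simp only [Finset.mem_filter, Finset.mem_univ, true_and] at hπ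
    obtain ⟨hfix, rfl⟩ := hπ
    have hsign : Perm.sign π = Perm.sign (π.cycleOf a) * Perm.sign ((π.cycleOf a)⁻¹ * π) := by
      rw [← map_mul, mul_inv_cancel_left]
    rw [hsign, ← Finset.prod_sdiff hBC, Units.val_mul, Int.cast_mul]
    have e1 : ∏ j ∈ Finset.univ.filter (fun b => π.SameCycle a b), T j (π j) =
        ∏ j ∈ Finset.univ.filter (fun b => π.SameCycle a b), T j (π.cycleOf a j) :=
      Finset.prod_congr rfl fun j hj => by rw [(Finset.mem_filter.1 hj).2.cycleOf_apply]
    have e2 : ∏ j ∈ C \ Finset.univ.filter (fun b => π.SameCycle a b), T j (π j) =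
        ∏ j ∈ C \ Finset.univ.filter (fun b => π.SameCycle a b), T j (((π.cycleOf a)⁻¹ * π) j) := by
      refine Finset.prod_congr rfl fun j hj => ?_
      have hs : ¬ π.SameCycle a j := by simpa using (Finset.mem_sdiff.1 hj).2
      have hs' : ¬ π.SameCycle a (π j) := by simpa using hs
      rw [Perm.mul_apply, Perm.inv_eq_iff_eq.2 (Perm.cycleOf_apply_of_not_sameCycle hs').symm]
    rw [e1, e2]
    ring

/-- Sums over cycles depend only on the entries with indices in `B`. -/
lemma cycSum_congr {T T' : Matrix ι ι R} {B : Finset ι}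
    (h : ∀ i ∈ B, ∀ j ∈ B, i ≠ j → T i j = T' i j) (hB : 2 ≤ B.card) : cycSum T B = cycSum T' B := by
  classical
  refine Finset.sum_congr rfl fun c hc => ?_
  obtain ⟨h1, h2⟩ := (Finset.mem_filter.1 hc).2
  congr 1
  refine Finset.prod_congr rfl fun j hj => h j hj _ ((apply_mem_of_fixes h1).2 hj) fun he => ?_
  obtain ⟨l, hl, hne⟩ := Finset.exists_mem_ne hB j
  obtain ⟨n, hn⟩ := h2 j hj l hl
  rw [Perm.zpow_apply_eq_self_of_apply_eq_self he.symm] at hn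
  exact hne hn.symm

lemma cycSum_singleton (T : Matrix ι ι R) (a : ι) : cycSum T {a} = T a a := by
  classical
  rw [cycSum, Finset.sum_eq_single 1]
  · simp
  · intro c hc hne
    obtain ⟨h1, -⟩ := (Finset.mem_filter.1 hc).2
    refine absurd (Equiv.ext fun j => ?_) hne
    by_cases hj : j = a
    · subst hj
      exact Finset.mem_singleton.1 ((apply_mem_of_fixes h1).2 (Finset.mem_singleton_self j))
    · exact h1 j (by simpa using hj)
  · intro h
    exact absurd (Finset.mem_filter.2 ⟨Finset.mem_univ _, fun _ _ => rfl, by simp⟩) h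

lemma cycSum_scale (T : Matrix ι ι R) (d : ι → R) (B : Finset ι) :
    cycSum (of fun i j => d i * T i j) B = (∏ i ∈ B, d i) * cycSum T B := by
  rw [cycSum, cycSum, Finset.mul_sum]
  refine Finset.sum_congr rfl fun c _ => ?_
  simp only [of_apply, Finset.prod_mul_distrib]
  ring

/-- Reindexing of sums over cycles. -/
lemma cycSum_map {κ : Type*} [Fintype κ] [DecidableEq κ] (T : Matrix ι ι R) (f : κ ↪ ι) :
    cycSum T (Finset.univ.map f) = cycSum (T.submatrix f f) Finset.univ := by
  classical
  symm
  have hsame : ∀ (σ : Perm κ) (i j : κ), (σ.viaFintypeEmbedding f).SameCycle (f i) (f j) ↔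
      σ.SameCycle i j := by
    intro σ i j
    have hpow : ∀ (n : ℕ) (i : κ), ((σ.viaFintypeEmbedding f) ^ n) (f i) = f ((σ ^ n) i) := by
      intro n i
      induction n with
      | zero => simp
      | succ n ih => rw [pow_succ', pow_succ', Perm.mul_apply, Perm.mul_apply, ih,
          Perm.viaFintypeEmbedding_apply_image]
    constructor
    · intro h
      have h' : ∃ n : ℕ, ((σ.viaFintypeEmbedding f) ^ n) (f i) = f j :=
        h.exists_pow_eq'.imp fun n hn => hn.2
      obtain ⟨n, hn⟩ := h'
      rw [hpow] at hn
      exact ⟨n, by simpa using f.injective hn⟩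
    · intro h
      obtain ⟨n, hn⟩ : ∃ n : ℕ, (σ ^ n) i = j := h.exists_pow_eq'.imp fun n hn => hn.2
      exact ⟨n, by rw [zpow_natCast, hpow, hn]⟩
  refine Finset.sum_bij (fun σ _ => σ.viaFintypeEmbedding f) ?_ ?_ ?_ ?_
  · intro σ hσ
    rw [Finset.mem_filter] at hσ ⊢
    refine ⟨Finset.mem_univ _, fun j hj => ?_, fun u hu v hv => ?_⟩
    · exact Perm.viaFintypeEmbedding_apply_notMem_range _ _ (by simpa using hj)
    · obtain ⟨i, -, rfl⟩ := Finset.mem_map.1 hu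
      obtain ⟨j, -, rfl⟩ := Finset.mem_map.1 hv
      exact (hsame σ i j).2 (hσ.2.2 i (Finset.mem_univ i) j (Finset.mem_univ j))
  · intro σ _ τ _ h
    ext i
    have := congrArg (fun p : Perm ι => p (f i)) h
    simpa [Perm.viaFintypeEmbedding_apply_image] using this
  · intro c hc
    rw [Finset.mem_filter] at hc
    obtain ⟨-, h1, h2⟩ := hc
    have hex : ∀ i, ∃ j, f j = c (f i) := fun i => by
      have := (apply_mem_of_fixes h1).2 (Finset.mem_map_of_mem f (Finset.mem_univ i))
      obtain ⟨j, -, hj⟩ := Finset.mem_map.1 this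
      exact ⟨j, hj⟩
    choose s hs using hex
    have hinj : Function.Injective s := fun i j h =>
      f.injective (c.injective (by rw [← hs, ← hs, h]))
    let σ : Perm κ := Equiv.ofBijective s (Finite.injective_iff_bijective.1 hinj)
    have hσ : σ.viaFintypeEmbedding f = c := by
      ext j
      by_cases hj : j ∈ Set.range f
      · obtain ⟨i, rfl⟩ := hj
        rw [Perm.viaFintypeEmbedding_apply_image]
        exact hs i
      · rw [Perm.viaFintypeEmbedding_apply_notMem_range _ _ hj, h1 j (by simpa using hj)]
    refine ⟨σ, Finset.mem_filter.2 ⟨Finset.mem_univ _, by simp, fun i _ j _ => ?_⟩, hσ⟩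
    rw [← hsame, hσ]
    exact h2 _ (Finset.mem_map_of_mem f (Finset.mem_univ i)) _
      (Finset.mem_map_of_mem f (Finset.mem_univ j))
  · intro σ _
    rw [Perm.viaFintypeEmbedding_sign, Finset.prod_map]
    congr 1
    refine Finset.prod_congr rfl fun i _ => ?_
    rw [submatrix_apply, Perm.viaFintypeEmbedding_apply_image]

end Cycles

/-! ### Cluster expansions relative to a subset of the indices -/

section Cluster

variable {ι : Type*} [DecidableEq ι] {R : Type*} [CommRing R]

/-- The sum over the partitions of `C` into blocks that meet `A`, with weights `κ`. The blocks are
split off in the order given by `pick`. -/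
def cluster (κ : Finset ι → R) (A : Finset ι) (pick : Finset ι → ι) (C : Finset ι) : R :=
  if (C ∩ A).Nonempty then
    ∑ B ∈ (C.powerset.filter (pick (C ∩ A) ∈ ·)).attach, κ B.1 * cluster κ A pick (C \ B.1)
  else if C = ∅ then 1 else 0
termination_by C.card
decreasing_by
  obtain ⟨h1, h2⟩ := Finset.mem_filter.1 B.2
  rw [Finset.mem_powerset] at h1
  exact Finset.card_lt_card (Finset.sdiff_ssubset h1 ⟨_, h2⟩)

variable (κ : Finset ι → R) (A : Finset ι) (pick : Finset ι → ι)

lemma cluster_of_nonempty {C : Finset ι} (h : (C ∩ A).Nonempty) :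
    cluster κ A pick C =
      ∑ B ∈ C.powerset with pick (C ∩ A) ∈ B, κ B * cluster κ A pick (C \ B) := by
  rw [cluster, if_pos h, Finset.sum_attach _ fun B => κ B * cluster κ A pick (C \ B)]

lemma cluster_of_empty {C : Finset ι} (h : C ∩ A = ∅) :
    cluster κ A pick C = if C = ∅ then 1 else 0 := by
  rw [cluster, if_neg (by simp [h])]

/-- The cycles of a permutation of `C` either meet `A` or avoid it; `I` is the union of those that
avoid it. Both sides satisfy the recursion that splits off the cycle through `pick (C ∩ A)`. -/
lemma permSum_eq_cluster [Fintype ι] (T : Matrix ι ι R)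
    (hpick : ∀ D : Finset ι, D.Nonempty → pick D ∈ D) (C : Finset ι) :
    permSum T C = ∑ I ∈ (C \ A).powerset, cluster (cycSum T) A pick (C \ I) * permSum T I := by
  induction hn : C.card using Nat.strong_induction_on generalizing C with
  | _ n ih =>
    by_cases h : (C ∩ A).Nonempty
    · have hp := hpick _ h
      obtain ⟨hpC, hpA⟩ := Finset.mem_inter.1 hp
      have h1 : ∀ B ∈ C.powerset.filter (pick (C ∩ A) ∈ ·), cycSum T B * permSum T (C \ B) =
          ∑ I ∈ (C \ A).powerset, if Disjoint I B then
            cycSum T B * cluster (cycSum T) A pick ((C \ B) \ I) * permSum T I else 0 := by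
        intro B hB
        obtain ⟨hBC, hpB⟩ := Finset.mem_filter.1 hB
        rw [Finset.mem_powerset] at hBC
        have hlt : (C \ B).card < n := hn ▸ Finset.card_lt_card (Finset.sdiff_ssubset hBC ⟨_, hpB⟩)
        rw [ih _ hlt _ rfl, Finset.mul_sum, ← Finset.sum_filter]
        refine Finset.sum_congr ?_ fun I _ => by ring
        ext I
        simp only [Finset.mem_filter, Finset.mem_powerset, Finset.subset_sdiff]
        tauto
      rw [permSum_rec T hpC, Finset.sum_congr rfl h1, Finset.sum_comm]
      refine Finset.sum_congr rfl fun I hI => ?_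
      rw [Finset.mem_powerset, Finset.subset_sdiff] at hI
      have hint : (C \ I) ∩ A = C ∩ A := by
        ext i
        simp only [Finset.mem_inter, Finset.mem_sdiff]
        constructor
        · tauto
        · rintro ⟨h1, h2⟩
          exact ⟨⟨h1, fun h => Finset.disjoint_left.1 hI.2 h h2⟩, h2⟩
      rw [cluster_of_nonempty _ _ _ (by rwa [hint]), hint, Finset.sum_mul, ← Finset.sum_filter]
      refine Finset.sum_congr ?_ fun B _ => ?_
      · ext B
        simp only [Finset.mem_filter, Finset.mem_powerset, Finset.subset_sdiff]
        constructor
        · rintro ⟨⟨h1, h2⟩, h3⟩; exact ⟨⟨h1, h3.symm⟩, h2⟩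
        · rintro ⟨⟨h1, h2⟩, h3⟩; exact ⟨⟨h1, h3⟩, h2.symm⟩
      · rw [sdiff_right_comm]
    · rw [Finset.not_nonempty_iff_eq_empty] at h
      have hCA : C \ A = C := by
        rw [Finset.sdiff_eq_self_iff_disjoint, Finset.disjoint_iff_inter_eq_empty, h]
      rw [hCA, Finset.sum_eq_single C]
      · rw [sdiff_self, Finset.bot_eq_empty, cluster_of_empty _ _ _ (by simp), if_pos rfl, one_mul]
      · intro I hI hne
        rw [Finset.mem_powerset] at hI
        rw [cluster_of_empty, if_neg, zero_mul]
        · rw [Finset.sdiff_eq_empty_iff_subset]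
          exact fun h => hne (Finset.Subset.antisymm hI h)
        · rw [← Finset.subset_empty, ← h]
          exact Finset.inter_subset_inter_right Finset.sdiff_subset
      · intro h; exact absurd (Finset.mem_powerset_self C) h

/-- Orders of vanishing of cluster sums. -/
lemma pow_dvd_cluster {X : R} {k : ℕ} (hk : 2 ≤ k) {a : ι}
    (hpick : ∀ D : Finset ι, D.Nonempty → pick D ∈ D)
    (hκ : ∀ B : Finset ι, 2 ≤ B.card → (B ∩ A).Nonempty →
      X ^ ((B ∩ A).card + min B.card k - 2) ∣ κ B)
    (C : Finset ι) (hC : a ∉ C) : X ^ min (C \ A).card (k - 1) ∣ cluster κ A pick C := by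
  induction hn : C.card using Nat.strong_induction_on generalizing C with
  | _ n ih =>
    by_cases h : (C ∩ A).Nonempty
    · rw [cluster_of_nonempty _ _ _ h]
      refine Finset.dvd_sum fun B hB => ?_
      obtain ⟨hBC, hpB⟩ := Finset.mem_filter.1 hB
      rw [Finset.mem_powerset] at hBC
      have hpA := (Finset.mem_inter.1 (hpick _ h)).2
      have hlt : (C \ B).card < n := hn ▸ Finset.card_lt_card (Finset.sdiff_ssubset hBC ⟨_, hpB⟩)
      have h1 := ih _ hlt (C \ B) (fun h => hC (Finset.mem_sdiff.1 h).1) rfl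
      have hne : (B ∩ A).Nonempty := ⟨_, Finset.mem_inter.2 ⟨hpB, hpA⟩⟩
      have hcard : (C \ A).card = ((C \ B) \ A).card + (B \ A).card := by
        rw [← Finset.card_union_of_disjoint]
        · congr 1
          ext i; simp only [Finset.mem_union, Finset.mem_sdiff]
          constructor
          · tauto
          · rintro (h | h)
            · tauto
            · exact ⟨hBC h.1, h.2⟩
        · refine Finset.disjoint_left.2 fun i hi hi' => ?_
          simp only [Finset.mem_sdiff] at hi hi'; tauto
      have hB' := Finset.card_inter_add_card_sdiff B A
      have hpos := hne.card_pos
      -- As `B` meets `A`, the exponent `|B ∩ A| + min |B| k - 2` is at least `min |B \ A| (k - 1)`.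
      -- A singleton block lies in `A` and uses up no element outside `A`.
      by_cases h2 : 2 ≤ B.card
      · refine dvd_trans (pow_dvd_pow X ?_) (pow_add X _ _ ▸ mul_dvd_mul (hκ B h2 hne) h1)
        omega
      · refine Dvd.dvd.mul_left (dvd_trans (pow_dvd_pow X ?_) h1) _
        omega
    · rw [Finset.not_nonempty_iff_eq_empty] at h
      rw [cluster_of_empty _ _ _ h]
      split_ifs with h0
      · rw [h0]; simp
      · exact dvd_zero _

/-- Each element outside `A` costs about one power of `X`, with saturation at `k - 1`. Only the
block `{a} ∪ (C \ A)` saves a power: a block through `a` that leaves out elements outside `A` pays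
for them separately, one with a second element of `A` has a larger exponent, and the singleton `{a}`
contributes a factor `X` by itself. -/
lemma cluster_main_term {X : R} {k : ℕ} (hk : 2 ≤ k) {a : ι} (ha : a ∈ A)
    (hpick : ∀ D : Finset ι, D.Nonempty → pick D ∈ D)
    (hκ : ∀ B : Finset ι, 2 ≤ B.card → (B ∩ A).Nonempty →
      X ^ ((B ∩ A).card + min B.card k - 2) ∣ κ B)
    (hκa : X ∣ κ {a}) (C : Finset ι) (hC : a ∈ C) (hpa : pick (C ∩ A) = a)
    (hcard : k ≤ (C \ A).card) :
    X ^ k ∣ cluster κ A pick C -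
      κ (insert a (C \ A)) * cluster κ A pick (C \ insert a (C \ A)) := by
  have hne : (C ∩ A).Nonempty := ⟨a, Finset.mem_inter.2 ⟨hC, ha⟩⟩
  rw [cluster_of_nonempty _ _ _ hne, hpa]
  have hB0 : insert a (C \ A) ∈ C.powerset.filter (a ∈ ·) := by
    rw [Finset.mem_filter, Finset.mem_powerset]
    exact ⟨Finset.insert_subset hC Finset.sdiff_subset, by simp⟩
  rw [← Finset.add_sum_erase _ _ hB0, add_sub_cancel_left]
  refine Finset.dvd_sum fun B hB => ?_
  obtain ⟨hBne, hB1⟩ := Finset.mem_erase.1 hB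
  obtain ⟨hBC, haB⟩ := Finset.mem_filter.1 hB1
  rw [Finset.mem_powerset] at hBC
  have h1 := pow_dvd_cluster κ A pick hk hpick hκ (C \ B) (a := a) (by simp [haB])
  have hne : (B ∩ A).Nonempty := ⟨_, Finset.mem_inter.2 ⟨haB, ha⟩⟩
  have hcard' : (C \ A).card = ((C \ B) \ A).card + (B \ A).card := by
    rw [← Finset.card_union_of_disjoint]
    · congr 1
      ext i; simp only [Finset.mem_union, Finset.mem_sdiff]
      constructor
      · tauto
      · rintro (h | h)
        · tauto
        · exact ⟨hBC h.1, h.2⟩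
    · refine Finset.disjoint_left.2 fun i hi hi' => ?_
      simp only [Finset.mem_sdiff] at hi hi'; tauto
  have hB' := Finset.card_inter_add_card_sdiff B A
  have hpos := hne.card_pos
  by_cases h2 : 2 ≤ B.card
  -- If `B` absorbs all elements outside `A` but is not the main block, it must contain a second
  -- element of `A`.
  · have h3 : ((C \ B) \ A).card = 0 → 2 ≤ (B ∩ A).card := by
      intro h0
      by_contra hlt
      have h4 : (B ∩ A).card = 1 := by omega
      apply hBne
      have h5 : B ∩ A = {a} := by
        obtain ⟨b, hb⟩ := Finset.card_eq_one.1 h4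
        have : a ∈ B ∩ A := Finset.mem_inter.2 ⟨haB, ha⟩
        rw [hb, Finset.mem_singleton] at this
        rw [hb, this]
      have h6 : C \ A ⊆ B := by
        intro i hi
        by_contra hiB
        have : i ∈ (C \ B) \ A := by simp only [Finset.mem_sdiff] at hi ⊢; tauto
        rw [Finset.card_eq_zero] at h0
        simp [h0] at this
      ext i
      rw [Finset.mem_insert]
      constructor
      · intro hi
        by_cases hiA : i ∈ A
        · left
          have : i ∈ B ∩ A := Finset.mem_inter.2 ⟨hi, hiA⟩
          rwa [h5, Finset.mem_singleton] at this
        · right; exact Finset.mem_sdiff.2 ⟨hBC hi, hiA⟩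
      · rintro (rfl | hi)
        · exact haB
        · exact h6 hi
    refine dvd_trans (pow_dvd_pow X ?_) (pow_add X _ _ ▸ mul_dvd_mul (hκ B h2 hne) h1)
    omega
  · have hBa : B = {a} := by
      refine (Finset.eq_of_subset_of_card_le (Finset.singleton_subset_iff.2 haB) ?_).symm
      rw [Finset.card_singleton]; omega
    -- One power of `X` comes from the weight of `{a}`, the remaining `k - 1` from the rest of the
    -- partition.
    have h4 : X ^ k = X * X ^ (k - 1) := by rw [← pow_succ']; congr 1; omega
    rw [h4]
    refine mul_dvd_mul (hBa ▸ hκa) (dvd_trans (pow_dvd_pow X ?_) h1)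
    rw [hBa] at hcard' hB' ⊢
    rw [Finset.singleton_inter_of_mem ha] at hB'
    simp only [Finset.card_singleton] at hB'
    omega

end Cluster

/-! ### Determinants of sums over chains -/

section Schur

variable {S : Type*} [Fintype S] [DecidableEq S] {n : ℕ} {R : Type*} [CommRing R]

/-- The ideal of the squares of the variables. -/
def sqIdeal (n : ℕ) (R : Type*) [CommRing R] : Ideal (MvPolynomial (Fin n) R) :=
  Ideal.span (Set.range fun i => MvPolynomial.X i ^ 2)

lemma coeff_ind_of_mem_sqIdeal {p : MvPolynomial (Fin n) R} (hp : p ∈ sqIdeal n R)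
    (I : Finset (Fin n)) : MvPolynomial.coeff (ind I) p = 0 := by
  have key : ∀ j (q : MvPolynomial (Fin n) R),
      MvPolynomial.coeff (ind I) (q * MvPolynomial.X j ^ 2) = 0 := by
    intro j q
    rw [MvPolynomial.X_pow_eq_monomial, MvPolynomial.coeff_mul_monomial', if_neg]
    intro h
    have := h j
    rw [ind_apply] at this
    split_ifs at this <;> simp at this
  refine Submodule.span_induction (p := fun p _ => MvPolynomial.coeff (ind I) p = 0)
    ?_ ?_ ?_ ?_ hp
  · rintro _ ⟨j, rfl⟩
    have := key j 1
    rwa [one_mul] at this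
  · exact MvPolynomial.coeff_zero _
  · intro p q _ _ hp hq
    rw [MvPolynomial.coeff_add, hp, hq, add_zero]
  · intro a p hp' _
    obtain ⟨c, rfl⟩ := (Submodule.mem_span_range_iff_exists_fun _).1 hp'
    rw [smul_eq_mul, Finset.mul_sum, MvPolynomial.coeff_sum]
    refine Finset.sum_eq_zero fun j _ => ?_
    rw [smul_eq_mul, ← mul_assoc, key]

lemma coeff_ind_C_mul_prod_X_mul (I J : Finset (Fin n)) (a : R) (q : MvPolynomial (Fin n) R) :
    MvPolynomial.coeff (ind J) ((MvPolynomial.C a * ∏ i ∈ I, MvPolynomial.X i) * q) =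
      if I ⊆ J then a * MvPolynomial.coeff (ind (J \ I)) q else 0 := by
  rw [prod_X_eq_monomial, mul_assoc, MvPolynomial.coeff_C_mul, MvPolynomial.coeff_monomial_mul']
  have hle : ind I ≤ ind J ↔ I ⊆ J := by
    constructor
    · intro h i hi
      have := h i
      rw [ind_apply, ind_apply, if_pos hi] at this
      by_contra hJ
      rw [if_neg hJ] at this
      omega
    · intro h i
      rw [ind_apply, ind_apply]
      by_cases hi : i ∈ I
      · rw [if_pos hi, if_pos (h hi)]
      · rw [if_neg hi]; exact Nat.zero_le _
  simp only [hle]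
  split_ifs with h
  · have : ind J - ind I = ind (J \ I) := by
      ext i
      rw [Finsupp.tsub_apply, ind_apply, ind_apply, ind_apply]
      by_cases hi : i ∈ I
      · simp [hi, h hi]
      · simp [hi]
    rw [this, one_mul]
  · rw [mul_zero]

omit [Fintype S] [DecidableEq S] in
/-- Powers of matrices as sums over paths. -/
lemma mul_pow_mul_apply {J A : Type*} [Fintype J] [DecidableEq J] [CommRing A] (W : Matrix J J A)
    (V : Matrix J S A) (k : ℕ) (P : Matrix S J A) (s s' : S) :
    (P * W ^ k * V) s s' =
      ∑ f : Fin (k + 1) → J,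
        P s (f 0) * (∏ j : Fin k, W (f j.castSucc) (f j.succ)) * V (f (Fin.last k)) s' := by
  induction k generalizing P with
  | zero =>
    rw [pow_zero, Matrix.mul_one, mul_apply]
    refine Fintype.sum_equiv (Equiv.funUnique (Fin 1) J).symm _ _ fun i => ?_
    simp
  | succ k ih =>
    rw [pow_succ', ← Matrix.mul_assoc, ih]
    rw [← (Fin.consEquiv fun _ : Fin (k + 2) => J).sum_comp, Fintype.sum_prod_type_right]
    refine Finset.sum_congr rfl fun f _ => ?_
    rw [mul_apply, Finset.sum_mul, Finset.sum_mul]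
    refine Finset.sum_congr rfl fun i _ => ?_
    rw [Fin.prod_univ_succ]
    simp only [Fin.consEquiv_apply, Fin.cons_zero, Fin.castSucc_zero, Fin.cons_succ,
      Fin.castSucc_succ, ← Fin.succ_last]
    ring

variable (H : Matrix S S R) (P : Matrix S (Fin n) R) (Q : Matrix (Fin n) S R)
  (G : Matrix (Fin n) (Fin n) R)

/-- The contribution of a chain. -/
def chainEntry (s s' : S) {k : ℕ} (f : Fin (k + 1) → Fin n) : MvPolynomial (Fin n) R :=
  MvPolynomial.C (P s (f 0) * (∏ j : Fin k, G (f j.castSucc) (f j.succ)) * Q (f (Fin.last k)) s') *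
    ∏ j, MvPolynomial.X (f j)

/-- The sum over all chains of distinct indices. -/
def chainMat : Matrix S S (MvPolynomial (Fin n) R) := of fun s s' =>
  ∑ k ∈ Finset.range n, ∑ f : Fin (k + 1) ↪ Fin n, chainEntry P Q G s s' f

/-- The matrix `P` over the polynomial ring. -/
def startMat : Matrix S (Fin n) (MvPolynomial (Fin n) R) := P.map MvPolynomial.C

/-- The matrix `X G`. -/
def stepMat : Matrix (Fin n) (Fin n) (MvPolynomial (Fin n) R) :=
  of fun i j => MvPolynomial.X i * MvPolynomial.C (G i j)

/-- The matrix `X Q`. -/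
def endMat : Matrix (Fin n) S (MvPolynomial (Fin n) R) :=
  of fun i j => MvPolynomial.X i * MvPolynomial.C (Q i j)

omit [Fintype S] [DecidableEq S] in
lemma chainEntry_eq (s s' : S) {k : ℕ} (f : Fin (k + 1) → Fin n) :
    startMat P s (f 0) * (∏ j : Fin k, stepMat G (f j.castSucc) (f j.succ)) *
      endMat Q (f (Fin.last k)) s' = chainEntry P Q G s s' f := by
  simp only [startMat, stepMat, endMat, of_apply, map_apply, chainEntry, Finset.prod_mul_distrib, map_mul,
    map_prod, Fin.prod_univ_castSucc]
  ring

omit [Fintype S] [DecidableEq S] in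
lemma chainEntry_mem (s s' : S) {k : ℕ} (f : Fin (k + 1) → Fin n) (hf : ¬ Function.Injective f) :
    chainEntry P Q G s s' f ∈ sqIdeal n R := by
  simp only [Function.Injective, not_forall] at hf
  obtain ⟨i, j, hij, hne⟩ := hf
  refine Ideal.mul_mem_left _ _ ?_
  rw [← Finset.mul_prod_erase _ _ (Finset.mem_univ i),
    ← Finset.mul_prod_erase _ _ (Finset.mem_erase.2 ⟨Ne.symm hne, Finset.mem_univ j⟩), ← mul_assoc,
    hij, ← pow_two]
  exact Ideal.mul_mem_right _ _ (Ideal.subset_span ⟨_, rfl⟩)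

omit [Fintype S] [DecidableEq S] in
lemma pathSum_sub_mem (k : ℕ) (s s' : S) :
    (startMat P * stepMat G ^ k * endMat Q) s s' -
      ∑ f : Fin (k + 1) ↪ Fin n, chainEntry P Q G s s' f ∈ sqIdeal n R := by
  classical
  rw [mul_pow_mul_apply]
  simp only [chainEntry_eq]
  have h1 : ∑ f : Fin (k + 1) ↪ Fin n, chainEntry P Q G s s' f =
      ∑ f : Fin (k + 1) → Fin n with Function.Injective f, chainEntry P Q G s s' f := by
    refine Finset.sum_nbij (fun f => f) ?_ ?_ ?_ ?_
    · intro f _; simp [f.injective]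
    · intro f _ g _ h; exact DFunLike.coe_injective h
    · intro f hf; exact ⟨⟨f, by simpa using hf⟩, by simp, rfl⟩
    · intro f _; rfl
  rw [h1, ← Finset.sum_filter_add_sum_filter_not Finset.univ (fun f : Fin (k + 1) → Fin n => Function.Injective f),
    add_sub_cancel_left]
  exact sum_mem fun f hf => chainEntry_mem P Q G s s' f (Finset.mem_filter.1 hf).2

/-- The solution `L` of `(1 - X G) L = X Q` modulo squares. -/
def solMat : Matrix (Fin n) S (MvPolynomial (Fin n) R) :=
  (∑ k ∈ Finset.range n, stepMat G ^ k) * endMat Q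

-- `solMat` is a truncated geometric series, hence a sum over paths in which every visited index `i`
-- carries a factor `X i`. Modulo squares only the paths without repetition remain, and these are
-- the chains.
omit [Fintype S] [DecidableEq S] in
lemma chainMat_sub_mem (s s' : S) :
    (startMat P * solMat Q G) s s' -
      chainMat P Q G s s' ∈ sqIdeal n R := by
  rw [solMat, ← Matrix.mul_assoc, Matrix.mul_sum, Matrix.sum_mul, Matrix.sum_apply, chainMat,
    of_apply, ← Finset.sum_sub_distrib]
  exact sum_mem fun k _ => pathSum_sub_mem P Q G k s s'

omit [Fintype S] [DecidableEq S] in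
lemma solMat_eq : (1 - stepMat G) * solMat Q G = endMat Q - stepMat G ^ n * endMat Q := by
  rw [solMat, ← Matrix.mul_assoc, mul_neg_geom_sum, Matrix.sub_mul, Matrix.one_mul]

-- Such a path visits `n + 1` indices out of `n`, so some variable occurs at least twice. This makes
-- the truncation of the geometric series harmless modulo squares.
omit [Fintype S] [DecidableEq S] in
lemma stepMat_pow_mem (j : Fin n) (s : S) :
    (stepMat G ^ n * endMat Q) j s ∈ sqIdeal n R := by
  have h := pathSum_sub_mem (S := S) (n := n) (of fun (_ : S) i => if i = j then 1 else 0) Q G n s s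
  have h0 : IsEmpty (Fin (n + 1) ↪ Fin n) := by
    refine ⟨fun f => ?_⟩
    have := Fintype.card_le_of_embedding f
    simp at this
  rw [Finset.univ_eq_empty, Finset.sum_empty, sub_zero, Matrix.mul_assoc, mul_apply,
    Finset.sum_eq_single j] at h
  · simpa [startMat] using h
  · intro i _ hi; simp [startMat, hi]
  · simp

/-- The block determinant factorizes modulo squares. -/
lemma det_blocks_sub_mem :
    (fromBlocks (H.map MvPolynomial.C) (startMat P) (-endMat Q) (1 - stepMat G)).det -
      (1 - stepMat G).det * (H.map MvPolynomial.C + chainMat P Q G).det ∈ sqIdeal n R := by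
  set π := Ideal.Quotient.mk (sqIdeal n R) with hπ
  rw [← Ideal.Quotient.eq_zero_iff_mem, map_sub, map_mul, sub_eq_zero]
  -- A unipotent column operation with `solMat` clears the lower left block up to the term with the
  -- `n`-th power, which lies in the ideal. This is the Schur complement without inverting `1 - X
  -- G`.
  have h1 : (fromBlocks (H.map MvPolynomial.C) (startMat P) (-endMat Q) (1 - stepMat G)).det =
      (fromBlocks (H.map MvPolynomial.C + startMat P * solMat Q G) (startMat P)
        (-(stepMat G ^ n * endMat Q)) (1 - stepMat G)).det := by
    have : (fromBlocks (1 : Matrix S S (MvPolynomial (Fin n) R)) 0 (solMat Q G) 1).det = 1 := by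
      rw [det_fromBlocks_zero₁₂]; simp
    rw [← mul_one (det _), ← this, ← det_mul, fromBlocks_multiply]
    simp only [Matrix.mul_one, Matrix.mul_zero, zero_add]
    rw [solMat_eq]
    congr 2
    abel
  rw [h1, RingHom.map_det, RingHom.map_det, RingHom.map_det, RingHom.mapMatrix_apply,
    RingHom.mapMatrix_apply, RingHom.mapMatrix_apply, fromBlocks_map]
  have h2 : (-(stepMat G ^ n * endMat Q)).map π = 0 := by
    ext j s
    rw [map_apply, Matrix.neg_apply, map_neg, Ideal.Quotient.eq_zero_iff_mem.2 (stepMat_pow_mem Q G j s)]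
    simp
  have h3 : (H.map MvPolynomial.C + startMat P * solMat Q G).map π =
      (H.map MvPolynomial.C + chainMat P Q G).map π := by
    ext s s'
    rw [map_apply, map_apply, Matrix.add_apply, Matrix.add_apply, map_add, map_add]
    congr 1
    rw [Ideal.Quotient.eq]
    exact chainMat_sub_mem P Q G s s'
  rw [h2, h3, det_fromBlocks_zero₂₁, mul_comm]

end Schur

/-! ### Expansion of the block determinants in principal minors -/

section SchurExpansion

lemma det_scale_add_one {ι A : Type*} [Fintype ι] [DecidableEq ι] [CommRing A] (c : ι → A)
    (T : Matrix ι ι A) :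
    ((of fun i j => c i * T i j) + 1).det = ∑ s : Finset ι, (∏ i ∈ s, c i) * permSum T s := by
  rw [det_add_eq_sum_piecewise]
  refine Finset.sum_congr rfl fun s _ => ?_
  rw [det_piecewise_mul, det_rowPiecewise_one]

lemma permSum_map {ι A B : Type*} [Fintype ι] [DecidableEq ι] [CommRing A] [CommRing B]
    (φ : A →+* B) (T : Matrix ι ι A) (s : Finset ι) : permSum (T.map φ) s = φ (permSum T s) := by
  simp [permSum, map_sum, map_prod]

variable {S : Type*} [Fintype S] [DecidableEq S] {n : ℕ} {R : Type*} [CommRing R]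
  (H : Matrix S S R) (P : Matrix S (Fin n) R) (Q : Matrix (Fin n) S R)
  (G : Matrix (Fin n) (Fin n) R)

omit [Fintype S] [DecidableEq S] in
lemma sum_disjSum {M : Type*} [AddCommMonoid M] [Fintype S] (L : Finset S)
    (f : Finset (S ⊕ Fin n) → M) (h : ∀ s, s.toLeft ≠ L → f s = 0) :
    ∑ s, f s = ∑ I : Finset (Fin n), f (L.disjSum I) := by
  symm
  refine Finset.sum_of_injOn (fun I => L.disjSum I) ?_ (by simp) ?_ (fun _ _ => rfl)
  · intro I _ J _ hIJ
    have := congrArg Finset.toRight hIJ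
    simpa using this
  · intro s _ hs
    refine h s fun hL => hs ⟨s.toRight, by simp, ?_⟩
    simp only
    rw [← hL, Finset.toLeft_disjSum_toRight]

lemma prod_neg_X_eq (I : Finset (Fin n)) :
    ∏ j ∈ I, (-MvPolynomial.X j : MvPolynomial (Fin n) R) =
      MvPolynomial.C ((-1) ^ I.card) * ∏ j ∈ I, MvPolynomial.X j := by
  rw [Finset.prod_neg, map_pow, map_neg, map_one]

/-- The rows of `1 - X G` are unit vectors plus multiples of `-X j`, so the determinant is the
generating function of principal minors. They are written as minors of the full block matrix, for
comparison with `det_blocks_eq`. -/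
lemma det_one_sub_stepMat :
    (1 - stepMat G).det = ∑ I : Finset (Fin n),
      MvPolynomial.C ((-1) ^ I.card * permSum (fromBlocks H P Q G) (Finset.disjSum ∅ I)) *
        ∏ j ∈ I, MvPolynomial.X j := by
  classical
  have h1 : (1 - stepMat G).det = (fromBlocks (1 : Matrix S S (MvPolynomial (Fin n) R)) 0 (-endMat Q)
      (1 - stepMat G)).det := by
    rw [det_fromBlocks_zero₁₂, det_one, one_mul]
  let c : S ⊕ Fin n → MvPolynomial (Fin n) R := Sum.elim (fun _ => 0) (fun j => -MvPolynomial.X j)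
  have h2 : fromBlocks (1 : Matrix S S (MvPolynomial (Fin n) R)) 0 (-endMat Q) (1 - stepMat G) =
      (of fun i j => c i * (fromBlocks H P Q G).map MvPolynomial.C i j) + 1 := by
    rw [← fromBlocks_one]
    ext1 i j
    rcases i with i | i <;> rcases j with j | j <;>
      simp [c, endMat, stepMat, sub_eq_neg_add, one_apply]
  rw [h1, h2, det_scale_add_one, sum_disjSum ∅]
  · refine Finset.sum_congr rfl fun I _ => ?_
    rw [permSum_map, Finset.prod_disjSum, Finset.prod_empty, one_mul]
    simp only [c, Sum.elim_inr]
    rw [prod_neg_X_eq, map_mul]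
    ring
  · intro s hs
    obtain ⟨i, hi⟩ := Finset.nonempty_iff_ne_empty.2 hs
    rw [Finset.prod_eq_zero (Finset.mem_toLeft.1 hi) rfl, zero_mul]

lemma det_blocks_eq :
    (fromBlocks (H.map MvPolynomial.C) (startMat P) (-endMat Q) (1 - stepMat G)).det =
      ∑ I : Finset (Fin n),
      MvPolynomial.C ((-1) ^ I.card * permSum (fromBlocks H P Q G) (Finset.disjSum Finset.univ I)) *
        ∏ j ∈ I, MvPolynomial.X j := by
  classical
  let c : S ⊕ Fin n → MvPolynomial (Fin n) R := Sum.elim (fun _ => 1) (fun j => -MvPolynomial.X j)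
  let B : Matrix (S ⊕ Fin n) (S ⊕ Fin n) (MvPolynomial (Fin n) R) := fromBlocks 0 0 0 1
  have h2 : fromBlocks (H.map MvPolynomial.C) (startMat P) (-endMat Q) (1 - stepMat G) =
      (of fun i j => c i * (fromBlocks H P Q G).map MvPolynomial.C i j) + B := by
    ext1 i j
    rcases i with i | i <;> rcases j with j | j <;>
      simp [c, B, startMat, endMat, stepMat, sub_eq_neg_add]
  rw [h2, det_add_eq_sum_piecewise, sum_disjSum Finset.univ]
  -- Since `B` is zero in the rows of `S`, only sets containing all of `S` contribute; on the
  -- remaining rows `B` agrees with the identity.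
  · refine Finset.sum_congr rfl fun I _ => ?_
    have h3 : rowPiecewise (Finset.disjSum Finset.univ I) ((fromBlocks H P Q G).map MvPolynomial.C) B =
        rowPiecewise (Finset.disjSum Finset.univ I) ((fromBlocks H P Q G).map MvPolynomial.C) 1 := by
      ext1 i j
      rw [rowPiecewise_apply, rowPiecewise_apply]
      split_ifs with h
      · rfl
      · rcases i with i | i
        · simp at h
        · simp only [B, ← fromBlocks_one]
          rcases j with j | j <;> rfl
    rw [det_piecewise_mul, h3, det_rowPiecewise_one, permSum_map, Finset.prod_disjSum]
    simp only [c, Sum.elim_inr, Sum.elim_inl, Finset.prod_const_one, one_mul]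
    rw [prod_neg_X_eq, map_mul]
    ring
  · intro s hs
    obtain ⟨i, hi⟩ : ∃ i, i ∉ s.toLeft := by
      by_contra h
      push Not at h
      exact hs (Finset.eq_univ_iff_forall.2 h)
    refine det_eq_zero_of_row_eq_zero (Sum.inl i) fun j => ?_
    rw [rowPiecewise_apply, if_neg (by simpa using hi)]
    rcases j with j | j <;> rfl

/-- The coefficients of the determinant of a sum over chains are the sums over the permutations all
of whose cycles meet `S`. -/
lemma coeff_det_chainMat (pick : Finset (S ⊕ Fin n) → S ⊕ Fin n)
    (hpick : ∀ D : Finset (S ⊕ Fin n), D.Nonempty → pick D ∈ D) (I : Finset (Fin n)) :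
    MvPolynomial.coeff (ind I) (H.map MvPolynomial.C + chainMat P Q G).det =
      (-1) ^ I.card * cluster (cycSum (fromBlocks H P Q G)) (Finset.disjSum Finset.univ ∅) pick
        (Finset.disjSum Finset.univ I) := by
  classical
  set T := fromBlocks H P Q G with hT
  set θ : Finset (Fin n) → R := fun I =>
    MvPolynomial.coeff (ind I) (H.map MvPolynomial.C + chainMat P Q G).det with hθ
  set F : Finset (Fin n) → R := fun I =>
    cluster (cycSum T) (Finset.disjSum Finset.univ ∅) pick (Finset.disjSum Finset.univ I) with hF
  change θ I = (-1) ^ I.card * F I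
  -- The Schur identity, read off at the monomial of `I`.
  have h1 : ∀ I : Finset (Fin n), (-1) ^ I.card * permSum T (Finset.disjSum Finset.univ I) =
      ∑ J ∈ I.powerset, (-1) ^ J.card * permSum T (Finset.disjSum ∅ J) * θ (I \ J) := by
    intro I
    have h := coeff_ind_of_mem_sqIdeal (det_blocks_sub_mem H P Q G) I
    rw [MvPolynomial.coeff_sub, det_blocks_eq, det_one_sub_stepMat H P Q G, Finset.sum_mul,
      MvPolynomial.coeff_sum, MvPolynomial.coeff_sum] at h
    simp only [coeff_ind_C_mul_prod_X, coeff_ind_C_mul_prod_X_mul, Finset.sum_ite_eq',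
      Finset.mem_univ, if_true] at h
    rw [sub_eq_zero.1 h, ← Finset.sum_filter]
    refine Finset.sum_congr ?_ fun _ _ => rfl
    ext J; simp
  -- The decomposition of permutations into the cycles that meet `S` and those that avoid it.
  have h2 : ∀ I : Finset (Fin n), permSum T (Finset.disjSum Finset.univ I) =
      ∑ J ∈ I.powerset, F (I \ J) * permSum T (Finset.disjSum ∅ J) := by
    intro I
    rw [permSum_eq_cluster (Finset.disjSum Finset.univ ∅) pick T hpick]
    symm
    refine Finset.sum_nbij (fun J => Finset.disjSum ∅ J) ?_ ?_ ?_ ?_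
    · intro J hJ
      rw [Finset.mem_powerset] at hJ ⊢
      intro i hi
      rcases i with i | i
      · simp at hi
      · simp at hi ⊢; exact hJ hi
    · intro J _ J' _ h
      have := congrArg Finset.toRight h
      simp only [Finset.toRight_disjSum] at this
      exact this
    · intro D hD
      rw [Finset.mem_coe, Finset.mem_powerset] at hD
      refine ⟨D.toRight, ?_, ?_⟩
      · rw [Finset.mem_coe, Finset.mem_powerset]
        intro i hi
        have := hD (Finset.mem_toRight.1 hi)
        simpa using this
      · have : D.toLeft = ∅ := by
          refine Finset.eq_empty_of_forall_notMem fun i hi => ?_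
          have := hD (Finset.mem_toLeft.1 hi)
          simp at this
        simp only
        rw [← this, Finset.toLeft_disjSum_toRight]
    · intro J _
      simp only [hF]
      congr 2
      ext i
      rcases i with i | i <;> simp
  -- `h1` and `h2` are the same convolution with the principal minors on subsets of `Fin n`. The
  -- minor of the empty set is `1`, so the convolution can be solved recursively and its solution is
  -- unique.
  induction hn : I.card using Nat.strong_induction_on generalizing I with
  | _ m ih =>
    have h3 := h1 I
    rw [h2 I, Finset.mul_sum] at h3
    have h4 : (∅ : Finset (Fin n)) ∈ I.powerset := Finset.empty_mem_powerset I
    rw [← Finset.add_sum_erase _ _ h4, ← Finset.add_sum_erase _ _ h4] at h3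
    have h5 : ∑ J ∈ I.powerset.erase ∅, (-1) ^ I.card * (F (I \ J) * permSum T (Finset.disjSum ∅ J)) =
        ∑ J ∈ I.powerset.erase ∅, (-1) ^ J.card * permSum T (Finset.disjSum ∅ J) * θ (I \ J) := by
      refine Finset.sum_congr rfl fun J hJ => ?_
      obtain ⟨hJ0, hJI⟩ := Finset.mem_erase.1 hJ
      rw [Finset.mem_powerset] at hJI
      have hc := Finset.card_sdiff_add_card_eq_card hJI
      have hpos := (Finset.nonempty_iff_ne_empty.2 hJ0).card_pos
      rw [ih _ (by omega) (I \ J) rfl, ← hc, pow_add]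
      ring
    rw [h5, add_left_inj] at h3
    have h6 : permSum T (Finset.disjSum ∅ ∅) = 1 := by
      rw [Finset.disjSum_empty, Finset.map_empty, permSum_empty]
    rw [h6, Finset.sdiff_empty, Finset.card_empty, pow_zero, mul_one, one_mul, one_mul] at h3
    rw [← hn, h3]

end SchurExpansion

/-! ### The amplitudes as sums over cycles -/

section RankOne

variable {ι R : Type*} [Fintype ι] [CommRing R]

lemma vecMulVec_mul_smul (u v w z : ι → R) :
    vecMulVec u v * vecMulVec w z = (v ⬝ᵥ w) • vecMulVec u z := by
  ext i j
  simp only [Matrix.mul_apply, vecMulVec_apply, Matrix.smul_apply, smul_eq_mul, dotProduct,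
    Finset.sum_mul]
  exact Finset.sum_congr rfl fun k _ => by ring

variable [DecidableEq ι]

lemma prod_vecMulVec {k : ℕ} (p q : Fin (k + 1) → ι → R) :
    (List.ofFn fun j => vecMulVec (p j) (q j)).prod =
      (∏ j : Fin k, q j.castSucc ⬝ᵥ p j.succ) • vecMulVec (p 0) (q (Fin.last k)) := by
  induction k with
  | zero => simp
  | succ k ih =>
    rw [List.ofFn_succ, List.prod_cons, ih (fun j => p j.succ) (fun j => q j.succ), mul_smul_comm,
      vecMulVec_mul_smul, smul_smul, Fin.prod_univ_succ, mul_comm]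
    rfl

lemma trace_prod_vecMulVec {n : ℕ} (hn : n ≠ 0) (p q : Fin n → ι → R) :
    (List.ofFn fun j => vecMulVec (p j) (q j)).prod.trace =
      ∏ j, q j ⬝ᵥ p (finRotate n j) := by
  obtain ⟨k, rfl⟩ := Nat.exists_eq_succ_of_ne_zero hn
  rw [prod_vecMulVec, Matrix.trace_smul, Fin.prod_univ_castSucc]
  simp only [finRotate_apply, Fin.coeSucc_eq_succ, Fin.last_add_one, smul_eq_mul,
    trace_vecMulVec]
  rw [dotProduct_comm]

end RankOne

/-! ### Cyclic orders and full cycles -/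

section CyclicOrders

open Equiv

variable {n : ℕ} {R : Type*} [CommRing R]

lemma isFullCycle_univ {ι : Type*} [Fintype ι] [DecidableEq ι] [Nontrivial ι] {c : Perm ι} :
    IsFullCycle c Finset.univ ↔ c.IsCycle ∧ c.support = Finset.univ := by
  constructor
  · rintro ⟨-, h⟩
    have hne : ∀ i, c i ≠ i := fun i hi => by
      obtain ⟨j, hj⟩ := exists_ne i
      obtain ⟨m, hm⟩ := h i (Finset.mem_univ i) j (Finset.mem_univ j)
      exact hj (hm.symm.trans (Perm.zpow_apply_eq_self_of_apply_eq_self hi m))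
    obtain ⟨i⟩ : Nonempty ι := inferInstance
    exact ⟨⟨i, hne i, fun j _ => h i (Finset.mem_univ i) j (Finset.mem_univ j)⟩,
      Finset.eq_univ_iff_forall.2 fun j => Perm.mem_support.2 (hne j)⟩
  · rintro ⟨h, hs⟩
    refine ⟨fun j hj => absurd (Finset.mem_univ j) hj, fun i _ j _ => ?_⟩
    have := fun k => Perm.mem_support.1 (hs ▸ Finset.mem_univ k : k ∈ c.support)
    exact h.sameCycle (this i) (this j)

/-- The sum over the cycles, as a sum over the orders which start with the first element. -/
lemma cycSum_univ_eq (hn : 2 ≤ n) (T : Matrix (Fin n) (Fin n) R) :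
    cycSum T Finset.univ = (-1) ^ (n - 1) *
      ∑ σ : Perm (Fin n) with ∀ i : Fin n, (i : ℕ) = 0 → σ i = i,
        ∏ i, T (σ i) (σ (finRotate n i)) := by
  classical
  have : Nontrivial (Fin n) := Fin.nontrivial_iff_two_le.2 hn
  have : NeZero n := ⟨by omega⟩
  have hrot := isCycle_finRotate_of_le hn
  have hsupp := support_finRotate_of_le hn
  have hfull : IsFullCycle (finRotate n) Finset.univ := isFullCycle_univ.2 ⟨hrot, hsupp⟩
  have hpow : ∀ i j : Fin n, ∃ k : ℕ, (finRotate n ^ k) i = j := fun i j =>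
    (hfull.2 i (Finset.mem_univ i) j (Finset.mem_univ j)).exists_pow_eq'.imp fun n hn => hn.2
  rw [cycSum, Finset.mul_sum]
  symm
  -- The order `σ` corresponds to the cycle `σ 0 → σ 1 → ⋯`, a conjugate of the rotation, which has
  -- sign `(-1) ^ (n - 1)`. Since `σ` fixes `0`, it is recovered by following the cycle from `0`.
  refine Finset.sum_bij (fun σ _ => σ * finRotate n * σ⁻¹) ?_ ?_ ?_ ?_
  · intro σ _
    refine Finset.mem_filter.2 ⟨Finset.mem_univ _, isFullCycle_univ.2 ⟨hrot.conj, ?_⟩⟩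
    refine Finset.eq_univ_iff_forall.2 fun j => ?_
    rw [Perm.mem_support, Perm.mul_apply, Perm.mul_apply, ne_eq, ← Perm.eq_inv_iff_eq]
    exact Perm.mem_support.1 (hsupp ▸ Finset.mem_univ (σ⁻¹ j) : σ⁻¹ j ∈ (finRotate n).support)
  · intro σ hσ τ hτ h
    have hσ0 := (Finset.mem_filter.1 hσ).2 0 rfl
    have hτ0 := (Finset.mem_filter.1 hτ).2 0 rfl
    have h1 : ∀ k : ℕ, σ * finRotate n ^ k * σ⁻¹ = τ * finRotate n ^ k * τ⁻¹ := fun k => by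
      rw [← conj_pow, ← conj_pow, h]
    ext1 j
    obtain ⟨k, rfl⟩ := hpow 0 j
    have h2 := congrArg (fun p : Perm (Fin n) => p 0) (h1 k)
    have e1 : σ⁻¹ 0 = 0 := Perm.inv_eq_iff_eq.2 hσ0.symm
    have e2 : τ⁻¹ 0 = 0 := Perm.inv_eq_iff_eq.2 hτ0.symm
    simpa only [Perm.mul_apply, e1, e2] using h2
  · intro c hc
    obtain ⟨hc1, hc2⟩ := isFullCycle_univ.1 (Finset.mem_filter.1 hc).2
    obtain ⟨τ, hτ⟩ := isConj_iff.1 (hrot.isConj hc1 (by rw [hsupp, hc2]))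
    -- A conjugating permutation may be multiplied by a power of the rotation; the power is chosen
    -- so that `0` becomes fixed.
    obtain ⟨k, hk⟩ := hpow 0 (τ⁻¹ 0)
    refine ⟨τ * finRotate n ^ k, Finset.mem_filter.2 ⟨Finset.mem_univ _, fun i hi => ?_⟩, ?_⟩
    · obtain rfl : i = 0 := Fin.ext hi
      rw [Perm.mul_apply, hk]; exact τ.apply_symm_apply 0
    · rw [← hτ]; group
  · intro σ _
    have hs : Perm.sign (σ * finRotate n * σ⁻¹) = (-1) ^ (n - 1) := by
      rw [map_mul, map_mul, sign_finRotate, Perm.sign_inv, mul_comm, ← mul_assoc,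
        Int.units_mul_self, one_mul]
    rw [hs]
    push_cast
    congr 1
    refine Fintype.prod_equiv σ _ _ fun i => ?_
    simp

/-- Sums over cycles do not depend on the order of the indices. -/
lemma cycSum_submatrix_univ {ι κ : Type*} [Fintype ι] [DecidableEq ι] [Fintype κ] [DecidableEq κ]
    (T : Matrix ι ι R) (f : κ ≃ ι) :
    cycSum (T.submatrix f f) Finset.univ = cycSum T Finset.univ := by
  have h := cycSum_map T f.toEmbedding
  rw [Finset.map_univ_equiv] at h
  exact h.symm

end CyclicOrders

namespace WKBSolution

variable {r : ℕ} {Φ : RationalHConnection r} {x y : K} (S : WKBSolution Φ x y)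
  {ι : Type*}

/-- The matrix of the `(U(t_i)⁻¹ U(t_j))_{a_i a_j} / (t_i - t_j)`. -/
def kern (t : ι → ℂ) (a : ι → Fin r) : Matrix ι ι R₀ := of fun i j =>
  PowerSeries.C (t i - t j)⁻¹ * ((S.U (t i))⁻¹ * S.U (t j)) (a i) (a j)

/-- The connected correlator of the sheets `a i` at the points `t i`. -/
def corr [Fintype ι] [DecidableEq ι] (t : ι → ℂ) (a : ι → Fin r) : R₀ :=
  cycSum (S.kern t a) Finset.univ

lemma M_e_eq (t : ℂ) (a : Fin r) :
    S.M t (e a) = vecMulVec (fun i => S.U t i a) ((S.U t)⁻¹ a) := by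
  ext i j
  rw [M_e_apply, vecMulVec_apply]

/-- The trace of a product of matrices of rank one is a cyclic product of scalars, here the entries
of `U(t_i)⁻¹ U(t_j)`, and the prefactor `(-1) ^ (n - 1)` is the sign of an `n`-cycle. The result
does not refer to an order of the points. -/
lemma amplitude_eq {n : ℕ} (hn : 2 ≤ n) (t : Fin n → ℂ) (a : Fin n → Fin r) :
    S.amplitude n t (fun i => e (a i)) = HahnSeries.ofPowerSeries ℤ ℂ (S.corr t a) := by
  rw [amplitude, dif_neg (by omega), corr, cycSum_univ_eq hn]
  congr 2
  refine Finset.sum_congr rfl fun σ _ => ?_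
  simp only [M_e_eq]
  rw [trace_prod_vecMulVec (by omega), ← Finset.prod_inv_distrib, map_prod,
    ← Finset.prod_mul_distrib]
  rfl

lemma corr_equiv {κ : Type*} [Fintype ι] [DecidableEq ι] [Fintype κ] [DecidableEq κ] (f : κ ≃ ι)
    (t : ι → ℂ) (a : ι → Fin r) : S.corr (t ∘ f) (a ∘ f) = S.corr t a :=
  cycSum_submatrix_univ (S.kern t a) f

lemma amplitude_perm (n : ℕ) (σ : Equiv.Perm (Fin n)) (t : Fin n → ℂ) (a : Fin n → Fin r) :
    S.amplitude n (t ∘ σ) (fun i => e (a (σ i))) = S.amplitude n t fun i => e (a i) := by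
  rcases lt_or_ge n 2 with h | h
  · have : Subsingleton (Fin n) := by
      interval_cases n
      · exact inferInstance
      · exact inferInstance
    obtain rfl : σ = 1 := Subsingleton.elim _ _
    rfl
  · rw [amplitude_eq S h t a, ← S.corr_equiv σ]
    exact amplitude_eq S h _ (a ∘ σ)

end WKBSolution

/-! ### The loop determinant on the sheets -/

section ConjDet

variable {ι σ R : Type*} [Fintype ι] [DecidableEq ι] [CommRing R]

lemma det_map_C_conj {V W : Matrix ι ι R} (h : W * V = 1) (A : Matrix ι ι (MvPolynomial σ R)) :
    (W.map MvPolynomial.C * A * V.map MvPolynomial.C).det = A.det := by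
  have hU : (W.map (MvPolynomial.C (σ := σ))).det * (V.map (MvPolynomial.C (σ := σ))).det = 1 := by
    rw [← det_mul, ← Matrix.map_mul, h, Matrix.map_one _ (map_zero _) (map_one _), det_one]
  rw [det_mul, det_mul, mul_right_comm, hU, one_mul]

end ConjDet

/-! ### Values of the sums over chains -/

section ChainValues

variable {r n : ℕ} {x : K}

/-- The values of the matrix `chainSum`. -/
def chainSumAt (s : ℂ) (t : Fin n → ℂ) (N : Fin n → Matrix (Fin r) (Fin r) R₀) :
    Matrix (Fin r) (Fin r) (MvPolynomial (Fin n) R₀) :=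
  ∑ k ∈ Finset.range n, ∑ f : Fin (k + 1) ↪ Fin n,
    (MvPolynomial.C (PowerSeries.C ((s - t (f 0)) * (∏ j : Fin k, (t (f j.castSucc) - t (f j.succ))) *
      (t (f (Fin.last k)) - s))⁻¹) * ∏ j, MvPolynomial.X (f j)) •
      ((List.ofFn fun j => N (f j)).prod).map MvPolynomial.C

lemma hasVal_chainCoeff {q : OnePoint ℂ} {s : ℂ} (hx : HasVal q x s) {t : Fin n → ℂ}
    (hs : ∀ i, t i ≠ s) (ht : Function.Injective t) {k : ℕ} (f : Fin (k + 1) ↪ Fin n) :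
    HasVal q (chainCoeff x t f) ((s - t (f 0)) *
      (∏ j : Fin k, (t (f j.castSucc) - t (f j.succ))) * (t (f (Fin.last k)) - s))⁻¹ := by
  refine HasVal.inv ?_ ?_
  · exact Subring.mul_pair_mem (T := valPairs q) (Subring.mul_pair_mem
      (Subring.sub_pair_mem hx (HasVal.const _ _))
      (Subring.prod_pair_mem _ fun j _ => HasVal.const _ _))
      (Subring.sub_pair_mem (HasVal.const _ _) hx)
  · refine mul_ne_zero (mul_ne_zero (sub_ne_zero.2 (hs _).symm) ?_) (sub_ne_zero.2 (hs _))
    refine Finset.prod_ne_zero_iff.2 fun j _ => sub_ne_zero.2 fun h => ?_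
    exact (Fin.castSucc_lt_succ (i := j)).ne (f.injective (ht h))

lemma chainSum_mem_valMv {q : OnePoint ℂ} {s : ℂ} (hx : HasVal q x s) {t : Fin n → ℂ}
    (hs : ∀ i, t i ≠ s) (ht : Function.Injective t) (N : Fin n → Matrix (Fin r) (Fin r) R₀)
    (i j : Fin r) : (chainSum x t N i j, chainSumAt s t N i j) ∈ valMv q n := by
  simp only [chainSum, chainSumAt, Matrix.sum_apply, chainTerm, Matrix.smul_apply, smul_eq_mul,
    map_apply]
  refine Subring.sum_pair_mem _ fun k _ => Subring.sum_pair_mem _ fun f _ => ?_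
  refine Subring.mul_pair_mem (Subring.mul_pair_mem ?_ ?_) ?_
  · exact C_mem_valMv (C_mem_valSeries (hasVal_chainCoeff hx hs ht f))
  · exact Subring.prod_pair_mem _ fun j _ => X_mem_valMv _
  · exact C_mem_valMv (map_C_mem_valSeries _)

/-- A product of matrices of rank one factors into a start vector, scalar steps and an end vector.
This gives `𝓜` the form to which the Schur complement argument applies. -/
lemma chainSumAt_rankOne (V W : Matrix (Fin r) (Fin r) R₀) (s : ℂ) (t : Fin n → ℂ)
    (p q : Fin n → Fin r → R₀) :
    V.map MvPolynomial.C * chainSumAt s t (fun i => vecMulVec (p i) (q i)) * W.map MvPolynomial.C =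
      chainMat (of fun a i => PowerSeries.C (s - t i)⁻¹ * (V *ᵥ p i) a)
        (of fun i a => PowerSeries.C (t i - s)⁻¹ * (q i ᵥ* W) a)
        (of fun i j => PowerSeries.C (t i - t j)⁻¹ * (q i ⬝ᵥ p j)) := by
  rw [chainSumAt, Matrix.mul_sum, Matrix.sum_mul]
  ext1 a b
  rw [Matrix.sum_apply, chainMat, of_apply]
  refine Finset.sum_congr rfl fun k _ => ?_
  rw [Matrix.mul_sum, Matrix.sum_mul, Matrix.sum_apply]
  refine Finset.sum_congr rfl fun f _ => ?_
  rw [prod_vecMulVec, Matrix.mul_smul, Matrix.smul_mul, ← Matrix.map_mul, ← Matrix.map_mul,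
    Matrix.smul_apply, chainEntry, map_apply, Matrix.mul_smul, Matrix.smul_mul, Matrix.smul_apply,
    mul_vecMulVec, vecMulVec_mul, vecMulVec_apply]
  simp only [of_apply, smul_eq_mul, Finset.prod_mul_distrib, mul_inv, map_mul, ← Finset.prod_inv_distrib,
    map_prod]
  ring

end ChainValues

/-! ### The loop determinant on a sheet as a sum over clusters -/

namespace WKBSolution

variable {r n : ℕ} {Φ : RationalHConnection r} {x y : K} (S : WKBSolution Φ x y)

/-- The conjugate of `y - Φ` by `U`. -/
def diagBlock (a : Fin r) (s : ℂ) : Matrix (Fin r) (Fin r) R₀ := (S.U s)⁻¹ * S.charMatAt a s * S.U s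

/-- From `Φ U = U Y + ħ U'`. Off the diagonal only `-ħ U⁻¹ U'` remains, which is `ħ` times the limit
of the correlator kernel when points on different sheets come together. -/
lemma diagBlock_eq (a : Fin r) {s : ℂ} (hs : s ∈ S.D) :
    S.diagBlock a s = diagonal (fun b => PowerSeries.C (S.eig a s) - S.Y s b) -
      (PowerSeries.X : R₀) • ((S.U s)⁻¹ * S.dU s) := by
  have h := S.X_smul_dU hs
  have h2 : Φ.at' s * S.U s = S.U s * diagonal (S.Y s) + (PowerSeries.X : R₀) • S.dU s := by
    rw [h]; abel
  rw [diagBlock, charMatAt, Matrix.mul_sub, Matrix.sub_mul, Matrix.mul_assoc _ (Φ.at' s), h2,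
    Matrix.mul_add, ← Matrix.mul_assoc, S.inv_mul_U hs, Matrix.one_mul, Matrix.mul_smul,
    ← sub_sub]
  congr 1
  have : (S.U s)⁻¹ * Matrix.scalar (Fin r) (PowerSeries.C (S.eig a s)) * S.U s =
      Matrix.scalar (Fin r) (PowerSeries.C (S.eig a s)) := by
    rw [Matrix.mul_assoc, (Matrix.scalar_commute _ (fun _ => Commute.all _ _) _).eq,
      ← Matrix.mul_assoc, S.inv_mul_U hs, Matrix.one_mul]
  rw [this, Matrix.scalar_apply, diagonal_sub]

/-- The matrix with the correlators at the points `t i` and the point `s`. -/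
def loopMat (a : Fin r) (s : ℂ) (t : Fin n → ℂ) (b : Fin n → Fin r) :
    Matrix (Fin r ⊕ Fin n) (Fin r ⊕ Fin n) R₀ :=
  fromBlocks (S.diagBlock a s)
    (of fun c i => PowerSeries.X * S.kern (Sum.elim (fun _ : Fin r => s) t) (Sum.elim id b)
      (Sum.inl c) (Sum.inr i))
    (of fun i c => S.kern (Sum.elim (fun _ : Fin r => s) t) (Sum.elim id b) (Sum.inr i) (Sum.inl c))
    (S.kern t b)

/-- The parameter `-ħ` produces `det (y - Φ + ħ 𝓜)`. Conjugation by `U` leaves it unchanged, and the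
`ħ` is absorbed into the start vectors, so that off the diagonal every row of `Fin r` carries
exactly one factor `ħ`. -/
lemma loopCoeff_mem_valSeries (hcurve : IsSmoothGenusZeroSpectralCurve Φ x y)
    (hA : S.Assumption5Star) (a : Fin r) {s : ℂ} (hs : s ∈ S.D) {t : Fin n → ℂ}
    (hts : ∀ i, t i ≠ s) (ht : Function.Injective t) (b : Fin n → Fin r)
    (pick : Finset (Fin r ⊕ Fin n) → Fin r ⊕ Fin n)
    (hpick : ∀ D : Finset (Fin r ⊕ Fin n), D.Nonempty → pick D ∈ D) :
    (loopCoeff x (charMat Φ x y) (-PowerSeries.X) t (fun i => S.M (t i) (e (b i))),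
      (-1) ^ n * cluster (cycSum (S.loopMat a s t b)) (Finset.disjSum Finset.univ ∅) pick
        Finset.univ) ∈ valSeries (S.sheet a s : OnePoint ℂ) := by
  have hdet := Subring.det_pair_mem (T := valMv (S.sheet a s : OnePoint ℂ) n)
    (M := (charMat Φ x y).map MvPolynomial.C -
      (MvPolynomial.C (-PowerSeries.X) : MvPolynomial (Fin n) (PowerSeries K)) •
        chainSum x t (fun i => S.M (t i) (e (b i))))
    (M' := (S.charMatAt a s).map MvPolynomial.C -
      (MvPolynomial.C (-PowerSeries.X) : MvPolynomial (Fin n) R₀) •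
        chainSumAt s t (fun i => S.M (t i) (e (b i)))) (fun i j => by
      refine Subring.sub_pair_mem ?_ ?_
      · exact C_mem_valMv (S.charMat_mem_valSeries hcurve hA a hs i j)
      · exact Subring.mul_pair_mem (C_mem_valMv (Subring.neg_pair_mem X_mem_valSeries))
          (chainSum_mem_valMv (S.hasVal_sheet a hs) hts ht _ i j))
  have h := hdet (allOnes n)
  have key : MvPolynomial.coeff (allOnes n) ((S.charMatAt a s).map MvPolynomial.C -
      (MvPolynomial.C (-PowerSeries.X) : MvPolynomial (Fin n) R₀) •
        chainSumAt s t (fun i => S.M (t i) (e (b i)))).det =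
      (-1) ^ n * cluster (cycSum (S.loopMat a s t b)) (Finset.disjSum Finset.univ ∅) pick
        Finset.univ := by
    have hc := coeff_det_chainMat (S.diagBlock a s)
      (of fun c i => PowerSeries.X * S.kern (Sum.elim (fun _ : Fin r => s) t) (Sum.elim id b)
        (Sum.inl c) (Sum.inr i))
      (of fun i c => S.kern (Sum.elim (fun _ : Fin r => s) t) (Sum.elim id b) (Sum.inr i) (Sum.inl c))
      (S.kern t b) pick hpick Finset.univ
    rw [ind_univ, Finset.card_univ, Fintype.card_fin, Finset.univ_disjSum_univ] at hc
    rw [loopMat, ← hc]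
    congr 1
    rw [← det_map_C_conj (S.inv_mul_U hs)]
    congr 1
    rw [Matrix.mul_sub, Matrix.sub_mul, sub_eq_add_neg]
    congr 1
    · rw [diagBlock, Matrix.map_mul, Matrix.map_mul]
    · simp only [M_e_eq]
      rw [Matrix.mul_smul, Matrix.smul_mul, chainSumAt_rankOne]
      ext1 c d
      rw [Matrix.neg_apply, Matrix.smul_apply, smul_eq_mul, map_neg]
      refine (by intro u v; ring : ∀ u v : MvPolynomial (Fin n) R₀, -(-u * v) = u * v) _ _ |>.trans ?_
      rw [chainMat, chainMat, of_apply, of_apply, Finset.mul_sum]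
      refine Finset.sum_congr rfl fun k _ => ?_
      rw [Finset.mul_sum]
      refine Finset.sum_congr rfl fun f _ => ?_
      rw [chainEntry, chainEntry, ← mul_assoc, ← map_mul]
      congr 2
      rw [← mul_assoc, ← mul_assoc]
      rfl
  rw [← key]
  exact h

end WKBSolution

/-! ### Poles of the loop determinant -/

section MvReg

variable {n : ℕ}

/-- The polynomials whose coefficients become regular at `q` when multiplied by `w`. -/
def regMv (n : ℕ) (q : OnePoint ℂ) (w : K) : AddSubgroup (MvPolynomial (Fin n) (PowerSeries K)) where
  carrier := {p | ∀ m, MvPolynomial.coeff m p ∈ regSeries q w}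
  zero_mem' m := by rw [MvPolynomial.coeff_zero]; exact ZeroMemClass.zero_mem _
  add_mem' {f g} hf hg m := by rw [MvPolynomial.coeff_add]; exact AddSubgroup.add_mem _ (hf m) (hg m)
  neg_mem' {f} hf m := by rw [MvPolynomial.coeff_neg]; exact AddSubgroup.neg_mem _ (hf m)

lemma mul_mem_regMv {q : OnePoint ℂ} {w w' : K} {f g : MvPolynomial (Fin n) (PowerSeries K)}
    (hf : f ∈ regMv n q w) (hg : g ∈ regMv n q w') : f * g ∈ regMv n q (w * w') := fun m => by
  classical
  rw [MvPolynomial.coeff_mul]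
  exact AddSubgroup.sum_mem _ fun p _ => mul_mem_regSeries (hf _) (hg _)

lemma C_mem_regMv {q : OnePoint ℂ} {w : K} {f : PowerSeries K} (hf : f ∈ regSeries q w) :
    MvPolynomial.C f ∈ regMv n q w := fun m => by
  classical
  rw [MvPolynomial.coeff_C]
  split_ifs
  · exact hf
  · exact ZeroMemClass.zero_mem _

lemma one_mem_regSeries (q : OnePoint ℂ) : (1 : PowerSeries K) ∈ regSeries q 1 := by
  rw [← map_one PowerSeries.C]
  exact C_mem_regSeries (by simp)

lemma X_mem_regMv (q : OnePoint ℂ) (j : Fin n) :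
    (MvPolynomial.X j : MvPolynomial (Fin n) (PowerSeries K)) ∈ regMv n q 1 := fun m => by
  classical
  rw [MvPolynomial.coeff_X]
  split_ifs
  · exact one_mem_regSeries q
  · exact ZeroMemClass.zero_mem _

lemma prod_mem_regMv {q : OnePoint ℂ} {ι : Type*} (s : Finset ι) {w : ι → K}
    {f : ι → MvPolynomial (Fin n) (PowerSeries K)} (hf : ∀ i ∈ s, f i ∈ regMv n q (w i)) :
    ∏ i ∈ s, f i ∈ regMv n q (∏ i ∈ s, w i) := by
  classical
  induction s using Finset.induction_on with
  | empty =>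
    rw [Finset.prod_empty, Finset.prod_empty, ← map_one MvPolynomial.C]
    exact C_mem_regMv (one_mem_regSeries q)
  | insert a s ha ih =>
    rw [Finset.prod_insert ha, Finset.prod_insert ha]
    exact mul_mem_regMv (hf a (Finset.mem_insert_self _ _))
      (ih fun i hi => hf i (Finset.mem_insert_of_mem hi))

end MvReg

/-! ### Regularity of the loop determinant away from the insertion points -/

section LoopPoles

variable {r n : ℕ} {x y : K} {Φ : RationalHConnection r}

/-- Only the first and the last factor of the denominator depend on `x`, and each contributes one `1
/ (x - t)`, of the order of `v`. -/
lemma ordAt_chainCoeff_le (hx : ∀ c : ℂ, x ≠ RatFunc.C c) {q : OnePoint ℂ} {t₀ : ℂ}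
    (h₀ : ¬ HasVal q x t₀) {t : Fin n → ℂ} (ht : ∀ i, ¬ HasVal q x (t i)) {k : ℕ}
    (f : Fin (k + 1) → Fin n) : ordAt q ((invCoord x t₀ ^ 2)⁻¹ * chainCoeff x t f) ≤ 1 := by
  have hv0 : ordAt q (invCoord x t₀) ≠ 0 := (Valuation.ne_zero_iff _).2 (invCoord_ne_zero hx t₀)
  have e : chainCoeff x t f = -(invCoord x (t (f 0)) * invCoord x (t (f (Fin.last k))) *
      RatFunc.C (∏ j : Fin k, (t (f j.castSucc) - t (f j.succ)))⁻¹) := by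
    have hneg : ∀ z : K, (-z)⁻¹ = -z⁻¹ := fun z => inv_neg
    rw [chainCoeff, invCoord, invCoord, map_inv₀, map_prod, mul_inv, mul_inv,
      ← neg_sub x (RatFunc.C (t (f (Fin.last k)))), hneg]
    ring
  rw [e, mul_neg, Valuation.map_neg, map_mul, map_mul, map_mul, map_inv₀, map_pow,
    ordAt_invCoord_eq (ht (f 0)) h₀, ordAt_invCoord_eq (ht (f (Fin.last k))) h₀, ← pow_two,
    ← mul_assoc, inv_mul_cancel₀ (pow_ne_zero _ hv0), one_mul]
  exact ordAt_le_one_iff.2 (C_mem_regAt _ _)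

lemma chainSum_mem_regMv (hx : ∀ c : ℂ, x ≠ RatFunc.C c) {q : OnePoint ℂ} {t₀ : ℂ}
    (h₀ : ¬ HasVal q x t₀) {t : Fin n → ℂ} (ht : ∀ i, ¬ HasVal q x (t i))
    (N : Fin n → Matrix (Fin r) (Fin r) R₀) (i j : Fin r) :
    chainSum x t N i j ∈ regMv n q (invCoord x t₀ ^ 2)⁻¹ := by
  rw [chainSum, Matrix.sum_apply]
  refine AddSubgroup.sum_mem _ fun k _ => ?_
  rw [Matrix.sum_apply]
  refine AddSubgroup.sum_mem _ fun f _ => ?_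
  rw [chainTerm, Matrix.smul_apply, smul_eq_mul, map_apply]
  have h1 : (MvPolynomial.C (PowerSeries.C (chainCoeff x t f)) : MvPolynomial (Fin n) (PowerSeries K)) ∈
      regMv n q (invCoord x t₀ ^ 2)⁻¹ :=
    C_mem_regMv (C_mem_regSeries (ordAt_chainCoeff_le hx h₀ ht f))
  have h2 := prod_mem_regMv (n := n) (q := q) Finset.univ (w := fun _ : Fin (k + 1) => (1 : K))
    (f := fun j => MvPolynomial.X (f j)) fun j _ => X_mem_regMv q (f j)
  have h3 : scalarHom n ((List.ofFn fun j => N (f j)).prod i j) ∈ regMv n q 1 :=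
    C_mem_regMv (map_C_mem_regSeries q _)
  simpa using mul_mem_regMv (mul_mem_regMv h1 h2) h3

/-- The loop determinant defines one-forms without poles at the points which do not lie over the
insertion points. -/
lemma loopCoeff_mem_regSeries (hcurve : IsSmoothGenusZeroSpectralCurve Φ x y)
    (S : WKBSolution Φ x y) (hA : S.Assumption5Star) (hn : n ≠ 0) {q : OnePoint ℂ} {t₀ : ℂ}
    (ht₀ : t₀ ∈ S.D) (hq : ¬ HasVal q x t₀) {c : PowerSeries K} (hc : c ∈ regSeries q 1)
    {t : Fin n → ℂ} (ht : ∀ i, ¬ HasVal q x (t i)) (N : Fin n → Matrix (Fin r) (Fin r) R₀) :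
    loopCoeff x (charMat Φ x y) c t N ∈ regSeries q (formFactor q * ratDeriv x / Eω Φ x y) := by
  have hx := hcurve.nonconstant
  have hv0 := invCoord_ne_zero hx t₀
  set B : Matrix (Fin r) (Fin r) (MvPolynomial (Fin n) (PowerSeries K)) :=
    -((MvPolynomial.C c : MvPolynomial (Fin n) (PowerSeries K)) • chainSum x t N) with hB
  have hBm : ∀ i j, B i j ∈ regMv n q (invCoord x t₀ ^ 2)⁻¹ := fun i j => by
    have h := mul_mem_regMv (C_mem_regMv hc) (chainSum_mem_regMv hx hq ht N i j)
    rw [one_mul] at h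
    exact AddSubgroup.neg_mem _ h
  rw [loopCoeff, sub_eq_neg_add, ← hB, det_add_eq_sum_piecewise, MvPolynomial.coeff_sum]
  refine AddSubgroup.sum_mem _ fun s _ => ?_
  -- The term without perturbed rows is constant in the `δ`, so it does not contain the monomial
  -- `δ_1 ⋯ δ_n`, `n` being nonzero.
  rcases s.eq_empty_or_nonempty with rfl | hs
  · have h0 : rowPiecewise ∅ B ((charMat Φ x y).map MvPolynomial.C) =
        (charMat Φ x y).map MvPolynomial.C := by
      ext1 i j; rw [rowPiecewise_apply, if_neg (Finset.notMem_empty i)]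
    have hne : (0 : Fin n →₀ ℕ) ≠ allOnes n := fun h => by
      have := DFunLike.congr_fun h ⟨0, Nat.pos_of_ne_zero hn⟩
      rw [allOnes_apply] at this
      simp at this
    rw [h0, ← RingHom.mapMatrix_apply, ← RingHom.map_det, MvPolynomial.coeff_C, if_neg hne]
    exact ZeroMemClass.zero_mem _
  · rw [det_piecewise_expand, MvPolynomial.coeff_sum]
    refine AddSubgroup.sum_mem _ fun g _ => ?_
    rw [← rowRepl_map, ← RingHom.mapMatrix_apply, ← RingHom.map_det,
      mul_comm _ (MvPolynomial.C _), MvPolynomial.coeff_C_mul]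
    have h1 := minor_mem hcurve S hA ht₀ hq s hs g
    have h2 := prod_mem_regMv s (f := fun i => B i (g i)) (fun i _ => hBm i (g i)) (allOnes n)
    have h3 := AddSubgroup.neg_mem _ (mul_mem_regSeries h1 h2)
    -- Each of the `m` perturbed rows brings `v²`. Against the weight `v ^ (2 (m - 1)) dv / E_ω` of
    -- the minor this leaves `dv / v² = -dx`.
    have hw : minorWeight Φ x y q t₀ s.card * ∏ i ∈ s, (invCoord x t₀ ^ 2)⁻¹ =
        -(formFactor q * ratDeriv x / Eω Φ x y) := by
      obtain ⟨m, hm⟩ : ∃ m, s.card = m + 1 := ⟨s.card - 1, by have := hs.card_pos; omega⟩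
      rw [Finset.prod_const, minorWeight, hm, Nat.add_sub_cancel, ratDeriv_invCoord hx,
        inv_pow, ← pow_mul]
      have hX : (invCoord x t₀) ^ (2 * (m + 1)) ≠ 0 := pow_ne_zero _ hv0
      field_simp
      ring
    rw [hw] at h3
    intro k
    have := h3 k
    rwa [map_neg, neg_mul_neg] at this

end LoopPoles

/-! ### Correlators at coinciding points -/

open Filter Topology

namespace CoeffHasDeriv

variable {F G : ℂ → R₀} {F' : R₀} {t : ℂ}

lemma C {f : ℂ → ℂ} {f' : ℂ} (h : HasDerivAt f f' t) :
    CoeffHasDeriv (fun s => PowerSeries.C (f s)) (PowerSeries.C f') t := fun k => by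
  simp only [PowerSeries.coeff_C]
  split_ifs
  · exact h
  · exact hasDerivAt_const _ _

lemma exists_mul (hF : ∃ F', CoeffHasDeriv F F' t) (hG : ∃ G', CoeffHasDeriv G G' t) :
    ∃ H', CoeffHasDeriv (fun s => F s * G s) H' t := by
  obtain ⟨F', hF⟩ := hF
  obtain ⟨G', hG⟩ := hG
  exact ⟨_, hF.mul hG⟩

lemma exists_sum {ι : Type*} (s : Finset ι) {F : ι → ℂ → R₀}
    (h : ∀ i ∈ s, ∃ F', CoeffHasDeriv (F i) F' t) :
    ∃ F', CoeffHasDeriv (fun t => ∑ i ∈ s, F i t) F' t := by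
  classical
  choose! F' hF' using h
  exact ⟨_, CoeffHasDeriv.sum s hF'⟩

lemma exists_inv_sub {c : ℂ} (hc : t ≠ c) :
    ∃ F', CoeffHasDeriv (fun s => PowerSeries.C (s - c)⁻¹) F' t :=
  ⟨_, CoeffHasDeriv.C (((hasDerivAt_id t).sub_const c).inv (sub_ne_zero.2 hc))⟩

lemma exists_inv_sub' {c : ℂ} (hc : c ≠ t) :
    ∃ F', CoeffHasDeriv (fun s => PowerSeries.C (c - s)⁻¹) F' t :=
  ⟨_, CoeffHasDeriv.C (((hasDerivAt_id t).const_sub c).inv (sub_ne_zero.2 hc))⟩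

/-- `G` is the difference quotient of `F` at a zero of `F`, so it converges to the derivative. -/
lemma exists_tendsto_of_eq (hF : ∃ F', CoeffHasDeriv F F' t) (h0 : F t = 0)
    (hG : ∀ᶠ s in 𝓝[≠] t, F s = PowerSeries.C (s - t) * G s) :
    ∃ L, CoeffTendsto (𝓝[≠] t) G L := by
  obtain ⟨F', hF⟩ := hF
  refine ⟨F', hF.slope.congr' ?_⟩
  filter_upwards [hG, self_mem_nhdsWithin] with s hs hne
  rw [hs, h0, sub_zero, ← mul_assoc, ← map_mul, inv_mul_cancel₀ (sub_ne_zero.2 hne), map_one, one_mul]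

end CoeffHasDeriv

section FullCycles

open Equiv

variable {ι : Type*} [Fintype ι] [DecidableEq ι]

omit [DecidableEq ι] in
lemma IsFullCycle.card_le_two {c : Perm ι} (hc : IsFullCycle c Finset.univ) {p i : ι}
    (h1 : c p = i) (h2 : c i = p) : Fintype.card ι ≤ 2 := by
  classical
  have h : ∀ j, j ∈ ({p, i} : Finset ι) := by
    intro j
    obtain ⟨n, hn⟩ : ∃ n : ℕ, (c ^ n) p = j :=
      (hc.2 p (Finset.mem_univ _) j (Finset.mem_univ _)).exists_pow_eq'.imp fun n hn => hn.2
    subst hn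
    induction n with
    | zero => simp
    | succ n ih =>
      rw [pow_succ', Perm.mul_apply]
      rw [Finset.mem_insert, Finset.mem_singleton] at ih
      rcases ih with ih | ih <;> simp [ih, h1, h2]
  exact (Finset.card_le_card fun j _ => h j).trans Finset.card_le_two

lemma IsFullCycle.apply_ne {c : Perm ι} (hc : IsFullCycle c Finset.univ)
    (h : 2 ≤ Fintype.card ι) (j : ι) : c j ≠ j := by
  have : Nontrivial ι := Fintype.one_lt_card_iff_nontrivial.1 h
  exact Perm.mem_support.1 ((isFullCycle_univ.1 hc).2 ▸ Finset.mem_univ j)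

omit [DecidableEq ι] in
lemma isFullCycle_conj {c : Perm ι} (τ : Perm ι) :
    IsFullCycle (τ * c * τ⁻¹) Finset.univ ↔ IsFullCycle c Finset.univ := by
  simp only [IsFullCycle, Finset.mem_univ, not_true_eq_false, false_imp_iff, implies_true, true_and,
    true_imp_iff, Perm.sameCycle_conj]
  exact ⟨fun h u v => by simpa using h (τ u) (τ v), fun h u v => h _ _⟩

lemma cycSum_pair {R : Type*} [CommRing R] (T : Matrix ι ι R) {p i : ι} (hpi : p ≠ i)
    (h : ∀ j, j = p ∨ j = i) : cycSum T Finset.univ = -(T p i * T i p) := by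
  classical
  have hu : (Finset.univ : Finset ι) = {p, i} := by
    ext j; simpa using h j
  have h2 : Fintype.card ι = 2 := by rw [← Finset.card_univ, hu, Finset.card_pair hpi]
  rw [cycSum, Finset.sum_eq_single (swap p i)]
  · rw [Perm.sign_swap hpi, hu, Finset.prod_pair hpi]
    simp
  · intro c hc hne
    have hc' := (Finset.mem_filter.1 hc).2
    refine absurd (Equiv.ext fun j => ?_) hne
    have hp := (h (c p)).resolve_left (hc'.apply_ne h2.ge p)
    have hi := (h (c i)).resolve_right (hc'.apply_ne h2.ge i)
    rcases h j with rfl | rfl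
    · rw [hp, swap_apply_left]
    · rw [hi, swap_apply_right]
  · intro hn
    refine absurd (Finset.mem_filter.2 ⟨Finset.mem_univ _, fun j hj => absurd (Finset.mem_univ j) hj,
      fun u _ v _ => ?_⟩) hn
    have key : (swap p i).SameCycle p i := ⟨1, by simp⟩
    rcases h u with rfl | rfl <;> rcases h v with rfl | rfl
    · exact Perm.SameCycle.refl _ _
    · exact key
    · exact key.symm
    · exact Perm.SameCycle.refl _ _

end FullCycles

namespace WKBSolution

variable {r : ℕ} {Φ : RationalHConnection r} {x y : K} (S : WKBSolution Φ x y)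

lemma exists_deriv_invU_mul {t : ℂ} (ht : t ∈ S.D) (V : Matrix (Fin r) (Fin r) R₀) (i j : Fin r) :
    ∃ F', CoeffHasDeriv (fun s => ((S.U s)⁻¹ * V) i j) F' t := by
  simp only [Matrix.mul_apply]
  exact CoeffHasDeriv.exists_sum _ fun k _ => CoeffHasDeriv.exists_mul
    (S.exists_coeffHasDeriv_inv ht i k) ⟨_, CoeffHasDeriv.const _ _⟩

lemma exists_deriv_mul_U {t : ℂ} (ht : t ∈ S.D) (V : Matrix (Fin r) (Fin r) R₀) (i j : Fin r) :
    ∃ F', CoeffHasDeriv (fun s => (V * S.U s) i j) F' t := by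
  simp only [Matrix.mul_apply]
  exact CoeffHasDeriv.exists_sum _ fun k _ => CoeffHasDeriv.exists_mul
    ⟨_, CoeffHasDeriv.const _ _⟩ ⟨_, S.coeffHasDeriv_U ht k j⟩

variable {ι : Type*} [DecidableEq ι] (t : ι → ℂ) (b : ι → Fin r) (p : ι)

open Function (update)

lemma kern_update_of_ne {j k : ι} (hj : j ≠ p) (hk : k ≠ p) (s : ℂ) (a : Fin r) :
    S.kern (update t p s) (update b p a) j k = S.kern t b j k := by
  simp [kern, Function.update_of_ne, hj, hk]

lemma kern_update_left {k : ι} (hk : k ≠ p) (s : ℂ) (a : Fin r) :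
    S.kern (update t p s) (update b p a) p k =
      PowerSeries.C (s - t k)⁻¹ * ((S.U s)⁻¹ * S.U (t k)) a (b k) := by
  simp [kern, Function.update_of_ne, hk]

lemma kern_update_right {k : ι} (hk : k ≠ p) (s : ℂ) (a : Fin r) :
    S.kern (update t p s) (update b p a) k p =
      PowerSeries.C (t k - s)⁻¹ * ((S.U (t k))⁻¹ * S.U s) (b k) a := by
  simp [kern, Function.update_of_ne, hk]

variable {t b p}

lemma exists_deriv_kern (hD : ∀ j, t j ∈ S.D) (ht : Function.Injective t) {i : ι} (a : Fin r)
    {j k : ι} (hjk : j ≠ k) (h1 : ¬ (j = p ∧ k = i)) (h2 : ¬ (j = i ∧ k = p)) :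
    ∃ F', CoeffHasDeriv (fun s => S.kern (update t p s) (update b p a) j k) F' (t i) := by
  by_cases hj : j = p
  · subst hj
    simp only [S.kern_update_left t b _ (Ne.symm hjk)]
    exact CoeffHasDeriv.exists_mul (CoeffHasDeriv.exists_inv_sub fun h => h1 ⟨rfl, (ht h).symm⟩)
      (S.exists_deriv_invU_mul (hD i) _ _ _)
  · by_cases hk : k = p
    · subst hk
      simp only [S.kern_update_right t b _ hjk]
      exact CoeffHasDeriv.exists_mul (CoeffHasDeriv.exists_inv_sub' fun h => h2 ⟨ht h, rfl⟩)
        (S.exists_deriv_mul_U (hD i) _ _ _)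
    · simp only [S.kern_update_of_ne t b p hj hk]
      exact ⟨_, CoeffHasDeriv.const _ _⟩

variable [Fintype ι]

/-- A summand of `(s - t_i) W_n`, continued to `s = t_i`. -/
def coincTerm (t : ι → ℂ) (b : ι → Fin r) (p i : ι) (a : Fin r) (c : Equiv.Perm ι) (s : ℂ) : R₀ :=
  if c p = i then ((S.U s)⁻¹ * S.U (t i)) a (b i) *
    ∏ j ∈ Finset.univ.erase p, S.kern (update t p s) (update b p a) j (c j)
  else if c i = p then -((S.U (t i))⁻¹ * S.U s) (b i) a *
    ∏ j ∈ Finset.univ.erase i, S.kern (update t p s) (update b p a) j (c j)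
  else PowerSeries.C (s - t i) * ∏ j, S.kern (update t p s) (update b p a) j (c j)

lemma coincTerm_eq {i : ι} (hi : i ≠ p) (a : Fin r) (c : Equiv.Perm ι) {s : ℂ} (hs : s ≠ t i) :
    S.coincTerm t b p i a c s =
      PowerSeries.C (s - t i) * ∏ j, S.kern (update t p s) (update b p a) j (c j) := by
  have hC : (PowerSeries.C (s - t i) : R₀) * PowerSeries.C (s - t i)⁻¹ = 1 := by
    rw [← map_mul, mul_inv_cancel₀ (sub_ne_zero.2 hs), map_one]
  rw [coincTerm]
  split_ifs with h1 h2
  · rw [← Finset.mul_prod_erase _ _ (Finset.mem_univ p), h1, S.kern_update_left t b p hi,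
      ← mul_assoc, ← mul_assoc, hC, one_mul]
  · rw [← Finset.mul_prod_erase _ _ (Finset.mem_univ i), h2, S.kern_update_right t b p hi,
      ← mul_assoc, ← mul_assoc, ← neg_sub s (t i), inv_neg, map_neg, mul_neg, hC]
    ring
  · rfl

/-- A cycle on at least three elements cannot contain both steps `p → i` and `i → p`. So at most one
factor is singular at `s = t i`, and `coincTerm` has cancelled it against `s - t i`. -/
lemma exists_deriv_coincTerm (h3 : 3 ≤ Fintype.card ι) (hD : ∀ j, t j ∈ S.D)
    (ht : Function.Injective t) {i : ι} (a : Fin r) {c : Equiv.Perm ι}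
    (hc : IsFullCycle c Finset.univ) :
    ∃ F', CoeffHasDeriv (S.coincTerm t b p i a c) F' (t i) := by
  have h2 : ∀ j k, ¬ (c j = k ∧ c k = j) := fun j k h => by
    have := hc.card_le_two h.1 h.2; omega
  have hne := hc.apply_ne (by omega)
  unfold coincTerm
  split_ifs with hp hi
  · refine CoeffHasDeriv.exists_mul (S.exists_deriv_invU_mul (hD i) _ _ _)
      (CoeffHasDeriv.exists_prod _ fun j hj => S.exists_deriv_kern hD ht a (hne j).symm ?_ ?_)
    · exact fun h => (Finset.mem_erase.1 hj).1 h.1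
    · exact fun h => h2 p i ⟨hp, by rw [← h.1, h.2]⟩
  · refine CoeffHasDeriv.exists_mul ?_
      (CoeffHasDeriv.exists_prod _ fun j hj => S.exists_deriv_kern hD ht a (hne j).symm ?_ ?_)
    · obtain ⟨F', hF'⟩ := S.exists_deriv_mul_U (hD i) (S.U (t i))⁻¹ (b i) a
      exact ⟨_, hF'.neg⟩
    · exact fun h => hp (by rw [← h.1, h.2])
    · exact fun h => (Finset.mem_erase.1 hj).1 h.1
  · refine CoeffHasDeriv.exists_mul ⟨_, CoeffHasDeriv.C ((hasDerivAt_id _).sub_const _)⟩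
      (CoeffHasDeriv.exists_prod _ fun j _ => S.exists_deriv_kern hD ht a (hne j).symm ?_ ?_)
    · exact fun h => hp (by rw [← h.1, h.2])
    · exact fun h => hi (by rw [← h.1, h.2])

lemma coincTerm_self (hD : ∀ j, t j ∈ S.D) {i : ι} (a : Fin r) (c : Equiv.Perm ι) (ha : a ≠ b i) :
    S.coincTerm t b p i a c (t i) = 0 := by
  rw [coincTerm, S.inv_mul_U (hD i), sub_self, map_zero, one_apply_ne ha, one_apply_ne ha.symm]
  split_ifs <;> ring

/-- When both points agree and lie on the same sheet, `p` and `i` are interchangeable. Conjugation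
by their transposition exchanges the cycles with `p → i` and those with `i → p`, whose residues have
opposite signs. -/
lemma coincTerm_conj (h3 : 3 ≤ Fintype.card ι) (hD : ∀ j, t j ∈ S.D) {i : ι} (hi : i ≠ p)
    {c : Equiv.Perm ι} (hc : IsFullCycle c Finset.univ) :
    S.coincTerm t b p i (b i) (Equiv.swap p i * c * (Equiv.swap p i)⁻¹) (t i) =
      -S.coincTerm t b p i (b i) c (t i) := by
  have h2 : ∀ j k, ¬ (c j = k ∧ c k = j) := fun j k h => by
    have := hc.card_le_two h.1 h.2; omega
  set τ := Equiv.swap p i with hτ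
  have hτp : τ p = i := Equiv.swap_apply_left _ _
  have hτi : τ i = p := Equiv.swap_apply_right _ _
  have hτi' : τ⁻¹ i = p := by rw [hτ, Equiv.swap_inv]; exact hτi
  have hτp' : τ⁻¹ p = i := by rw [hτ, Equiv.swap_inv]; exact hτp
  have e1 : (τ * c * τ⁻¹) p = i ↔ c i = p := by
    rw [Equiv.Perm.mul_apply, Equiv.Perm.mul_apply, hτp', ← hτp, τ.injective.eq_iff]
  have e2 : (τ * c * τ⁻¹) i = p ↔ c p = i := by
    rw [Equiv.Perm.mul_apply, Equiv.Perm.mul_apply, hτi', ← hτi, τ.injective.eq_iff]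
  have ht' : ∀ j, update t p (t i) (τ j) = update t p (t i) j := by
    intro j
    rcases eq_or_ne j p with rfl | hp
    · rw [hτp]; simp [hi]
    · rcases eq_or_ne j i with rfl | hji
      · rw [hτi]; simp [hi]
      · rw [hτ, Equiv.swap_apply_of_ne_of_ne hp hji]
  have hb' : ∀ j, update b p (b i) (τ j) = update b p (b i) j := by
    intro j
    rcases eq_or_ne j p with rfl | hp
    · rw [hτp]; simp [hi]
    · rcases eq_or_ne j i with rfl | hji
      · rw [hτi]; simp [hi]
      · rw [hτ, Equiv.swap_apply_of_ne_of_ne hp hji]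
  have hk : ∀ j k, S.kern (update t p (t i)) (update b p (b i)) (τ j) (τ k) =
      S.kern (update t p (t i)) (update b p (b i)) j k := by
    intro j k
    simp only [kern, of_apply, ht', hb']
  have hprod : ∀ u v, τ v = u → ∏ j ∈ Finset.univ.erase u,
      S.kern (update t p (t i)) (update b p (b i)) j ((τ * c * τ⁻¹) j) =
      ∏ j ∈ Finset.univ.erase v, S.kern (update t p (t i)) (update b p (b i)) j (c j) := by
    rintro u v rfl
    symm
    refine Finset.prod_equiv τ (fun j => by simp) fun j _ => ?_
    have e : τ⁻¹ (τ j) = j := τ.symm_apply_apply j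
    rw [Equiv.Perm.mul_apply, Equiv.Perm.mul_apply, e, hk]
  rw [coincTerm, coincTerm, S.inv_mul_U (hD i), sub_self, map_zero, one_apply_eq]
  by_cases h : c p = i
  · have h' : ¬ c i = p := fun h' => h2 p i ⟨h, h'⟩
    rw [if_neg (fun h3 => h' (e1.1 h3)), if_pos (e2.2 h), if_pos h, hprod i p hτp]
    ring
  · by_cases h' : c i = p
    · rw [if_pos (e1.2 h'), if_neg h, if_pos h', hprod p i hτi]
      ring
    · rw [if_neg (fun h3 => h' (e1.1 h3)), if_neg (fun h3 => h (e2.1 h3)), if_neg h, if_neg h']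
      ring

/-- For `n ≥ 3` the correlator has a limit at coinciding points. -/
lemma exists_tendsto_corr (h3 : 3 ≤ Fintype.card ι) (hD : ∀ j, t j ∈ S.D)
    (ht : Function.Injective t) {i : ι} (hi : i ≠ p) (a : Fin r) :
    ∃ L, CoeffTendsto (𝓝[≠] (t i)) (fun s => S.corr (update t p s) (update b p a)) L := by
  classical
  refine CoeffHasDeriv.exists_tendsto_of_eq (F := fun s =>
    ∑ c : Equiv.Perm ι with IsFullCycle c Finset.univ, ((Equiv.Perm.sign c : ℤ) : R₀) *
      S.coincTerm t b p i a c s) ?_ ?_ ?_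
  · exact CoeffHasDeriv.exists_sum _ fun c hc => CoeffHasDeriv.exists_mul
      ⟨_, CoeffHasDeriv.const _ _⟩ (S.exists_deriv_coincTerm h3 hD ht a (Finset.mem_filter.1 hc).2)
  · by_cases ha : a = b i
    · subst ha
      have hself : ∀ f : R₀, -f = f → f = 0 := fun f hf => by
        ext k
        have := congrArg (PowerSeries.coeff k) hf
        rw [map_neg] at this
        rw [map_zero]
        exact self_eq_neg.1 this.symm
      -- Conjugation by the transposition permutes the full cycles and preserves their signs, while
      -- it negates `coincTerm`. Hence the sum equals its own negative.
      refine hself _ ?_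
      rw [← Finset.sum_neg_distrib]
      have hτ : Equiv.swap p i * Equiv.swap p i = 1 := Equiv.swap_mul_self _ _
      refine Finset.sum_equiv (MulAut.conj (Equiv.swap p i)).toEquiv (fun c => ?_) fun c hc => ?_
      · simp only [Finset.mem_filter, Finset.mem_univ, true_and, MulEquiv.toEquiv_eq_coe,
          EquivLike.coe_coe, MulAut.conj_apply, isFullCycle_conj]
      · simp only [MulEquiv.toEquiv_eq_coe, EquivLike.coe_coe, MulAut.conj_apply]
        rw [S.coincTerm_conj h3 hD hi (Finset.mem_filter.1 hc).2, map_mul, map_mul,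
          Equiv.Perm.sign_inv, mul_comm (Equiv.Perm.sign _), mul_assoc, Int.units_mul_self, mul_one]
        ring
    · exact Finset.sum_eq_zero fun c _ => by rw [S.coincTerm_self hD a c ha, mul_zero]
  · filter_upwards [self_mem_nhdsWithin] with s hs
    rw [corr, cycSum, Finset.mul_sum]
    refine Finset.sum_congr rfl fun c _ => ?_
    rw [S.coincTerm_eq hi a c hs]
    ring

/-- For `n = 2` this holds for the coefficients of positive order. -/
lemma exists_tendsto_corr_pair {i : ι} (h : ∀ j, j = p ∨ j = i) (hi : i ≠ p) (hti : t i ∈ S.D)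
    (a : Fin r) {k : ℕ} (hk : k ≠ 0) :
    ∃ L, Tendsto (fun s => PowerSeries.coeff k (S.corr (update t p s) (update b p a))) (𝓝[≠] (t i))
      (𝓝 L) := by
  have hlim : ∀ c d : Fin r, c ≠ d →
      ∃ L, CoeffTendsto (𝓝[≠] (t i)) (fun s => (PowerSeries.C (s - t i)⁻¹ *
        ((S.U s)⁻¹ * S.U (t i)) c d) * (PowerSeries.C (s - t i)⁻¹ *
          ((S.U (t i))⁻¹ * S.U s) d c)) L := by
    intro c d hcd
    obtain ⟨F', hF'⟩ := S.exists_deriv_invU_mul hti (S.U (t i)) c d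
    obtain ⟨G', hG'⟩ := S.exists_deriv_mul_U hti (S.U (t i))⁻¹ d c
    have h1 := hF'.slope
    have h2 := hG'.slope
    simp only [S.inv_mul_U hti, one_apply_ne hcd, one_apply_ne hcd.symm, sub_zero] at h1 h2
    exact ⟨_, h1.mul h2⟩
  have hcorr : ∀ s, S.corr (update t p s) (update b p a) = (PowerSeries.C (s - t i)⁻¹ *
        ((S.U s)⁻¹ * S.U (t i)) a (b i)) * (PowerSeries.C (s - t i)⁻¹ *
          ((S.U (t i))⁻¹ * S.U s) (b i) a) := by
    intro s
    rw [corr, cycSum_pair _ hi.symm h, S.kern_update_left t b p hi, S.kern_update_right t b p hi,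
      ← neg_sub s (t i), inv_neg, map_neg]
    ring
  by_cases ha : a = b i
  · subst ha
    choose! L hL using hlim
    have hs : CoeffTendsto (𝓝[≠] (t i)) (fun s => ∑ d ∈ Finset.univ.erase (b i),
        (PowerSeries.C (s - t i)⁻¹ * ((S.U s)⁻¹ * S.U (t i)) (b i) d) *
          (PowerSeries.C (s - t i)⁻¹ * ((S.U (t i))⁻¹ * S.U s) d (b i)))
        (∑ d ∈ Finset.univ.erase (b i), L (b i) d) :=
      CoeffTendsto.sum _ fun d hd => hL _ _ (Finset.mem_erase.1 hd).1.symm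
    refine ⟨_, ((hs k).neg).congr' ?_⟩
    filter_upwards [mem_nhdsWithin_of_mem_nhds (S.eventually_mem hti)] with s hsD
    -- On the same sheet the double pole persists, but the sum over all sheets `d` is `1 / (s - t
    -- i)²` exactly, without higher orders in `ħ`. The sheets `d ≠ b i` have finite limits, hence so
    -- do the positive orders on the sheet `b i`.
    have hone : ∑ d : Fin r, ((S.U s)⁻¹ * S.U (t i)) (b i) d * ((S.U (t i))⁻¹ * S.U s) d (b i) = 1 := by
      have h1 : ((S.U s)⁻¹ * S.U (t i)) * ((S.U (t i))⁻¹ * S.U s) = 1 := by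
        rw [Matrix.mul_assoc, ← Matrix.mul_assoc (S.U (t i)), S.U_mul_inv hti,
          Matrix.one_mul, S.inv_mul_U hsD]
      have h2 := congrFun (congrFun h1 (b i)) (b i)
      rwa [Matrix.mul_apply, one_apply_eq] at h2
    have hsum : ∑ d : Fin r, (PowerSeries.C (s - t i)⁻¹ * ((S.U s)⁻¹ * S.U (t i)) (b i) d) *
          (PowerSeries.C (s - t i)⁻¹ * ((S.U (t i))⁻¹ * S.U s) d (b i)) =
        PowerSeries.C ((s - t i)⁻¹ * (s - t i)⁻¹) := by
      rw [← mul_one (PowerSeries.C ((s - t i)⁻¹ * (s - t i)⁻¹)), ← hone, Finset.mul_sum]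
      refine Finset.sum_congr rfl fun d _ => ?_
      rw [map_mul]; ring
    rw [← Finset.add_sum_erase _ _ (Finset.mem_univ (b i)), ← hcorr] at hsum
    have := congrArg (PowerSeries.coeff k) hsum
    rw [map_add, PowerSeries.coeff_C, if_neg hk] at this
    exact (eq_neg_of_add_eq_zero_left this).symm
  · obtain ⟨L, hL⟩ := hlim a (b i) ha
    refine ⟨_, (hL k).congr fun s => ?_⟩
    rw [hcorr]

end WKBSolution

/-! ### The correlators as rational functions of one variable -/

open Filter Topology

/-- A rational function which has a finite limit along a filter has no pole. -/
lemma mem_regAt_of_tendsto {g : K} {z₀ : ℂ} {α : Type*} {l : Filter α} [l.NeBot] {φ : α → ℂ}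
    (hφ : Tendsto φ l (𝓝 z₀)) {w : α → ℂ} {L : ℂ} (hw : Tendsto w l (𝓝 L))
    (h : ∀ᶠ s in l, HasVal (φ s : OnePoint ℂ) g (w s)) : g ∈ regAt (z₀ : OnePoint ℂ) := by
  by_contra hg
  have hg0 : g ≠ 0 := fun h0 => hg (h0 ▸ (regAt _).zero_mem)
  have h1 : HasVal (z₀ : OnePoint ℂ) g⁻¹ 0 := by
    rw [HasVal, map_zero, sub_zero, ordAt_lt_one_iff_inv_not_mem (inv_ne_zero hg0), inv_inv]
    exact hg
  obtain ⟨h2, h3⟩ := HasVal.coe_iff.1 h1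
  have h4 : Tendsto (fun s => ratEval g⁻¹ (φ s)) l (𝓝 0) := by
    have := (hasDerivAt_ratEval h2).continuousAt.tendsto.comp hφ
    rwa [h3] at this
  have h5 : ∀ᶠ s in l, (g⁻¹).denom.eval (φ s) ≠ 0 :=
    ((g⁻¹).denom.continuous.continuousAt.tendsto.comp hφ).eventually_ne h2
  have h6 : ∀ᶠ s in l, w s * ratEval g⁻¹ (φ s) = 1 := by
    filter_upwards [h, h5] with s hs hs'
    have h7 := hs.mul (HasVal.coe_iff.2 ⟨hs', rfl⟩)
    rw [mul_inv_cancel₀ hg0, ← map_one RatFunc.C] at h7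
    exact h7.unique (HasVal.const _ _)
  have h8 := (hw.mul h4).congr' h6
  rw [mul_zero] at h8
  exact zero_ne_one (tendsto_nhds_unique h8 tendsto_const_nhds)

section BoundSeries

/-- The power series whose coefficients up to order `k` are bounded by `γ` at `q`. -/
def boundSeries (q : OnePoint ℂ) (k : ℕ) (γ : (regAt q).ValueGroup) : AddSubgroup (PowerSeries K) where
  carrier := {f | ∀ k' ≤ k, ordAt q (PowerSeries.coeff k' f) ≤ γ}
  zero_mem' k' _ := by simp
  add_mem' {f g} hf hg k' hk' := by
    rw [map_add]
    exact (Valuation.map_add _ _ _).trans (max_le (hf k' hk') (hg k' hk'))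
  neg_mem' {f} hf k' hk' := by rw [map_neg, Valuation.map_neg]; exact hf k' hk'

variable {q : OnePoint ℂ} {k : ℕ} {γ : (regAt q).ValueGroup} {f : PowerSeries K}

lemma map_C_mul_mem_boundSeries (s : R₀) (hf : f ∈ boundSeries q k γ) :
    PowerSeries.map (RatFunc.C : ℂ →+* K) s * f ∈ boundSeries q k γ := fun k' hk' => by
  rw [PowerSeries.coeff_mul]
  refine Valuation.map_sum_le _ fun p hp => ?_
  rw [map_mul, PowerSeries.coeff_map]
  have := Finset.HasAntidiagonal.mem_antidiagonal.1 hp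
  exact (mul_le_mul' (ordAt_le_one_iff.2 (C_mem_regAt _ _)) (hf _ (by omega))).trans (one_mul _).le

lemma C_mul_mem_boundSeries {α : K} {δ : (regAt q).ValueGroup} (hα : ordAt q α ≤ δ)
    (hf : f ∈ boundSeries q k γ) : PowerSeries.C α * f ∈ boundSeries q k (δ * γ) := fun k' hk' => by
  rw [PowerSeries.coeff_C_mul, map_mul]
  exact mul_le_mul' hα (hf k' hk')

end BoundSeries

namespace WKBSolution

variable {r : ℕ} {Φ : RationalHConnection r} {x y : K} (S : WKBSolution Φ x y)
  {N : ℕ → Matrix (Fin r) (Fin r) K} {ι : Type*} [Fintype ι] [DecidableEq ι] {t : ι → ℂ}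
  {b : ι → Fin r} {p : ι}

open Function (update)

open Classical in
/-- The correlator as a function of the point of the curve with the index `p`. -/
def oneVar (N : ℕ → Matrix (Fin r) (Fin r) K) (t : ι → ℂ) (b : ι → Fin r) (p : ι) : PowerSeries K :=
  ∑ c : Equiv.Perm ι with IsFullCycle c Finset.univ,
    PowerSeries.map (RatFunc.C : ℂ →+* K) (((Equiv.Perm.sign c : ℤ) : R₀) *
      ∏ j ∈ (Finset.univ.erase p).erase (c⁻¹ p), S.kern t b j (c j)) *
    (PowerSeries.C ((RatFunc.C (t (c⁻¹ p)) - x) * (x - RatFunc.C (t (c p))))⁻¹ *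
      ∑ u, ∑ v, PowerSeries.map (RatFunc.C : ℂ →+* K)
        ((S.U (t (c⁻¹ p)))⁻¹ (b (c⁻¹ p)) u * S.U (t (c p)) v (b (c p))) * expSeries N u v)

-- The point `p` enters a cycle through two adjacent factors only, and their product is linear in
-- the projector `M`. That is why the correlator is rational in this point.
omit [Fintype ι] in
lemma kern_mul_kern {i j : ι} (hi : i ≠ p) (hj : j ≠ p) (s : ℂ) (a : Fin r) :
    S.kern (update t p s) (update b p a) p j * S.kern (update t p s) (update b p a) i p =
      PowerSeries.C ((t i - s) * (s - t j))⁻¹ *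
        ∑ u, ∑ v, ((S.U (t i))⁻¹ (b i) u * S.U (t j) v (b j)) * S.M s (e a) u v := by
  rw [S.kern_update_left t b p hj, S.kern_update_right t b p hi, mul_inv, map_mul]
  simp only [Matrix.mul_apply, M_e_apply]
  have : ∑ u, ∑ v, (S.U (t i))⁻¹ (b i) u * S.U (t j) v (b j) * (S.U s u a * (S.U s)⁻¹ a v) =
      (∑ u, (S.U (t i))⁻¹ (b i) u * S.U s u a) * ∑ v, (S.U s)⁻¹ a v * S.U (t j) v (b j) := by
    rw [Finset.sum_mul_sum]
    exact Finset.sum_congr rfl fun u _ => Finset.sum_congr rfl fun v _ => by ring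
  rw [this]
  ring

lemma oneVar_mem_valSeries (hN : S.IsExpansion N) (hcurve : IsSmoothGenusZeroSpectralCurve Φ x y)
    (hA : S.Assumption5Star) (h2 : 2 ≤ Fintype.card ι) {s : ℂ} (hs : s ∈ S.D)
    (hts : ∀ j, j ≠ p → t j ≠ s) (a : Fin r) :
    (S.oneVar N t b p, S.corr (update t p s) (update b p a)) ∈
      valSeries (S.sheet a s : OnePoint ℂ) := by
  classical
  rw [oneVar, corr, cycSum]
  refine Subring.sum_pair_mem _ fun c hc => ?_
  have hne := (Finset.mem_filter.1 hc).2.apply_ne h2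
  have hp : c p ≠ p := hne p
  have hp' : c⁻¹ p ≠ p := fun h => hp (by nth_rewrite 1 [← h]; exact c.apply_symm_apply p)
  have hcp : c (c⁻¹ p) = p := c.apply_symm_apply p
  have e : ((Equiv.Perm.sign c : ℤ) : R₀) *
      ∏ j, S.kern (update t p s) (update b p a) j (c j) =
      (((Equiv.Perm.sign c : ℤ) : R₀) *
      ∏ j ∈ (Finset.univ.erase p).erase (c⁻¹ p), S.kern t b j (c j)) *
      (PowerSeries.C ((t (c⁻¹ p) - s) * (s - t (c p)))⁻¹ *
        ∑ u, ∑ v, ((S.U (t (c⁻¹ p)))⁻¹ (b (c⁻¹ p)) u * S.U (t (c p)) v (b (c p))) *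
          S.M s (e a) u v) := by
    rw [← S.kern_mul_kern hp' hp, ← Finset.mul_prod_erase _ _ (Finset.mem_univ p),
      ← Finset.mul_prod_erase _ _ (Finset.mem_erase.2 ⟨hp', Finset.mem_univ _⟩), hcp]
    have : ∏ j ∈ (Finset.univ.erase p).erase (c⁻¹ p),
        S.kern (update t p s) (update b p a) j (c j) =
        ∏ j ∈ (Finset.univ.erase p).erase (c⁻¹ p), S.kern t b j (c j) := by
      refine Finset.prod_congr rfl fun j hj => S.kern_update_of_ne t b p ?_ ?_ s a
      · exact (Finset.mem_erase.1 (Finset.mem_erase.1 hj).2).1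
      · intro h
        exact (Finset.mem_erase.1 hj).1 (c.injective (h.trans hcp.symm))
    rw [this]
    ring
  rw [e]
  have hx := S.hasVal_sheet a hs
  refine Subring.mul_pair_mem (map_C_mem_valSeries _) (Subring.mul_pair_mem
    (C_mem_valSeries (HasVal.inv ?_ ?_)) (Subring.sum_pair_mem _ fun u _ =>
      Subring.sum_pair_mem _ fun v _ => Subring.mul_pair_mem (map_C_mem_valSeries _)
        (hN.mem_valSeries hcurve hA a hs u v)))
  · exact Subring.mul_pair_mem (T := valPairs _) (Subring.sub_pair_mem (HasVal.const _ _) hx)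
      (Subring.sub_pair_mem hx (HasVal.const _ _))
  · exact mul_ne_zero (sub_ne_zero.2 (hts _ hp')) (sub_ne_zero.2 (hts _ hp).symm)

/-- The two factors `1 / (x - t)` are of order `v²` and are absorbed by `dx = -dv / v²`. The bound
`γ` depends on `N` alone, not on the other points; the common denominator rests on this. -/
lemma ordAt_oneVar_le (hcurve : IsSmoothGenusZeroSpectralCurve Φ x y) (h2 : 2 ≤ Fintype.card ι)
    {q : OnePoint ℂ} (hq : ∀ j, j ≠ p → ¬ HasVal q x (t j)) {k : ℕ} {γ : (regAt q).ValueGroup}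
    (hγ : ∀ k' ≤ k, ∀ u v, ordAt q (N k' u v) ≤ γ) :
    ordAt q (formFactor q * (PowerSeries.coeff k (S.oneVar N t b p) * ratDeriv x)) ≤ γ := by
  have hx := hcurve.nonconstant
  obtain ⟨j₀, hj₀⟩ : ∃ j, j ≠ p := by
    have : Nontrivial ι := Fintype.one_lt_card_iff_nontrivial.1 h2
    exact exists_ne p
  have hv0 : ordAt q (invCoord x (t j₀)) ≠ 0 :=
    (Valuation.ne_zero_iff _).2 (invCoord_ne_zero hx _)
  have hmem : S.oneVar N t b p ∈ boundSeries q k (ordAt q (invCoord x (t j₀)) ^ 2 * γ) := by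
    classical
    refine AddSubgroup.sum_mem _ fun c hc => ?_
    have hne := (Finset.mem_filter.1 hc).2.apply_ne h2
    have hp : c p ≠ p := hne p
    have hp' : c⁻¹ p ≠ p := fun h => hp (by nth_rewrite 1 [← h]; exact c.apply_symm_apply p)
    refine map_C_mul_mem_boundSeries _ (C_mul_mem_boundSeries ?_ (AddSubgroup.sum_mem _ fun u _ =>
      AddSubgroup.sum_mem _ fun v _ => map_C_mul_mem_boundSeries _ fun k' hk' => ?_))
    · have h1 := ordAt_invCoord_eq (hq _ hp') (hq _ hj₀)
      have h3 := ordAt_invCoord_eq (hq _ hp) (hq _ hj₀)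
      rw [invCoord, map_inv₀] at h1 h3
      rw [mul_inv, map_mul, map_inv₀, map_inv₀, ← Valuation.map_neg, neg_sub, h1, h3, ← pow_two]
    · rw [coeff_expSeries]
      exact hγ k' hk' u v
  have h1 := hmem k le_rfl
  have h3 := formRegularAt_ratDeriv_invCoord (hq _ hj₀)
  rw [ratDeriv_invCoord hx, map_mul, map_mul, Valuation.map_neg, map_pow] at h3
  rw [map_mul, map_mul]
  calc _ = (ordAt q (formFactor q) * ordAt q (ratDeriv x)) *
        ordAt q (PowerSeries.coeff k (S.oneVar N t b p)) := by
        rw [mul_assoc, mul_comm (ordAt q (ratDeriv x))]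
    _ ≤ (ordAt q (formFactor q) * ordAt q (ratDeriv x)) *
        (ordAt q (invCoord x (t j₀)) ^ 2 * γ) := mul_le_mul' le_rfl h1
    _ = (ordAt q (formFactor q) * (ordAt q (ratDeriv x) * ordAt q (invCoord x (t j₀)) ^ 2)) * γ := by
        simp only [mul_assoc]
    _ ≤ 1 * γ := mul_le_mul' h3 le_rfl
    _ = γ := one_mul _

lemma tendsto_sheet (a : Fin r) {t : ℂ} (ht : t ∈ S.D) :
    Tendsto (S.sheet a) (𝓝[≠] t) (𝓝 (S.sheet a t)) :=
  (S.hasDerivAt_sheet a ht).continuousAt.tendsto.mono_left nhdsWithin_le_nhds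

/-- The coefficients of the correlators, as one-forms in one of the variables. -/
theorem exists_oneVar (hN : S.IsExpansion N) (hcurve : IsSmoothGenusZeroSpectralCurve Φ x y)
    (hA : S.Assumption5Star) (h2 : 2 ≤ Fintype.card ι) (hD : ∀ j, t j ∈ S.D)
    (ht : Function.Injective t) (b : ι → Fin r) (p : ι) {k : ℕ}
    (hk : 3 ≤ Fintype.card ι ∨ k ≠ 0) :
    ∃ g : K, (∀ a, ∀ s ∈ S.D, (∀ j, j ≠ p → t j ≠ s) → HasVal (S.sheet a s : OnePoint ℂ) g
        (PowerSeries.coeff k (S.corr (update t p s) (update b p a)) *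
          ratEval (ratDeriv x) (S.sheet a s))) ∧
      (∀ q, ¬ IsRamified x q → FormRegularAt g q) ∧
      ∀ q, IsRamified x q → ∀ γ, (∀ k' ≤ k, ∀ u v, ordAt q (N k' u v) ≤ γ) →
        ordAt q (formFactor q * g) ≤ γ := by
  have hval : ∀ a, ∀ s ∈ S.D, (∀ j, j ≠ p → t j ≠ s) → HasVal (S.sheet a s : OnePoint ℂ)
        (PowerSeries.coeff k (S.oneVar N t b p) * ratDeriv x)
        (PowerSeries.coeff k (S.corr (update t p s) (update b p a)) *
          ratEval (ratDeriv x) (S.sheet a s)) := fun a s hs hts =>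
    (S.oneVar_mem_valSeries hN hcurve hA h2 hs hts a k).mul
      (HasVal.coe_iff.2 ⟨S.ratDeriv_sheet_mem a hs, rfl⟩)
  refine ⟨PowerSeries.coeff k (S.oneVar N t b p) * ratDeriv x, hval, fun q hq => ?_,
    fun q hq γ hγ => S.ordAt_oneVar_le hcurve h2
      (fun j _ => S.not_hasVal_of_isRamified hcurve hq (hD j)) hγ⟩
  -- Over another insertion point `oneVar` has apparent poles, which the finite limit of the
  -- correlator excludes. At the other unramified points regularity of `N` is enough.
  by_cases h : ∃ i, i ≠ p ∧ HasVal q x (t i)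
  · obtain ⟨i, hi, hqi⟩ := h
    obtain ⟨a, rfl⟩ := S.exists_sheet hcurve (hD i) hqi
    have hlim : ∃ L, Tendsto (fun s => PowerSeries.coeff k
        (S.corr (update t p s) (update b p a))) (𝓝[≠] (t i)) (𝓝 L) := by
      by_cases h3 : 3 ≤ Fintype.card ι
      · obtain ⟨L, hL⟩ := S.exists_tendsto_corr (b := b) h3 hD ht hi a
        exact ⟨_, hL k⟩
      · refine S.exists_tendsto_corr_pair (fun j => ?_) hi (hD i) a (hk.resolve_left h3)
        by_contra! hj
        have hc : ({p, i, j} : Finset ι).card = 3 := by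
          rw [Finset.card_eq_three]
          exact ⟨p, i, j, hi.symm, hj.1.symm, hj.2.symm, rfl⟩
        exact h3 (hc ▸ Finset.card_le_univ _)
    obtain ⟨L, hL⟩ := hlim
    have hx' : Tendsto (fun s => ratEval (ratDeriv x) (S.sheet a s)) (𝓝[≠] (t i))
        (𝓝 (ratEval (ratDeriv x) (S.sheet a (t i)))) :=
      (hasDerivAt_ratEval (S.ratDeriv_sheet_mem a (hD i))).continuousAt.tendsto.comp
        (S.tendsto_sheet a (hD i))
    rw [formRegularAt_iff]
    refine ordAt_le_one_iff.2 (((regAt _).mul_mem _ _ (by exact (regAt _).one_mem)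
      (mem_regAt_of_tendsto (S.tendsto_sheet a (hD i)) (hL.mul hx') ?_)))
    have hne : ∀ᶠ s in 𝓝[≠] (t i), ∀ j, j ≠ p → t j ≠ s := by
      rw [eventually_all]
      intro j
      by_cases hji : j = i
      · subst hji
        filter_upwards [self_mem_nhdsWithin] with s hs _ h'
        exact hs h'.symm
      · filter_upwards [mem_nhdsWithin_of_mem_nhds (isOpen_ne.mem_nhds
          (fun h => hji (ht h.symm) : t i ≠ t j))] with s hs _ h'
        exact hs h'.symm
    filter_upwards [mem_nhdsWithin_of_mem_nhds (S.eventually_mem (hD i)), hne] with s hs hs'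
    exact hval a s hs hs'
  · push Not at h
    rw [formRegularAt_iff]
    exact S.ordAt_oneVar_le hcurve h2 h fun k' _ u v => ordAt_le_one_iff.2 (hN.mem hcurve hA hq k' u v)

end WKBSolution

/-! ### The order in `ħ` of the correlators -/

open Filter Topology

lemma CoeffHasDeriv.comp_affine {F : ℂ → R₀} {F' : R₀} {s : ℂ} (h : CoeffHasDeriv F F' s) (c : ℂ) :
    CoeffHasDeriv (fun ε => F (s + ε * c)) (PowerSeries.C c * F') 0 := fun k => by
  have h1 : HasDerivAt (fun ε : ℂ => s + ε * c) c 0 := by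
    simpa using ((hasDerivAt_id (0 : ℂ)).mul_const c).const_add s
  have h2 := HasDerivAt.comp (h₂ := fun s => PowerSeries.coeff k (F s)) (0 : ℂ) (by
    simpa using h k) h1
  rw [PowerSeries.coeff_C_mul, mul_comm]
  exact h2

lemma X_pow_dvd_of_tendsto {α : Type*} {l : Filter α} [l.NeBot] {F : α → R₀} {f : R₀}
    (hF : CoeffTendsto l F f) {m : ℕ} (h : ∀ᶠ s in l, PowerSeries.X ^ m ∣ F s) :
    PowerSeries.X ^ m ∣ f := by
  rw [PowerSeries.X_pow_dvd_iff]
  intro k hk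
  refine tendsto_nhds_unique (hF k) (tendsto_const_nhds.congr' ?_)
  filter_upwards [h] with s hs
  exact (PowerSeries.X_pow_dvd_iff.1 hs k hk).symm

namespace WKBSolution

variable {r n : ℕ} {Φ : RationalHConnection r} {x y : K} (S : WKBSolution Φ x y)

/-- The limit of the matrices `kern` for `r` points on the different sheets which converge to the
same point of the base. -/
def limKern (s : ℂ) (t : Fin n → ℂ) (b : Fin n → Fin r) :
    Matrix (Fin r ⊕ Fin n) (Fin r ⊕ Fin n) R₀ :=
  fromBlocks (of fun c d => if c = d then 0 else -((S.U s)⁻¹ * S.dU s) c d)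
    (of fun c i => S.kern (Sum.elim (fun _ : Fin r => s) t) (Sum.elim id b) (Sum.inl c) (Sum.inr i))
    (of fun i c => S.kern (Sum.elim (fun _ : Fin r => s) t) (Sum.elim id b) (Sum.inr i) (Sum.inl c))
    (S.kern t b)

lemma loopMat_eq (a : Fin r) {s : ℂ} (hs : s ∈ S.D) (t : Fin n → ℂ) (b : Fin n → Fin r)
    {i j : Fin r ⊕ Fin n} (hij : i ≠ j) :
    S.loopMat a s t b i j =
      Sum.elim (fun _ => (PowerSeries.X : R₀)) (fun _ => 1) i * S.limKern s t b i j := by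
  rcases i with c | i <;> rcases j with d | j
  · have hcd : c ≠ d := fun h => hij (h ▸ rfl)
    simp [loopMat, limKern, S.diagBlock_eq a hs, hcd]
  · simp [loopMat, limKern]
  · simp [loopMat, limKern]
  · simp [loopMat, limKern]

/-- The points `s + ε c`, `c ∈ Fin r`, together with the points `t i`. -/
def spread (s : ℂ) (t : Fin n → ℂ) (ε : ℂ) : Fin r ⊕ Fin n → ℂ :=
  Sum.elim (fun c : Fin r => s + ε * (c : ℕ)) t

/-- At `ε = 0` the off-diagonal entry vanishes, and its derivative is `(c - d) (-U⁻¹ U')`, because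
`(U⁻¹)' U = -U⁻¹ U'`. The factor `c - d` cancels against the denominator `ε (c - d)`; the different
speeds keep the points apart. -/
lemma tendsto_kern_same {s : ℂ} (hs : s ∈ S.D) {c d : Fin r} (hcd : c ≠ d) :
    CoeffTendsto (𝓝[≠] (0 : ℂ)) (fun ε => PowerSeries.C ((s + ε * (c : ℕ)) - (s + ε * (d : ℕ)))⁻¹ *
      ((S.U (s + ε * (c : ℕ)))⁻¹ * S.U (s + ε * (d : ℕ))) c d) (-((S.U s)⁻¹ * S.dU s) c d) := by
  choose W hW using fun i j => S.exists_coeffHasDeriv_inv hs i j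
  have hWU : of W * S.U s = -((S.U s)⁻¹ * S.dU s) := by
    ext1 i j
    have h1 : CoeffHasDeriv (fun u => ∑ k, (S.U u)⁻¹ i k * S.U u k j)
        (∑ k, (W i k * S.U s k j + (S.U s)⁻¹ i k * S.dU s k j)) s :=
      CoeffHasDeriv.sum _ fun k _ => (hW i k).mul (S.coeffHasDeriv_U hs k j)
    have h2 : CoeffHasDeriv (fun u => ∑ k, (S.U u)⁻¹ i k * S.U u k j) 0 s := by
      refine (CoeffHasDeriv.const ((1 : Matrix (Fin r) (Fin r) R₀) i j) s).congr ?_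
      filter_upwards [S.eventually_mem hs] with u hu
      rw [← S.inv_mul_U hu, Matrix.mul_apply]
    have h3 := h1.unique h2
    rw [Finset.sum_add_distrib] at h3
    rw [Matrix.neg_apply, Matrix.mul_apply, Matrix.mul_apply]
    exact eq_neg_of_add_eq_zero_left h3
  have hF : CoeffHasDeriv (fun ε => ((S.U (s + ε * (c : ℕ)))⁻¹ * S.U (s + ε * (d : ℕ))) c d)
      (PowerSeries.C ((c : ℕ) - (d : ℕ) : ℂ) * -((S.U s)⁻¹ * S.dU s) c d) 0 := by
    have h1 := CoeffHasDeriv.sum Finset.univ fun k _ =>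
      ((hW c k).comp_affine (c : ℕ)).mul ((S.coeffHasDeriv_U hs k d).comp_affine (d : ℕ))
    simp only [Matrix.mul_apply]
    convert h1 using 1
    simp only [zero_mul, add_zero]
    rw [Finset.sum_add_distrib]
    have e1 : ∑ k, PowerSeries.C ((c : ℕ) : ℂ) * W c k * S.U s k d =
        PowerSeries.C ((c : ℕ) : ℂ) * -((S.U s)⁻¹ * S.dU s) c d := by
      rw [← Matrix.neg_apply, ← hWU, Matrix.mul_apply, Finset.mul_sum]
      exact Finset.sum_congr rfl fun k _ => by rw [of_apply, mul_assoc]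
    have e2 : ∑ k, (S.U s)⁻¹ c k * (PowerSeries.C ((d : ℕ) : ℂ) * S.dU s k d) =
        PowerSeries.C ((d : ℕ) : ℂ) * ((S.U s)⁻¹ * S.dU s) c d := by
      rw [Matrix.mul_apply, Finset.mul_sum]
      exact Finset.sum_congr rfl fun k _ => by ring
    rw [e1, e2, ← Matrix.mul_apply, map_sub]
    ring
  have hne : ((c : ℕ) - (d : ℕ) : ℂ) ≠ 0 :=
    sub_ne_zero.2 fun h => hcd (Fin.ext (Nat.cast_injective h))
  have hs1 := hF.slope
  have h0 : ((S.U s)⁻¹ * S.U s) c d = 0 := by rw [S.inv_mul_U hs, one_apply_ne hcd]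
  simp only [zero_mul, add_zero, h0, sub_zero] at hs1
  have h4 := (CoeffTendsto.const (PowerSeries.C ((c : ℕ) - (d : ℕ) : ℂ)⁻¹) (𝓝[≠] (0 : ℂ))).mul hs1
  rw [← mul_assoc, ← map_mul, inv_mul_cancel₀ hne, map_one, one_mul] at h4
  refine h4.congr' (Eventually.of_forall fun ε => ?_)
  rw [← mul_assoc, ← map_mul]
  congr 2
  rw [add_sub_add_left_eq_sub, ← mul_sub, mul_inv, mul_comm]

lemma tendsto_kern_spread {s : ℂ} (hs : s ∈ S.D) {t : Fin n → ℂ} (hts : ∀ i, t i ≠ s)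
    (b : Fin n → Fin r) (i j : Fin r ⊕ Fin n) :
    CoeffTendsto (𝓝[≠] (0 : ℂ)) (fun ε => S.kern (spread s t ε) (Sum.elim id b) i j)
      (S.limKern s t b i j) := by
  have haff : ∀ c : Fin r, Tendsto (fun ε : ℂ => s + ε * (c : ℕ)) (𝓝[≠] (0 : ℂ)) (𝓝 s) := fun c => by
    have : Tendsto (fun ε : ℂ => s + ε * (c : ℕ)) (𝓝 0) (𝓝 (s + 0 * (c : ℕ))) :=
      (by fun_prop : Continuous fun ε : ℂ => s + ε * (c : ℕ)).tendsto 0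
    rw [zero_mul, add_zero] at this
    exact this.mono_left nhdsWithin_le_nhds
  rcases i with c | i <;> rcases j with d | j
  · by_cases hcd : c = d
    · subst hcd
      -- On the diagonal `kern` is zero, by the convention `0⁻¹ = 0`.
      simpa [limKern, kern, spread] using CoeffTendsto.const (0 : R₀) (𝓝[≠] (0 : ℂ))
    · have := S.tendsto_kern_same hs hcd
      simp only [limKern, fromBlocks_apply₁₁, of_apply, if_neg hcd]
      exact this
  · obtain ⟨F', hF'⟩ := S.exists_deriv_invU_mul hs (S.U (t j)) c (b j)
    obtain ⟨G', hG'⟩ := CoeffHasDeriv.exists_inv_sub (hts j).symm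
    exact ((hG'.mul hF').tendsto).comp (haff c)
  · obtain ⟨F', hF'⟩ := S.exists_deriv_mul_U hs (S.U (t i))⁻¹ (b i) d
    obtain ⟨G', hG'⟩ := CoeffHasDeriv.exists_inv_sub' (hts i)
    exact ((hG'.mul hF').tendsto).comp (haff d)
  · exact CoeffTendsto.const _ _

/-- The correlators of at least two points vanish to the order `min n k - 2`. -/
def OrderBound (k : ℕ) : Prop :=
  ∀ (m : ℕ), 2 ≤ m → ∀ (t : Fin m → ℂ) (b : Fin m → Fin r), (∀ i, t i ∈ S.D) →
    Function.Injective t → (PowerSeries.X : R₀) ^ (min m k - 2) ∣ S.corr t b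

lemma eventually_spread {s : ℂ} (hs : s ∈ S.D) {t : Fin n → ℂ} (hD : ∀ i, t i ∈ S.D)
    (ht : Function.Injective t) (hts : ∀ i, t i ≠ s) :
    ∀ᶠ ε in 𝓝[≠] (0 : ℂ), (∀ i : Fin r ⊕ Fin n, spread s t ε i ∈ S.D) ∧
      Function.Injective (spread (r := r) s t ε) := by
  have hU : (S.D ∩ {u | ∀ i, t i ≠ u}) ∈ 𝓝 s := by
    refine inter_mem (S.eventually_mem hs) ?_
    have : ∀ᶠ u in 𝓝 s, ∀ i, t i ≠ u := by
      rw [eventually_all]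
      intro i
      filter_upwards [isOpen_ne.mem_nhds (hts i).symm] with u hu h
      exact hu h.symm
    exact this
  have haff : ∀ᶠ ε in 𝓝 (0 : ℂ), ∀ c : Fin r,
      s + ε * (c : ℕ) ∈ S.D ∩ {u | ∀ i, t i ≠ u} := by
    rw [eventually_all]
    intro c
    have : Tendsto (fun ε : ℂ => s + ε * (c : ℕ)) (𝓝 0) (𝓝 (s + 0 * (c : ℕ))) :=
      (by fun_prop : Continuous fun ε : ℂ => s + ε * (c : ℕ)).tendsto 0
    rw [zero_mul, add_zero] at this
    exact this hU
  filter_upwards [mem_nhdsWithin_of_mem_nhds haff, self_mem_nhdsWithin] with ε hε hne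
  refine ⟨fun i => ?_, fun i j hij => ?_⟩
  · rcases i with c | i
    · exact (hε c).1
    · exact hD i
  · rcases i with c | i <;> rcases j with d | j
    · have h1 : ε * (c : ℕ) = ε * (d : ℕ) := add_left_cancel hij
      have h2 := Nat.cast_injective (mul_left_cancel₀ hne h1)
      rw [Fin.ext h2]
    · exact absurd hij.symm ((hε c).2 j)
    · exact absurd hij ((hε d).2 i)
    · rw [ht hij]

/-- For small `ε ≠ 0` the points are distinct and in `D`, so the cycle sum is a true correlator and
obeys the induction hypothesis. Divisibility by a power of `ħ` passes to coefficientwise limits. -/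
lemma pow_dvd_cycSum_limKern {k : ℕ} (hk : S.OrderBound k) {s : ℂ} (hs : s ∈ S.D) {t : Fin n → ℂ}
    (hD : ∀ i, t i ∈ S.D) (ht : Function.Injective t) (hts : ∀ i, t i ≠ s) (b : Fin n → Fin r)
    {B : Finset (Fin r ⊕ Fin n)} (hB : 2 ≤ B.card) :
    (PowerSeries.X : R₀) ^ (min B.card k - 2) ∣ cycSum (S.limKern s t b) B := by
  classical
  have hlim : CoeffTendsto (𝓝[≠] (0 : ℂ))
      (fun ε => cycSum (S.kern (spread s t ε) (Sum.elim id b)) B) (cycSum (S.limKern s t b) B) :=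
    CoeffTendsto.sum _ fun c _ => (CoeffTendsto.const _ _).mul
      (CoeffTendsto.prod _ fun j _ => S.tendsto_kern_spread hs hts b j (c j))
  refine X_pow_dvd_of_tendsto hlim ?_
  filter_upwards [S.eventually_spread hs hD ht hts] with ε hε
  let f : Fin B.card ↪ Fin r ⊕ Fin n := B.equivFin.symm.toEmbedding.trans (Function.Embedding.subtype _)
  have hf : Finset.univ.map f = B := by
    ext j
    simp only [Finset.mem_map, Finset.mem_univ, true_and]
    constructor
    · rintro ⟨i, rfl⟩
      exact (B.equivFin.symm i).2
    · intro hj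
      exact ⟨B.equivFin ⟨j, hj⟩, by simp [f]⟩
  have h := hk B.card hB (spread s t ε ∘ f) (Sum.elim id b ∘ f) (fun i => hε.1 _)
    (hε.2.comp f.injective)
  have e : cycSum (S.kern (spread s t ε) (Sum.elim id b)) B =
      S.corr (spread s t ε ∘ f) (Sum.elim id b ∘ f) := by
    have h1 := cycSum_map (S.kern (spread s t ε) (Sum.elim id b)) f
    rw [hf] at h1
    exact h1
  rw [e]
  exact h

lemma prod_sumElim (B : Finset (Fin r ⊕ Fin n)) :
    ∏ i ∈ B, Sum.elim (fun _ : Fin r => (PowerSeries.X : R₀)) (fun _ : Fin n => 1) i =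
      PowerSeries.X ^ (B ∩ Finset.disjSum Finset.univ ∅).card := by
  rw [← Finset.prod_subset (Finset.inter_subset_left (s₂ := Finset.disjSum Finset.univ ∅)),
    Finset.prod_congr rfl (g := fun _ => (PowerSeries.X : R₀)), Finset.prod_const]
  · intro i hi
    rcases i with c | i
    · rfl
    · simp at hi
  · intro i hi hi'
    rcases i with c | i
    · simp [hi] at hi'
    · rfl

lemma cycSum_loopMat (a : Fin r) {s : ℂ} (hs : s ∈ S.D) (t : Fin n → ℂ) (b : Fin n → Fin r)
    {B : Finset (Fin r ⊕ Fin n)} (hB : 2 ≤ B.card) :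
    cycSum (S.loopMat a s t b) B =
      PowerSeries.X ^ (B ∩ Finset.disjSum Finset.univ ∅).card * cycSum (S.limKern s t b) B := by
  rw [← prod_sumElim, ← cycSum_scale]
  exact cycSum_congr (fun i _ j _ hij => S.loopMat_eq a hs t b hij) hB

end WKBSolution

/-! ### Leading order of the loop determinant and the induction on the order -/

section Diagonal

variable {ι : Type*} [Fintype ι] [DecidableEq ι] {R : Type*} [CommRing R]

lemma permSum_of_diagonal {T : Matrix ι ι R} {C : Finset ι}
    (h : ∀ i ∈ C, ∀ j ∈ C, i ≠ j → T i j = 0) : permSum T C = ∏ j ∈ C, T j j := by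
  rw [permSum, Finset.sum_eq_single 1]
  · simp
  · intro π hπ hne
    have hfix := (Finset.mem_filter.1 hπ).2
    obtain ⟨j, hj⟩ : ∃ j, π j ≠ j := by
      by_contra! hall
      exact hne (Equiv.ext hall)
    have hjC : j ∈ C := by_contra fun hjC => hj (hfix j hjC)
    rw [Finset.prod_eq_zero hjC (h j hjC (π j) ((apply_mem_of_fixes hfix).2 hjC) hj.symm), mul_zero]
  · intro hn
    exact absurd (Finset.mem_filter.2 ⟨Finset.mem_univ _, fun _ _ => rfl⟩) hn

lemma cluster_eq_permSum (T : Matrix ι ι R) {A C : Finset ι} {pick : Finset ι → ι}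
    (hpick : ∀ D : Finset ι, D.Nonempty → pick D ∈ D) (hC : C ⊆ A) :
    cluster (cycSum T) A pick C = permSum T C := by
  rw [permSum_eq_cluster A pick T hpick, Finset.sdiff_eq_empty_iff_subset.2 hC,
    Finset.powerset_empty, Finset.sum_singleton, Finset.sdiff_empty, permSum_empty, mul_one]

end Diagonal

namespace WKBSolution

variable {r n : ℕ} {Φ : RationalHConnection r} {x y : K} (S : WKBSolution Φ x y)

lemma constantCoeff_diagBlock (a : Fin r) {s : ℂ} (hs : s ∈ S.D) (c d : Fin r) :
    PowerSeries.constantCoeff (S.diagBlock a s c d) = if c = d then S.eig a s - S.eig c s else 0 := by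
  rw [S.diagBlock_eq a hs, Matrix.sub_apply, Matrix.smul_apply, smul_eq_mul, map_sub, map_mul,
    PowerSeries.constantCoeff_X, zero_mul, sub_zero]
  split_ifs with h
  · subst h
    have := S.leading_Y c s hs
    rw [PowerSeries.coeff_zero_eq_constantCoeff_apply] at this
    rw [diagonal_apply_eq, map_sub, PowerSeries.constantCoeff_C, this, eig, eig]
  · rw [diagonal_apply_ne _ h, map_zero]

lemma constantCoeff_permSum (a : Fin r) {s : ℂ} (hs : s ∈ S.D) (t : Fin n → ℂ) (b : Fin n → Fin r) :
    PowerSeries.constantCoeff (permSum (S.loopMat a s t b)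
      (Finset.disjSum (Finset.univ.erase a) ∅)) = S.eigProd a s := by
  rw [← permSum_map, permSum_of_diagonal, eigProd]
  · rw [Finset.disjSum_empty, Finset.prod_map]
    refine Finset.prod_congr rfl fun c _ => ?_
    change PowerSeries.constantCoeff (S.diagBlock a s c c) = _
    rw [S.constantCoeff_diagBlock a hs, if_pos rfl]
  · intro i hi j hj hij
    rcases i with c | i <;> rcases j with d | j
    · change PowerSeries.constantCoeff (S.diagBlock a s c d) = _
      rw [S.constantCoeff_diagBlock a hs, if_neg (fun h : c = d => hij (h ▸ rfl))]
    · simp at hj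
    · simp at hi
    · simp at hi

/-- The leading order of the loop determinant on a sheet. -/
lemma coeff_cluster_loopMat {k : ℕ} (h2 : 2 ≤ k) (hk : S.OrderBound k) (hkn : k ≤ n) (a : Fin r)
    {s : ℂ} (hs : s ∈ S.D) {t : Fin n → ℂ} (hD : ∀ i, t i ∈ S.D) (ht : Function.Injective t)
    (hts : ∀ i, t i ≠ s) (b : Fin n → Fin r) :
    ∃ pick : Finset (Fin r ⊕ Fin n) → Fin r ⊕ Fin n, (∀ D, D.Nonempty → pick D ∈ D) ∧
      PowerSeries.coeff (k - 1) (cluster (cycSum (S.loopMat a s t b))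
        (Finset.disjSum Finset.univ ∅) pick Finset.univ) =
      PowerSeries.coeff (k - 2) (S.corr (Fin.cons s t : Fin (n + 1) → ℂ) (Fin.cons a b : Fin (n + 1) → Fin r)) * S.eigProd a s := by
  classical
  set A : Finset (Fin r ⊕ Fin n) := Finset.disjSum Finset.univ ∅ with hAdef
  -- The cycle through `Sum.inl a` is split off first, which exposes the main term.
  let pick : Finset (Fin r ⊕ Fin n) → Fin r ⊕ Fin n := fun D =>
    if Sum.inl a ∈ D then Sum.inl a else if h : D.Nonempty then h.choose else Sum.inl a
  have hpick : ∀ D : Finset (Fin r ⊕ Fin n), D.Nonempty → pick D ∈ D := fun D hD => by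
    simp only [pick]
    split_ifs with h
    · exact h
    · exact hD.choose_spec
  refine ⟨pick, hpick, ?_⟩
  have haA : Sum.inl a ∈ A := by simp [hAdef]
  have hcompl : Finset.univ \ A = Finset.disjSum ∅ (Finset.univ : Finset (Fin n)) := by
    ext i; rcases i with c | i <;> simp [hAdef]
  -- A block of at least two elements has weight `ħ ^ |B ∩ A|` from its rows times `ħ ^ (min |B| k -
  -- 2)` from the induction hypothesis, and the singleton `{a}` has weight `y - Y_a = O(ħ)`.
  have hmain := cluster_main_term (R := R₀) (X := PowerSeries.X) (k := k) (A := A) (a := Sum.inl a)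
    (κ := cycSum (S.loopMat a s t b)) (pick := pick) h2 haA hpick ?_ ?_ Finset.univ
    (Finset.mem_univ _) ?_ ?_
  rotate_left
  · intro B hB hBA
    rw [S.cycSum_loopMat a hs t b hB]
    have h3 : (B ∩ A).card + min B.card k - 2 = (B ∩ A).card + (min B.card k - 2) := by
      have : 2 ≤ min B.card k := le_min hB h2
      omega
    rw [h3, pow_add]
    exact mul_dvd_mul dvd_rfl (S.pow_dvd_cycSum_limKern hk hs hD ht hts b hB)
  · rw [cycSum_singleton, PowerSeries.X_dvd_iff]
    change PowerSeries.constantCoeff (S.diagBlock a s a a) = 0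
    rw [S.constantCoeff_diagBlock a hs, if_pos rfl, sub_self]
  · rw [Finset.univ_inter]
    simp only [pick, if_pos haA]
  · rw [hcompl, Finset.card_disjSum]
    simpa using hkn
  rw [hcompl] at hmain
  have hrest : Finset.univ \ insert (Sum.inl a) (Finset.disjSum ∅ (Finset.univ : Finset (Fin n))) =
      Finset.disjSum (Finset.univ.erase a) ∅ := by
    ext i; rcases i with c | i <;> simp
  rw [hrest, cluster_eq_permSum _ hpick (Finset.disjSum_mono (Finset.erase_subset _ _) le_rfl)] at hmain
  set B : Finset (Fin r ⊕ Fin n) := insert (Sum.inl a) (Finset.disjSum ∅ (Finset.univ : Finset (Fin n))) with hB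
  let f : Fin (n + 1) ↪ Fin r ⊕ Fin n :=
    ⟨Fin.cons (Sum.inl a) Sum.inr, by
      rw [Fin.cons_injective_iff]
      exact ⟨by simp, Sum.inr_injective⟩⟩
  have hf : Finset.univ.map f = B := by
    ext i
    simp only [Finset.mem_map, Finset.mem_univ, true_and, Fin.exists_fin_succ, f,
      Function.Embedding.coeFn_mk, Fin.cons_zero, Fin.cons_succ, hB, Finset.mem_insert]
    rcases i with c | i <;> simp [eq_comm]
  have hBc : B.card = n + 1 := by rw [← hf, Finset.card_map, Finset.card_univ, Fintype.card_fin]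
  have hBA : (B ∩ A).card = 1 := by
    have : B ∩ A = {Sum.inl a} := by
      ext i; rcases i with c | i <;> simp [hB, hAdef]
    rw [this, Finset.card_singleton]
  have hκ : cycSum (S.loopMat a s t b) B = PowerSeries.X * S.corr (Fin.cons s t : Fin (n + 1) → ℂ) (Fin.cons a b : Fin (n + 1) → Fin r) := by
    rw [S.cycSum_loopMat a hs t b (by omega), hBA, pow_one]
    congr 1
    have h4 := cycSum_map (S.limKern s t b) f
    rw [hf] at h4
    rw [h4, corr]
    refine cycSum_congr (fun i _ j _ hij => ?_) (by rw [Finset.card_univ, Fintype.card_fin]; omega)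
    induction i using Fin.cases with
    | zero =>
      induction j using Fin.cases with
      | zero => exact absurd rfl hij
      | succ j => rfl
    | succ i =>
      induction j using Fin.cases with
      | zero => rfl
      | succ j => rfl
  rw [hκ] at hmain
  -- Order `k - 1` is the last one below the error `O(ħ^k)`. The main term starts there, as `ħ ·
  -- ħ^(k-2)` times a series, so only constant coefficients enter, among them that of the remaining
  -- minor, which is `E_ω`.
  have h5 := PowerSeries.X_pow_dvd_iff.1 hmain (k - 1) (by omega)
  rw [map_sub, sub_eq_zero] at h5
  have hdvd : (PowerSeries.X : R₀) ^ (k - 2) ∣ S.corr (Fin.cons s t : Fin (n + 1) → ℂ) (Fin.cons a b : Fin (n + 1) → Fin r) := by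
    have h6 := hk (n + 1) (by omega) (Fin.cons s t) (Fin.cons a b) (fun i => by
      induction i using Fin.cases with
      | zero => exact hs
      | succ i => exact hD i) (by
        rw [Fin.cons_injective_iff]
        exact ⟨fun ⟨i, hi⟩ => hts i hi, ht⟩)
    rwa [min_eq_right (by omega : k ≤ n + 1)] at h6
  obtain ⟨w, hw⟩ := hdvd
  rw [h5, hw, ← S.constantCoeff_permSum a hs t b]
  have hk1 : k - 1 = (k - 2) + 1 := by omega
  have e1 : ∀ z : R₀, PowerSeries.coeff (k - 1) (PowerSeries.X * (PowerSeries.X ^ (k - 2) * w) * z) =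
      PowerSeries.coeff 0 (w * z) := by
    intro z
    rw [hk1, show (PowerSeries.X : R₀) * (PowerSeries.X ^ (k - 2) * w) * z =
      PowerSeries.X ^ (k - 2 + 1) * (w * z) by ring]
    have := PowerSeries.coeff_X_pow_mul (w * z) (k - 2 + 1) 0
    rwa [zero_add] at this
  have e2 : PowerSeries.coeff (k - 2) (PowerSeries.X ^ (k - 2) * w) = PowerSeries.coeff 0 w := by
    have := PowerSeries.coeff_X_pow_mul w (k - 2) 0
    rwa [zero_add] at this
  rw [e1, e2, PowerSeries.coeff_zero_eq_constantCoeff_apply,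
    PowerSeries.coeff_zero_eq_constantCoeff_apply, map_mul]

variable {N : ℕ → Matrix (Fin r) (Fin r) K}

/-- For more than `k` points, the coefficient `[ħ^(k-2)]` as a form in the first point is regular
off the ramification points by `exists_oneVar`. At the ramification points it is regular by the loop
equation, which identifies it with the loop determinant times `dx / E_ω`. The projective line has no
nonzero regular one-form. -/
lemma OrderBound.succ (hN : S.IsExpansion N) (hcurve : IsSmoothGenusZeroSpectralCurve Φ x y)
    (hA : S.Assumption5Star) {k : ℕ} (h2 : 2 ≤ k) (hk : S.OrderBound k) : S.OrderBound (k + 1) := by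
  intro m hm τ β hτD hτ
  rcases le_or_gt m k with hmk | hmk
  · have := hk m hm τ β hτD hτ
    rw [min_eq_left hmk] at this
    rw [min_eq_left (by omega : m ≤ k + 1)]
    exact this
  obtain ⟨n, rfl⟩ : ∃ n, m = n + 1 := ⟨m - 1, by omega⟩
  have hkn : k ≤ n := by omega
  have hk1 := hk (n + 1) hm τ β hτD hτ
  rw [min_eq_right hmk.le] at hk1
  rw [min_eq_right (by omega : k + 1 ≤ n + 1)]
  -- Here `n ≥ k ≥ 2`, so there are at least three points and no pole at coinciding points, even at
  -- order `ħ⁰`.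
  obtain ⟨g, hg1, hg2, hg3⟩ := S.exists_oneVar hN hcurve hA (ι := Fin (n + 1))
    (by rw [Fintype.card_fin]; omega) hτD hτ β 0 (k := k - 2) (Or.inl (by rw [Fintype.card_fin]; omega))
  set t : Fin n → ℂ := fun i => τ i.succ with htdef
  set b : Fin n → Fin r := fun i => β i.succ with hbdef
  have hup : ∀ s : ℂ, Function.update τ 0 s = (Fin.cons s t : Fin (n + 1) → ℂ) := fun s => by
    rw [← Fin.cons_self_tail τ, Fin.update_cons_zero]
    rfl
  have hub : ∀ a : Fin r, Function.update β 0 a = (Fin.cons a b : Fin (n + 1) → Fin r) := fun s => by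
    rw [← Fin.cons_self_tail β, Fin.update_cons_zero]
    rfl
  have htD : ∀ i, t i ∈ S.D := fun i => hτD _
  have ht : Function.Injective t := fun i j h => Fin.succ_injective _ (hτ h)
  set L := loopCoeff x (charMat Φ x y) (-PowerSeries.X) t (fun i => S.M (t i) (e (b i))) with hL
  have hE := hcurve.derivative_ne_zero
  -- the loop equation
  have hloop : g * Eω Φ x y =
      PowerSeries.coeff (k - 1) L * (RatFunc.C ((-1) ^ n) * ratDeriv x) := by
    have hDinf : (S.D \ Set.range t).Infinite := S.infinite_D.sdiff (Set.finite_range t)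
    have a : Fin r := β 0
    refine ratFunc_eq_of_hasVal (S.infinite_sheet_image a Set.sdiff_subset hDinf) ?_
    rintro _ ⟨s, ⟨hs, hst⟩, rfl⟩
    have hts : ∀ i, t i ≠ s := fun i h => hst ⟨i, h⟩
    obtain ⟨pick, hpick, hco⟩ := S.coeff_cluster_loopMat h2 hk hkn a hs htD ht hts b
    have h3 := S.loopCoeff_mem_valSeries hcurve hA a hs hts ht b pick hpick (k - 1)
    have h4 := (hg1 a s hs (fun j hj => by
      obtain ⟨i, rfl⟩ := Fin.exists_succ_eq.2 hj
      exact hts i)).mul (S.hasVal_Eω hcurve a hs)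
    refine ⟨_, h4, ?_⟩
    have h5 := h3.mul ((HasVal.const ((-1) ^ n) _).mul
      (HasVal.coe_iff.2 ⟨S.ratDeriv_sheet_mem a hs, rfl⟩))
    have e1 : PowerSeries.coeff (k - 1) ((-1) ^ n * cluster (cycSum (S.loopMat a s t b))
        (Finset.disjSum Finset.univ ∅) pick Finset.univ) = (-1) ^ n *
        (PowerSeries.coeff (k - 2) (S.corr (Fin.cons s t : Fin (n + 1) → ℂ) (Fin.cons a b : Fin (n + 1) → Fin r)) * S.eigProd a s) := by
      rw [← hco, show ((-1 : R₀) ^ n) = PowerSeries.C ((-1) ^ n) by simp, PowerSeries.coeff_C_mul]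
    convert h5 using 1
    change _ = PowerSeries.coeff (k - 1) ((-1) ^ n * cluster (cycSum (S.loopMat a s t b))
        (Finset.disjSum Finset.univ ∅) pick Finset.univ) * _
    rw [e1, hup, hub]
    have hsq : ((-1 : ℂ) ^ n) * (-1) ^ n = 1 := by rw [← mul_pow]; simp
    linear_combination (-(PowerSeries.coeff (k - 2) (S.corr (Fin.cons s t : Fin (n + 1) → ℂ) (Fin.cons a b : Fin (n + 1) → Fin r)) * ratEval (ratDeriv x) (S.sheet a s) *
      S.eigProd a s)) * hsq
  have hg0 : g = 0 := by
    refine eq_zero_of_formRegularAt fun q => ?_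
    by_cases hq : IsRamified x q
    · obtain ⟨t₀, ht₀⟩ := S.infinite_D.nonempty
      have h3 := loopCoeff_mem_regSeries hcurve S hA (by omega : n ≠ 0) ht₀
        (S.not_hasVal_of_isRamified hcurve hq ht₀) (c := -PowerSeries.X) (AddSubgroup.neg_mem _ (by
          intro j
          rw [PowerSeries.coeff_X, one_mul]
          split_ifs <;> simp)) (fun i => S.not_hasVal_of_isRamified hcurve hq (htD i))
        (fun i => S.M (t i) (e (b i))) (k - 1)
      rw [formRegularAt_iff]
      have e2 : formFactor q * g = RatFunc.C ((-1) ^ n) *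
          (formFactor q * ratDeriv x / Eω Φ x y * PowerSeries.coeff (k - 1) L) := by
        have hE' : Eω Φ x y ≠ 0 := hE
        field_simp
        linear_combination formFactor q * hloop
      rw [e2, map_mul]
      exact mul_le_one' (ordAt_le_one_iff.2 (C_mem_regAt _ _)) h3
    · exact hg2 q hq
  have hcoef : PowerSeries.coeff (k - 2) (S.corr τ β) = 0 := by
    have h3 := hg1 (β 0) (τ 0) (hτD 0) (fun j hj h => hj (hτ h))
    rw [hg0, ← map_zero RatFunc.C, Function.update_eq_self, Function.update_eq_self] at h3
    have h4 := h3.unique (HasVal.const 0 _)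
    exact (mul_eq_zero.1 h4).resolve_right (S.ratEval_deriv_sheet_ne_zero hcurve _ (hτD 0))
  rw [PowerSeries.X_pow_dvd_iff] at hk1 ⊢
  intro j hj
  rcases lt_or_ge j (k - 2) with h | h
  · exact hk1 j h
  · obtain rfl : j = k - 2 := by omega
    exact hcoef

/-- The correlators of `n ≥ 2` points are divisible by `ħ ^ (n - 2)`. -/
theorem pow_dvd_corr (hN : S.IsExpansion N) (hcurve : IsSmoothGenusZeroSpectralCurve Φ x y)
    (hA : S.Assumption5Star) {m : ℕ} (hm : 2 ≤ m) {t : Fin m → ℂ} (hD : ∀ i, t i ∈ S.D)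
    (ht : Function.Injective t) (b : Fin m → Fin r) :
    (PowerSeries.X : R₀) ^ (m - 2) ∣ S.corr t b := by
  have h : ∀ k, 2 ≤ k → S.OrderBound k := by
    intro k hk
    induction k, hk using Nat.le_induction with
    | base =>
      intro m hm t b _ _
      rw [min_eq_right hm, Nat.sub_self, pow_zero]
      exact one_dvd _
    | succ k hk ih => exact OrderBound.succ S hN hcurve hA hk ih
  simpa using h m hm m hm t b hD ht

end WKBSolution

/-! ### Functions which are polynomials in each variable -/

section Interpolation

open Function (update)

variable {n : ℕ} (Z : Set ℂ) (ξ : ℂ → ℂ)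

lemma degreeOf_aeval_X_le (P : ℂ[X]) (i j : Fin n) :
    (aeval (MvPolynomial.X j : MvPolynomial (Fin n) ℂ) P).degreeOf i ≤
      if j = i then P.natDegree else 0 := by
  rw [aeval_eq_sum_range]
  refine (MvPolynomial.degreeOf_sum_le _ _ _).trans (Finset.sup_le fun m hm => ?_)
  rw [MvPolynomial.smul_eq_C_mul]
  refine (MvPolynomial.degreeOf_C_mul_le _ _ _).trans ((MvPolynomial.degreeOf_pow_le _ _ _).trans ?_)
  rw [Finset.mem_range] at hm
  rw [MvPolynomial.degreeOf_X]
  by_cases h : j = i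
  · subst h
    rw [if_pos rfl, if_pos rfl]
    omega
  · rw [if_neg h, if_neg (Ne.symm h), mul_zero]

/-- The tuples of points of `Z` with distinct images under `ξ`. -/
def Generic (z : Fin n → ℂ) : Prop := (∀ i, z i ∈ Z) ∧ Function.Injective (ξ ∘ z)

variable {Z ξ}

lemma Generic.update {z : Fin n → ℂ} (hz : Generic Z ξ z) {p : Fin n} {w : ℂ} (hw : w ∈ Z)
    (h : ∀ j, j ≠ p → ξ (z j) ≠ ξ w) : Generic Z ξ (update z p w) := by
  refine ⟨fun i => ?_, fun i j hij => ?_⟩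
  · rcases eq_or_ne i p with rfl | hi
    · rwa [Function.update_self]
    · rw [Function.update_of_ne hi]; exact hz.1 i
  · simp only [Function.comp_apply] at hij
    rcases eq_or_ne i p with rfl | hi <;> rcases eq_or_ne j i with rfl | hji
    · rfl
    · rw [Function.update_self, Function.update_of_ne hji] at hij
      exact absurd hij.symm (h j hji)
    · rfl
    · rw [Function.update_of_ne hi] at hij
      rcases eq_or_ne j p with rfl | hj
      · rw [Function.update_self] at hij
        exact absurd hij (h i hi)
      · rw [Function.update_of_ne hj] at hij
        exact hz.2 hij

/-- A function on the generic tuples which is a polynomial of degree less than `e` in each of the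
variables is a polynomial. -/
theorem exists_mvPolynomial (hZ : (ξ '' Z).Infinite) {e : ℕ} {G : (Fin n → ℂ) → ℂ}
    (hG : ∀ z, Generic Z ξ z → ∀ p, ∃ P ∈ degreeLT ℂ e, ∀ w, Generic Z ξ (update z p w) →
      G (update z p w) = P.eval w) :
    ∃ N : MvPolynomial (Fin n) ℂ, (∀ z, Generic Z ξ z → G z = MvPolynomial.eval z N) ∧
      ∀ i, N = 0 ∨ N.degreeOf i < e := by
  classical
  -- the grid
  obtain ⟨v, hvZ, hv⟩ : ∃ v : Fin n × Fin e → ℂ, (∀ i, v i ∈ Z) ∧ Function.Injective (ξ ∘ v) := by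
    let f : Fin n × Fin e → ξ '' Z := fun i => hZ.natEmbedding _ (Fintype.equivFin _ i)
    have hf : Function.Injective f := (hZ.natEmbedding _).injective.comp
      (Fin.val_injective.comp (Fintype.equivFin _).injective)
    choose v hvZ hv using fun i => (f i).2
    refine ⟨v, hvZ, fun i j hij => hf (Subtype.ext ?_)⟩
    rw [← hv, ← hv]
    exact hij
  have hvi : ∀ i, Function.Injective fun j => v (i, j) := fun i j k h => by
    have := hv (congrArg ξ h : (ξ ∘ v) (i, j) = (ξ ∘ v) (i, k))
    exact (Prod.ext_iff.1 this).2
  let ℓ : Fin n → Fin e → ℂ[X] := fun i j => Lagrange.basis Finset.univ (fun j => v (i, j)) j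
  have hℓdeg : ∀ i j, ℓ i j ∈ degreeLT ℂ e := fun i j => by
    rw [mem_degreeLT, Lagrange.degree_basis ((hvi i).injOn) (Finset.mem_univ j), Finset.card_univ,
      Fintype.card_fin]
    exact_mod_cast Nat.sub_lt (by have := j.2; omega) one_pos
  let N : MvPolynomial (Fin n) ℂ := ∑ α : Fin n → Fin e,
    MvPolynomial.C (G fun i => v (i, α i)) *
      ∏ i, aeval (MvPolynomial.X i : MvPolynomial (Fin n) ℂ) (ℓ i (α i))
  have hNeval : ∀ z, MvPolynomial.eval z N =
      ∑ α : Fin n → Fin e, G (fun i => v (i, α i)) * ∏ i, (ℓ i (α i)).eval (z i) := by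
    intro z
    simp only [N, map_sum, map_mul, map_prod, MvPolynomial.eval_C]
    refine Finset.sum_congr rfl fun α _ => ?_
    congr 1
    refine Finset.prod_congr rfl fun i _ => ?_
    have h := hom_eval₂ (ℓ i (α i)) (algebraMap ℂ (MvPolynomial (Fin n) ℂ)) (MvPolynomial.eval z)
      (MvPolynomial.X i)
    rw [aeval_def, h, MvPolynomial.eval_X]
    have : (MvPolynomial.eval z).comp (algebraMap ℂ (MvPolynomial (Fin n) ℂ)) = RingHom.id ℂ := by
      ext c; simp
    rw [this]
    rfl
  have hNpoly : ∀ z p, ∃ Q ∈ degreeLT ℂ e, ∀ w, MvPolynomial.eval (update z p w) N = Q.eval w := by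
    intro z p
    refine ⟨∑ α : Fin n → Fin e, (G (fun i => v (i, α i)) *
      ∏ i ∈ Finset.univ.erase p, (ℓ i (α i)).eval (z i)) • ℓ p (α p),
      Submodule.sum_mem _ fun α _ => Submodule.smul_mem _ _ (hℓdeg _ _), fun w => ?_⟩
    rw [hNeval, eval_finsetSum]
    refine Finset.sum_congr rfl fun α _ => ?_
    rw [eval_smul, smul_eq_mul, ← Finset.mul_prod_erase _ _ (Finset.mem_univ p), Function.update_self]
    have : ∏ i ∈ Finset.univ.erase p, (ℓ i (α i)).eval (update z p w i) =
        ∏ i ∈ Finset.univ.erase p, (ℓ i (α i)).eval (z i) :=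
      Finset.prod_congr rfl fun i hi => by rw [Function.update_of_ne (Finset.mem_erase.1 hi).1]
    rw [this]
    ring
  -- agreement at enough points
  have hstep : ∀ z, Generic Z ξ z → ∀ p, ∀ s : Finset ℂ, e ≤ s.card →
      (∀ w ∈ s, Generic Z ξ (update z p w) ∧ G (update z p w) = MvPolynomial.eval (update z p w) N) →
      G z = MvPolynomial.eval z N := by
    intro z hz p s hs h
    obtain ⟨P, hP, hP'⟩ := hG z hz p
    obtain ⟨Q, hQ, hQ'⟩ := hNpoly z p
    have hPQ : P = Q := by
      refine Polynomial.eq_of_degrees_lt_of_eval_finset_eq s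
        ((mem_degreeLT.1 hP).trans_le (by exact_mod_cast hs))
        ((mem_degreeLT.1 hQ).trans_le (by exact_mod_cast hs)) fun w hw => ?_
      rw [← hP' w (h w hw).1, ← hQ', (h w hw).2]
    have h1 := hP' (z p) (by rwa [Function.update_eq_self])
    have h2 := hQ' (z p)
    rw [Function.update_eq_self] at h1 h2
    rw [h1, h2, hPQ]
  -- `T` contains the coordinates off the grid. Moving the coordinate `p` to its `e` grid values
  -- reduces to a smaller `T`; the moved points stay generic because the other coordinates of `T`
  -- avoid the grid under `ξ`.
  have hgrid : ∀ T : Finset (Fin n), ∀ z, Generic Z ξ z → (∀ i ∉ T, ∃ j, z i = v (i, j)) →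
      (∀ i ∈ T, ∀ k, ξ (z i) ≠ ξ (v k)) → G z = MvPolynomial.eval z N := by
    intro T
    induction T using Finset.induction_on with
    | empty =>
      intro z _ hz _
      choose α hα using fun i => hz i (Finset.notMem_empty i)
      obtain rfl : z = fun i => v (i, α i) := funext hα
      rw [hNeval, Finset.sum_eq_single α]
      · rw [Finset.prod_eq_one, mul_one]
        exact fun i _ => Lagrange.eval_basis_self (F := ℂ) (hvi i).injOn (Finset.mem_univ _)
      · intro β _ hβ
        obtain ⟨i, hi⟩ := Function.ne_iff.1 hβ
        rw [Finset.prod_eq_zero (Finset.mem_univ i), mul_zero]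
        exact Lagrange.eval_basis_of_ne (v := fun j => v (i, j)) hi (Finset.mem_univ _)
      · intro h
        exact absurd (Finset.mem_univ _) h
    | insert p T hp ih =>
      intro z hz h1 h2
      refine hstep z hz p (Finset.univ.image fun j => v (p, j)) ?_ ?_
      · rw [Finset.card_image_of_injective _ (hvi p), Finset.card_univ, Fintype.card_fin]
      · intro w hw
        obtain ⟨j, -, rfl⟩ := Finset.mem_image.1 hw
        have hgen : Generic Z ξ (update z p (v (p, j))) := by
          refine hz.update (hvZ _) fun i hi h => ?_
          by_cases hiT : i ∈ T
          · exact h2 i (Finset.mem_insert_of_mem hiT) _ h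
          · obtain ⟨k, hk⟩ := h1 i (by simp [hi, hiT])
            rw [hk] at h
            exact hi (Prod.ext_iff.1 (hv h)).1
        refine ⟨hgen, ih _ hgen (fun i hi => ?_) fun i hi k => ?_⟩
        · rcases eq_or_ne i p with rfl | hip
          · exact ⟨j, by rw [Function.update_self]⟩
          · rw [Function.update_of_ne hip]
            exact h1 i (by simp [hi, hip])
        · have hip : i ≠ p := fun h => hp (h ▸ hi)
          rw [Function.update_of_ne hip]
          exact h2 i (Finset.mem_insert_of_mem hi) k
  refine ⟨N, ?_, fun i => ?_⟩
  · -- points of the grid are avoided by moving the coordinates one by one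
    have key : ∀ m : ℕ, ∀ z, Generic Z ξ z →
        (Finset.univ.filter fun i => ∃ k, ξ (z i) = ξ (v k)).card = m →
        G z = MvPolynomial.eval z N := by
      intro m
      induction m using Nat.strong_induction_on with
      | _ m ih =>
        intro z hz hm
        by_cases h0 : ∀ i k, ξ (z i) ≠ ξ (v k)
        · exact hgrid Finset.univ z hz (fun i hi => absurd (Finset.mem_univ i) hi) fun i _ => h0 i
        push Not at h0
        obtain ⟨p, hp⟩ := h0
        have hinf : (ξ '' Z \ (Set.range (ξ ∘ v) ∪ Set.range (ξ ∘ z))).Infinite :=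
          hZ.sdiff ((Set.finite_range _).union (Set.finite_range _))
        have hinf' : {w | w ∈ Z ∧ (∀ k, ξ w ≠ ξ (v k)) ∧ ∀ j, ξ (z j) ≠ ξ w}.Infinite := by
          refine Set.Infinite.of_image ξ (hinf.mono ?_)
          rintro _ ⟨⟨w, hw, rfl⟩, hw'⟩
          exact ⟨w, ⟨hw, fun k h => hw' (Or.inl ⟨k, h.symm⟩), fun j h => hw' (Or.inr ⟨j, h⟩)⟩, rfl⟩
        obtain ⟨s, hs, hsc⟩ := hinf'.exists_subset_card_eq e
        refine hstep z hz p s hsc.ge fun w hw => ?_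
        obtain ⟨hwZ, hwv, hwz⟩ := hs hw
        have hgen := hz.update (p := p) hwZ fun j _ => hwz j
        refine ⟨hgen, ih _ ?_ _ hgen rfl⟩
        rw [← hm]
        refine Finset.card_lt_card (Finset.ssubset_iff.2 ⟨p, ?_, ?_⟩)
        · simp only [Finset.mem_filter, Finset.mem_univ, true_and, Function.update_self, not_exists]
          exact hwv
        · intro i hi
          rcases Finset.mem_insert.1 hi with rfl | hi
          · exact Finset.mem_filter.2 ⟨Finset.mem_univ _, hp⟩
          · obtain ⟨-, k, hk⟩ := Finset.mem_filter.1 hi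
            rcases eq_or_ne i p with rfl | hip
            · exact Finset.mem_filter.2 ⟨Finset.mem_univ _, hp⟩
            · rw [Function.update_of_ne hip] at hk
              exact Finset.mem_filter.2 ⟨Finset.mem_univ _, k, hk⟩
    exact fun z hz => key _ z hz rfl
  · rcases Nat.eq_zero_or_pos e with rfl | he
    · left
      have : IsEmpty (Fin n → Fin 0) := ⟨fun f => (f i).elim0⟩
      exact Finset.sum_of_isEmpty _
    · right
      rw [Nat.lt_iff_le_pred he]
      refine (MvPolynomial.degreeOf_sum_le _ _ _).trans (Finset.sup_le fun α _ => ?_)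
      refine (MvPolynomial.degreeOf_C_mul_le _ _ _).trans ((MvPolynomial.degreeOf_prod_le _ _ _).trans ?_)
      calc _ ≤ ∑ j, if j = i then (ℓ j (α j)).natDegree else 0 := Finset.sum_le_sum fun j _ => degreeOf_aeval_X_le _ _ _
        _ = (ℓ i (α i)).natDegree := by simp
        _ ≤ e - 1 := by
          have h := mem_degreeLT.1 (hℓdeg i (α i))
          have : (ℓ i (α i)).natDegree < e := (natDegree_lt_iff_degree_lt
            (Lagrange.basis_ne_zero (hvi i).injOn (Finset.mem_univ (α i)))).2 h
          omega

end Interpolation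

/-! ### A common denominator -/

lemma algebraMap_mem_regAt (p : ℂ[X]) (a : ℂ) :
    algebraMap ℂ[X] K p ∈ regAt (a : OnePoint ℂ) := by
  rw [mem_regAt_coe, RatFunc.denom_algebraMap, eval_one]
  exact one_ne_zero

/-- A rational function without finite poles is a polynomial. -/
lemma eq_algebraMap_num {f : K} (h : ∀ a : ℂ, f ∈ regAt (a : OnePoint ℂ)) :
    f = algebraMap ℂ[X] K f.num := by
  have h1 : f.denom.degree = 0 := by
    by_contra hd
    obtain ⟨a, ha⟩ := IsAlgClosed.exists_root f.denom hd
    exact mem_regAt_coe.1 (h a) ha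
  have h2 : f.denom = 1 := (RatFunc.monic_denom f).natDegree_eq_zero.1
    (natDegree_eq_of_degree_eq_some h1)
  conv_lhs => rw [← RatFunc.num_div_denom f, h2, map_one, div_one]

lemma ordAt_infty_le_X_pow {f : K} {m : ℕ} (h : f.intDegree ≤ m) :
    ordAt OnePoint.infty f ≤ ordAt OnePoint.infty (algebraMap ℂ[X] K (X ^ m)) := by
  have hX : algebraMap ℂ[X] K (X ^ m) ≠ 0 := algebraMap_ratFunc_ne_zero (pow_ne_zero _ X_ne_zero)
  rcases eq_or_ne f 0 with rfl | hf
  · rw [map_zero]; exact zero_le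
  · have h1 : f / algebraMap ℂ[X] K (X ^ m) ∈ regAt OnePoint.infty := by
      have h2 := RatFunc.intDegree_mul (div_ne_zero hf hX) hX
      rw [div_mul_cancel₀ _ hX, RatFunc.intDegree_polynomial, natDegree_X_pow] at h2
      rw [mem_regAt_infty]
      omega
    have h3 := ordAt_le_one_iff.2 h1
    calc ordAt OnePoint.infty f = ordAt OnePoint.infty (f / algebraMap ℂ[X] K (X ^ m)) *
          ordAt OnePoint.infty (algebraMap ℂ[X] K (X ^ m)) := by
          rw [← map_mul, div_mul_cancel₀ _ hX]
      _ ≤ 1 * ordAt OnePoint.infty (algebraMap ℂ[X] K (X ^ m)) := mul_le_mul' h3 le_rfl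
      _ = _ := one_mul _

lemma intDegree_le_of_ordAt_le {f : K} {m : ℕ} (hf : f ≠ 0)
    (h : ordAt OnePoint.infty f ≤ ordAt OnePoint.infty (algebraMap ℂ[X] K (X ^ m))) :
    f.intDegree ≤ m := by
  have hX : algebraMap ℂ[X] K (X ^ m) ≠ 0 := algebraMap_ratFunc_ne_zero (pow_ne_zero _ X_ne_zero)
  have hX' : ordAt OnePoint.infty (algebraMap ℂ[X] K (X ^ m)) ≠ 0 := (Valuation.ne_zero_iff _).2 hX
  have h1 : f / algebraMap ℂ[X] K (X ^ m) ∈ regAt OnePoint.infty := by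
    rw [← ordAt_le_one_iff, map_div₀]
    exact div_le_one_of_le₀ h zero_le
  have h2 := RatFunc.intDegree_mul (div_ne_zero hf hX) hX
  rw [div_mul_cancel₀ _ hX, RatFunc.intDegree_polynomial, natDegree_X_pow] at h2
  rw [mem_regAt_infty] at h1
  omega

/-- The one-forms whose poles are bounded by those of finitely many functions have a common
denominator. -/
lemma exists_denominator {ι : Type*} [Fintype ι] (F : ι → K) (R : Set (OnePoint ℂ))
    (hF : ∀ i, ∀ q ∉ R, F i ∈ regAt q) :
    ∃ (d : ℂ[X]) (e : ℕ), d ≠ 0 ∧ (∀ a, d.eval a = 0 → (a : OnePoint ℂ) ∈ R) ∧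
      (OnePoint.infty ∉ R → e = d.natDegree - 1) ∧
      ∀ g : K, (∀ q ∉ R, FormRegularAt g q) →
        (∀ q ∈ R, ∀ γ, (∀ i, ordAt q (F i) ≤ γ) → ordAt q (formFactor q * g) ≤ γ) →
        ∃ P ∈ degreeLT ℂ e, g * algebraMap ℂ[X] K d = algebraMap ℂ[X] K P := by
  classical
  -- With the product of all denominators every `d F_i` is a polynomial. Hence `d` clears the finite
  -- poles of any form bounded by the `F_i`.
  set d : ℂ[X] := ∏ i, (F i).denom with hd
  have hd0 : d ≠ 0 := Finset.prod_ne_zero_iff.2 fun i _ => RatFunc.denom_ne_zero _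
  have hdK := algebraMap_ratFunc_ne_zero hd0
  -- A bound for the pole orders of the `F_i` at infinity, needed if infinity belongs to `R`.
  set m : ℕ := ∑ i, (F i).intDegree.natAbs with hm
  have hfin : ∀ g : K, (∀ q ∉ R, FormRegularAt g q) →
        (∀ q ∈ R, ∀ γ, (∀ i, ordAt q (F i) ≤ γ) → ordAt q (formFactor q * g) ≤ γ) →
        g * algebraMap ℂ[X] K d = algebraMap ℂ[X] K (g * algebraMap ℂ[X] K d).num := by
    intro g h1 h2
    refine eq_algebraMap_num fun a => ?_
    by_cases ha : (a : OnePoint ℂ) ∈ R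
    · have hd' : ordAt (a : OnePoint ℂ) (algebraMap ℂ[X] K d) ≠ 0 := (Valuation.ne_zero_iff _).2 hdK
      have h3 := h2 a ha (ordAt (a : OnePoint ℂ) (algebraMap ℂ[X] K d))⁻¹ fun i => by
        have h4 : algebraMap ℂ[X] K d * F i ∈ regAt (a : OnePoint ℂ) := by
          have e1 : algebraMap ℂ[X] K d * F i = algebraMap ℂ[X] K
              ((∏ j ∈ Finset.univ.erase i, (F j).denom) * (F i).num) := by
            rw [hd, ← Finset.mul_prod_erase _ _ (Finset.mem_univ i), map_mul, map_mul]
            nth_rewrite 2 [← RatFunc.num_div_denom (F i)]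
            have := algebraMap_ratFunc_ne_zero (RatFunc.denom_ne_zero (F i))
            field_simp
          rw [e1]
          exact algebraMap_mem_regAt _ _
        have h5 := ordAt_le_one_iff.2 h4
        rw [map_mul] at h5
        calc ordAt (a : OnePoint ℂ) (F i) = (ordAt (a : OnePoint ℂ) (algebraMap ℂ[X] K d))⁻¹ *
              (ordAt (a : OnePoint ℂ) (algebraMap ℂ[X] K d) * ordAt (a : OnePoint ℂ) (F i)) := by
              rw [← mul_assoc, inv_mul_cancel₀ hd', one_mul]
          _ ≤ (ordAt (a : OnePoint ℂ) (algebraMap ℂ[X] K d))⁻¹ * 1 := mul_le_mul' le_rfl h5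
          _ = _ := mul_one _
      rw [show formFactor (a : OnePoint ℂ) = 1 from rfl, one_mul] at h3
      rw [← ordAt_le_one_iff, map_mul]
      exact (mul_le_mul' h3 le_rfl).trans (inv_mul_cancel₀ hd').le
    · have h3 := formRegularAt_iff.1 (h1 a ha)
      rw [show formFactor (a : OnePoint ℂ) = 1 from rfl, one_mul] at h3
      exact (regAt _).mul_mem _ _ (ordAt_le_one_iff.1 h3) (algebraMap_mem_regAt _ _)
  have hdeg : ∀ g : K, g ≠ 0 → g * algebraMap ℂ[X] K d =
      algebraMap ℂ[X] K (g * algebraMap ℂ[X] K d).num →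
      (((g * algebraMap ℂ[X] K d).num.natDegree : ℕ) : ℤ) = g.intDegree + d.natDegree := by
    intro g hg h
    rw [← RatFunc.intDegree_polynomial (p := (g * algebraMap ℂ[X] K d).num), ← h,
      RatFunc.intDegree_mul hg hdK, RatFunc.intDegree_polynomial]
  have hroot : ∀ a, d.eval a = 0 → (a : OnePoint ℂ) ∈ R := by
    intro a ha
    by_contra hR
    rw [hd, eval_prod, Finset.prod_eq_zero_iff] at ha
    obtain ⟨i, -, hi⟩ := ha
    exact mem_regAt_coe.1 (hF i a hR) hi
  have hlt : ∀ (g : K) (e : ℕ), (g ≠ 0 → g * algebraMap ℂ[X] K d =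
      algebraMap ℂ[X] K (g * algebraMap ℂ[X] K d).num → g.intDegree + d.natDegree < e) →
      g * algebraMap ℂ[X] K d = algebraMap ℂ[X] K (g * algebraMap ℂ[X] K d).num →
      ∃ P ∈ degreeLT ℂ e, g * algebraMap ℂ[X] K d = algebraMap ℂ[X] K P := by
    intro g e he h
    rcases eq_or_ne g 0 with rfl | hg
    · exact ⟨0, Submodule.zero_mem _, by simp⟩
    · refine ⟨_, mem_degreeLT.2 ?_, h⟩
      refine degree_le_natDegree.trans_lt ?_
      have h1 := hdeg g hg h
      have h2 := he hg h
      exact_mod_cast (by omega : (g * algebraMap ℂ[X] K d).num.natDegree < e)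
  by_cases hR : OnePoint.infty ∈ R
  · refine ⟨d, d.natDegree + m, hd0, hroot, fun h => absurd hR h, fun g h1 h2 => hlt g _ ?_ (hfin g h1 h2)⟩
    intro hg h
    have h3 := h2 OnePoint.infty hR (ordAt OnePoint.infty (algebraMap ℂ[X] K (X ^ m))) fun i =>
      ordAt_infty_le_X_pow (by
        have : (F i).intDegree.natAbs ≤ m :=
          Finset.single_le_sum (f := fun i => (F i).intDegree.natAbs) (fun _ _ => Nat.zero_le _)
            (Finset.mem_univ i)
        omega)
    have h4 := intDegree_le_of_ordAt_le (mul_ne_zero (formFactor_ne_zero _) hg) h3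
    rw [show formFactor OnePoint.infty = RatFunc.X ^ 2 from rfl, intDegree_X_sq_mul hg] at h4
    push_cast
    omega
  -- A form regular at infinity has degree at most `-2`, so its numerator has degree at most `deg d
  -- - 2`.
  · refine ⟨d, d.natDegree - 1, hd0, hroot, fun _ => rfl, fun g h1 h2 => hlt g _ ?_ (hfin g h1 h2)⟩
    intro hg h
    have h3 : g.intDegree ≤ -2 := (h1 _ hR).resolve_left hg
    have h4 := hdeg g hg h
    omega

/-! ### Forms in several variables -/

section MvForms

variable {n : ℕ}

lemma eval_aeval_X (z : Fin n → ℂ) (i : Fin n) (P : ℂ[X]) :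
    MvPolynomial.eval z (aeval (MvPolynomial.X i : MvPolynomial (Fin n) ℂ) P) = P.eval (z i) := by
  induction P using Polynomial.induction_on' with
  | add p q hp hq => rw [map_add, map_add, hp, hq, eval_add]
  | monomial m c => simp [aeval_monomial]

lemma prod_aeval_X_ne_zero {d : ℂ[X]} (hd : d ≠ 0) :
    ∏ i : Fin n, aeval (MvPolynomial.X i : MvPolynomial (Fin n) ℂ) d ≠ 0 := by
  obtain ⟨a, ha⟩ : ∃ a, d.eval a ≠ 0 := by
    by_contra! h
    exact hd (Polynomial.funext fun a => by rw [h a, eval_zero])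
  intro h0
  have h1 := congrArg (MvPolynomial.eval fun _ => a) h0
  rw [map_prod, map_zero, Finset.prod_eq_zero_iff] at h1
  obtain ⟨i, -, hi⟩ := h1
  rw [eval_aeval_X] at hi
  exact ha hi

lemma algebraMap_mvRat_ne_zero {Q : MvPolynomial (Fin n) ℂ} (hQ : Q ≠ 0) :
    algebraMap _ (MvRat n) Q ≠ 0 :=
  (map_ne_zero_iff _ (IsFractionRing.injective _ _)).2 hQ

lemma mvHasValueAt_zero (p : Fin n → ℂ) : MvHasValueAt (0 : MvRat n) p 0 :=
  ⟨0, 1, by simp, by simp, by simp⟩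

lemma mvPolesIn_zero (R : Set (OnePoint ℂ)) : MvPolesIn R (0 : MvRat n) :=
  ⟨1, 0, one_ne_zero, fun a h => by simp at h, by simp, fun _ _ => Or.inl rfl⟩

lemma mvHasValueAt_div {N Q : MvPolynomial (Fin n) ℂ} {p : Fin n → ℂ}
    (hQ : MvPolynomial.eval p Q ≠ 0) :
    MvHasValueAt (algebraMap _ (MvRat n) N / algebraMap _ (MvRat n) Q) p
      (MvPolynomial.eval p N / MvPolynomial.eval p Q) :=
  ⟨N, Q, hQ, div_mul_cancel₀ _ (algebraMap_mvRat_ne_zero fun h => hQ (by rw [h, map_zero])), rfl⟩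

/-- One-forms of one variable. -/
lemma exists_mvForm_one {g : K} {R : Set (OnePoint ℂ)} (hg : ∀ q ∉ R, FormRegularAt g q) :
    ∃ w : MvRat 1, MvPolesIn R w ∧
      ∀ (z : Fin 1 → ℂ) (v : ℂ), HasVal (z 0 : OnePoint ℂ) g v → MvHasValueAt w z v := by
  set N : MvPolynomial (Fin 1) ℂ := aeval (MvPolynomial.X 0) g.num with hN
  set Q : MvPolynomial (Fin 1) ℂ := aeval (MvPolynomial.X 0) g.denom with hQ
  have hQ0 : Q ≠ 0 := by
    have := prod_aeval_X_ne_zero (n := 1) (RatFunc.denom_ne_zero g)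
    rwa [Fin.prod_univ_one] at this
  refine ⟨algebraMap _ (MvRat 1) N / algebraMap _ (MvRat 1) Q,
    ⟨g.denom, N, RatFunc.denom_ne_zero g, fun a ha => ?_, ?_, fun h i => ?_⟩, fun z v hv => ?_⟩
  · by_contra hR
    exact hg _ hR ha
  · rw [Fin.prod_univ_one]
    exact div_mul_cancel₀ _ (algebraMap_mvRat_ne_zero hQ0)
  · rcases hg _ h with h0 | h0
    · left
      rw [hN, h0, RatFunc.num_zero, map_zero]
    · right
      have h1 := degreeOf_aeval_X_le g.num i (0 : Fin 1)
      rw [if_pos (Subsingleton.elim _ _)] at h1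
      have h2 : (g.num.natDegree : ℤ) - g.denom.natDegree ≤ -2 := h0
      rw [hN]
      omega
  · obtain ⟨h1, h2⟩ := HasVal.coe_iff.1 hv
    have h3 : MvPolynomial.eval z Q ≠ 0 := by rwa [hQ, eval_aeval_X]
    have h4 := mvHasValueAt_div (N := N) h3
    rw [hN, hQ, eval_aeval_X, eval_aeval_X] at h4
    have h5 : ratEval g (z 0) = g.num.eval (z 0) / g.denom.eval (z 0) := by
      rw [← ratEval_div _ _ h1, RatFunc.num_div_denom]
    rwa [← h5, h2] at h4

end MvForms

namespace WKBSolution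

variable {r : ℕ} {Φ : RationalHConnection r} {x y : K} (S : WKBSolution Φ x y)
  {N : ℕ → Matrix (Fin r) (Fin r) K}

open Function (update)

/-- The coefficients of the correlators as rational forms. -/
theorem exists_mvForm (hN : S.IsExpansion N) (hcurve : IsSmoothGenusZeroSpectralCurve Φ x y)
    (hA : S.Assumption5Star) {n : ℕ} (hn : 2 ≤ n) {k : ℕ} (hk : 3 ≤ n ∨ k ≠ 0) :
    ∃ w : MvRat n, MvPolesIn {q | IsRamified x q} w ∧
      ∀ (t : Fin n → ℂ) (a : Fin n → Fin r), (∀ i, t i ∈ S.D) → Function.Injective t →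
        MvHasValueAt w (fun i => S.sheet (a i) (t i))
          (PowerSeries.coeff k (S.corr t a) * ∏ i, ratEval (ratDeriv x) (S.sheet (a i) (t i))) := by
  classical
  -- The poles are compared with those of all entries of `N k'`, `k' ≤ k`, so the denominator and
  -- the degree bound do not depend on the other points.
  obtain ⟨d, e, hd0, hdroot, hde, hd⟩ := exists_denominator
    (fun i : Fin (k + 1) × Fin r × Fin r => N i.1 i.2.1 i.2.2) {q | IsRamified x q}
    fun i q hq => hN.mem hcurve hA hq _ _ _
  let Z : Set ℂ := {z | ∃ a, ∃ t ∈ S.D, z = S.sheet a t}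
  let ξ : ℂ → ℂ := ratEval x
  have a₀ : Fin r := ⟨0, hcurve.pos⟩
  have hZξ : ∀ z ∈ Z, ξ z ∈ S.D ∧ ∃ a, z = S.sheet a (ξ z) := by
    rintro _ ⟨a, t, ht, rfl⟩
    have : ξ (S.sheet a t) = t := S.ratEval_x_sheet a ht
    rw [this]
    exact ⟨ht, a, rfl⟩
  have hex : ∀ z, ∃ a, z ∈ Z → z = S.sheet a (ξ z) := fun z => by
    by_cases hz : z ∈ Z
    · exact (hZξ z hz).2.imp fun a h _ => h
    · exact ⟨a₀, fun h => absurd h hz⟩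
  -- A point over `D` determines its base point `ξ z` and its sheet `sh z`, so the correlator
  -- becomes a function of points of the curve alone.
  choose sh hsh using hex
  have hsheet : ∀ a, ∀ t ∈ S.D, S.sheet a t ∈ Z ∧ ξ (S.sheet a t) = t ∧ sh (S.sheet a t) = a := by
    intro a t ht
    have h1 : S.sheet a t ∈ Z := ⟨a, t, ht, rfl⟩
    have h2 : ξ (S.sheet a t) = t := S.ratEval_x_sheet a ht
    refine ⟨h1, h2, S.sheet_injective t ht ?_⟩
    have := hsh _ h1
    rw [h2] at this
    exact this.symm
  have hdZ : ∀ z ∈ Z, d.eval z ≠ 0 := by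
    rintro _ ⟨a, t, ht, rfl⟩ h
    exact S.not_isRamified_sheet hcurve a ht (hdroot _ h)
  have hZ : (ξ '' Z).Infinite := S.infinite_D.mono fun t ht =>
    ⟨S.sheet a₀ t, (hsheet a₀ t ht).1, (hsheet a₀ t ht).2.1⟩
  -- The prospective numerator: the coefficient of the form multiplied by the common denominator in
  -- every variable.
  let G : (Fin n → ℂ) → ℂ := fun z => PowerSeries.coeff k (S.corr (ξ ∘ z) (sh ∘ z)) *
    ∏ i, (ratEval (ratDeriv x) (z i) * d.eval (z i))
  obtain ⟨P, hP, hPdeg⟩ := exists_mvPolynomial (n := n) hZ (e := e) (G := G) (by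
    intro z hz p
    obtain ⟨g, hg1, hg2, hg3⟩ := S.exists_oneVar hN hcurve hA (ι := Fin n) (t := ξ ∘ z)
      (by rwa [Fintype.card_fin]) (fun i => (hZξ _ (hz.1 i)).1) hz.2 (sh ∘ z) p (k := k)
      (by rwa [Fintype.card_fin])
    obtain ⟨P, hP, hgP⟩ := hd g hg2 fun q hq γ hγ => hg3 q hq γ fun k' hk' u v =>
      hγ (⟨k', by omega⟩, u, v)
    refine ⟨(∏ i ∈ Finset.univ.erase p, (ratEval (ratDeriv x) (z i) * d.eval (z i))) • P,
      Submodule.smul_mem _ _ hP, fun w hw => ?_⟩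
    have hwZ : w ∈ Z := by have := hw.1 p; rwa [Function.update_self] at this
    have hwp : ∀ j, j ≠ p → (ξ ∘ z) j ≠ ξ w := by
      intro j hj h
      refine hj (hw.2 ?_)
      simp only [Function.comp_apply, Function.update_self, Function.update_of_ne hj]
      exact h
    have h1 := hg1 (sh w) (ξ w) (hZξ w hwZ).1 hwp
    rw [← hsh w hwZ] at h1
    have hpoly : ∀ p : ℂ[X], HasVal (w : OnePoint ℂ) (algebraMap ℂ[X] K p) (p.eval w) := fun p => by
      refine HasVal.coe_iff.2 ⟨algebraMap_mem_regAt p w, ?_⟩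
      have h := ratEval_div (a := w) p 1 (by rw [eval_one]; exact one_ne_zero)
      rwa [map_one, div_one, eval_one, div_one] at h
    have h2 := h1.mul (hpoly d)
    rw [hgP] at h2
    have h3 := h2.unique (hpoly P)
    simp only [G]
    rw [Function.comp_update, Function.comp_update, eval_smul, ← h3,
      ← Finset.mul_prod_erase _ _ (Finset.mem_univ p), Function.update_self]
    have : ∏ i ∈ Finset.univ.erase p,
        (ratEval (ratDeriv x) (update z p w i) * d.eval (update z p w i)) =
        ∏ i ∈ Finset.univ.erase p, (ratEval (ratDeriv x) (z i) * d.eval (z i)) :=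
      Finset.prod_congr rfl fun i hi => by rw [Function.update_of_ne (Finset.mem_erase.1 hi).1]
    rw [this, smul_eq_mul]
    ring)
  set Q : MvPolynomial (Fin n) ℂ := ∏ i : Fin n, aeval (MvPolynomial.X i : MvPolynomial (Fin n) ℂ) d
    with hQ
  refine ⟨algebraMap _ (MvRat n) P / algebraMap _ (MvRat n) Q, ⟨d, P, hd0, hdroot, ?_, ?_⟩, ?_⟩
  · exact div_mul_cancel₀ _ (algebraMap_mvRat_ne_zero (prod_aeval_X_ne_zero hd0))
  · intro h i
    refine (hPdeg i).imp_right fun h1 => ?_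
    rw [hde h] at h1
    omega
  · intro t a ht hti
    set z : Fin n → ℂ := fun i => S.sheet (a i) (t i) with hz
    have hξz : ξ ∘ z = t := funext fun i => (hsheet (a i) (t i) (ht i)).2.1
    have hshz : sh ∘ z = a := funext fun i => (hsheet (a i) (t i) (ht i)).2.2
    have hzZ : ∀ i, z i ∈ Z := fun i => (hsheet (a i) (t i) (ht i)).1
    have hQz : MvPolynomial.eval z Q = ∏ i, d.eval (z i) := by
      rw [hQ, map_prod]
      exact Finset.prod_congr rfl fun i _ => eval_aeval_X z i d
    have hQ0 : ∏ i, d.eval (z i) ≠ 0 := Finset.prod_ne_zero_iff.2 fun i _ => hdZ _ (hzZ i)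
    have h := mvHasValueAt_div (N := P) (Q := Q) (p := z) (by rw [hQz]; exact hQ0)
    rw [← hP z ⟨hzZ, by rw [hξz]; exact hti⟩, hQz] at h
    simp only [G] at h
    rwa [hξz, hshz, Finset.prod_mul_distrib, ← mul_assoc, mul_div_cancel_right₀ _ hQ0] at h

/-- The series `Tr (M Φ)` as a function on the curve. -/
def traceSeries (Φ : RationalHConnection r) (x : K) (N : ℕ → Matrix (Fin r) (Fin r) K) :
    PowerSeries K := ∑ i, ∑ j, expSeries N i j * Φ.pull x j i

lemma traceSeries_mem_valSeries (hN : S.IsExpansion N)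
    (hcurve : IsSmoothGenusZeroSpectralCurve Φ x y) (hA : S.Assumption5Star) (a : Fin r) {t : ℂ}
    (ht : t ∈ S.D) : (traceSeries Φ x N, (S.M t (e a) * Φ.at' t).trace) ∈
      valSeries (S.sheet a t : OnePoint ℂ) := by
  simp only [Matrix.trace, Matrix.diag, Matrix.mul_apply]
  exact Subring.sum_pair_mem _ fun i _ => Subring.sum_pair_mem _ fun j _ =>
    Subring.mul_pair_mem (hN.mem_valSeries hcurve hA a ht i j) (S.pull_mem_valSeries hA a ht j i)

/-- `M` is regular at unramified points, and `Φ_ħ dx` is regular away from the singularities. A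
singularity over an unramified point may still give a pole of `W_1`, which explains the larger set
of poles. -/
lemma formRegularAt_traceSeries (hN : S.IsExpansion N)
    (hcurve : IsSmoothGenusZeroSpectralCurve Φ x y) (hA : S.Assumption5Star) (k : ℕ)
    {q : OnePoint ℂ} (hq : q ∉ {q | IsRamified x q ∨ Φ.IsSingularity 0 (ratMap x q)}) :
    FormRegularAt (PowerSeries.coeff k (traceSeries Φ x N) * ratDeriv x) q := by
  rw [Set.mem_ofPred_eq, not_or] at hq
  obtain ⟨t₀, -, ht₀⟩ := S.exists_not_hasVal q
  have hv := formRegularAt_ratDeriv_invCoord ht₀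
  rw [ratDeriv_invCoord hcurve.nonconstant, map_mul, map_mul, Valuation.map_neg, map_pow] at hv
  have hsum : ordAt q (PowerSeries.coeff k (traceSeries Φ x N)) ≤ ordAt q (invCoord x t₀) ^ 2 := by
    rw [traceSeries, map_sum]
    refine Valuation.map_sum_le _ fun i _ => ?_
    rw [map_sum]
    refine Valuation.map_sum_le _ fun j _ => ?_
    rw [PowerSeries.coeff_mul]
    refine Valuation.map_sum_le _ fun p _ => ?_
    rw [map_mul, coeff_expSeries]
    refine (mul_le_mul' (ordAt_le_one_iff.2 (hN.mem hcurve hA hq.1 p.1 i j)) ?_).trans (one_mul _).le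
    simp only [RationalHConnection.pull, of_apply, PowerSeries.coeff_mk]
    exact ordAt_pullback_le ht₀ (S.regular_coeff hA hq.2 p.2 j i)
  rw [formRegularAt_iff, map_mul, map_mul]
  calc _ ≤ ordAt q (formFactor q) * (ordAt q (invCoord x t₀) ^ 2 * ordAt q (ratDeriv x)) :=
        mul_le_mul' le_rfl (mul_le_mul' hsum le_rfl)
    _ = ordAt q (formFactor q) * (ordAt q (ratDeriv x) * ordAt q (invCoord x t₀) ^ 2) := by
        rw [mul_comm (ordAt q (ratDeriv x))]
    _ ≤ 1 := hv

end WKBSolution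

/-! ### The topological type property -/

lemma coeff_ofPowerSeries_of_neg (f : R₀) {k : ℤ} (hk : k < 0) :
    (HahnSeries.ofPowerSeries ℤ ℂ f).coeff k = 0 := by
  have h := PowerSeries.coeff_coe (f := f) (i := k)
  rwa [if_pos hk] at h

lemma coeff_ofPowerSeries_toNat (f : R₀) {k : ℤ} (hk : 0 ≤ k) :
    (HahnSeries.ofPowerSeries ℤ ℂ f).coeff k = PowerSeries.coeff k.toNat f := by
  obtain ⟨n, rfl⟩ := Int.eq_ofNat_of_zero_le hk
  rw [HahnSeries.ofPowerSeries_apply_coeff, Int.toNat_natCast]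

lemma coeff_ofPowerSeries_of_dvd {f : R₀} {m : ℕ} (hf : PowerSeries.X ^ m ∣ f) {k : ℤ} (hk : k < m) :
    (HahnSeries.ofPowerSeries ℤ ℂ f).coeff k = 0 := by
  rcases lt_or_ge k 0 with h | h
  · exact coeff_ofPowerSeries_of_neg f h
  · rw [coeff_ofPowerSeries_toNat f h]
    exact PowerSeries.X_pow_dvd_iff.1 hf _ (by omega)

/-- The fundamental bidifferential of the projective line. -/
lemma residuelessDoublePole_bergman : ResiduelessDoublePole (1 / algebraMap (MvPolynomial (Fin 2) ℂ)
    (MvRat 2) ((MvPolynomial.X 0 - MvPolynomial.X 1) ^ 2)) := by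
  refine ⟨1, ?_, by simp, fun i => ⟨by simp, ?_⟩⟩
  · rw [map_one]
    refine one_div_mul_cancel (algebraMap_mvRat_ne_zero (pow_ne_zero 2 (sub_ne_zero.2 fun h => ?_)))
    exact absurd (MvPolynomial.X_injective h) (by decide)
  · rw [← MvPolynomial.C_1, MvPolynomial.degreeOf_C]

namespace WKBSolution

variable {r : ℕ} {Φ : RationalHConnection r} {x y : K} (S : WKBSolution Φ x y)
  {N : ℕ → Matrix (Fin r) (Fin r) K}

lemma coeff_amplitude_one (t : Fin 1 → ℂ) (E : Fin 1 → Matrix (Fin r) (Fin r) ℂ) (k : ℤ) :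
    (S.amplitude 1 t E).coeff k =
      (HahnSeries.ofPowerSeries ℤ ℂ (S.M (t 0) (E 0) * Φ.at' (t 0)).trace).coeff (k + 1) := by
  rw [amplitude, dif_pos rfl, HahnSeries.coeff_single_mul, one_mul, sub_neg_eq_add]
  rfl

lemma M_diagonal (t : ℂ) (d : Fin r → ℂ) :
    S.M t (diagonal d) = ∑ a, (PowerSeries.C (d a) : R₀) • S.M t (e a) := by
  have h : (diagonal d).map (PowerSeries.C : ℂ →+* R₀) =
      ∑ a, (PowerSeries.C (d a) : R₀) • (e a : Matrix (Fin r) (Fin r) ℂ).map PowerSeries.C := by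
    ext1 i j
    rw [Matrix.sum_apply]
    simp only [e, Matrix.smul_apply, map_apply, diagonal_apply, smul_eq_mul]
    split_ifs with hij
    · simp [Pi.single_apply, apply_ite (PowerSeries.C : ℂ →+* R₀)]
    · simp
  simp only [M, h, Finset.mul_sum, Finset.sum_mul, mul_smul_comm, smul_mul_assoc]

/-- Multilinearity of the amplitudes. -/
lemma amplitude_diagonal {n : ℕ} (hn : 2 ≤ n) (t : Fin n → ℂ) (d : Fin n → Fin r → ℂ) :
    S.amplitude n t (fun i => diagonal (d i)) = HahnSeries.ofPowerSeries ℤ ℂ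
      (∑ α : Fin n → Fin r, (∏ i, (PowerSeries.C (d i (α i)) : R₀)) * S.corr t α) := by
  -- The amplitude as a multilinear map in the matrices `M`, so that diagonal matrices can be
  -- expanded in the `e_a`.
  let F : MultilinearMap R₀ (fun _ : Fin n => Matrix (Fin r) (Fin r) R₀) R₀ :=
    ((-1) ^ (n - 1) : R₀) • ∑ σ : Equiv.Perm (Fin n) with ∀ i : Fin n, (i : ℕ) = 0 → σ i = i,
      (PowerSeries.C (∏ i, (t (σ i) - t (σ (finRotate n i))))⁻¹ : R₀) •
        (Matrix.traceLinearMap (Fin r) R₀ R₀).compMultilinearMap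
          ((MultilinearMap.mkPiAlgebraFin R₀ n (Matrix (Fin r) (Fin r) R₀)).domDomCongr σ)
  have hF : ∀ E : Fin n → Matrix (Fin r) (Fin r) ℂ,
      S.amplitude n t E = HahnSeries.ofPowerSeries ℤ ℂ (F fun i => S.M (t i) (E i)) := by
    intro E
    rw [amplitude, dif_neg (by omega)]
    simp only [F, _root_.smul_apply, _root_.sum_apply, smul_eq_mul,
      LinearMap.compMultilinearMap_apply, MultilinearMap.domDomCongr_apply,
      MultilinearMap.mkPiAlgebraFin_apply, traceLinearMap_apply]
  rw [hF]
  simp only [M_diagonal]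
  rw [MultilinearMap.map_sum]
  congr 1
  refine Finset.sum_congr rfl fun α _ => ?_
  rw [MultilinearMap.map_smul_univ, smul_eq_mul]
  congr 1
  apply HahnSeries.ofPowerSeries_injective (Γ := ℤ)
  rw [← amplitude_eq S hn t α, hF]

/-- The rational forms which represent the coefficients of the amplitudes. -/
theorem exists_amplitudeForm (hN : S.IsExpansion N) (hcurve : IsSmoothGenusZeroSpectralCurve Φ x y)
    (hA : S.Assumption5Star) (hB : S.LeadingW2IsBergman) (n : ℕ) (k : ℤ) :
    ∃ w : MvRat n,
      (1 ≤ n → ∀ (t : Fin n → ℂ) (a : Fin n → Fin r), (∀ i, t i ∈ S.D) → Function.Injective t →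
        MvHasValueAt w (fun i => S.sheet (a i) (t i))
          ((S.amplitude n t fun i => e (a i)).coeff k *
            ∏ i, ratEval (ratDeriv x) (S.sheet (a i) (t i)))) ∧
      (n = 1 → MvPolesIn {q | IsRamified x q ∨ Φ.IsSingularity 0 (ratMap x q)} w) ∧
      (2 ≤ n → ¬ (n = 2 ∧ k = 0) → MvPolesIn {q | IsRamified x q} w) ∧
      -- The transport along `h` is needed because the type of `w` depends on the variable `n`.
      (∀ h : n = 2, k = 0 → ResiduelessDoublePole (h ▸ w)) ∧
      (1 ≤ n → k < (n : ℤ) - 2 → w = 0) := by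
  rcases Nat.lt_or_ge n 2 with hn | hn
  · interval_cases n
    · exact ⟨0, by omega, by omega, by omega, by omega, by omega⟩
    · rcases lt_or_ge k (-1) with hk | hk
      · refine ⟨0, fun _ t a ht hti => ?_, fun _ => mvPolesIn_zero _, by omega, by omega,
          fun _ _ => rfl⟩
        rw [coeff_amplitude_one, coeff_ofPowerSeries_of_neg _ (by omega), zero_mul]
        exact mvHasValueAt_zero _
      · obtain ⟨w, hw, hv⟩ := exists_mvForm_one fun q hq =>
          S.formRegularAt_traceSeries hN hcurve hA (k + 1).toNat hq
        refine ⟨w, fun _ t a ht hti => hv _ _ ?_, fun _ => hw, by omega, by omega,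
          fun _ h => absurd h (by push_cast; omega)⟩
        rw [coeff_amplitude_one, coeff_ofPowerSeries_toNat _ (by omega), Fin.prod_univ_one]
        exact HasVal.mul (S.traceSeries_mem_valSeries hN hcurve hA (a 0) (ht 0) _)
          (HasVal.coe_iff.2 ⟨S.ratDeriv_sheet_mem (a 0) (ht 0), rfl⟩)
  · rcases lt_or_ge k ((n : ℤ) - 2) with hk | hk
    · refine ⟨0, fun _ t a ht hti => ?_, by omega, fun _ _ => mvPolesIn_zero _,
        fun h h' => absurd hk (by omega), fun _ _ => rfl⟩
      rw [S.amplitude_eq hn, coeff_ofPowerSeries_of_dvd (S.pow_dvd_corr hN hcurve hA hn ht hti a)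
        (by omega), zero_mul]
      exact mvHasValueAt_zero _
    · by_cases h2 : n = 2 ∧ k = 0
      -- The only coefficient for `n ≥ 2` with a pole on the diagonal; its form is supplied by the
      -- assumption on `[ħ⁰] W_2`.
      · obtain ⟨rfl, rfl⟩ := h2
        refine ⟨_, fun _ t a ht hti => ?_, by omega, fun _ h => absurd ⟨rfl, rfl⟩ h,
          fun _ _ => residuelessDoublePole_bergman, fun _ h => absurd h (by omega)⟩
        have hne : S.sheet (a 0) (t 0) - S.sheet (a 1) (t 1) ≠ 0 :=
          sub_ne_zero.2 (S.sheet_ne (ht 0) (ht 1) fun h => absurd (hti h) (by decide))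
        have h := mvHasValueAt_div (N := 1) (Q := (MvPolynomial.X 0 - MvPolynomial.X 1) ^ 2)
          (p := fun i => S.sheet (a i) (t i)) (by simpa using hne)
        rw [hB t a ht hti]
        simpa using h
      · obtain ⟨w, hw, hv⟩ := S.exists_mvForm hN hcurve hA hn (k := k.toNat) (by omega)
        refine ⟨w, fun _ t a ht hti => ?_, by omega, fun _ _ => hw,
          fun h h' => absurd ⟨h, h'⟩ h2, fun _ h => absurd h (by omega)⟩
        rw [S.amplitude_eq hn, coeff_ofPowerSeries_toNat _ (by omega)]
        exact hv t a ht hti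

theorem topologicalType (hN : S.IsExpansion N) (hcurve : IsSmoothGenusZeroSpectralCurve Φ x y)
    (hA : S.Assumption5Star) (hB : S.LeadingW2IsBergman) :
    S.TopologicalType {q | IsRamified x q ∨ Φ.IsSingularity 0 (ratMap x q)} := by
  choose w hw using S.exists_amplitudeForm hN hcurve hA hB
  exact ⟨fun n σ t a _ _ => S.amplitude_perm n σ t a, w,
    fun n hn t a ht hti k => (hw n k).1 hn t a ht hti, fun k _ => (hw 1 k).2.1 rfl,
    fun n hn k hk => (hw n k).2.2.1 hn hk, (hw 2 0).2.2.2.1 rfl rfl,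
    fun n hn k hk => (hw n k).2.2.2.2 hn hk⟩

theorem coeff_amplitude_diagonal_eq_zero (hN : S.IsExpansion N)
    (hcurve : IsSmoothGenusZeroSpectralCurve Φ x y) (hA : S.Assumption5Star) {j : ℕ} (hj : 1 ≤ j)
    {t : Fin j → ℂ} (d : Fin j → Fin r → ℂ) (ht : ∀ i, t i ∈ S.D) (hti : Function.Injective t)
    {m : ℤ} (hm : m < (j : ℤ) - 2) :
    (S.amplitude j t fun i => diagonal (d i)).coeff m = 0 := by
  rcases Nat.lt_or_ge j 2 with h | h
  · obtain rfl : j = 1 := by omega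
    rw [coeff_amplitude_one, coeff_ofPowerSeries_of_neg _ (by push_cast at hm; omega)]
  · rw [S.amplitude_diagonal h]
    exact coeff_ofPowerSeries_of_dvd (Finset.dvd_sum fun α _ =>
      (S.pow_dvd_corr hN hcurve hA h ht hti α).mul_left _) (by omega)

end WKBSolution

end

theorem proposition5p17 {r : ℕ} (Φ : RationalHConnection r) (x y : RatFunc ℂ)
    (hcurve : IsSmoothGenusZeroSpectralCurve Φ x y) (S : WKBSolution Φ x y)
    (hA : S.Assumption5Star) (hM : S.HasRationalExpansion) (hB : S.LeadingW2IsBergman) :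
    S.TopologicalType {q | IsRamified x q ∨ Φ.IsSingularity 0 (ratMap x q)} ∧
    ((∀ q, Φ.IsSingularity 0 (ratMap x q) → IsRamified x q) →
      S.TopologicalType {q | IsRamified x q}) ∧
    ∀ k : ℕ, 1 ≤ k → ∀ j : ℕ, k ≤ j →
      ∀ (t : Fin j → ℂ) (d : Fin j → Fin r → ℂ), (∀ i, t i ∈ S.D) → Function.Injective t →
        ∀ m : ℤ, m < (k : ℤ) - 2 →
          (S.amplitude j t fun i => Matrix.diagonal (d i)).coeff m = 0 := by
  obtain ⟨N, hv, hp⟩ := hM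
  have hN : S.IsExpansion N := ⟨hv, hp⟩
  have h := S.topologicalType hN hcurve hA hB
  refine ⟨h, fun hram => ?_, fun k hk j hj t d ht hti m hm =>
    S.coeff_amplitude_diagonal_eq_zero hN hcurve hA (hk.trans hj) d ht hti (by omega)⟩
  have hR : {q | IsRamified x q ∨ Φ.IsSingularity 0 (ratMap x q)} = {q | IsRamified x q} :=
    Set.ext fun q => or_iff_left_of_imp (hram q)
  rwa [hR] at h
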